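/- **Setting.** Let $\mathcal G$ be a finite-dimensional semisimple ribbon Hopf-$*$-algebra over $\mathbb C$, with coproduct $\Delta$, counit $\epsilon$, antipode $\mathcal S$, universal $R$-matrix $R\in\mathcal G\otimes\mathcal G$ and ribbon element $v$, where $\Delta$ and $R$ are compatible with $*$ for the operation $(\xi\otimes\eta)^*=\eta^*\otimes\xi^*$ on $\mathcal G\otimes\mathcal G$ (so $\Delta(\xi^*)=\Delta(\xi)^*$, $R^*=R^{-1}$), and $v$ is central with $v^2=u\,\mathcal S(u)$, $\mathcal S(v)=v$, $\epsilon(v)=1$, $v^*=v^{-1}$, $\Delta(v)=(R'R)^{-1}(v\otimes v)$; here $R=\sum r^1\otimes r^2$, $R'=\sum r^2\otimes r^1$, $u=\sum\mathcal S(r^2)r^1$. Put $g=u^{-1}v$. Assume that every irreducible representation of $\mathcal G$ is equivalent to a $*$-representation, and let $\tau^I$ on $V^I$ be $*$-representations on finite-dimensional Hilbert spaces, one for each equivalence class $I$ of irreducible representations; $0$ is the trivial class ($\tau^0=\epsilon$) and $\bar I$ the class dual to $I$. For $X\in\mathcal G\otimes\mathcal G$ write $X^{IJ}=(\tau^I\otimes\tau^J)(X)$.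 Let $C^a[IJ|K]:V^I\otimes V^J\to V^K$ be bases of the spaces of intertwiners (from $(\tau^I\otimes\tau^J)\circ\Delta$ to $\tau^K$), and suppose that there are numbers $\kappa_I$ with $\kappa_I^2=\tau^I(v)$ and $$C^a[IJ|K]\,(R')^{IJ}\,C^b[IJ|L]^*=\delta_{a,b}\,\delta_{K,L}\,\frac{\kappa_I\kappa_J}{\kappa_K};$$ let $\kappa\in\mathcal G$ be the central element with $\tau^I(\kappa)=\kappa_I$. Let $tr_q^I(X)=tr(X\tau^I(g))$ be the $q$-trace and $d_I=tr^I_q(1)$. Assume that $d_I>0$ for all $I$ and that the matrix $S_{IJ}=\mathcal N\,(tr_q^I\otimes tr_q^J)(R'R)$, $\mathcal N=(\sum_K d_K^2)^{-1/2}$, is invertible. **Graph algebra.** $\mathcal L_m$ is the unital associative algebra generated by the matrix elements of $M_\nu^I\in End(V^I)\otimes\mathcal L_m$, $1\le\nu\le m$, with $M_\nu^0=1$ and the relations $$\overset{1}{M}{}_\nu^I R^{IJ}\overset{2}{M}{}_\nu^J=\sum_{K,a} C^a[IJ|K]^*M_\nu^KC^a[IJ|K],$$ $$(R^{-1})^{IJ}\overset{1}{M}{}_\nu^IR^{IJ}\overset{2}{M}{}_\mu^J=\overset{2}{M}{}_\mu^J(R^{-1})^{IJ}\overset{1}{M}{}_\nu^IR^{IJ}\quad(\nu<\mu),$$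 where $\overset{1}{X}=X\otimes 1$ and $\overset{2}{X}=1\otimes X$. The algebra $\mathcal G$ acts on $\mathcal L_m$ by $\xi(M^I_\nu)=\sum\tau^I(\mathcal S(\xi^1))M_\nu^I\tau^I(\xi^2)$, $\xi(XY)=\sum\xi^1(X)\xi^2(Y)$, $\xi(1)=\epsilon(\xi)1$, where $\Delta(\xi)=\sum\xi^1\otimes\xi^2$. Let $\mathcal A_m=\{X\in\mathcal L_m:\xi(X)=\epsilon(\xi)X \text{ for all }\xi\in\mathcal G\}$. The semi-direct product $\mathcal S_m$ is generated by $\mathcal L_m$ and $\mathcal G$ with $\mu^J(\xi)M_\nu^J=M_\nu^J\mu^J(\xi)$, $\mu^J(\xi)=(\tau^J\otimes id)\Delta(\xi)$. Its $*$-operation, given on $\mathcal L_m$ by $(M_\nu^I)^*=\kappa^{-1}R^I(M_\nu^I)^{-1}(R^{-1})^I\kappa$ with $R^I=(\tau^I\otimes id)(R)$ and $(R^{-1})^I=(\tau^I\otimes id)(R^{-1})$, restricts to $\mathcal A_m$. **Moduli algebra.** Put $c_\nu^I=\kappa_I\,tr_q^I(M_\nu^I)$ for $1\le\nu\le m$,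 $c_0^I=\kappa_I\,tr_q^I(\kappa_I^{m-1}M_m^I\cdots M_1^I)$ and $\chi_\nu^K=\mathcal N d_K\sum_I S_{K\bar I}\,c^I_\nu$ for $0\le\nu\le m$. The genus-$0$ moduli algebra with $m$ punctures labelled $K_1,\dots,K_m$ is the $*$-algebra $$\mathcal M_m^{K_1,\dots,K_m}=\chi_0^0\prod_{\nu=1}^m\chi_\nu^{K_\nu}\,\mathcal A_m .$$ **Theorem (First pinching theorem).** Let $m\ge2$, let $K_1,\dots,K_m$ be classes of irreducible representations of $\mathcal G$, and let $\mathcal V(l)\subset\mathcal M_m^{K_1,\dots,K_m}$ be the fusion algebra of the cycle $l=l_ml_{m-1}$, that is, the subalgebra generated by (the images of) the elements $c^I(l)=tr_q^I(M_m^IM_{m-1}^I)$. The commutant of $\mathcal V(l)$ in $\mathcal M_m^{K_1,\dots,K_m}$ is isomorphic, as a $*$-algebra, to $$\bigoplus_K\mathcal M_{m-1}^{K_1,\dots,K_{m-2},K}\otimes\mathcal M_3^{\bar K,K_{m-1},K_m},$$ where the sum runs over all classes $K$ of irreducible representations of $\mathcal G$. -/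

import Mathlib

open scoped TensorProduct Kronecker Matrix

noncomputable section

set_option linter.unusedSectionVars false

namespace ChernSimons

/-! ### Ribbon Hopf-`*`-algebras -/

section Ribbon

variable (G : Type*) [Ring G] [HopfAlgebra ℂ G] [StarRing G] [StarModule ℂ G]

/-- The leg embedding `X ↦ X₁₂` of `G ⊗ G` into `G ⊗ (G ⊗ G)`. -/
def leg12 : G ⊗[ℂ] G →ₐ[ℂ] G ⊗[ℂ] (G ⊗[ℂ] G) :=
  Algebra.TensorProduct.map (AlgHom.id ℂ G) Algebra.TensorProduct.includeLeft

/-- The leg embedding `X ↦ X₁₃`. -/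
def leg13 : G ⊗[ℂ] G →ₐ[ℂ] G ⊗[ℂ] (G ⊗[ℂ] G) :=
  Algebra.TensorProduct.map (AlgHom.id ℂ G) Algebra.TensorProduct.includeRight

/-- The leg embedding `X ↦ X₂₃`. -/
def leg23 : G ⊗[ℂ] G →ₐ[ℂ] G ⊗[ℂ] (G ⊗[ℂ] G) :=
  Algebra.TensorProduct.includeRight

/-- The flip `ξ ⊗ η ↦ η ⊗ ξ`; thus `R' = swapT R` and `Δ' = swapT ∘ Δ`. -/
def swapT : G ⊗[ℂ] G →ₐ[ℂ] G ⊗[ℂ] G :=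
  (Algebra.TensorProduct.comm ℂ G G).toAlgHom

/-- A ribbon Hopf-`*`-algebra structure on the Hopf algebra and `*`-algebra `G`, for the
`*`-operation `(ξ ⊗ η)^* = η^* ⊗ ξ^*` on `G ⊗ G`: the universal `R`-matrix `R` and the
ribbon element `v`. -/
structure RibbonStarHopf where
  /-- the universal `R`-matrix -/
  R : (G ⊗[ℂ] G)ˣ
  /-- the ribbon element -/
  v : G
  comul_star : ∀ x : G, Coalgebra.comul (R := ℂ) (star x)
    = swapT G (star (Coalgebra.comul (R := ℂ) x))
  counit_star : ∀ x : G, Coalgebra.counit (R := ℂ) (star x)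
    = star (Coalgebra.counit (R := ℂ) x)
  intertwine : ∀ x : G, (R : G ⊗[ℂ] G) * Coalgebra.comul (R := ℂ) x
    = swapT G (Coalgebra.comul (R := ℂ) x) * R
  comul_left : Algebra.TensorProduct.assoc ℂ ℂ ℂ G G G
      (Algebra.TensorProduct.map (Bialgebra.comulAlgHom ℂ G) (AlgHom.id ℂ G) (R : G ⊗[ℂ] G))
    = leg13 G R * leg23 G R
  comul_right :
    Algebra.TensorProduct.map (AlgHom.id ℂ G) (Bialgebra.comulAlgHom ℂ G) (R : G ⊗[ℂ] G)
    = leg13 G R * leg12 G R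
  star_R : swapT G (star (R : G ⊗[ℂ] G)) = ((R⁻¹ : (G ⊗[ℂ] G)ˣ) : G ⊗[ℂ] G)
  v_central : ∀ x : G, v * x = x * v
  v_sq : v ^ 2 =
    LinearMap.mul' ℂ G (TensorProduct.map (HopfAlgebra.antipode ℂ) LinearMap.id (swapT G R)) *
    HopfAlgebra.antipode ℂ
      (LinearMap.mul' ℂ G (TensorProduct.map (HopfAlgebra.antipode ℂ) LinearMap.id (swapT G R)))
  antipode_v : HopfAlgebra.antipode ℂ v = v
  counit_v : Coalgebra.counit (R := ℂ) v = 1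
  star_v : star v * v = 1
  comul_v : (swapT G R * R) * Coalgebra.comul (R := ℂ) v = v ⊗ₜ[ℂ] v

variable {G}

/-- `u = ∑ S(r²) r¹`, where `R = ∑ r¹ ⊗ r²`. -/
def RibbonStarHopf.u (H : RibbonStarHopf G) : G :=
  LinearMap.mul' ℂ G (TensorProduct.map (HopfAlgebra.antipode ℂ) LinearMap.id (swapT G H.R))

/-- The grouplike element `g = u⁻¹ v` (the element `u` is invertible). -/
def RibbonStarHopf.g (H : RibbonStarHopf G) : G := Ring.inverse H.u * H.v

end Ribbon

/-! ### Irreducible representations -/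

section Irreps

variable {G : Type*} [Ring G] [Algebra ℂ G]

/-- Irreducibility of a matrix representation. -/
def IsIrrep {k : ℕ} (ρ : G →ₐ[ℂ] Matrix (Fin k) (Fin k) ℂ) : Prop :=
  0 < k ∧ ∀ W : Submodule ℂ (Fin k → ℂ), (∀ x, ∀ w ∈ W, ρ x *ᵥ w ∈ W) → W = ⊥ ∨ W = ⊤

/-- Equivalence of matrix representations. -/
def RepEquiv {k l : ℕ} (ρ : G →ₐ[ℂ] Matrix (Fin k) (Fin k) ℂ)
    (σ : G →ₐ[ℂ] Matrix (Fin l) (Fin l) ℂ) : Prop :=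
  ∃ (T : Matrix (Fin k) (Fin l) ℂ) (T' : Matrix (Fin l) (Fin k) ℂ),
    T * T' = 1 ∧ T' * T = 1 ∧ ∀ x, ρ x * T = T * σ x

end Irreps

variable (G : Type*) [Ring G] [HopfAlgebra ℂ G] [StarRing G] [StarModule ℂ G]
variable (ι : Type*)

/-- A choice, for every equivalence class `I` of irreducible representations of `G`, of a
representative `*`-representation `τ I` on the Hilbert space `V^I = ℂ^(n I)`; the
label `triv` stands for the trivial representation (the counit). -/
structure IrrepSystem where
  n : ι → ℕ
  τ : ∀ I, G →⋆ₐ[ℂ] Matrix (Fin (n I)) (Fin (n I)) ℂ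
  irrep : ∀ I, IsIrrep (τ I).toAlgHom
  inequiv : ∀ I J, RepEquiv (τ I).toAlgHom (τ J).toAlgHom → I = J
  exhaustive : ∀ (k : ℕ) (ρ : G →ₐ[ℂ] Matrix (Fin k) (Fin k) ℂ), IsIrrep ρ →
    ∃ I, RepEquiv (τ I).toAlgHom ρ
  triv : ι
  τ_triv : ∀ x, τ triv x = Coalgebra.counit (R := ℂ) x • (1 : Matrix _ _ ℂ)

variable {G ι}

namespace IrrepSystem

variable (V : IrrepSystem G ι)

/-- `(τ^I ⊗ τ^J)(X)` for `X ∈ G ⊗ G`. -/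
def ten (I J : ι) :
    G ⊗[ℂ] G →ₐ[ℂ] Matrix (Fin (V.n I) × Fin (V.n J)) (Fin (V.n I) × Fin (V.n J)) ℂ :=
  (Matrix.kroneckerAlgEquiv (Fin (V.n I)) (Fin (V.n J)) ℂ).toAlgHom.comp
    (Algebra.TensorProduct.map (V.τ I).toAlgHom (V.τ J).toAlgHom)

/-- The space of intertwiners `V^I ⊗ V^J → V^K`. -/
def intertwiners (I J K : ι) :
    Submodule ℂ (Matrix (Fin (V.n K)) (Fin (V.n I) × Fin (V.n J)) ℂ) where
  carrier := {T | ∀ x : G, T * V.ten I J (Coalgebra.comul (R := ℂ) x) = V.τ K x * T}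
  add_mem' := by
    intro a b ha hb x
    rw [Matrix.add_mul, Matrix.mul_add, ha x, hb x]
  zero_mem' := by
    intro x
    simp
  smul_mem' := by
    intro c a ha x
    rw [Matrix.smul_mul, Matrix.mul_smul, ha x]

/-- The fusion rules `N^{IJ}_K`. -/
def fusion (I J K : ι) : ℕ := Module.finrank ℂ (V.intertwiners I J K)

/-- `IsConj J I` says that `τ^J` is equivalent to the representation dual to `τ^I`, i.e. to
the transpose of `τ^I ∘ S`. -/
def IsConj (J I : ι) : Prop :=
  ∃ (T : Matrix (Fin (V.n J)) (Fin (V.n I)) ℂ) (T' : Matrix (Fin (V.n I)) (Fin (V.n J)) ℂ),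
    T * T' = 1 ∧ T' * T = 1 ∧
    ∀ x : G, V.τ J x * T = T * (V.τ I (HopfAlgebra.antipode ℂ x))ᵀ

/-- The label `Ī` conjugate to `I`: the unique one with `IsConj Ī I`. -/
def bar (I : ι) : ι :=
  haveI : Nonempty ι := ⟨V.triv⟩
  Classical.epsilon fun J => V.IsConj J I

end IrrepSystem

variable (G ι) in
/-- The full symmetry data: a ribbon Hopf-`*`-algebra with its irreducible representations,
bases `C^a[IJ|K]` of the spaces of intertwiners (Clebsch-Gordan maps), and square roots
`κ_I` of the values `v_I` of the ribbon element, normalized with respect to each other;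
`kappa` is the central element of `G` with `τ^I(kappa) = κ_I`. -/
structure SymmetryData extends RibbonStarHopf G, IrrepSystem G ι where
  κ : ι → ℂ
  κ_sq : ∀ I, toIrrepSystem.τ I v = (κ I) ^ 2 • (1 : Matrix _ _ ℂ)
  kappa : G
  τ_kappa : ∀ I, toIrrepSystem.τ I kappa = κ I • (1 : Matrix _ _ ℂ)
  CG : ∀ I J K, Module.Basis (Fin (toIrrepSystem.fusion I J K)) ℂ
    (toIrrepSystem.intertwiners I J K)
  normalized : ∀ I J K (a b : Fin (toIrrepSystem.fusion I J K)),
    (CG I J K a).1 * toIrrepSystem.ten I J (swapT G R) * ((CG I J K b).1)ᴴ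
      = if a = b then (κ I * κ J / κ K) • (1 : Matrix _ _ ℂ) else 0
  orthogonal : ∀ I J K L (a : Fin (toIrrepSystem.fusion I J K))
    (b : Fin (toIrrepSystem.fusion I J L)), K ≠ L →
    (CG I J K a).1 * toIrrepSystem.ten I J (swapT G R) * ((CG I J L b).1)ᴴ = 0

/-! ### Matrices with entries in an algebra -/

section Matrices

variable {k l : Type*} [DecidableEq k] [DecidableEq l] {A : Type*} [Zero A]

/-- `X ↦ X ⊗ 1`, for a matrix `X` with entries in an algebra. -/
def onLeft (l : Type*) [DecidableEq l] (X : Matrix k k A) : Matrix (k × l) (k × l) A :=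
  Matrix.of fun p q => if p.2 = q.2 then X p.1 q.1 else 0

/-- `X ↦ 1 ⊗ X`, for a matrix `X` with entries in an algebra. -/
def onRight (k : Type*) [DecidableEq k] (X : Matrix l l A) : Matrix (k × l) (k × l) A :=
  Matrix.of fun p q => if p.1 = q.1 then X p.2 q.2 else 0

/-- A scalar matrix, viewed as a matrix with entries in a `ℂ`-algebra. -/
def scal {k l : Type*} (A : Type*) [Ring A] [Algebra ℂ A] (X : Matrix k l ℂ) : Matrix k l A :=
  X.map (algebraMap ℂ A)

end Matrices

namespace SymmetryData

variable (D : SymmetryData G ι)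

/-- `R^{IJ}`. -/
def RR (I J : ι) : Matrix (Fin (D.n I) × Fin (D.n J)) (Fin (D.n I) × Fin (D.n J)) ℂ :=
  D.ten I J D.R

/-- `(R⁻¹)^{IJ}`. -/
def RRinv (I J : ι) : Matrix (Fin (D.n I) × Fin (D.n J)) (Fin (D.n I) × Fin (D.n J)) ℂ :=
  D.ten I J ((D.R⁻¹ : (G ⊗[ℂ] G)ˣ) : G ⊗[ℂ] G)

/-- The `q`-trace `tr_q^I(X) = tr(X τ^I(g))` of a matrix with entries in an algebra. -/
def qtr {A : Type*} [Ring A] [Algebra ℂ A] (I : ι) (X : Matrix (Fin (D.n I)) (Fin (D.n I)) A) :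
    A :=
  (X * scal A (D.τ I D.g)).trace

/-- The quantum dimension `d_I = tr_q^I(e^I)`. -/
def qdim (I : ι) : ℂ := D.qtr I (1 : Matrix _ _ ℂ)

/-- `(∑_K d_K²)^(-1/2)`; the quantum dimensions will be positive real numbers. -/
def norm_const [Fintype ι] : ℝ := (√(∑ K, (D.qdim K).re ^ 2))⁻¹

/-- The matrix `S_{IJ}`, a multiple of `(tr_q^I ⊗ tr_q^J)(R'R)`. -/
def S [Fintype ι] : Matrix ι ι ℂ := Matrix.of fun I J =>
  (D.norm_const : ℂ) *
    (D.ten I J (swapT G D.R * D.R) * ((D.τ I D.g) ⊗ₖ (D.τ J D.g))).trace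

/-! ### The graph algebra of the `m`-punctured sphere -/

/-- Generators: the matrix elements `(M_ν^I)_{ab}`. -/
structure Gen (m : ℕ) where
  ν : Fin m
  I : ι
  a : Fin (D.n I)
  b : Fin (D.n I)

/-- The matrix of free generators `M_ν^I`. -/
def freeM {m : ℕ} (ν : Fin m) (I : ι) :
    Matrix (Fin (D.n I)) (Fin (D.n I)) (FreeAlgebra ℂ (D.Gen m)) :=
  Matrix.of fun a b => FreeAlgebra.ι ℂ ⟨ν, I, a, b⟩

/-- `∑_{K,a} C^a[IJ|K]^* X^K C^a[IJ|K]`. -/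
def fuse [Fintype ι] {A : Type*} [Ring A] [Algebra ℂ A]
    (X : ∀ I, Matrix (Fin (D.n I)) (Fin (D.n I)) A) (I J : ι) :
    Matrix (Fin (D.n I) × Fin (D.n J)) (Fin (D.n I) × Fin (D.n J)) A :=
  ∑ K, ∑ a, scal A ((D.CG I J K a).1)ᴴ * X K * scal A (D.CG I J K a).1

/-- `X₁ R^{IJ} Y₂`, the left-hand side of the functoriality relation. -/
def funL {A : Type*} [Ring A] [Algebra ℂ A]
    (X : ∀ I, Matrix (Fin (D.n I)) (Fin (D.n I)) A) (I J : ι) :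
    Matrix (Fin (D.n I) × Fin (D.n J)) (Fin (D.n I) × Fin (D.n J)) A :=
  onLeft _ (X I) * scal A (D.RR I J) * onRight _ (X J)

/-- `(R⁻¹)^{IJ} X₁ R^{IJ} Y₂`, the left-hand side of the exchange relation. -/
def exchL {A : Type*} [Ring A] [Algebra ℂ A]
    (X Y : ∀ I, Matrix (Fin (D.n I)) (Fin (D.n I)) A) (I J : ι) :
    Matrix (Fin (D.n I) × Fin (D.n J)) (Fin (D.n I) × Fin (D.n J)) A :=
  scal A (D.RRinv I J) * onLeft _ (X I) * scal A (D.RR I J) * onRight _ (Y J)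

/-- `Y₂ (R⁻¹)^{IJ} X₁ R^{IJ}`, the right-hand side of the exchange relation. -/
def exchR {A : Type*} [Ring A] [Algebra ℂ A]
    (X Y : ∀ I, Matrix (Fin (D.n I)) (Fin (D.n I)) A) (I J : ι) :
    Matrix (Fin (D.n I) × Fin (D.n J)) (Fin (D.n I) × Fin (D.n J)) A :=
  onRight _ (Y J) * scal A (D.RRinv I J) * onLeft _ (X I) * scal A (D.RR I J)

/-- The defining relations of the graph algebra: functoriality, the exchange relations, and
the convention that the monodromy in the trivial representation is the unit. -/
inductive GraphRel [Fintype ι] (m : ℕ) :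
    FreeAlgebra ℂ (D.Gen m) → FreeAlgebra ℂ (D.Gen m) → Prop
  | functoriality (ν : Fin m) (I J : ι) (p q : Fin (D.n I) × Fin (D.n J)) :
      GraphRel m (D.funL (D.freeM ν) I J p q) (D.fuse (D.freeM ν) I J p q)
  | exchange (ν μ : Fin m) (h : ν < μ) (I J : ι) (p q : Fin (D.n I) × Fin (D.n J)) :
      GraphRel m (D.exchL (D.freeM ν) (D.freeM μ) I J p q)
        (D.exchR (D.freeM ν) (D.freeM μ) I J p q)
  | unit (ν : Fin m) (a b : Fin (D.n D.triv)) :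
      GraphRel m (D.freeM ν D.triv a b) ((1 : Matrix _ _ (FreeAlgebra ℂ (D.Gen m))) a b)

/-- The graph algebra `L_m = L_{0,m}`. -/
def L [Fintype ι] (m : ℕ) : Type _ := RingQuot (D.GraphRel m)

instance [Fintype ι] (m : ℕ) : Ring (D.L m) := inferInstanceAs (Ring (RingQuot (D.GraphRel m)))

instance [Fintype ι] (m : ℕ) : Algebra ℂ (D.L m) :=
  inferInstanceAs (Algebra ℂ (RingQuot (D.GraphRel m)))

variable [Fintype ι]

/-- The quotient map onto the graph algebra. -/
def proj (m : ℕ) : FreeAlgebra ℂ (D.Gen m) →ₐ[ℂ] D.L m := RingQuot.mkAlgHom ℂ (D.GraphRel m)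

/-- The monodromy `M_ν^I`, a matrix with entries in the graph algebra. -/
def M {m : ℕ} (ν : Fin m) (I : ι) : Matrix (Fin (D.n I)) (Fin (D.n I)) (D.L m) :=
  (D.freeM ν I).map (D.proj m)

/-! ### The action of the symmetry algebra -/

section Convolution

open LinearMap

variable {A : Type*} [Ring A] [Algebra ℂ A]

variable (A) in
/-- The matrix with entries in the convolution algebra `Hom(G, A)` given by a linear
matrix-valued function on `G`. -/
def conv {k l : Type*} (F : G →ₗ[ℂ] Matrix k l ℂ) :
    Matrix k l (WithConv (G →ₗ[ℂ] A)) :=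
  Matrix.of fun a b => WithConv.toConv
    (Algebra.linearMap ℂ A ∘ₗ Matrix.entryLinearMap ℂ ℂ a b ∘ₗ F)

theorem conv_apply {k l : Type*} (F : G →ₗ[ℂ] Matrix k l ℂ) (a : k) (b : l) (ξ : G) :
    (conv A F a b).ofConv ξ = algebraMap ℂ A (F ξ a b) := rfl

variable (G A) in
/-- The embedding of `A` into the convolution algebra `Hom(G, A)`, `X ↦ ε(·) X`. -/
def constConv : A →ₐ[ℂ] WithConv (G →ₗ[ℂ] A) where
  toFun x := WithConv.toConv ((Coalgebra.counit (R := ℂ) (A := G)).smulRight x)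
  map_one' := by
    ext ξ
    simp [Algebra.algebraMap_eq_smul_one]
  map_mul' x y := by
    ext ξ
    rw [(Coalgebra.Repr.arbitrary ℂ ξ).convMul_apply]
    simp only [LinearMap.smulRight_apply, smul_mul_assoc, mul_smul_comm,
      smul_smul, ← Finset.sum_smul]
    congr 1
    have h := Coalgebra.sum_counit_smul (R := ℂ) (Coalgebra.Repr.arbitrary ℂ ξ)
    have h' := congrArg (Coalgebra.counit (R := ℂ)) h
    simp only [map_sum, map_smul, smul_eq_mul] at h'
    rw [← h']
    simp only [mul_comm]
  map_zero' := by ext; simp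
  map_add' x y := by ext; simp
  commutes' c := by
    ext ξ
    simp [Algebra.algebraMap_eq_smul_one, smul_smul, mul_comm]

theorem constConv_apply (x : A) (ξ : G) :
    (constConv G A x).ofConv ξ = Coalgebra.counit (R := ℂ) ξ • x := rfl

theorem counit_left (f : G →ₗ[ℂ] ℂ) (ξ : G) (r : Coalgebra.Repr ℂ ξ (G × G)) :
    ∑ i ∈ r.index, Coalgebra.counit (R := ℂ) (r.left i) * f (r.right i) = f ξ := by
  have h := congrArg f (Coalgebra.sum_counit_smul (R := ℂ) r)
  simpa only [map_sum, map_smul, smul_eq_mul] using h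

theorem counit_right (f : G →ₗ[ℂ] ℂ) (ξ : G) (r : Coalgebra.Repr ℂ ξ (G × G)) :
    ∑ i ∈ r.index, f (r.left i) * Coalgebra.counit (R := ℂ) (r.right i) = f ξ := by
  have h := congrArg (LinearMap.mul' ℂ ℂ ∘ₗ TensorProduct.map f LinearMap.id)
    (Coalgebra.sum_tmul_counit_eq (R := ℂ) r)
  simpa only [map_sum, LinearMap.comp_apply, TensorProduct.map_tmul, LinearMap.mul'_apply,
    LinearMap.id_apply, mul_one] using h

theorem constConv_comm (x : A) {k l : Type*} (F : G →ₗ[ℂ] Matrix k l ℂ) (a : k) (b : l) :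
    constConv G A x * conv A F a b = conv A F a b * constConv G A x := by
  ext ξ
  have r := Coalgebra.Repr.arbitrary ℂ ξ
  rw [r.convMul_apply, r.convMul_apply]
  simp only [constConv_apply, conv_apply, Algebra.algebraMap_eq_smul_one, smul_mul_assoc,
    mul_smul_comm, one_mul, mul_one, smul_smul, ← Finset.sum_smul]
  congr 1
  have h1 := counit_left (Matrix.entryLinearMap ℂ ℂ a b ∘ₗ F) ξ r
  have h2 := counit_right (Matrix.entryLinearMap ℂ ℂ a b ∘ₗ F) ξ r
  simp only [LinearMap.comp_apply, Matrix.entryLinearMap_apply] at h1 h2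
  exact ((Finset.sum_congr rfl fun _ _ => mul_comm _ _).trans (h1.trans h2.symm)).trans
    (Finset.sum_congr rfl fun _ _ => mul_comm _ _)

theorem conv_mul {j k l : Type*} [Fintype k] (F : G →ₗ[ℂ] Matrix j k ℂ)
    (F' : G →ₗ[ℂ] Matrix k l ℂ) (P : G →ₗ[ℂ] Matrix j l ℂ)
    (hP : ∀ (ξ : G) (r : Coalgebra.Repr ℂ ξ (G × G)),
      P ξ = ∑ i ∈ r.index, F (r.left i) * F' (r.right i)) :
    conv A F * conv A F' = conv A P := by
  ext a b ξ
  have r := Coalgebra.Repr.arbitrary ℂ ξ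
  rw [conv_apply, hP ξ r, Matrix.mul_apply, WithConv.ofConv_sum, LinearMap.sum_apply]
  simp only [r.convMul_apply, conv_apply, ← map_mul]
  rw [Finset.sum_comm]
  simp only [← map_sum, Matrix.sum_apply, Matrix.mul_apply]

theorem scal_mul_conv {j k l : Type*} [Fintype k] (X : Matrix j k ℂ)
    (F : G →ₗ[ℂ] Matrix k l ℂ) (P : G →ₗ[ℂ] Matrix j l ℂ) (hP : ∀ ξ, P ξ = X * F ξ) :
    scal (WithConv (G →ₗ[ℂ] A)) X * conv A F = conv A P := by
  ext a b ξ
  rw [conv_apply, hP ξ, Matrix.mul_apply, WithConv.ofConv_sum, LinearMap.sum_apply]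
  simp only [scal, Matrix.map_apply, ← Algebra.smul_def, WithConv.ofConv_smul,
    LinearMap.smul_apply, conv_apply, Matrix.mul_apply, map_sum, map_mul]

theorem conv_mul_scal {j k l : Type*} [Fintype k] (X : Matrix k l ℂ)
    (F : G →ₗ[ℂ] Matrix j k ℂ) (P : G →ₗ[ℂ] Matrix j l ℂ) (hP : ∀ ξ, P ξ = F ξ * X) :
    conv A F * scal (WithConv (G →ₗ[ℂ] A)) X = conv A P := by
  ext a b ξ
  rw [conv_apply, hP ξ, Matrix.mul_apply, WithConv.ofConv_sum, LinearMap.sum_apply]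
  have hc : ∀ (y : WithConv (G →ₗ[ℂ] A)) (c : ℂ), y * algebraMap ℂ _ c = c • y := by
    intro y c
    rw [Algebra.smul_def, Algebra.commutes]
  simp only [scal, Matrix.map_apply, hc,
    WithConv.ofConv_smul, LinearMap.smul_apply, conv_apply, Matrix.mul_apply, map_sum, map_mul]
  refine Finset.sum_congr rfl fun i _ => ?_
  rw [Algebra.smul_def, Algebra.commutes]

end Convolution

section Legs

variable {k l : Type*} [DecidableEq k] [DecidableEq l] [Fintype k] [Fintype l]
  {A : Type*} [Ring A]

theorem onLeft_mul_onRight (X : Matrix k k A) (Y : Matrix l l A) :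
    onLeft l X * onRight k Y = Matrix.of fun p q => X p.1 q.1 * Y p.2 q.2 := by
  ext p q
  simp [Matrix.mul_apply, Fintype.sum_prod_type, onLeft, onRight]

theorem onRight_mul_onLeft (X : Matrix k k A) (Y : Matrix l l A) :
    onRight k Y * onLeft l X = Matrix.of fun p q => Y p.2 q.2 * X p.1 q.1 := by
  ext p q
  simp [Matrix.mul_apply, Fintype.sum_prod_type, onLeft, onRight]

theorem leg_comm (X : Matrix k k A) (Y : Matrix l l A)
    (h : ∀ a b c d, X a b * Y c d = Y c d * X a b) :
    onLeft l X * onRight k Y = onRight k Y * onLeft l X := by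
  rw [onLeft_mul_onRight, onRight_mul_onLeft]
  ext p q
  exact h _ _ _ _

theorem onLeft_mul (X Y : Matrix k k A) : onLeft l (X * Y) = onLeft l X * onLeft l Y := by
  ext p q
  simp only [onLeft, Matrix.mul_apply, Fintype.sum_prod_type, Matrix.of_apply, mul_ite,
    mul_zero, ite_mul, zero_mul]
  by_cases h : p.2 = q.2 <;> simp [h]

theorem onRight_mul (X Y : Matrix l l A) : onRight k (X * Y) = onRight k X * onRight k Y := by
  ext p q
  simp only [onRight, Matrix.mul_apply, Fintype.sum_prod_type, Matrix.of_apply, mul_ite,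
    mul_zero, ite_mul, zero_mul]
  by_cases h : p.1 = q.1 <;> simp [h]

theorem onLeft_one : onLeft l (1 : Matrix k k A) = 1 := by
  ext p q
  simp only [onLeft, Matrix.of_apply, Matrix.one_apply, Prod.ext_iff]
  by_cases h : p.2 = q.2 <;> simp [h]

theorem onRight_one : onRight k (1 : Matrix l l A) = 1 := by
  ext p q
  simp only [onRight, Matrix.of_apply, Matrix.one_apply, Prod.ext_iff]
  by_cases h : p.1 = q.1 <;> simp [h]

theorem onLeft_map {B : Type*} [Ring B] (f : A →+* B) (X : Matrix k k A) :
    onLeft l (X.map f) = (onLeft l X).map f := by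
  ext p q
  by_cases h : p.2 = q.2 <;> simp [onLeft, h]

theorem onRight_map {B : Type*} [Ring B] (f : A →+* B) (X : Matrix l l A) :
    onRight k (X.map f) = (onRight k X).map f := by
  ext p q
  by_cases h : p.1 = q.1 <;> simp [onRight, h]

end Legs

section Invariance

variable {A : Type*} [Ring A] [Algebra ℂ A]

/-- The matrix of the functions `ξ ↦ τ^I(ξ)_{ab}`. -/
def U (A : Type*) [Ring A] [Algebra ℂ A] (I : ι) :
    Matrix (Fin (D.n I)) (Fin (D.n I)) (WithConv (G →ₗ[ℂ] A)) :=
  conv A (D.τ I).toAlgHom.toLinearMap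

/-- The matrix of the functions `ξ ↦ τ^I(S(ξ))_{ab}`. -/
def Uinv (A : Type*) [Ring A] [Algebra ℂ A] (I : ι) :
    Matrix (Fin (D.n I)) (Fin (D.n I)) (WithConv (G →ₗ[ℂ] A)) :=
  conv A ((D.τ I).toAlgHom.toLinearMap ∘ₗ HopfAlgebra.antipode ℂ)

theorem conv_counit (k : Type*) [DecidableEq k] :
    conv A ((Coalgebra.counit (R := ℂ) (A := G)).smulRight (1 : Matrix k k ℂ)) = 1 := by
  ext a b ξ
  rw [conv_apply]
  by_cases h : a = b
  · subst h
    simp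
  · simp [Matrix.one_apply_ne h]

theorem Uinv_mul_U (I : ι) : D.Uinv A I * D.U A I = 1 := by
  rw [← conv_counit]
  refine conv_mul _ _ _ fun ξ r => ?_
  have h := congrArg (D.τ I) (HopfAlgebra.sum_antipode_mul_eq_smul (R := ℂ) r)
  simp only [map_sum, map_mul, map_smul, map_one] at h
  exact h.symm

theorem U_mul_Uinv (I : ι) : D.U A I * D.Uinv A I = 1 := by
  rw [← conv_counit]
  refine conv_mul _ _ _ fun ξ r => ?_
  have h := congrArg (D.τ I) (HopfAlgebra.sum_mul_antipode_eq_smul (R := ℂ) r)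
  simp only [map_sum, map_mul, map_smul, map_one] at h
  exact h.symm

theorem ten_tmul (I J : ι) (x y : G) : D.ten I J (x ⊗ₜ y) = D.τ I x ⊗ₖ D.τ J y := by
  simp [IrrepSystem.ten]

theorem ten_star (I J : ι) (X : G ⊗[ℂ] G) : D.ten I J (star X) = (D.ten I J X)ᴴ := by
  induction X with
  | zero => simp
  | add x y hx hy => rw [star_add, map_add, map_add, hx, hy, Matrix.conjTranspose_add]
  | tmul x y =>
    rw [TensorProduct.star_tmul, ten_tmul, ten_tmul, Matrix.conjTranspose_kronecker,
      map_star, map_star]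
    rfl

theorem swapT_star (X : G ⊗[ℂ] G) : swapT G (star X) = star (swapT G X) := by
  induction X with
  | zero => simp
  | add x y hx hy => rw [star_add, map_add, map_add, hx, hy, star_add]
  | tmul x y => simp [swapT]

/-- `ξ ↦ (τ^I ⊗ τ^J)(Δ ξ)`. -/
def tenComul (I J : ι) :
    G →ₗ[ℂ] Matrix (Fin (D.n I) × Fin (D.n J)) (Fin (D.n I) × Fin (D.n J)) ℂ :=
  (D.ten I J).toLinearMap ∘ₗ Coalgebra.comul

/-- `ξ ↦ (τ^I ⊗ τ^J)(Δ' ξ)`. -/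
def tenComulOp (I J : ι) :
    G →ₗ[ℂ] Matrix (Fin (D.n I) × Fin (D.n J)) (Fin (D.n I) × Fin (D.n J)) ℂ :=
  (D.ten I J).toLinearMap ∘ₗ (swapT G).toLinearMap ∘ₗ Coalgebra.comul

theorem U_left_right (I J : ι) :
    onLeft _ (D.U A I) * onRight _ (D.U A J) = conv A (D.tenComul I J) := by
  rw [onLeft_mul_onRight]
  ext p q ξ
  have r := Coalgebra.Repr.arbitrary ℂ ξ
  rw [conv_apply, Matrix.of_apply, r.convMul_apply, tenComul, LinearMap.comp_apply, ← r.eq]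
  simp [U, conv_apply, ten_tmul, Matrix.sum_apply]

theorem U_right_left (I J : ι) :
    onRight _ (D.U A J) * onLeft _ (D.U A I) = conv A (D.tenComulOp I J) := by
  rw [onRight_mul_onLeft]
  ext p q ξ
  have r := Coalgebra.Repr.arbitrary ℂ ξ
  rw [conv_apply, Matrix.of_apply, r.convMul_apply, tenComulOp, LinearMap.comp_apply,
    LinearMap.comp_apply, ← r.eq]
  simp [U, conv_apply, ten_tmul, Matrix.sum_apply, swapT, ← map_mul, mul_comm]

theorem R_mul_UU (I J : ι) :
    scal (WithConv (G →ₗ[ℂ] A)) (D.RR I J) * (onLeft _ (D.U A I) * onRight _ (D.U A J)) =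
      onRight _ (D.U A J) * onLeft _ (D.U A I) * scal (WithConv (G →ₗ[ℂ] A)) (D.RR I J) := by
  rw [U_left_right, U_right_left,
    conv_mul_scal _ _ (LinearMap.mulRight ℂ (D.RR I J) ∘ₗ D.tenComulOp I J) (fun _ => rfl)]
  refine scal_mul_conv _ _ _ fun ξ => ?_
  have h := congrArg (D.ten I J) (D.intertwine ξ)
  rw [map_mul, map_mul] at h
  exact h.symm

theorem CG_mul_UU (I J K : ι) (a : Fin (D.fusion I J K)) :
    scal (WithConv (G →ₗ[ℂ] A)) (D.CG I J K a).1 * (onLeft _ (D.U A I) * onRight _ (D.U A J)) =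
      D.U A K * scal (WithConv (G →ₗ[ℂ] A)) (D.CG I J K a).1 := by
  rw [U_left_right, U,
    conv_mul_scal _ _ (mulRightLinearMap (Fin (D.n K)) ℂ (D.CG I J K a).1 ∘ₗ
      (D.τ K).toAlgHom.toLinearMap) (fun _ => rfl)]
  exact scal_mul_conv _ _ _ fun ξ => ((D.CG I J K a).2 ξ).symm

theorem UU_mul_CG (I J K : ι) (a : Fin (D.fusion I J K)) :
    (onRight _ (D.U A J) * onLeft _ (D.U A I)) * scal (WithConv (G →ₗ[ℂ] A)) ((D.CG I J K a).1)ᴴ =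
      scal (WithConv (G →ₗ[ℂ] A)) ((D.CG I J K a).1)ᴴ * D.U A K := by
  rw [U_right_left, U,
    scal_mul_conv _ _ (mulLeftLinearMap (Fin (D.n K)) ℂ ((D.CG I J K a).1)ᴴ ∘ₗ
      (D.τ K).toAlgHom.toLinearMap) (fun _ => rfl)]
  refine conv_mul_scal _ _ _ fun ξ => ?_
  have h := congrArg Matrix.conjTranspose ((D.CG I J K a).2 (star ξ))
  rw [Matrix.conjTranspose_mul, Matrix.conjTranspose_mul, ← ten_star, D.comul_star,
    ← swapT_star, star_star, map_star] at h
  rw [Matrix.star_eq_conjTranspose, Matrix.conjTranspose_conjTranspose] at h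
  exact h.symm

theorem dress_aux {Q : Type*} [Ring Q] {U₁ V₂ U₂ R : Q} (h₂ : V₂ * U₂ = 1)
    (h₂' : U₂ * V₂ = 1) (hR : R * (U₁ * U₂) = U₂ * U₁ * R) : U₁ * R * V₂ = V₂ * R * U₁ := by
  calc U₁ * R * V₂ = V₂ * (U₂ * U₁ * R) * V₂ := by
        simp only [← mul_assoc]
        rw [h₂, one_mul]
    _ = V₂ * (R * (U₁ * U₂)) * V₂ := by rw [hR]
    _ = V₂ * R * U₁ := by
        simp only [mul_assoc]
        rw [h₂', mul_one]

theorem fun_aux {Q : Type*} [Ring Q] {V₁ U₁ V₂ U₂ M₁ M₂ R : Q} (h₂ : V₂ * U₂ = 1)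
    (h₂' : U₂ * V₂ = 1) (hR : R * (U₁ * U₂) = U₂ * U₁ * R)
    (c₁ : M₁ * V₂ = V₂ * M₁) (c₂ : U₁ * M₂ = M₂ * U₁) :
    (V₁ * M₁ * U₁) * R * (V₂ * M₂ * U₂) = V₁ * V₂ * (M₁ * R * M₂) * (U₁ * U₂) := by
  have h := dress_aux h₂ h₂' hR
  calc (V₁ * M₁ * U₁) * R * (V₂ * M₂ * U₂) = V₁ * M₁ * (U₁ * R * V₂) * M₂ * U₂ := by
        simp only [mul_assoc]
    _ = V₁ * (M₁ * V₂) * R * (U₁ * M₂) * U₂ := by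
        rw [h]
        simp only [mul_assoc]
    _ = V₁ * V₂ * (M₁ * R * M₂) * (U₁ * U₂) := by
        rw [c₁, c₂]
        simp only [mul_assoc]

theorem inv_aux {Q : Type*} [Ring Q] {V₁ U₁ V₂ U₂ R R' : Q} (h₁ : V₁ * U₁ = 1)
    (h₁' : U₁ * V₁ = 1) (h₂ : V₂ * U₂ = 1) (h₂' : U₂ * V₂ = 1)
    (hr : R' * R = 1) (hr' : R * R' = 1)
    (hR : R * (U₁ * U₂) = U₂ * U₁ * R) : R' * (V₁ * V₂) = V₂ * V₁ * R' := by
  calc R' * (V₁ * V₂) = (V₂ * (V₁ * U₁) * U₂) * R' * (V₁ * V₂) := by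
        rw [h₁, mul_one, h₂, one_mul]
    _ = V₂ * V₁ * (R' * (R * (U₁ * U₂))) * R' * (V₁ * V₂) := by
        rw [← mul_assoc R' R, hr, one_mul]
        simp only [mul_assoc]
    _ = V₂ * V₁ * R' * (U₂ * (U₁ * (R * R') * V₁) * V₂) := by
        rw [hR]
        simp only [mul_assoc]
    _ = V₂ * V₁ * R' := by
        rw [hr', mul_one, h₁', mul_one, h₂', mul_one]

theorem exch_aux {Q : Type*} [Ring Q] {V₁ U₁ V₂ U₂ M₁ M₂ R R' : Q} (h₁ : V₁ * U₁ = 1)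
    (h₁' : U₁ * V₁ = 1) (h₂ : V₂ * U₂ = 1) (h₂' : U₂ * V₂ = 1)
    (hr : R' * R = 1) (hr' : R * R' = 1)
    (hR : R * (U₁ * U₂) = U₂ * U₁ * R)
    (c₁ : M₁ * V₂ = V₂ * M₁) (c₂ : U₁ * M₂ = M₂ * U₁) (c₃ : M₂ * V₁ = V₁ * M₂)
    (c₄ : U₂ * M₁ = M₁ * U₂) (hM : R' * M₁ * R * M₂ = M₂ * R' * M₁ * R) :
    R' * (V₁ * M₁ * U₁) * R * (V₂ * M₂ * U₂) = (V₂ * M₂ * U₂) * R' * (V₁ * M₁ * U₁) * R := by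
  have hi := inv_aux h₁ h₁' h₂ h₂' hr hr' hR
  have hR' : R' * (U₂ * U₁) = U₁ * U₂ * R' := by
    calc R' * (U₂ * U₁) = R' * (U₂ * U₁ * R) * R' := by
          simp only [mul_assoc]
          rw [hr', mul_one]
      _ = U₁ * U₂ * R' := by
          rw [← hR, ← mul_assoc R' R, hr, one_mul]
  have h := dress_aux h₁ h₁' hR'
  calc R' * (V₁ * M₁ * U₁) * R * (V₂ * M₂ * U₂)
        = R' * ((V₁ * M₁ * U₁) * R * (V₂ * M₂ * U₂)) := by simp only [mul_assoc]
    _ = R' * (V₁ * V₂) * (M₁ * R * M₂) * (U₁ * U₂) := by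
        rw [fun_aux h₂ h₂' hR c₁ c₂]
        simp only [mul_assoc]
    _ = V₂ * V₁ * (R' * M₁ * R * M₂) * (U₁ * U₂) := by
        rw [hi]
        simp only [mul_assoc]
    _ = V₂ * (V₁ * M₂) * R' * M₁ * (R * (U₁ * U₂)) := by
        rw [hM]
        simp only [mul_assoc]
    _ = V₂ * M₂ * (V₁ * R' * U₂) * M₁ * U₁ * R := by
        rw [← c₃, hR]
        simp only [mul_assoc]
        rw [← mul_assoc M₁ U₂, ← c₄]
        simp only [mul_assoc]
    _ = (V₂ * M₂ * U₂) * R' * (V₁ * M₁ * U₁) * R := by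
        rw [← h]
        simp only [mul_assoc]

/-- The matrix `ξ ↦ ∑ τ^I(S(ξ¹)) X^I τ^I(ξ²)`, with entries in the convolution algebra. -/
def dress (X : ∀ I, Matrix (Fin (D.n I)) (Fin (D.n I)) A) (I : ι) :
    Matrix (Fin (D.n I)) (Fin (D.n I)) (WithConv (G →ₗ[ℂ] A)) :=
  D.Uinv A I * (X I).map (constConv G A) * D.U A I

theorem scal_map {B : Type*} [Ring B] [Algebra ℂ B] {k l : Type*} (f : A →ₐ[ℂ] B)
    (Y : Matrix k l ℂ) : (scal A Y).map f = scal B Y := by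
  ext a b
  simp [scal]

theorem scal_mul {k l j : Type*} [Fintype l] (X : Matrix k l ℂ) (Y : Matrix l j ℂ) :
    scal A (X * Y) = scal A X * scal A Y := by
  rw [scal, scal, scal, Matrix.map_mul]

theorem scal_one {k : Type*} [DecidableEq k] : scal A (1 : Matrix k k ℂ) = 1 := by
  simp [scal, Matrix.map_one]

theorem map_funL {B : Type*} [Ring B] [Algebra ℂ B] (f : A →ₐ[ℂ] B)
    (X : ∀ I, Matrix (Fin (D.n I)) (Fin (D.n I)) A) (I J : ι) :
    (D.funL X I J).map f = D.funL (fun I => (X I).map f) I J := by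
  rw [funL, funL, Matrix.map_mul, Matrix.map_mul, scal_map]
  congr 1
  · congr 1
    exact (onLeft_map f.toRingHom _).symm
  · exact (onRight_map f.toRingHom _).symm

theorem map_fuse {B : Type*} [Ring B] [Algebra ℂ B] (f : A →ₐ[ℂ] B)
    (X : ∀ I, Matrix (Fin (D.n I)) (Fin (D.n I)) A) (I J : ι) :
    (D.fuse X I J).map f = D.fuse (fun I => (X I).map f) I J := by
  have h : ∀ Y, Y.map f = f.toRingHom.toAddMonoidHom.mapMatrix
    (m := Fin (D.n I) × Fin (D.n J)) (n := Fin (D.n I) × Fin (D.n J)) Y := fun _ => rfl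
  rw [fuse, fuse, h]
  simp only [map_sum]
  refine Finset.sum_congr rfl fun K _ => Finset.sum_congr rfl fun a _ => ?_
  rw [← h, Matrix.map_mul, Matrix.map_mul, scal_map, scal_map]

theorem map_exchL {B : Type*} [Ring B] [Algebra ℂ B] (f : A →ₐ[ℂ] B)
    (X Y : ∀ I, Matrix (Fin (D.n I)) (Fin (D.n I)) A) (I J : ι) :
    (D.exchL X Y I J).map f = D.exchL (fun I => (X I).map f) (fun I => (Y I).map f) I J := by
  rw [exchL, exchL, Matrix.map_mul, Matrix.map_mul, Matrix.map_mul, scal_map, scal_map]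
  congr 1
  · congr 2
    exact (onLeft_map f.toRingHom _).symm
  · exact (onRight_map f.toRingHom _).symm

theorem map_exchR {B : Type*} [Ring B] [Algebra ℂ B] (f : A →ₐ[ℂ] B)
    (X Y : ∀ I, Matrix (Fin (D.n I)) (Fin (D.n I)) A) (I J : ι) :
    (D.exchR X Y I J).map f = D.exchR (fun I => (X I).map f) (fun I => (Y I).map f) I J := by
  rw [exchR, exchR, Matrix.map_mul, Matrix.map_mul, Matrix.map_mul, scal_map, scal_map]
  congr 2
  · congr 1
    exact (onRight_map f.toRingHom _).symm
  · exact (onLeft_map f.toRingHom _).symm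

theorem comm_left (X : ∀ I, Matrix (Fin (D.n I)) (Fin (D.n I)) A) (I J : ι)
    (F : G →ₗ[ℂ] Matrix (Fin (D.n J)) (Fin (D.n J)) ℂ) :
    onLeft _ ((X I).map (constConv G A)) * onRight _ (conv A F) =
      onRight _ (conv A F) * onLeft _ ((X I).map (constConv G A)) :=
  leg_comm _ _ fun _ _ _ _ => constConv_comm _ _ _ _

theorem comm_right (X : ∀ I, Matrix (Fin (D.n I)) (Fin (D.n I)) A) (I J : ι)
    (F : G →ₗ[ℂ] Matrix (Fin (D.n I)) (Fin (D.n I)) ℂ) :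
    onLeft _ (conv A F) * onRight _ ((X J).map (constConv G A)) =
      onRight _ ((X J).map (constConv G A)) * onLeft _ (conv A F) :=
  leg_comm _ _ fun _ _ _ _ => (constConv_comm _ _ _ _).symm

theorem onLeft_inv (I J : ι) :
    onLeft (Fin (D.n J)) (D.Uinv A I) * onLeft _ (D.U A I) = 1 ∧
    onLeft (Fin (D.n J)) (D.U A I) * onLeft _ (D.Uinv A I) = 1 := by
  rw [← onLeft_mul, ← onLeft_mul, Uinv_mul_U, U_mul_Uinv, onLeft_one]
  exact ⟨rfl, rfl⟩

theorem onRight_inv (I J : ι) :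
    onRight (Fin (D.n J)) (D.Uinv A I) * onRight _ (D.U A I) = 1 ∧
    onRight (Fin (D.n J)) (D.U A I) * onRight _ (D.Uinv A I) = 1 := by
  rw [← onRight_mul, ← onRight_mul, Uinv_mul_U, U_mul_Uinv, onRight_one]
  exact ⟨rfl, rfl⟩

theorem RR_inv (I J : ι) : D.RRinv I J * D.RR I J = 1 ∧ D.RR I J * D.RRinv I J = 1 := by
  rw [RR, RRinv, ← map_mul, ← map_mul, Units.inv_mul, Units.mul_inv, map_one]
  exact ⟨rfl, rfl⟩

theorem exch_dress {X Y : ∀ I, Matrix (Fin (D.n I)) (Fin (D.n I)) A} {I J : ι}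
    (h : D.exchL X Y I J = D.exchR X Y I J) :
    D.exchL (D.dress X) (D.dress Y) I J = D.exchR (D.dress X) (D.dress Y) I J := by
  have h' := congrArg (fun Z => Z.map (constConv G A)) h
  simp only [map_exchL, map_exchR] at h'
  rw [exchL, exchR] at h' ⊢
  simp only [dress, onLeft_mul, onRight_mul]
  refine exch_aux (D.onLeft_inv I J).1 (D.onLeft_inv I J).2 (D.onRight_inv J I).1
    (D.onRight_inv J I).2 ?_ ?_ (D.R_mul_UU I J) (D.comm_left X I J _) (D.comm_right Y I J _)
    (D.comm_right Y I J _).symm (D.comm_left X I J _).symm h'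
  · rw [← scal_mul, (D.RR_inv I J).1, scal_one]
  · rw [← scal_mul, (D.RR_inv I J).2, scal_one]

theorem fun_dress {X : ∀ I, Matrix (Fin (D.n I)) (Fin (D.n I)) A} {I J : ι}
    (h : D.funL X I J = D.fuse X I J) :
    D.funL (D.dress X) I J = D.fuse (D.dress X) I J := by
  have h' := congrArg (fun Z => Z.map (constConv G A)) h
  simp only [map_funL, map_fuse] at h'
  rw [funL] at h' ⊢
  simp only [dress, onLeft_mul, onRight_mul]
  rw [fun_aux (D.onRight_inv J I).1 (D.onRight_inv J I).2 (D.R_mul_UU I J)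
    (D.comm_left X I J _) (D.comm_right X I J _), h', fuse, fuse, Matrix.mul_sum,
    Matrix.sum_mul]
  refine Finset.sum_congr rfl fun K _ => ?_
  rw [Matrix.mul_sum, Matrix.sum_mul]
  refine Finset.sum_congr rfl fun a _ => ?_
  have e1 := D.CG_mul_UU (A := A) I J K a
  have e2 : onLeft (Fin (D.n J)) (D.Uinv A I) * (onRight (Fin (D.n I)) (D.Uinv A J) * scal (WithConv (G →ₗ[ℂ] A)) ((D.CG I J K a).1)ᴴ) =
      scal (WithConv (G →ₗ[ℂ] A)) ((D.CG I J K a).1)ᴴ * D.Uinv A K := by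
    have e3 := D.UU_mul_CG (A := A) I J K a
    calc onLeft (Fin (D.n J)) (D.Uinv A I) * (onRight (Fin (D.n I)) (D.Uinv A J) * scal (WithConv (G →ₗ[ℂ] A)) ((D.CG I J K a).1)ᴴ)
        = onLeft (Fin (D.n J)) (D.Uinv A I) * (onRight (Fin (D.n I)) (D.Uinv A J) *
            (scal (WithConv (G →ₗ[ℂ] A)) ((D.CG I J K a).1)ᴴ * D.U A K * D.Uinv A K)) := by
          rw [Matrix.mul_assoc (scal (WithConv (G →ₗ[ℂ] A)) _), U_mul_Uinv, Matrix.mul_one]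
      _ = onLeft (Fin (D.n J)) (D.Uinv A I) * ((onRight (Fin (D.n I)) (D.Uinv A J) * onRight (Fin (D.n I)) (D.U A J)) *
            (onLeft (Fin (D.n J)) (D.U A I) * (scal (WithConv (G →ₗ[ℂ] A)) ((D.CG I J K a).1)ᴴ * D.Uinv A K))) := by
          rw [← e3]
          simp only [Matrix.mul_assoc]
      _ = scal (WithConv (G →ₗ[ℂ] A)) ((D.CG I J K a).1)ᴴ * D.Uinv A K := by
          rw [(D.onRight_inv J I).1, Matrix.one_mul, ← Matrix.mul_assoc,
            (D.onLeft_inv I J).1, Matrix.one_mul]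
  simp only [Matrix.mul_assoc, dress]
  rw [e1]
  simp only [← Matrix.mul_assoc]
  simp only [← Matrix.mul_assoc] at e2
  rw [e2]

end Invariance

theorem M_eq (m : ℕ) (ν : Fin m) : (fun I => (D.freeM ν I).map (D.proj m)) = D.M ν := rfl

theorem M_fun (m : ℕ) (ν : Fin m) (I J : ι) : D.funL (D.M ν) I J = D.fuse (D.M ν) I J := by
  rw [← M_eq, ← map_funL, ← map_fuse]
  ext p q
  exact RingQuot.mkAlgHom_rel ℂ (GraphRel.functoriality ν I J p q)

theorem M_exch (m : ℕ) (ν μ : Fin m) (h : ν < μ) (I J : ι) :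
    D.exchL (D.M ν) (D.M μ) I J = D.exchR (D.M ν) (D.M μ) I J := by
  rw [← M_eq, ← M_eq, ← map_exchL, ← map_exchR]
  ext p q
  exact RingQuot.mkAlgHom_rel ℂ (GraphRel.exchange ν μ h I J p q)

theorem M_triv (m : ℕ) (ν : Fin m) : D.M ν D.triv = 1 := by
  have h : (1 : Matrix (Fin (D.n D.triv)) (Fin (D.n D.triv)) (FreeAlgebra ℂ (D.Gen m))).map
      (D.proj m) = 1 := Matrix.map_one _ (map_zero _) (map_one _)
  rw [← h]
  ext a b
  exact RingQuot.mkAlgHom_rel ℂ (GraphRel.unit ν a b)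

/-- The action of `G` on the graph algebra `L_m`, as the algebra homomorphism
`X ↦ (ξ ↦ ξ(X))` into the convolution algebra `Hom(G, L_m)`. On generators it is
`ξ(M_ν^I) = ∑ τ^I(S(ξ¹)) M_ν^I τ^I(ξ²)`; multiplicativity with respect to the convolution
product says that `ξ(XY) = ∑ ξ¹(X) ξ²(Y)`. -/
def actHom (m : ℕ) : D.L m →ₐ[ℂ] WithConv (G →ₗ[ℂ] D.L m) :=
  RingQuot.liftAlgHom ℂ ⟨FreeAlgebra.lift ℂ fun x : D.Gen m => D.dress (D.M x.ν) x.I x.a x.b, by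
    have hφ : ∀ ν : Fin m, (fun I => (D.freeM ν I).map
        (FreeAlgebra.lift ℂ fun x : D.Gen m => D.dress (D.M x.ν) x.I x.a x.b)) =
        D.dress (D.M ν) := by
      intro ν
      ext I a b
      simp [freeM]
    intro x y hxy
    cases hxy with
    | functoriality ν I J p q =>
      have h := D.fun_dress (D.M_fun m ν I J)
      rw [← hφ, ← map_funL, ← map_fuse] at h
      exact congrFun (congrFun h p) q
    | exchange ν μ hνμ I J p q =>
      have h := D.exch_dress (D.M_exch m ν μ hνμ I J)
      rw [← hφ, ← hφ, ← map_exchL, ← map_exchR] at h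
      exact congrFun (congrFun h p) q
    | unit ν a b =>
      have h : D.dress (D.M ν) D.triv = 1 := by
        rw [dress, M_triv, Matrix.map_one _ (map_zero _) (map_one _), Matrix.mul_one, Uinv_mul_U]
      have h2 := congrFun (congrFun ((congrFun (hφ ν) D.triv).trans h) a) b
      rw [Matrix.map_apply] at h2
      rw [h2]
      by_cases hab : a = b
      · subst hab
        simp
      · simp [Matrix.one_apply_ne hab]⟩

/-- `ξ(X)`, for `ξ ∈ G` and `X ∈ L_m`. -/
def act {m : ℕ} (ξ : G) (X : D.L m) : D.L m := (D.actHom m X).ofConv ξ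

theorem actHom_M {m : ℕ} (ν : Fin m) (I : ι) (a b : Fin (D.n I)) :
    D.actHom m (D.M ν I a b) = D.dress (D.M ν) I a b := by
  have h : D.M ν I a b = RingQuot.mkAlgHom ℂ (D.GraphRel m) (D.freeM ν I a b) := rfl
  rw [h]
  refine (RingQuot.liftAlgHom_mkAlgHom_apply ℂ _ _ _).trans ?_
  simp [freeM]

/-- The algebra `A_m` of invariants: all `X ∈ L_m` with `ξ(X) = ε(ξ) X` for all `ξ ∈ G`. -/
def invariants (m : ℕ) : Subalgebra ℂ (D.L m) where
  carrier := {X | ∀ ξ : G, D.act ξ X = Coalgebra.counit (R := ℂ) ξ • X}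
  mul_mem' := by
    intro X Y hX hY
    have hX' : D.actHom m X = constConv G (D.L m) X := by
      ext ξ
      exact hX ξ
    have hY' : D.actHom m Y = constConv G (D.L m) Y := by
      ext ξ
      exact hY ξ
    intro ξ
    rw [act, map_mul, hX', hY', ← map_mul]
    rfl
  add_mem' := by
    intro X Y hX hY ξ
    have h : D.act ξ (X + Y) = D.act ξ X + D.act ξ Y := by simp [act]
    rw [h, hX ξ, hY ξ, smul_add]
  algebraMap_mem' := by
    intro c ξ
    rw [act, AlgHom.commutes, ← AlgHom.commutes (constConv G (D.L m))]
    rfl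

/-! ### The moduli algebra -/

/-- `c_ν^I = κ_I tr_q^I(M_ν^I)`. -/
def c {m : ℕ} (ν : Fin m) (I : ι) : D.L m := D.κ I • D.qtr I (D.M ν I)

/-- `κ_I^(m-1) M_m^I ⋯ M_1^I`, the holonomy around all the punctures. -/
def total (m : ℕ) (I : ι) : Matrix (Fin (D.n I)) (Fin (D.n I)) (D.L m) :=
  (D.κ I) ^ ((m : ℤ) - 1) • (List.ofFn fun ν : Fin m => D.M ν I).reverse.prod

/-- `c_0^I = κ_I tr_q^I(κ_I^(m-1) M_m^I ⋯ M_1^I)`. -/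
def c₀ (m : ℕ) (I : ι) : D.L m := D.κ I • D.qtr I (D.total m I)

/-- The coefficient `(∑_L d_L²)^(-1/2) d_K S_{K Ī}` of `c^I` in the characteristic
projector `χ^K`. -/
def chiCoeff (K I : ι) : ℂ := (D.norm_const : ℂ) * D.qdim K * D.S K (D.bar I)

/-- The characteristic projector `χ_ν^K`. -/
def χ {m : ℕ} (ν : Fin m) (K : ι) : D.L m := ∑ I, D.chiCoeff K I • D.c ν I

/-- The characteristic projector `χ_0^K`. -/
def χ₀ (m : ℕ) (K : ι) : D.L m := ∑ I, D.chiCoeff K I • D.c₀ m I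

/-- `χ_0^0 ∏_ν χ_ν^{K_ν}`. -/
def moduliUnit {m : ℕ} (K : Fin m → ι) : D.L m :=
  D.χ₀ m D.triv * (List.ofFn fun ν => D.χ ν (K ν)).prod

/-- The moduli algebra `M_m^{K_1,…,K_m} = χ_0^0 ∏_ν χ_ν^{K_ν} A_m`. The element
`χ_0^0 ∏_ν χ_ν^{K_ν}` is a central projector of `A_m`, hence the set of all the products
below is an algebra, and it coincides with the algebra that it generates. -/
def moduli {m : ℕ} (K : Fin m → ι) : NonUnitalSubalgebra ℂ (D.L m) :=
  NonUnitalAlgebra.adjoin ℂ {Y | ∃ X ∈ D.invariants m, Y = D.moduliUnit K * X}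

/-- The element `c^I(l) = tr_q^I(M_m^I M_{m-1}^I)` for the cycle `l = l_m l_{m-1}`, where
`m = n + 2`. -/
def cycleElt (n : ℕ) (I : ι) : D.L (n + 2) :=
  D.qtr I (D.M (Fin.last (n + 1)) I * D.M (Fin.last n).castSucc I)

/-- The fusion algebra `V(l)` in the moduli algebra, generated by the images of the
`c^I(l)`. -/
def fusionAlg {n : ℕ} (K : Fin (n + 2) → ι) : NonUnitalSubalgebra ℂ (D.L (n + 2)) :=
  NonUnitalAlgebra.adjoin ℂ {Y | ∃ I, Y = D.moduliUnit K * D.cycleElt n I}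

/-- The commutant of `V(l)` in the moduli algebra. -/
def fusionCommutant {n : ℕ} (K : Fin (n + 2) → ι) : NonUnitalSubalgebra ℂ (D.L (n + 2)) :=
  D.moduli K ⊓ NonUnitalSubalgebra.centralizer ℂ (D.fusionAlg K : Set (D.L (n + 2)))

/-! ### The semi-direct product and the `*`-operation -/

/-- The linear embedding of the generators `ξ ∈ G` into the tensor algebra of `G × L_m`. -/
def preG (m : ℕ) : G →ₗ[ℂ] TensorAlgebra ℂ (G × D.L m) :=
  TensorAlgebra.ι ℂ ∘ₗ LinearMap.inl ℂ G (D.L m)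

/-- The linear embedding of the generators `X ∈ L_m` into the tensor algebra of `G × L_m`. -/
def preL (m : ℕ) : D.L m →ₗ[ℂ] TensorAlgebra ℂ (G × D.L m) :=
  TensorAlgebra.ι ℂ ∘ₗ LinearMap.inr ℂ G (D.L m)

/-- `(τ^J ⊗ f)(X)` for `X ∈ G ⊗ G`, as a matrix. -/
def half {B : Type*} [Ring B] [Algebra ℂ B] (J : ι) (f : G →ₗ[ℂ] B) (X : G ⊗[ℂ] G) :
    Matrix (Fin (D.n J)) (Fin (D.n J)) B :=
  Matrix.of fun a b => TensorProduct.lid ℂ B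
    (TensorProduct.map (Matrix.entryLinearMap ℂ ℂ a b ∘ₗ (D.τ J).toAlgHom.toLinearMap) f X)

/-- The defining relations of the semi-direct product `S_m` of `L_m` and `G`: it contains
`L_m` and `G` as subalgebras, and `μ^J(ξ) M_ν^J = M_ν^J μ^J(ξ)`, where
`μ^J(ξ) = (τ^J ⊗ id)(Δ ξ)`. -/
inductive CrossRel (m : ℕ) :
    TensorAlgebra ℂ (G × D.L m) → TensorAlgebra ℂ (G × D.L m) → Prop
  | oneG : CrossRel m (D.preG m 1) 1
  | mulG (ξ η : G) : CrossRel m (D.preG m (ξ * η)) (D.preG m ξ * D.preG m η)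
  | oneL : CrossRel m (D.preL m 1) 1
  | mulL (X Y : D.L m) : CrossRel m (D.preL m (X * Y)) (D.preL m X * D.preL m Y)
  | cross (ξ : G) (ν : Fin m) (J : ι) (a b : Fin (D.n J)) :
      CrossRel m
        ((D.half J (D.preG m) (Coalgebra.comul (R := ℂ) ξ) * (D.M ν J).map (D.preL m)) a b)
        (((D.M ν J).map (D.preL m) * D.half J (D.preG m) (Coalgebra.comul (R := ℂ) ξ)) a b)

/-- The semi-direct product `S_m` of `L_m` and `G`. -/
def SD (m : ℕ) : Type _ := RingQuot (D.CrossRel m)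

instance (m : ℕ) : Ring (D.SD m) := inferInstanceAs (Ring (RingQuot (D.CrossRel m)))

instance (m : ℕ) : Algebra ℂ (D.SD m) :=
  inferInstanceAs (Algebra ℂ (RingQuot (D.CrossRel m)))

/-- The embedding of `G` into `S_m`. -/
def inG (m : ℕ) : G →ₗ[ℂ] D.SD m :=
  (RingQuot.mkAlgHom ℂ (D.CrossRel m)).toLinearMap ∘ₗ D.preG m

/-- The embedding of `L_m` into `S_m`. -/
def inL (m : ℕ) : D.L m →ₗ[ℂ] D.SD m :=
  (RingQuot.mkAlgHom ℂ (D.CrossRel m)).toLinearMap ∘ₗ D.preL m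

/-- The matrix `(M_ν^I)^* = σ_κ(R^I (M_ν^I)⁻¹ (R⁻¹)^I)` over `S_m`, where
`R^I = (τ^I ⊗ id)(R)` and `σ_κ(F) = κ⁻¹ F κ` for the central element `κ` of `G`. The matrix
`M_ν^I` is invertible. -/
def Mstar {m : ℕ} (ν : Fin m) (I : ι) : Matrix (Fin (D.n I)) (Fin (D.n I)) (D.SD m) :=
  (D.half I (D.inG m) D.R * Ring.inverse ((D.M ν I).map (D.inL m)) *
    D.half I (D.inG m) ((D.R⁻¹ : (G ⊗[ℂ] G)ˣ) : G ⊗[ℂ] G)).map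
    fun F => D.inG m (Ring.inverse D.kappa) * F * D.inG m D.kappa

/-- The graph of the `*`-operation `L_m → S_m`, the conjugate-linear antimultiplicative map
given on generators by `Mstar`. As always for matrices with entries in a `*`-algebra, the
entries are related by `(X^*)_{ab} = (X_{ba})^*`. -/
inductive StarGraph (m : ℕ) : D.L m → D.SD m → Prop
  | scalar (z : ℂ) : StarGraph m (algebraMap ℂ _ z) (algebraMap ℂ _ (star z))
  | gen (ν : Fin m) (I : ι) (a b : Fin (D.n I)) : StarGraph m (D.M ν I a b) (D.Mstar ν I b a)
  | add {X X' : D.L m} {Y Y' : D.SD m} :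
      StarGraph m X Y → StarGraph m X' Y' → StarGraph m (X + X') (Y + Y')
  | mul {X X' : D.L m} {Y Y' : D.SD m} :
      StarGraph m X Y → StarGraph m X' Y' → StarGraph m (X * X') (Y' * Y)

/-- `IsAdj X Y` says that `Y = X^*`. The `*`-operation of `S_m` maps the algebra `A_m`,
and the moduli algebra, to itself. -/
def IsAdj {m : ℕ} (X Y : D.L m) : Prop := D.StarGraph m X (D.inL m Y)

end SymmetryData
end ChernSimons
end

noncomputable section

set_option linter.unusedSectionVars false

namespace ChernSimons

/-! ### Leg calculus -/

section LegCalculus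

variable {G : Type*} [Ring G] [HopfAlgebra ℂ G]
variable {A : Type*} [Ring A] [Algebra ℂ A] {B : Type*} [Ring B] [Algebra ℂ B]

/-! The graph algebra is a tensor power of `G` in disguise. Collect the matrices `κ_I M_ν^I` into
one universal element `N_ν` of `G ⊗ L_m`. Because `Θ = R Δ(κ) (κ ⊗ κ)⁻¹` is the Gram operator of the
Clebsch-Gordan maps (`ten_Θ`), functoriality for all pairs `I, J` becomes the single equation `R₁₂⁻¹
N₁₃ R₁₂ N₂₃ = (Δ ⊗ id)(N)`. The double braiding `Q = R'R` solves the same equation (`comulL_Q`), so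
sending the last monodromy to `Q₁₂` and the others to `R₁₂⁻¹ N₁₃ R₁₂` defines a homomorphism `phi :
L_{m+1} → G ⊗ L_m`. Invertibility of `S` makes `R` factorizable: the slices of `Q` exhaust `G`
(`exists_slice_Q`), and `phi` is onto. Normal ordering bounds the dimension of `L_{m+1}` from above
(`spanMap_surjective`), so `phi` is an isomorphism and `L_m ≅ G^{⊗m}`.

In this picture the iterated coproduct is a moment map `delta`. The product of all monodromies is
`(id ⊗ delta)(Q)` (`totalN_eq`), the invariants are the commutant of the image of `delta`
(`mem_invariants`), `χ_ν^K` is the minimal central idempotent `e_K` in one tensor factor, and `χ_0^0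
= delta(e_0)`. Hence the moduli algebra is the corner `p L_m p` of the projector `p = χ_0^0 ∏
χ_ν^{K_ν}` (`mem_moduli`), that is, the endomorphisms of the invariant vectors in the tensor product
of the `V^{K_ν}`.

The element `c^I(l)` is a multiple of `Δ(z_I)` in the last two factors, where `z_I = (tr_q^I ⊗
id)(Q)` (`cycleElt_eq`). As `S` is invertible, the `z_I` span the same space as the `e_J`, so the
commutant of `V(l)` consists of the elements that are block diagonal for the orthogonal projectors
`Δ(e_J)`, which sum to one. The Clebsch-Gordan maps and their duals split the block of `J` into
`V^J` times a multiplicity space of dimension `N = fusion(K_m, K_{m-1}, J)`; the block is therefore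
the moduli algebra with `K_{m-1}, K_m` replaced by `J`, tensored with the `N × N` matrices (`unit`,
`sum_component`). Pinching the sphere labelled `J̄, K_{m-1}, K_m` in the same way, down to two and
then one puncture, shows that its moduli algebra is that matrix algebra
(`exists_matrixUnits_three`). Gluing identifies the two systems of matrix units.

For the `*`-operation, `starL` is built by recursion: at each step the `*` of the new factor `G` is
tensored with the previous one and twisted by `Θ`. The cocycle identity for `Θ` and the Gram
property give `unit_{ab}^* = unit_{ba}` (`starL_unit`). The prescribed adjoint lives in the
semi-direct product, which is isomorphic to `G ⊗ L_m` by `ξ ↦ ∑ ξ² ⊗ delta(ξ¹)` (`decouple`). There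
it is `starL` conjugated by the flipped `Θ`; on the corner `delta` acts by the counit and the
conjugation disappears (`isAdj_iff`). -/

variable (G A) in
/-- `x ⊗ y ↦ x ⊗ y ⊗ 1`. -/
def j12 : G ⊗[ℂ] G →ₐ[ℂ] G ⊗[ℂ] (G ⊗[ℂ] A) :=
  Algebra.TensorProduct.map (AlgHom.id ℂ G) Algebra.TensorProduct.includeLeft

variable (G A) in
/-- `x ⊗ a ↦ x ⊗ 1 ⊗ a`. -/
def j13 : G ⊗[ℂ] A →ₐ[ℂ] G ⊗[ℂ] (G ⊗[ℂ] A) :=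
  Algebra.TensorProduct.map (AlgHom.id ℂ G) Algebra.TensorProduct.includeRight

variable (G A) in
/-- `x ⊗ a ↦ 1 ⊗ x ⊗ a`. -/
def j23 : G ⊗[ℂ] A →ₐ[ℂ] G ⊗[ℂ] (G ⊗[ℂ] A) :=
  Algebra.TensorProduct.includeRight

variable (G A) in
/-- `Δ ⊗ id`. -/
def comulL : G ⊗[ℂ] A →ₐ[ℂ] G ⊗[ℂ] (G ⊗[ℂ] A) :=
  (Algebra.TensorProduct.assoc ℂ ℂ ℂ G G A).toAlgHom.comp
    (Algebra.TensorProduct.map (Bialgebra.comulAlgHom ℂ G) (AlgHom.id ℂ A))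

variable (G) in
/-- `id ⊗ f`. -/
def idT (f : A →ₐ[ℂ] B) : G ⊗[ℂ] A →ₐ[ℂ] G ⊗[ℂ] B :=
  Algebra.TensorProduct.map (AlgHom.id ℂ G) f

variable (G A) in
/-- `ε ⊗ id`. -/
def counitL : G ⊗[ℂ] A →ₐ[ℂ] A :=
  (Algebra.TensorProduct.lid ℂ A).toAlgHom.comp
    (Algebra.TensorProduct.map (Bialgebra.counitAlgHom ℂ G) (AlgHom.id ℂ A))

variable (G A) in
/-- The flip of the first two legs. -/
def swap12 : G ⊗[ℂ] (G ⊗[ℂ] A) →ₐ[ℂ] G ⊗[ℂ] (G ⊗[ℂ] A) :=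
  (Algebra.TensorProduct.leftComm ℂ G G A).toAlgHom

/-- `(id ⊗ δ) Δ`. -/
def coact (δ : G →ₐ[ℂ] A) : G →ₐ[ℂ] G ⊗[ℂ] A := (idT G δ).comp (Bialgebra.comulAlgHom ℂ G)

@[simp] theorem j12_tmul (x y : G) : j12 G A (x ⊗ₜ y) = x ⊗ₜ (y ⊗ₜ 1) := rfl
@[simp] theorem j13_tmul (x : G) (a : A) : j13 G A (x ⊗ₜ a) = x ⊗ₜ (1 ⊗ₜ a) := rfl
@[simp] theorem j23_apply (X : G ⊗[ℂ] A) : j23 G A X = 1 ⊗ₜ X := rfl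
@[simp] theorem idT_tmul (f : A →ₐ[ℂ] B) (x : G) (a : A) : idT G f (x ⊗ₜ a) = x ⊗ₜ f a := rfl
@[simp] theorem counitL_tmul (x : G) (a : A) :
    counitL G A (x ⊗ₜ a) = Coalgebra.counit (R := ℂ) x • a := rfl
@[simp] theorem swap12_tmul (x y : G) (a : A) :
    swap12 G A (x ⊗ₜ (y ⊗ₜ a)) = y ⊗ₜ (x ⊗ₜ a) := rfl
@[simp] theorem swapT_tmul (x y : G) : swapT G (x ⊗ₜ y) = y ⊗ₜ x := rfl

theorem coact_apply (δ : G →ₐ[ℂ] A) (x : G) :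
    coact δ x = idT G δ (Coalgebra.comul (R := ℂ) x) := rfl

/-- In this form an induction on the first two legs can treat `Δ(x)` as an arbitrary tensor, with
`a` as a factor that commutes with it. -/
theorem comulL_tmul_eq (x : G) (a : A) : comulL G A (x ⊗ₜ a) =
    j12 G A (Coalgebra.comul (R := ℂ) x) * (1 ⊗ₜ (1 ⊗ₜ a)) := by
  change Algebra.TensorProduct.assoc ℂ ℂ ℂ G G A (Coalgebra.comul (R := ℂ) x ⊗ₜ a) = _
  induction Coalgebra.comul (R := ℂ) x with
  | zero => simp
  | add p q hp hq => simp only [TensorProduct.add_tmul, map_add, hp, hq, add_mul]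
  | tmul y z => simp

theorem swapT_swapT (X : G ⊗[ℂ] G) : swapT G (swapT G X) = X := by
  induction X with
  | zero => simp
  | add p q hp hq => rw [map_add, map_add, hp, hq]
  | tmul x y => rfl

theorem swap12_swap12 (X : G ⊗[ℂ] (G ⊗[ℂ] A)) : swap12 G A (swap12 G A X) = X :=
  (Algebra.TensorProduct.leftComm ℂ G G A).symm_apply_apply X

theorem swap12_j12 (X : G ⊗[ℂ] G) : swap12 G A (j12 G A X) = j12 G A (swapT G X) := by
  induction X with
  | zero => simp
  | add p q hp hq => simp only [map_add, hp, hq]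
  | tmul x y => rfl

theorem swap12_j13 (X : G ⊗[ℂ] A) : swap12 G A (j13 G A X) = j23 G A X := by
  induction X with
  | zero => simp
  | add p q hp hq => simp only [map_add, hp, hq]
  | tmul x y => rfl

theorem swap12_j23 (X : G ⊗[ℂ] A) : swap12 G A (j23 G A X) = j13 G A X := by
  rw [← swap12_j13, swap12_swap12]

theorem idT_j12 (f : A →ₐ[ℂ] B) (X : G ⊗[ℂ] G) : idT G (idT G f) (j12 G A X) = j12 G B X := by
  induction X with
  | zero => simp
  | add p q hp hq => simp only [map_add, hp, hq]
  | tmul x y => simp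

theorem idT_j13 (f : A →ₐ[ℂ] B) (X : G ⊗[ℂ] A) :
    idT G (idT G f) (j13 G A X) = j13 G B (idT G f X) := by
  induction X with
  | zero => simp
  | add p q hp hq => simp only [map_add, hp, hq]
  | tmul x y => simp

theorem idT_j23 (f : A →ₐ[ℂ] B) (X : G ⊗[ℂ] A) :
    idT G (idT G f) (j23 G A X) = j23 G B (idT G f X) := rfl

theorem idT_comulL (f : A →ₐ[ℂ] B) (X : G ⊗[ℂ] A) :
    idT G (idT G f) (comulL G A X) = comulL G B (idT G f X) := by
  induction X with
  | zero => simp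
  | add p q hp hq => simp only [map_add, hp, hq]
  | tmul x y => rw [comulL_tmul_eq, map_mul, idT_j12, idT_tmul, idT_tmul, idT_tmul, comulL_tmul_eq]

theorem idT_comp {C : Type*} [Ring C] [Algebra ℂ C] (f : A →ₐ[ℂ] B) (h : B →ₐ[ℂ] C)
    (X : G ⊗[ℂ] A) : idT G h (idT G f X) = idT G (h.comp f) X := by
  induction X with
  | zero => simp
  | add p q hp hq => simp only [map_add, hp, hq]
  | tmul x y => simp

theorem idT_id (X : G ⊗[ℂ] A) : idT G (AlgHom.id ℂ A) X = X := by
  simp [idT]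

theorem counitL_idT (f : A →ₐ[ℂ] B) (X : G ⊗[ℂ] A) :
    counitL G B (idT G f X) = f (counitL G A X) := by
  induction X with
  | zero => simp
  | add p q hp hq => simp only [map_add, hp, hq]
  | tmul x y => simp

theorem counitL_comul (x : G) : counitL G G (Coalgebra.comul (R := ℂ) x) = x := by
  have h := congrArg (TensorProduct.lid ℂ G) (Coalgebra.rTensor_counit_comul (R := ℂ) x)
  rw [TensorProduct.lid_tmul, one_smul] at h
  exact h

theorem counitL_coact (δ : G →ₐ[ℂ] A) (x : G) : counitL G A (coact δ x) = δ x := by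
  rw [coact_apply, counitL_idT, counitL_comul]

theorem counitL_j12 (X : G ⊗[ℂ] G) :
    counitL G (G ⊗[ℂ] A) (j12 G A X) = counitL G G X ⊗ₜ 1 := by
  induction X with
  | zero => simp
  | add p q hp hq => simp only [map_add, hp, hq, TensorProduct.add_tmul]
  | tmul x y => simp [TensorProduct.smul_tmul']

theorem counitL_j13 (X : G ⊗[ℂ] A) :
    counitL G (G ⊗[ℂ] A) (j13 G A X) = 1 ⊗ₜ counitL G A X := by
  induction X with
  | zero => simp
  | add p q hp hq => simp only [map_add, hp, hq, TensorProduct.tmul_add]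
  | tmul x y => simp

theorem counitL_j23 (X : G ⊗[ℂ] A) : counitL G (G ⊗[ℂ] A) (j23 G A X) = X := by simp

theorem counitL_comulL (X : G ⊗[ℂ] A) : counitL G (G ⊗[ℂ] A) (comulL G A X) = X := by
  induction X with
  | zero => simp
  | add p q hp hq => simp only [map_add, hp, hq]
  | tmul x y =>
    rw [comulL_tmul_eq, map_mul, counitL_j12, counitL_comul]
    simp

/-- If `δ` is the moment map of `L_m`, then `coact δ` is the one of `L_{m+1}` seen in `G ⊗ L_m`.
Coassociativity in this form drives every induction on the number of punctures. -/
theorem coassoc_coact (δ : G →ₐ[ℂ] A) (x : G) :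
    comulL G A (coact δ x) = coact (coact δ) x := by
  have h := Coalgebra.coassoc_apply (R := ℂ) x
  have h2 : comulL G G (Coalgebra.comul (R := ℂ) x) =
      idT G (Bialgebra.comulAlgHom ℂ G) (Coalgebra.comul (R := ℂ) x) := h
  rw [coact_apply, ← idT_comulL, h2, coact_apply, idT_comp]
  rfl

end LegCalculus

/-! ### Elementary consequences of quasitriangularity -/

section Quasitriangular

variable {G : Type*} [Ring G] [HopfAlgebra ℂ G] [StarRing G] [StarModule ℂ G]
variable {A : Type*} [Ring A] [Algebra ℂ A]

namespace RibbonStarHopf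

variable (H : RibbonStarHopf G)

/-- The inverse of the universal `R`-matrix. -/
def Ri : G ⊗[ℂ] G := ((H.R⁻¹ : (G ⊗[ℂ] G)ˣ) : G ⊗[ℂ] G)

theorem Ri_mul : H.Ri * H.R = 1 := Units.inv_mul _
theorem mul_Ri : (H.R : G ⊗[ℂ] G) * H.Ri = 1 := Units.mul_inv _

theorem comulL_R : comulL G G H.R = j13 G G H.R * j23 G G H.R := H.comul_left

theorem idT_comul_R : idT G (Bialgebra.comulAlgHom ℂ G) H.R = j13 G G H.R * j12 G G H.R :=
  H.comul_right

/-- The counit applied to the first leg of `(Δ ⊗ id)(R) = R₁₃ R₂₃` gives `R = (1 ⊗ c) R` with `c =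
(ε ⊗ id)(R)`; then cancel `R`. -/
theorem counitL_R : counitL G G H.R = 1 := by
  have h := congrArg (counitL G (G ⊗[ℂ] G)) H.comulL_R
  rw [counitL_comulL, map_mul, counitL_j13, counitL_j23] at h
  have h2 : (1 : G) ⊗ₜ[ℂ] counitL G G (H.R : G ⊗[ℂ] G) = 1 := by
    calc _ = (1 : G) ⊗ₜ[ℂ] counitL G G (H.R : G ⊗[ℂ] G) * H.R * H.Ri := by
          rw [mul_assoc, mul_Ri, mul_one]
      _ = 1 := by rw [← h, mul_Ri]
  simpa using congrArg (counitL G G) h2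

theorem j12_R_mul_comulL (X : G ⊗[ℂ] A) :
    j12 G A H.R * comulL G A X = swap12 G A (comulL G A X) * j12 G A H.R := by
  induction X with
  | zero => simp
  | add p q hp hq => simp only [map_add, hp, hq, mul_add, add_mul]
  | tmul x a =>
    have h : Commute ((1 : G) ⊗ₜ[ℂ] ((1 : G) ⊗ₜ[ℂ] a)) (j12 G A H.R) := by
      induction (H.R : G ⊗[ℂ] G) with
      | zero => simp
      | add p q hp hq => rw [map_add]; exact hp.add_right hq
      | tmul a b => simp [Commute, SemiconjBy]
    rw [comulL_tmul_eq, map_mul, swap12_j12, ← mul_assoc, ← map_mul, H.intertwine, map_mul,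
      mul_assoc, mul_assoc, swap12_tmul, h.eq]

/-- `R₁₃ R₂₃` is `(Δ ⊗ id)(R)`, and moving `R₁₂` across a coproduct in the first two legs flips
them. -/
theorem yang_baxter : j12 G G H.R * j13 G G H.R * j23 G G H.R =
    j23 G G H.R * j13 G G H.R * j12 G G H.R := by
  rw [mul_assoc, ← comulL_R, j12_R_mul_comulL, comulL_R, map_mul, swap12_j13, swap12_j23]

end RibbonStarHopf
end Quasitriangular

/-! ### The antipode and the Drinfeld element -/

section Slices

variable {G : Type*} [Ring G] [HopfAlgebra ℂ G]
variable {A : Type*} [Ring A] [Algebra ℂ A] {B : Type*} [Ring B] [Algebra ℂ B]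

variable (A) in
/-- The slice map `f ⊗ id`. -/
def slice (f : G →ₗ[ℂ] ℂ) : G ⊗[ℂ] A →ₗ[ℂ] A :=
  (TensorProduct.lid ℂ A).toLinearMap ∘ₗ TensorProduct.map f LinearMap.id

@[simp] theorem slice_tmul (f : G →ₗ[ℂ] ℂ) (x : G) (a : A) :
    slice A f (x ⊗ₜ a) = f x • a := rfl

theorem slice_mul_one_tmul (f : G →ₗ[ℂ] ℂ) (X : G ⊗[ℂ] A) (a : A) :
    slice A f (X * 1 ⊗ₜ a) = slice A f X * a := by
  induction X with
  | zero => simp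
  | add p q hp hq => simp only [map_add, add_mul, hp, hq]
  | tmul x y => simp

theorem slice_one_tmul_mul (f : G →ₗ[ℂ] ℂ) (X : G ⊗[ℂ] A) (a : A) :
    slice A f (1 ⊗ₜ a * X) = a * slice A f X := by
  induction X with
  | zero => simp
  | add p q hp hq => simp only [map_add, mul_add, hp, hq]
  | tmul x y => simp

theorem slice_idT (f : G →ₗ[ℂ] ℂ) (h : A →ₐ[ℂ] B) (X : G ⊗[ℂ] A) :
    slice B f (idT G h X) = h (slice A f X) := by
  induction X with
  | zero => simp
  | add p q hp hq => simp only [map_add, hp, hq]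
  | tmul x y => simp

theorem slice_j12 (f : G →ₗ[ℂ] ℂ) (X : G ⊗[ℂ] G) :
    slice (G ⊗[ℂ] A) f (j12 G A X) = slice G f X ⊗ₜ 1 :=
  slice_idT f (Algebra.TensorProduct.includeLeft : G →ₐ[ℂ] G ⊗[ℂ] A) X

theorem slice_j13 (f : G →ₗ[ℂ] ℂ) (X : G ⊗[ℂ] A) :
    slice (G ⊗[ℂ] A) f (j13 G A X) = 1 ⊗ₜ slice A f X :=
  slice_idT f (Algebra.TensorProduct.includeRight : A →ₐ[ℂ] G ⊗[ℂ] A) X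

variable (G A) in
/-- `S ⊗ id`. -/
def antipodeL : G ⊗[ℂ] A →ₗ[ℂ] G ⊗[ℂ] A :=
  TensorProduct.map (HopfAlgebra.antipode ℂ) LinearMap.id

@[simp] theorem antipodeL_tmul (x : G) (a : A) :
    antipodeL G A (x ⊗ₜ a) = HopfAlgebra.antipode ℂ x ⊗ₜ a := rfl

variable (G A) in
/-- `x ⊗ y ⊗ a ↦ x y ⊗ a`. -/
def mulL : G ⊗[ℂ] (G ⊗[ℂ] A) →ₗ[ℂ] G ⊗[ℂ] A :=
  TensorProduct.map (LinearMap.mul' ℂ G) LinearMap.id ∘ₗ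
    (TensorProduct.assoc ℂ G G A).symm.toLinearMap

@[simp] theorem mulL_tmul (x y : G) (a : A) :
    mulL G A (x ⊗ₜ (y ⊗ₜ a)) = (x * y) ⊗ₜ a := rfl

theorem mulL_antipodeL_comulL (X : G ⊗[ℂ] A) :
    mulL G A (antipodeL G _ (comulL G A X)) = 1 ⊗ₜ counitL G A X := by
  induction X with
  | zero => simp
  | add p q hp hq => simp only [map_add, hp, hq, TensorProduct.tmul_add]
  | tmul x a =>
    have h := HopfAlgebra.mul_antipode_rTensor_comul_apply (R := ℂ) x
    have h2 : ∀ Y : G ⊗[ℂ] G, mulL G A (antipodeL G _ (j12 G A Y * (1 ⊗ₜ (1 ⊗ₜ a)))) =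
        LinearMap.mul' ℂ G ((HopfAlgebra.antipode ℂ).rTensor G Y) ⊗ₜ a := by
      intro Y
      induction Y with
      | zero => simp
      | add p q hp hq => simp only [map_add, add_mul, hp, hq, TensorProduct.add_tmul]
      | tmul y z => simp
    rw [comulL_tmul_eq, h2, h, counitL_tmul, Algebra.algebraMap_eq_smul_one,
      TensorProduct.smul_tmul]

theorem mulL_antipodeL_j13_mul_j23 (X Y : G ⊗[ℂ] A) :
    mulL G A (antipodeL G _ (j13 G A X * j23 G A Y)) = antipodeL G A X * Y := by
  induction X with
  | zero => simp
  | add p q hp hq => simp only [map_add, add_mul, hp, hq]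
  | tmul x a =>
    induction Y with
    | zero => simp
    | add p q hp hq => simp only [map_add, mul_add, hp, hq]
    | tmul y b => simp

/-- Both sides are inverse to `Δ` in the convolution algebra `Hom(G, G ⊗ G)`. For the right-hand
side this follows by writing `Δ` as the convolution product of the two inclusions, each inverted by
composing with the antipode. -/
theorem comul_antipode (x : G) : Coalgebra.comul (R := ℂ) (HopfAlgebra.antipode ℂ x) =
    TensorProduct.map (HopfAlgebra.antipode ℂ) (HopfAlgebra.antipode ℂ)
      (swapT G (Coalgebra.comul (R := ℂ) x)) := by
  open WithConv LinearMap in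
  set i1 : G →ₐ[ℂ] G ⊗[ℂ] G := Algebra.TensorProduct.includeLeft
  set i2 : G →ₐ[ℂ] G ⊗[ℂ] G := Algebra.TensorProduct.includeRight
  set s1 : WithConv (G →ₗ[ℂ] G ⊗[ℂ] G) := toConv (i1.toLinearMap ∘ₗ HopfAlgebra.antipode ℂ)
  set s2 : WithConv (G →ₗ[ℂ] G ⊗[ℂ] G) := toConv (i2.toLinearMap ∘ₗ HopfAlgebra.antipode ℂ)
  have hs : ∀ i : G →ₐ[ℂ] G ⊗[ℂ] G,
      toConv (i.toLinearMap ∘ₗ HopfAlgebra.antipode ℂ) * toConv i.toLinearMap = 1 := by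
    intro i
    ext y
    have r := Coalgebra.Repr.arbitrary ℂ y
    rw [r.convMul_apply]
    have := congrArg i (HopfAlgebra.sum_antipode_mul_eq_algebraMap_counit r)
    simpa using this
  have hc : toConv i1.toLinearMap * toConv i2.toLinearMap =
      toConv (Coalgebra.comul (R := ℂ) (A := G)) := by
    ext y
    have r := Coalgebra.Repr.arbitrary ℂ y
    rw [r.convMul_apply]
    simp [i1, i2, r.eq]
  have h1 : (s2 * s1) * toConv (Coalgebra.comul (R := ℂ) (A := G)) = 1 := by
    rw [← hc, mul_assoc, ← mul_assoc s1, hs i1, one_mul, hs i2]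
  have h2 := left_inv_eq_right_inv h1 (comul_right_inv (R := ℂ) (C := G))
  have h3 := congrArg (fun f => f.ofConv x) h2
  have r := Coalgebra.Repr.arbitrary ℂ x
  simp only [r.convMul_apply] at h3
  rw [← r.eq]
  refine Eq.trans h3.symm ?_
  simp [s1, s2, i1, i2]

end Slices

/-! ### The Drinfeld element and the square of the antipode. -/

section Drinfeld

variable {G : Type*} [Ring G] [HopfAlgebra ℂ G] [StarRing G] [StarModule ℂ G]
variable {A : Type*} [Ring A] [Algebra ℂ A]

local notation "SS" => HopfAlgebra.antipode ℂ (A := G)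

variable (G) in
/-- `x ⊗ y ↦ S(y) x`. -/
def drinfeldMap : G ⊗[ℂ] G →ₗ[ℂ] G :=
  LinearMap.mul' ℂ G ∘ₗ TensorProduct.map SS LinearMap.id ∘ₗ (swapT G).toLinearMap

@[simp] theorem drinfeldMap_tmul (x y : G) : drinfeldMap G (x ⊗ₜ y) = SS y * x := rfl

/-- The contraction produces `S(b) S(x¹) x² a`, in which the antipode axiom collapses `S(x¹) x²`. -/
theorem drinfeldMap_comulOp_mul (x : G) (X : G ⊗[ℂ] G) :
    drinfeldMap G (swapT G (Coalgebra.comul (R := ℂ) x) * X) =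
      Coalgebra.counit (R := ℂ) x • drinfeldMap G X := by
  induction X with
  | zero => simp
  | add p q hp hq => simp only [map_add, mul_add, hp, hq, smul_add]
  | tmul a b =>
    have h := HopfAlgebra.mul_antipode_rTensor_comul_apply (R := ℂ) x
    have h2 : ∀ Y : G ⊗[ℂ] G, drinfeldMap G (swapT G Y * a ⊗ₜ b) =
        SS b * (LinearMap.mul' ℂ G ((HopfAlgebra.antipode ℂ).rTensor G Y)) * a := by
      intro Y
      induction Y with
      | zero => simp
      | add p q hp hq => simp only [map_add, add_mul, hp, hq, mul_add]
      | tmul y z => simp [HopfAlgebra.antipode_mul_antidistrib, mul_assoc]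
    rw [h2, h, Algebra.algebraMap_eq_smul_one]
    simp

/-- `x ⊗ y ↦ S²(y) · (drinfeldMap (X Δ(x)))`. -/
def drinfeldAux (X : G ⊗[ℂ] G) : G ⊗[ℂ] G →ₗ[ℂ] G :=
  LinearMap.mul' ℂ G ∘ₗ TensorProduct.map (SS ∘ₗ SS)
    (drinfeldMap G ∘ₗ LinearMap.mulLeft ℂ X ∘ₗ Coalgebra.comul) ∘ₗ (swapT G).toLinearMap

theorem drinfeldAux_tmul (X : G ⊗[ℂ] G) (x y : G) : drinfeldAux X (x ⊗ₜ y) =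
    SS (SS y) * drinfeldMap G (X * Coalgebra.comul (R := ℂ) x) := rfl

/-- For `X = a ⊗ b` the left-hand side is `∑ S²(x³) S(x²) S(b) a x¹ = ∑ S(x² S(x³)) S(b) a x¹`. By
coassociativity the first factor reduces to a counit. -/
theorem drinfeldAux_comul (X : G ⊗[ℂ] G) (x : G) :
    drinfeldAux X (Coalgebra.comul (R := ℂ) x) = drinfeldMap G X * x := by
  induction X with
  | zero =>
    have : ∀ Y : G ⊗[ℂ] G, drinfeldAux 0 Y = 0 := by
      intro Y
      induction Y with
      | zero => simp
      | add p q hp hq => rw [map_add, hp, hq, add_zero]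
      | tmul y z => simp [drinfeldAux_tmul]
    simp [this]
  | add p q hp hq =>
    have : ∀ Y : G ⊗[ℂ] G, drinfeldAux (p + q) Y = drinfeldAux p Y + drinfeldAux q Y := by
      intro Y
      induction Y with
      | zero => simp
      | add p q hp hq => rw [map_add, map_add, map_add, hp, hq]; abel
      | tmul y z => simp [drinfeldAux_tmul, add_mul, mul_add]
    rw [this, hp, hq, map_add, add_mul]
  | tmul a b =>
    -- `L` is the contraction of the threefold coproduct; `h1` and `h2` evaluate it on its two
    -- bracketings.
    let L : G ⊗[ℂ] (G ⊗[ℂ] G) →ₗ[ℂ] G :=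
      LinearMap.mul' ℂ G ∘ₗ TensorProduct.map (SS ∘ₗ LinearMap.mul' ℂ G ∘ₗ LinearMap.lTensor G SS)
        (LinearMap.mulLeft ℂ (SS b * a)) ∘ₗ (TensorProduct.comm ℂ G (G ⊗[ℂ] G)).toLinearMap
    have hL : ∀ x y z, L (x ⊗ₜ (y ⊗ₜ z)) = SS (y * SS z) * ((SS b * a) * x) := fun _ _ _ => rfl
    have h1 : ∀ Y : G ⊗[ℂ] G, drinfeldAux (a ⊗ₜ b) Y = L (comulL G G Y) := by
      intro Y
      induction Y with
      | zero => simp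
      | add p q hp hq => simp only [map_add, hp, hq]
      | tmul y z =>
        rw [drinfeldAux_tmul, comulL_tmul_eq]
        induction Coalgebra.comul (R := ℂ) y with
        | zero => simp
        | add p q hp hq => simp only [map_add, add_mul, mul_add, hp, hq]
        | tmul c d =>
          simp [hL, HopfAlgebra.antipode_mul_antidistrib, mul_assoc]
    have h2 : ∀ Y : G ⊗[ℂ] G, L (idT G (Bialgebra.comulAlgHom ℂ G) Y) =
        drinfeldMap G (a ⊗ₜ b) * (TensorProduct.rid ℂ G
          (TensorProduct.map LinearMap.id (Coalgebra.counit (R := ℂ)) Y)) := by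
      intro Y
      induction Y with
      | zero => simp
      | add p q hp hq => simp only [map_add, mul_add, hp, hq]
      | tmul y z =>
        have h := HopfAlgebra.mul_antipode_lTensor_comul_apply (R := ℂ) z
        change SS (LinearMap.mul' ℂ G (LinearMap.lTensor G SS (Coalgebra.comul (R := ℂ) z))) *
          ((SS b * a) * y) = _
        rw [h, Algebra.algebraMap_eq_smul_one]
        simp
    have h3 : comulL G G (Coalgebra.comul (R := ℂ) x) =
        idT G (Bialgebra.comulAlgHom ℂ G) (Coalgebra.comul (R := ℂ) x) :=
      Coalgebra.coassoc_apply (R := ℂ) x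
    have h4 : TensorProduct.map LinearMap.id (Coalgebra.counit (R := ℂ))
        (Coalgebra.comul (R := ℂ) x) = x ⊗ₜ 1 := Coalgebra.lTensor_counit_comul (R := ℂ) x
    rw [h1, h3, h2, h4]
    simp

namespace RibbonStarHopf

variable (H : RibbonStarHopf G)

/-- Multiplying `S(first leg)` into the second leg turns `(Δ ⊗ id)(R)` into a counit and `R₁₃ R₂₃`
into `(S ⊗ id)(R) · R`. So `(S ⊗ id)(R)` is a left inverse of `R`. -/
theorem antipodeL_R : antipodeL G G H.R = H.Ri := by
  have h := mulL_antipodeL_j13_mul_j23 (H.R : G ⊗[ℂ] G) H.R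
  rw [← comulL_R, mulL_antipodeL_comulL, counitL_R] at h
  calc antipodeL G G H.R = antipodeL G G H.R * H.R * H.Ri := by
        rw [mul_assoc, mul_Ri, mul_one]
    _ = H.Ri := by
        rw [← h]
        exact one_mul _

theorem u_eq : H.u = drinfeldMap G H.R := rfl

/-- Drinfeld's argument: the contraction of `R Δ(x) = Δ'(x) R` is computed by `drinfeldAux_comul` on
one side and by `drinfeldMap_comulOp_mul` on the other. -/
theorem antipode_sq_mul_u (x : G) : SS (SS x) * H.u = H.u * x := by
  have h1 := drinfeldAux_comul (H.R : G ⊗[ℂ] G) x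
  have h2 : ∀ Y : G ⊗[ℂ] G, drinfeldAux (H.R : G ⊗[ℂ] G) Y =
      SS (SS (counitL G G Y)) * drinfeldMap G H.R := by
    intro Y
    induction Y with
    | zero => simp
    | add p q hp hq => simp only [map_add, add_mul, hp, hq]
    | tmul y z =>
      rw [drinfeldAux_tmul, H.intertwine, drinfeldMap_comulOp_mul]
      simp
  rw [h2, counitL_comul] at h1
  exact h1

variable [FiniteDimensional ℂ G]

theorem isUnit_v : IsUnit H.v :=
  ⟨⟨H.v, star H.v, by rw [H.v_central, H.star_v], H.star_v⟩, rfl⟩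

/-- Since `v² = u S(u)` and `v` is unitary and central, `u` has a right inverse. In a
finite-dimensional algebra it is two-sided. -/
theorem isUnit_u : IsUnit H.u := by
  have h : IsUnit (H.u * SS H.u) := by
    have h := H.v_sq
    change H.v ^ 2 = H.u * SS H.u at h
    rw [← h]
    exact H.isUnit_v.pow 2
  obtain ⟨w, hw⟩ := h
  have : IsNoetherianRing G := IsNoetherianRing.of_finite ℂ G
  have h1 : H.u * (SS H.u * ((w⁻¹ : Gˣ) : G)) = 1 := by
    rw [← mul_assoc, ← hw, Units.mul_inv]
  exact IsUnit.of_mul_eq_one _ h1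

/-- The inverse of the Drinfeld element. -/
def ui : G := Ring.inverse H.u

theorem ui_mul : H.ui * H.u = 1 := Ring.inverse_mul_cancel _ H.isUnit_u
theorem mul_ui : H.u * H.ui = 1 := Ring.mul_inverse_cancel _ H.isUnit_u

theorem g_eq : H.g = H.ui * H.v := rfl

theorem u_mul_g : H.u * H.g = H.v := by rw [g_eq, ← mul_assoc, mul_ui, one_mul]

theorem mul_ui_eq (x : G) : x * H.ui = H.ui * SS (SS x) := by
  calc x * H.ui = H.ui * (H.u * x) * H.ui := by rw [← mul_assoc, ui_mul, one_mul]
    _ = H.ui * SS (SS x) := by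
      rw [← antipode_sq_mul_u, mul_assoc, mul_assoc, mul_ui, mul_one]

theorem mul_g (x : G) : x * H.g = H.g * SS (SS x) := by
  rw [g_eq, ← mul_assoc, mul_ui_eq, mul_assoc, mul_assoc, H.v_central]

/-- The inverse of the antipode. -/
def antipodeInv : G →ₗ[ℂ] G := LinearMap.mulRight ℂ H.u ∘ₗ LinearMap.mulLeft ℂ H.ui ∘ₗ SS

theorem antipodeInv_apply (x : G) : H.antipodeInv x = H.ui * SS x * H.u := rfl

theorem mul_antipodeInv (y z : G) :
    z * H.antipodeInv y = H.ui * SS (y * SS z) * H.u := by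
  rw [antipodeInv_apply, ← mul_assoc, ← mul_assoc, mul_ui_eq,
    HopfAlgebra.antipode_mul_antidistrib, mul_assoc H.ui]

/-- Mirror image of `antipodeL_R`: contract the last two legs of `(id ⊗ Δ)(R) = R₁₃ R₁₂` by `y ⊗ z ↦
z S⁻¹(y)`, where `S⁻¹(y) = u⁻¹ S(y) u`. -/
theorem map_antipodeInv_R :
    TensorProduct.map LinearMap.id H.antipodeInv (H.R : G ⊗[ℂ] G) = H.Ri := by
  let L : G ⊗[ℂ] (G ⊗[ℂ] G) →ₗ[ℂ] G ⊗[ℂ] G :=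
    LinearMap.lTensor G (LinearMap.mulRight ℂ H.u ∘ₗ LinearMap.mulLeft ℂ H.ui ∘ₗ SS ∘ₗ
      LinearMap.mul' ℂ G ∘ₗ LinearMap.lTensor G SS)
  have hL : ∀ x y z, L (x ⊗ₜ (y ⊗ₜ z)) = x ⊗ₜ (z * H.antipodeInv y) := by
    intro x y z
    rw [mul_antipodeInv]
    rfl
  have h1 : ∀ X : G ⊗[ℂ] G, L (idT G (Bialgebra.comulAlgHom ℂ G) X) =
      (TensorProduct.rid ℂ G
          (TensorProduct.map LinearMap.id (Coalgebra.counit (R := ℂ)) X)) ⊗ₜ 1 := by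
    intro Y
    induction Y with
    | zero => simp
    | add p q hp hq => simp only [map_add, TensorProduct.add_tmul, hp, hq]
    | tmul y z =>
      have h := HopfAlgebra.mul_antipode_lTensor_comul_apply (R := ℂ) z
      change y ⊗ₜ (H.ui * SS (LinearMap.mul' ℂ G (LinearMap.lTensor G SS (Coalgebra.comul (R := ℂ) z)))
        * H.u) = _
      rw [h, Algebra.algebraMap_eq_smul_one]
      simp [ui_mul, TensorProduct.smul_tmul']
  have h2 : ∀ X Y : G ⊗[ℂ] G, L (j13 G G X * j12 G G Y) =
      X * TensorProduct.map LinearMap.id H.antipodeInv Y := by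
    intro X Y
    induction X with
    | zero => simp
    | add p q hp hq => simp only [map_add, add_mul, hp, hq]
    | tmul x a =>
      induction Y with
      | zero => simp
      | add p q hp hq => simp only [map_add, mul_add, hp, hq]
      | tmul y b => simp [hL]
  have h3 : ∃ c : G, (H.R : G ⊗[ℂ] G) * TensorProduct.map LinearMap.id H.antipodeInv
      (H.R : G ⊗[ℂ] G) = c ⊗ₜ 1 := by
    rw [← h2, ← idT_comul_R, h1]
    exact ⟨_, rfl⟩
  -- The normalization `(id ⊗ ε)(R) = 1` follows from the same coproduct formula by applying the
  -- counit to the middle leg and cancelling `R`.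
  have hr : TensorProduct.rid ℂ G (TensorProduct.map LinearMap.id (Coalgebra.counit (R := ℂ))
      (H.R : G ⊗[ℂ] G)) = 1 := by
    let E : G ⊗[ℂ] (G ⊗[ℂ] G) →ₐ[ℂ] G ⊗[ℂ] G := idT G (counitL G G)
    have hE1 : ∀ X : G ⊗[ℂ] G, E (idT G (Bialgebra.comulAlgHom ℂ G) X) = X := by
      intro X
      induction X with
      | zero => simp
      | add p q hp hq => simp only [map_add, hp, hq]
      | tmul y z => exact congrArg (y ⊗ₜ ·) (counitL_comul z)
    have hE2 : ∀ X : G ⊗[ℂ] G, E (j13 G G X) = X := by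
      intro X
      induction X with
      | zero => simp
      | add p q hp hq => simp only [map_add, hp, hq]
      | tmul y z => simp [E]
    have hE3 : ∀ X : G ⊗[ℂ] G, E (j12 G G X) = (TensorProduct.rid ℂ G
        (TensorProduct.map LinearMap.id (Coalgebra.counit (R := ℂ)) X)) ⊗ₜ 1 := by
      intro X
      induction X with
      | zero => simp
      | add p q hp hq => simp only [map_add, hp, hq, TensorProduct.add_tmul]
      | tmul y z => simp [E, TensorProduct.smul_tmul']
    have h := congrArg E H.idT_comul_R
    rw [hE1, map_mul, hE2, hE3] at h
    have h2 : (TensorProduct.rid ℂ G (TensorProduct.map LinearMap.id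
        (Coalgebra.counit (R := ℂ)) (H.R : G ⊗[ℂ] G))) ⊗ₜ[ℂ] (1 : G) = 1 := by
      have h3 := congrArg (H.Ri * ·) h
      simp only [← mul_assoc, Ri_mul, one_mul] at h3
      exact h3.symm
    have h4 := congrArg (counitL G G ∘ swapT G) h2
    simpa using h4
  have h4 : (H.R : G ⊗[ℂ] G) * TensorProduct.map LinearMap.id H.antipodeInv
      (H.R : G ⊗[ℂ] G) = 1 := by
    rw [← h2, ← idT_comul_R, h1, hr]
    rfl
  calc _ = H.Ri * ((H.R : G ⊗[ℂ] G) * TensorProduct.map LinearMap.id H.antipodeInv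
      (H.R : G ⊗[ℂ] G)) := by rw [← mul_assoc, Ri_mul, one_mul]
    _ = H.Ri := by rw [h4, mul_one]

theorem antipode_sq_conj (x : G) : SS (SS (H.ui * x * H.u)) = x := by
  calc _ = SS (SS (H.ui * x * H.u)) * H.u * H.ui := by rw [mul_assoc _ H.u H.ui, mul_ui, mul_one]
    _ = H.u * H.ui * x * (H.u * H.ui) := by
        rw [antipode_sq_mul_u]
        simp only [mul_assoc]
    _ = x := by rw [mul_ui, one_mul, mul_one]

theorem antipode_sq_inj (H : RibbonStarHopf G) {y z : G} (hyz : SS (SS y) = SS (SS z)) : y = z := by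
  have h := H.antipode_sq_mul_u y
  rw [hyz, H.antipode_sq_mul_u] at h
  have h7 := congrArg (H.ui * ·) h
  simp only [← mul_assoc, H.ui_mul, one_mul] at h7
  exact h7.symm

theorem antipode_conj (x : G) : SS (H.ui * SS x * H.u) = x :=
  H.antipode_sq_inj (congrArg SS (H.antipode_sq_conj (SS x)))

end RibbonStarHopf
end Drinfeld

/-! ### The balancing element and the double braiding -/

section Balancing

variable {G : Type*} [Ring G] [HopfAlgebra ℂ G] [StarRing G] [StarModule ℂ G]
variable {A : Type*} [Ring A] [Algebra ℂ A]

local notation "SS" => HopfAlgebra.antipode ℂ (A := G)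

variable (G) in
/-- `x ⊗ y ↦ (S(y) ⊗ 1) Δ(x)`. -/
def drinfeldComul : G ⊗[ℂ] G →ₗ[ℂ] G ⊗[ℂ] G :=
  LinearMap.mul' ℂ (G ⊗[ℂ] G) ∘ₗ TensorProduct.map
    ((Algebra.TensorProduct.includeLeft : G →ₐ[ℂ] G ⊗[ℂ] G).toLinearMap ∘ₗ SS)
      Coalgebra.comul ∘ₗ (swapT G).toLinearMap

theorem drinfeldComul_tmul (x y : G) :
    drinfeldComul G (x ⊗ₜ y) = (SS y ⊗ₜ 1) * Coalgebra.comul (R := ℂ) x := rfl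

/-- As `Δ ∘ S = (S ⊗ S) ∘ Δ'`, the coproduct of `S(y) x` is a contraction over `(id ⊗ Δ)(X) = X₁₃
X₁₂`. The contraction over `X₁₃` is performed first and gives `drinfeldComul X`, sandwiched by the
one over `X₁₂`. -/
theorem comul_drinfeldMap {X : G ⊗[ℂ] G}
    (h : idT G (Bialgebra.comulAlgHom ℂ G) X = j13 G G X * j12 G G X) :
    Coalgebra.comul (R := ℂ) (drinfeldMap G X) =
      LinearMap.mul' ℂ (G ⊗[ℂ] G) (TensorProduct.map
        (LinearMap.mulRight ℂ (drinfeldComul G X) ∘ₗ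
          (Algebra.TensorProduct.includeRight : G →ₐ[ℂ] G ⊗[ℂ] G).toLinearMap ∘ₗ SS)
        Coalgebra.comul (swapT G X)) := by
  let L : G ⊗[ℂ] (G ⊗[ℂ] G) →ₗ[ℂ] G ⊗[ℂ] G :=
    LinearMap.mul' ℂ (G ⊗[ℂ] G) ∘ₗ TensorProduct.map
      (TensorProduct.map SS SS ∘ₗ (swapT G).toLinearMap) Coalgebra.comul ∘ₗ
      (TensorProduct.comm ℂ G (G ⊗[ℂ] G)).toLinearMap
  have hL : ∀ x y z, L (x ⊗ₜ (y ⊗ₜ z)) = (SS z ⊗ₜ SS y) * Coalgebra.comul (R := ℂ) x :=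
    fun _ _ _ => rfl
  have h1 : ∀ Y : G ⊗[ℂ] G, L (idT G (Bialgebra.comulAlgHom ℂ G) Y) =
      Coalgebra.comul (R := ℂ) (drinfeldMap G Y) := by
    intro Y
    induction Y with
    | zero => simp
    | add p q hp hq => simp only [map_add, hp, hq]
    | tmul y z =>
      rw [drinfeldMap_tmul, Bialgebra.comul_mul, comul_antipode]
      rfl
  have h2 : ∀ Y Z : G ⊗[ℂ] G, L (j13 G G Y * j12 G G Z) =
      LinearMap.mul' ℂ (G ⊗[ℂ] G) (TensorProduct.map
        (LinearMap.mulRight ℂ (drinfeldComul G Y) ∘ₗ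
          (Algebra.TensorProduct.includeRight : G →ₐ[ℂ] G ⊗[ℂ] G).toLinearMap ∘ₗ SS)
        Coalgebra.comul (swapT G Z)) := by
    intro Y Z
    induction Z with
    | zero => simp
    | add p q hp hq => simp only [map_add, mul_add, hp, hq]
    | tmul z w =>
      induction Y with
      | zero => simp
      | add p q hp hq =>
        simp only [swapT_tmul, TensorProduct.map_tmul, LinearMap.comp_apply,
          LinearMap.mulRight_apply, LinearMap.mul'_apply] at hp hq ⊢
        simp only [map_add, add_mul, mul_add, hp, hq]
      | tmul x y =>
        simp [hL, drinfeldComul_tmul, ← mul_assoc]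
  rw [← h1, h, h2]

theorem drinfeldComul_eq {X : G ⊗[ℂ] G} (h : comulL G G X = j13 G G X * j23 G G X) :
    drinfeldComul G X = TensorProduct.map (LinearMap.mulRight ℂ (drinfeldMap G X) ∘ₗ SS)
      LinearMap.id (swapT G X) := by
  let L : G ⊗[ℂ] (G ⊗[ℂ] G) →ₗ[ℂ] G ⊗[ℂ] G :=
    TensorProduct.map (drinfeldMap G) LinearMap.id ∘ₗ
      (TensorProduct.assoc ℂ G G G).symm.toLinearMap ∘ₗ
      LinearMap.lTensor G (TensorProduct.comm ℂ G G).toLinearMap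
  have hL : ∀ x y z, L (x ⊗ₜ (y ⊗ₜ z)) = (SS z * x) ⊗ₜ y := fun _ _ _ => rfl
  have h1 : ∀ Y : G ⊗[ℂ] G, L (comulL G G Y) = drinfeldComul G Y := by
    intro Y
    induction Y with
    | zero => simp
    | add p q hp hq => simp only [map_add, hp, hq]
    | tmul y z =>
      rw [comulL_tmul_eq, drinfeldComul_tmul]
      induction Coalgebra.comul (R := ℂ) y with
      | zero => simp
      | add p q hp hq => simp only [map_add, add_mul, mul_add, hp, hq]
      | tmul a b => simp [hL]
  have h2 : ∀ Y Z : G ⊗[ℂ] G, L (j13 G G Y * j23 G G Z) =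
      TensorProduct.map (LinearMap.mulRight ℂ (drinfeldMap G Y) ∘ₗ SS)
      LinearMap.id (swapT G Z) := by
    intro Y Z
    induction Z with
    | zero => simp
    | add p q hp hq => simp only [map_add, mul_add, hp, hq]
    | tmul z w =>
      induction Y with
      | zero => simp
      | add p q hp hq =>
        simp only [swapT_tmul, TensorProduct.map_tmul, LinearMap.comp_apply,
          LinearMap.mulRight_apply] at hp hq ⊢
        simp only [map_add, add_mul, mul_add, hp, hq, TensorProduct.add_tmul]
      | tmul x y =>
        simp [hL, HopfAlgebra.antipode_mul_antidistrib, mul_assoc]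
  rw [← h1, h, h2]

namespace RibbonStarHopf

variable (H : RibbonStarHopf G)

/-- The double braiding `R'R`. -/
def Q : G ⊗[ℂ] G := swapT G H.R * H.R

theorem swapT_Ri_mul : swapT G H.Ri * swapT G H.R = 1 := by rw [← map_mul, Ri_mul, map_one]
theorem swapT_R_mul : swapT G H.R * swapT G H.Ri = 1 := by rw [← map_mul, mul_Ri, map_one]

theorem swapT_R_mul_comulOp (x : G) :
    swapT G H.R * swapT G (Coalgebra.comul (R := ℂ) x) =
      Coalgebra.comul (R := ℂ) x * swapT G H.R := by
  rw [← map_mul, H.intertwine, map_mul, swapT_swapT]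

theorem Q_comm (x : G) : Commute H.Q (Coalgebra.comul (R := ℂ) x) := by
  rw [Commute, SemiconjBy, Q, mul_assoc, H.intertwine, ← mul_assoc, swapT_R_mul_comulOp,
    mul_assoc]

theorem swapT_Ri_mul_comul (x : G) :
    swapT G H.Ri * Coalgebra.comul (R := ℂ) x =
      swapT G (Coalgebra.comul (R := ℂ) x) * swapT G H.Ri := by
  calc _ = swapT G H.Ri * (Coalgebra.comul (R := ℂ) x * swapT G H.R) * swapT G H.Ri := by
        rw [mul_assoc, mul_assoc, swapT_R_mul, mul_one]
    _ = _ := by rw [← swapT_R_mul_comulOp, ← mul_assoc, swapT_Ri_mul, one_mul]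

theorem counit_u : Coalgebra.counit (R := ℂ) H.u = 1 := by
  have h : ∀ X : G ⊗[ℂ] G, Coalgebra.counit (R := ℂ) (drinfeldMap G X) =
      Coalgebra.counit (R := ℂ) (counitL G G X) := by
    intro X
    induction X with
    | zero => simp
    | add p q hp hq => simp only [map_add, hp, hq]
    | tmul x y => simp [mul_comm]
  rw [u_eq, h, counitL_R, Bialgebra.counit_one]

variable [FiniteDimensional ℂ G]

/-- Here `S(y) u = u S⁻¹(y)`, and `(id ⊗ S⁻¹)(R) = R⁻¹`. -/
theorem drinfeldComul_R : drinfeldComul G H.R = (H.u ⊗ₜ 1) * swapT G H.Ri := by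
  rw [drinfeldComul_eq H.comulL_R, ← H.map_antipodeInv_R, ← u_eq]
  induction (H.R : G ⊗[ℂ] G) with
  | zero => simp
  | add p q hp hq => simp only [map_add, mul_add, hp, hq]
  | tmul x y => simp [antipodeInv_apply, ← mul_assoc, mul_ui]

/-- In the remaining contraction `R'⁻¹` is carried past `Δ(x)`, turning it into `Δ'(x)`. What is
left is the flip of the contraction computed in `drinfeldComul_R`. -/
theorem comul_u : Coalgebra.comul (R := ℂ) H.u = (H.u ⊗ₜ H.u) * (H.Ri * swapT G H.Ri) := by
  have h : ∀ Y : G ⊗[ℂ] G, LinearMap.mul' ℂ (G ⊗[ℂ] G) (TensorProduct.map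
        (LinearMap.mulRight ℂ ((H.u ⊗ₜ 1) * swapT G H.Ri) ∘ₗ
          (Algebra.TensorProduct.includeRight : G →ₐ[ℂ] G ⊗[ℂ] G).toLinearMap ∘ₗ SS)
        Coalgebra.comul (swapT G Y)) =
      (H.u ⊗ₜ 1) * swapT G (drinfeldComul G Y) * swapT G H.Ri := by
    intro Y
    induction Y with
    | zero => simp
    | add p q hp hq => simp only [map_add, mul_add, add_mul, hp, hq]
    | tmul x y =>
      simp only [swapT_tmul, TensorProduct.map_tmul, LinearMap.comp_apply,
        LinearMap.mulRight_apply, LinearMap.mul'_apply, AlgHom.toLinearMap_apply,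
        Algebra.TensorProduct.includeRight_apply]
      rw [mul_assoc, mul_assoc, swapT_Ri_mul_comul, drinfeldComul_tmul, map_mul, swapT_tmul]
      simp only [← mul_assoc]
      simp
  rw [u_eq, comul_drinfeldMap H.idT_comul_R, drinfeldComul_R, h, drinfeldComul_R, map_mul,
    swapT_swapT, swapT_tmul, u_eq]
  simp only [← mul_assoc]
  simp

/-- `Δ(u)` and `Δ(v)` contain the same factor `(R'R)⁻¹`, which cancels in `u⁻¹ v`. -/
theorem comul_g : Coalgebra.comul (R := ℂ) H.g = H.g ⊗ₜ H.g := by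
  have h1 : Coalgebra.comul (R := ℂ) H.u * H.Q = H.u ⊗ₜ H.u := by
    rw [comul_u, Q, mul_assoc, mul_assoc, ← mul_assoc (swapT G H.Ri), swapT_Ri_mul, one_mul,
      Ri_mul, mul_one]
  have h2 : H.Q * (Coalgebra.comul (R := ℂ) H.u * Coalgebra.comul (R := ℂ) H.g) =
      H.v ⊗ₜ H.v := by
    rw [← Bialgebra.comul_mul, u_mul_g]
    exact H.comul_v
  rw [← mul_assoc, (H.Q_comm _).eq, h1] at h2
  calc _ = (H.ui ⊗ₜ H.ui) * ((H.u ⊗ₜ[ℂ] H.u) * Coalgebra.comul (R := ℂ) H.g) := by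
        rw [← mul_assoc, Algebra.TensorProduct.tmul_mul_tmul, ui_mul,
          ← Algebra.TensorProduct.one_def, one_mul]
    _ = _ := by
        rw [h2, Algebra.TensorProduct.tmul_mul_tmul]
        rfl

theorem counit_g : Coalgebra.counit (R := ℂ) H.g = 1 := by
  have h := congrArg (Coalgebra.counit (R := ℂ)) H.u_mul_g
  rwa [Bialgebra.counit_mul, counit_u, one_mul, H.counit_v] at h

end RibbonStarHopf

/-! ### Coproducts of the double braiding -/

namespace RibbonStarHopf

variable (H : RibbonStarHopf G)

theorem comulL_swapT_R :
    comulL G G (swapT G H.R) = j23 G G (swapT G H.R) * j13 G G (swapT G H.R) := by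
  let P : G ⊗[ℂ] (G ⊗[ℂ] G) →ₐ[ℂ] G ⊗[ℂ] (G ⊗[ℂ] G) :=
    (idT G (swapT G)).comp (swap12 G G)
  have hP : ∀ x y z : G, P (x ⊗ₜ (y ⊗ₜ z)) = y ⊗ₜ (z ⊗ₜ x) := fun _ _ _ => rfl
  have h1 : ∀ X : G ⊗[ℂ] G, P (idT G (Bialgebra.comulAlgHom ℂ G) X) =
      comulL G G (swapT G X) := by
    intro X
    induction X with
    | zero => simp
    | add p q hp hq => simp only [map_add, hp, hq]
    | tmul x y =>
      rw [swapT_tmul, comulL_tmul_eq, idT_tmul]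
      change P (x ⊗ₜ Coalgebra.comul (R := ℂ) y) = _
      induction Coalgebra.comul (R := ℂ) y with
      | zero => simp
      | add p q hp hq => simp only [map_add, TensorProduct.tmul_add, add_mul, hp, hq]
      | tmul a b => simp [hP]
  have h2 : ∀ X : G ⊗[ℂ] G, P (j13 G G X) = j23 G G (swapT G X) := by
    intro X
    induction X with
    | zero => simp
    | add p q hp hq => simp only [map_add, hp, hq]
    | tmul x y => simp [hP]
  have h3 : ∀ X : G ⊗[ℂ] G, P (j12 G G X) = j13 G G (swapT G X) := by
    intro X
    induction X with
    | zero => simp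
    | add p q hp hq => simp only [map_add, hp, hq]
    | tmul x y => simp [hP]
  rw [← h1, H.idT_comul_R, map_mul, h2, h3]

theorem idT_comul_swapT_R : idT G (Bialgebra.comulAlgHom ℂ G) (swapT G H.R) =
    j12 G G (swapT G H.R) * j13 G G (swapT G H.R) := by
  let P : G ⊗[ℂ] (G ⊗[ℂ] G) →ₐ[ℂ] G ⊗[ℂ] (G ⊗[ℂ] G) :=
    (swap12 G G).comp (idT G (swapT G))
  have hP : ∀ x y z : G, P (x ⊗ₜ (y ⊗ₜ z)) = z ⊗ₜ (x ⊗ₜ y) := fun _ _ _ => rfl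
  have h1 : ∀ X : G ⊗[ℂ] G, P (comulL G G X) =
      idT G (Bialgebra.comulAlgHom ℂ G) (swapT G X) := by
    intro X
    induction X with
    | zero => simp
    | add p q hp hq => simp only [map_add, hp, hq]
    | tmul x y =>
      rw [swapT_tmul, comulL_tmul_eq, idT_tmul]
      change _ = y ⊗ₜ Coalgebra.comul (R := ℂ) x
      induction Coalgebra.comul (R := ℂ) x with
      | zero => simp
      | add p q hp hq => simp only [map_add, TensorProduct.tmul_add, add_mul, hp, hq]
      | tmul a b => simp [hP]
  have h2 : ∀ X : G ⊗[ℂ] G, P (j13 G G X) = j12 G G (swapT G X) := by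
    intro X
    induction X with
    | zero => simp
    | add p q hp hq => simp only [map_add, hp, hq]
    | tmul x y => simp [hP]
  have h3 : ∀ X : G ⊗[ℂ] G, P (j23 G G X) = j13 G G (swapT G X) := by
    intro X
    induction X with
    | zero => simp
    | add p q hp hq => simp only [map_add, hp, hq, j23_apply] at *
    | tmul x y => simp [hP]
  rw [← h1, H.comulL_R, map_mul, h2, h3]

theorem idT_comul_Q : idT G (Bialgebra.comulAlgHom ℂ G) H.Q =
    j12 G G (swapT G H.R) * j13 G G H.Q * j12 G G H.R := by
  rw [Q, map_mul, idT_comul_R, idT_comul_swapT_R, map_mul]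
  simp only [mul_assoc]

theorem j12_Ri_mul : j12 G A H.Ri * j12 G A H.R = 1 := by rw [← map_mul, Ri_mul, map_one]
theorem j12_R_mul_Ri : j12 G A H.R * j12 G A H.Ri = 1 := by rw [← map_mul, mul_Ri, map_one]

theorem j23_swapT_R_mul (X : G ⊗[ℂ] G) :
    idT G (Bialgebra.comulAlgHom ℂ G) X * j23 G G (swapT G H.R) =
      j23 G G (swapT G H.R) * idT G (swapT G) (idT G (Bialgebra.comulAlgHom ℂ G) X) := by
  induction X with
  | zero => simp
  | add p q hp hq => simp only [map_add, mul_add, add_mul, hp, hq]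
  | tmul x y =>
    have h := H.swapT_R_mul_comulOp y
    change (x ⊗ₜ Coalgebra.comul (R := ℂ) y) * (1 ⊗ₜ swapT G H.R) = (1 ⊗ₜ swapT G H.R) *
      (x ⊗ₜ swapT G (Coalgebra.comul (R := ℂ) y))
    simp [h]

theorem idT_swapT_j13 (X : G ⊗[ℂ] G) : idT G (swapT G) (j13 G G X) = j12 G G X := by
  induction X with
  | zero => simp
  | add p q hp hq => simp only [map_add, hp, hq]
  | tmul x y => simp

theorem idT_swapT_j12 (X : G ⊗[ℂ] G) : idT G (swapT G) (j12 G G X) = j13 G G X := by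
  induction X with
  | zero => simp
  | add p q hp hq => simp only [map_add, hp, hq]
  | tmul x y => simp

/-- The functoriality relation of the double braiding. -/
theorem comulL_Q : j12 G G H.Ri * j13 G G H.Q * j12 G G H.R * j23 G G H.Q =
    comulL G G H.Q := by
  -- `h1` and `h2` are the mixed Yang-Baxter relations between `R` and `R'`. Together they carry
  -- `R₁₂` to the far left, where it cancels `R₁₂⁻¹`.
  have h1 := H.j12_R_mul_comulL (A := G) (swapT G H.R)
  rw [comulL_swapT_R, map_mul, swap12_j13, swap12_j23] at h1
  have h2 := H.j23_swapT_R_mul H.R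
  rw [idT_comul_R, map_mul, idT_swapT_j13, idT_swapT_j12] at h2
  rw [Q, map_mul (comulL G G), comulL_swapT_R, comulL_R, map_mul, map_mul]
  calc _ = j12 G G H.Ri * j13 G G (swapT G H.R) * (j13 G G H.R * j12 G G H.R *
        j23 G G (swapT G H.R)) * j23 G G H.R := by simp only [mul_assoc]
    _ = j12 G G H.Ri * (j13 G G (swapT G H.R) * j23 G G (swapT G H.R) * j12 G G H.R) *
        j13 G G H.R * j23 G G H.R := by rw [h2]; simp only [mul_assoc]
    _ = _ := by
        rw [← h1]
        simp only [← mul_assoc]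
        rw [j12_Ri_mul, one_mul]

theorem counitL_swapT_R [FiniteDimensional ℂ G] : counitL G G (swapT G H.R) = 1 := by
  have h := congrArg (counitL G (G ⊗[ℂ] G)) H.comulL_swapT_R
  rw [counitL_comulL, map_mul, counitL_j13, counitL_j23] at h
  have h2 : (1 : G) ⊗ₜ[ℂ] counitL G G (swapT G H.R) = 1 := by
    have h3 := congrArg (swapT G H.Ri * ·) h
    simp only [← mul_assoc, swapT_Ri_mul, one_mul] at h3
    exact h3.symm
  simpa using congrArg (counitL G G) h2

theorem counitL_Q [FiniteDimensional ℂ G] : counitL G G H.Q = 1 := by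
  rw [Q, map_mul, counitL_R, counitL_swapT_R, one_mul]

end RibbonStarHopf

/-! ### Twisted traces -/

/-- Functionals with the trace property of the `q`-traces. -/
def IsTwistedTrace (f : G →ₗ[ℂ] ℂ) : Prop := ∀ x y, f (x * y) = f (SS (SS y) * x)

/-- The quantum trace of a covariant element is invariant. Contract `S(x¹)` with `coact δ (x²)` on
the left and on the right of `N`; covariance makes the two contractions equal, and they evaluate to
the two sides. -/
theorem IsTwistedTrace.slice_comm {f : G →ₗ[ℂ] ℂ} (hf : IsTwistedTrace f) (δ : G →ₐ[ℂ] A)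
    {N : G ⊗[ℂ] A} (hN : ∀ x, Commute (coact δ x) N) (x : G) :
    Commute (δ x) (slice A f N) := by
  let L : (G ⊗[ℂ] A →ₗ[ℂ] G ⊗[ℂ] A) → G ⊗[ℂ] (G ⊗[ℂ] A) →ₗ[ℂ] A := fun m =>
    slice A f ∘ₗ LinearMap.mul' ℂ (G ⊗[ℂ] A) ∘ₗ TensorProduct.map
      ((Algebra.TensorProduct.includeLeft : G →ₐ[ℂ] G ⊗[ℂ] A).toLinearMap ∘ₗ SS) m
  have hL : ∀ m p W, L m (p ⊗ₜ W) = slice A f ((SS p ⊗ₜ 1) * m W) := fun _ _ _ => rfl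
  -- On the left of `N` the factor `S(x¹) x²` collapses at once.
  have h1 : ∀ Z : G ⊗[ℂ] A, L (LinearMap.mulRight ℂ N) (comulL G A Z) =
      counitL G A Z * slice A f N := by
    intro Z
    induction Z with
    | zero => simp
    | add p q hp hq => simp only [map_add, add_mul, hp, hq]
    | tmul z a =>
      have h := HopfAlgebra.mul_antipode_rTensor_comul_apply (R := ℂ) z
      have h2 : ∀ Y : G ⊗[ℂ] G, L (LinearMap.mulRight ℂ N) (j12 G A Y * (1 ⊗ₜ (1 ⊗ₜ a))) =
          slice A f ((LinearMap.mul' ℂ G (LinearMap.rTensor G SS Y) ⊗ₜ a) * N) := by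
        intro Y
        induction Y with
        | zero => simp
        | add p q hp hq => simp only [map_add, add_mul, hp, hq, TensorProduct.add_tmul]
        | tmul c d => simp [hL, ← mul_assoc]
      rw [comulL_tmul_eq, h2, h, Algebra.algebraMap_eq_smul_one, ← TensorProduct.smul_tmul',
        smul_mul_assoc, map_smul, slice_one_tmul_mul, counitL_tmul, smul_mul_assoc]
  -- On the right of `N` the twisted trace property moves `x²` to the front as `S²(x²)`, and `S²(x²)
  -- S(x¹) = S(x¹ S(x²))` collapses.
  have h3 : ∀ Z : G ⊗[ℂ] A, L (LinearMap.mulLeft ℂ N) (comulL G A Z) =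
      slice A f N * counitL G A Z := by
    intro Z
    induction Z with
    | zero => simp
    | add p q hp hq => simp only [map_add, mul_add, hp, hq]
    | tmul z a =>
      have h := HopfAlgebra.mul_antipode_lTensor_comul_apply (R := ℂ) z
      have h2 : ∀ Y : G ⊗[ℂ] G, L (LinearMap.mulLeft ℂ N) (j12 G A Y * (1 ⊗ₜ (1 ⊗ₜ a))) =
          slice A f ((SS (LinearMap.mul' ℂ G (LinearMap.lTensor G SS Y)) ⊗ₜ 1) * N) * a := by
        intro Y
        induction Y with
        | zero => simp
        | add p q hp hq => simp only [map_add, add_mul, hp, hq, TensorProduct.add_tmul]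
        | tmul c d =>
          clear hN h1
          induction N with
          | zero => simp [hL]
          | add p q hp hq =>
            simp only [hL, j12_tmul, LinearMap.mulLeft_apply,
              Algebra.TensorProduct.tmul_mul_tmul, mul_one, one_mul] at hp hq ⊢
            simp only [map_add, add_mul, mul_add, hp, hq]
          | tmul n b =>
            have h := hf (SS c * n) d
            simp only [hL, j12_tmul, LinearMap.mulLeft_apply,
              Algebra.TensorProduct.tmul_mul_tmul, mul_one, one_mul, slice_tmul,
              LinearMap.lTensor_tmul, LinearMap.mul'_apply,
              HopfAlgebra.antipode_mul_antidistrib, mul_assoc] at h ⊢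
            rw [h, smul_mul_assoc]
      rw [comulL_tmul_eq, h2, h, Algebra.algebraMap_eq_smul_one, map_smul,
        HopfAlgebra.antipode_one, ← TensorProduct.smul_tmul', ← Algebra.TensorProduct.one_def,
        smul_mul_assoc, one_mul, map_smul, counitL_tmul, mul_smul_comm, smul_mul_assoc]
  have h4 : ∀ Y : G ⊗[ℂ] G, L (LinearMap.mulLeft ℂ N) (idT G (coact δ) Y) =
      L (LinearMap.mulRight ℂ N) (idT G (coact δ) Y) := by
    intro Y
    induction Y with
    | zero => simp
    | add p q hp hq => simp only [map_add, hp, hq]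
    | tmul c d => simp [hL, (hN d).eq]
  have h5 := coassoc_coact δ x
  have h6 := h4 (Coalgebra.comul (R := ℂ) x)
  rw [← coact_apply, ← h5, h1, h3, counitL_coact] at h6
  exact h6.symm

namespace RibbonStarHopf

variable (H : RibbonStarHopf G)

/-- With `R⁻¹ = (S ⊗ id)(R)` and the twisted trace property the two `R`-factors combine to `(S ⊗
id)(R R⁻¹) = 1`. -/
theorem slice_conj_tmul_one {f : G →ₗ[ℂ] ℂ} (hf : IsTwistedTrace f) (n : G) :
    slice G f (H.Ri * (n ⊗ₜ 1) * (H.R : G ⊗[ℂ] G)) = f n • 1 := by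
  have h : ∀ X Y : G ⊗[ℂ] G, slice G f (antipodeL G G X * (n ⊗ₜ 1) * Y) =
      slice G (f ∘ₗ LinearMap.mulRight ℂ n) (antipodeL G G (X * antipodeL G G Y)) := by
    intro X Y
    induction X with
    | zero => simp
    | add p q hp hq => simp only [map_add, add_mul, hp, hq]
    | tmul x a =>
      induction Y with
      | zero => simp
      | add p q hp hq => simp only [map_add, mul_add, hp, hq]
      | tmul y b =>
        have h := hf (SS x * n) y
        simp [HopfAlgebra.antipode_mul_antidistrib, mul_assoc] at h ⊢
        rw [h]
  rw [← antipodeL_R, h, antipodeL_R, mul_Ri, Algebra.TensorProduct.one_def]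
  simp

/-- Invariance of twisted traces under conjugation with the universal `R`-matrix. -/
theorem slice_conj {f : G →ₗ[ℂ] ℂ} (hf : IsTwistedTrace f) (N : G ⊗[ℂ] A) :
    slice (G ⊗[ℂ] A) f (j12 G A H.Ri * j13 G A N * j12 G A H.R) = 1 ⊗ₜ slice A f N := by
  induction N with
  | zero => simp
  | add p q hp hq => simp only [map_add, mul_add, add_mul, hp, hq, TensorProduct.tmul_add]
  | tmul n a =>
    have h : ∀ X : G ⊗[ℂ] G, Commute (j12 G A X) (1 ⊗ₜ (1 ⊗ₜ a)) := by
      intro X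
      induction X with
      | zero => simp
      | add p q hp hq => rw [map_add]; exact hp.add_left hq
      | tmul x y => simp [Commute, SemiconjBy]
    have h2 : j13 G A (n ⊗ₜ a) = j12 G A (n ⊗ₜ 1) * (1 ⊗ₜ (1 ⊗ₜ a)) := by simp
    rw [h2, ← mul_assoc, mul_assoc, ← (h _).eq, ← mul_assoc, ← map_mul, ← map_mul,
      slice_mul_one_tmul, slice_j12, H.slice_conj_tmul_one hf]
    simp [TensorProduct.smul_tmul']

end RibbonStarHopf
end Balancing

/-! ### Semisimplicity: `G` is the product of the matrix algebras of its irreducibles -/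

section Semisimple

section Algebras

variable {G : Type*} [Ring G] [Algebra ℂ G]

/-- A rank-one matrix carries any nonzero vector of an invariant subspace to any prescribed vector.
-/
theorem isIrrep_of_surjective {k : ℕ} (hk : 0 < k) (ρ : G →ₐ[ℂ] Matrix (Fin k) (Fin k) ℂ)
    (hρ : Function.Surjective ρ) : IsIrrep ρ := by
  refine ⟨hk, fun W hW => ?_⟩
  by_contra! h
  obtain ⟨w, hw, hw0⟩ := (Submodule.ne_bot_iff W).1 h.1
  obtain ⟨i, hi⟩ := Function.ne_iff.1 hw0
  refine h.2 ((Submodule.eq_top_iff').2 fun x => ?_)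
  obtain ⟨y, hy⟩ := hρ (Matrix.vecMulVec x (Pi.single i (w i)⁻¹))
  have := hW y w hw
  rw [hy, Matrix.vecMulVec_mulVec] at this
  simpa [inv_mul_cancel₀ hi] using this

theorem RepEquiv.symm {k l : ℕ} {ρ : G →ₐ[ℂ] Matrix (Fin k) (Fin k) ℂ}
    {σ : G →ₐ[ℂ] Matrix (Fin l) (Fin l) ℂ} (h : RepEquiv ρ σ) : RepEquiv σ ρ := by
  obtain ⟨T, T', h1, h2, h3⟩ := h
  refine ⟨T', T, h2, h1, fun x => ?_⟩
  calc σ x * T' = T' * (T * σ x) * T' := by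
        rw [← Matrix.mul_assoc, h2, Matrix.one_mul]
    _ = T' * ρ x := by rw [← h3, Matrix.mul_assoc, Matrix.mul_assoc, h1, Matrix.mul_one]

theorem RepEquiv.trans {k l j : ℕ} {ρ : G →ₐ[ℂ] Matrix (Fin k) (Fin k) ℂ}
    {σ : G →ₐ[ℂ] Matrix (Fin l) (Fin l) ℂ} {π : G →ₐ[ℂ] Matrix (Fin j) (Fin j) ℂ}
    (h : RepEquiv ρ σ) (h' : RepEquiv σ π) : RepEquiv ρ π := by
  obtain ⟨T, T', h1, h2, h3⟩ := h
  obtain ⟨U, U', k1, k2, k3⟩ := h'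
  refine ⟨T * U, U' * T', ?_, ?_, fun x => ?_⟩
  · rw [Matrix.mul_assoc, ← Matrix.mul_assoc U, k1, Matrix.one_mul, h1]
  · rw [Matrix.mul_assoc, ← Matrix.mul_assoc T', h2, Matrix.one_mul, k2]
  · rw [← Matrix.mul_assoc, h3, Matrix.mul_assoc, k3, ← Matrix.mul_assoc]

theorem RepEquiv.apply_eq {k l : ℕ} {ρ : G →ₐ[ℂ] Matrix (Fin k) (Fin k) ℂ}
    {σ : G →ₐ[ℂ] Matrix (Fin l) (Fin l) ℂ} (h : RepEquiv ρ σ) {x y : G} (hx : ρ x = ρ y) :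
    σ x = σ y := by
  obtain ⟨T, T', -, h2, h3⟩ := h
  have : ∀ z, σ z = T' * ρ z * T := fun z => by
    rw [Matrix.mul_assoc, h3, ← Matrix.mul_assoc, h2, Matrix.one_mul]
  rw [this, this, hx]

/-- Schur's lemma: a nonzero intertwiner of irreducible representations is invertible. -/
theorem repEquiv_of_intertwiner {k l : ℕ} {ρ : G →ₐ[ℂ] Matrix (Fin k) (Fin k) ℂ}
    {σ : G →ₐ[ℂ] Matrix (Fin l) (Fin l) ℂ} (hρ : IsIrrep ρ) (hσ : IsIrrep σ)
    {T : Matrix (Fin k) (Fin l) ℂ} (hT : T ≠ 0) (h : ∀ x, ρ x * T = T * σ x) :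
    RepEquiv ρ σ := by
  have hker : LinearMap.ker T.mulVecLin = ⊥ := by
    refine (hσ.2 _ fun x w hw => ?_).resolve_right fun h' => hT ?_
    · rw [LinearMap.mem_ker, Matrix.mulVecLin_apply] at hw ⊢
      rw [Matrix.mulVec_mulVec, ← h, ← Matrix.mulVec_mulVec, hw, Matrix.mulVec_zero]
    · have h0 := LinearMap.ker_eq_top.1 h'
      ext i j
      have := congrFun (congrArg (fun f => f (Pi.single j 1)) h0) i
      simpa using this
  have hran : LinearMap.range T.mulVecLin = ⊤ := by
    refine (hρ.2 _ fun x w hw => ?_).resolve_left fun h' => hT ?_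
    · obtain ⟨z, rfl⟩ := hw
      refine ⟨σ x *ᵥ z, ?_⟩
      rw [Matrix.mulVecLin_apply, Matrix.mulVecLin_apply, Matrix.mulVec_mulVec,
        Matrix.mulVec_mulVec, h]
    · have h0 := LinearMap.range_eq_bot.1 h'
      ext i j
      have := congrFun (congrArg (fun f => f (Pi.single j 1)) h0) i
      simpa using this
  let E := LinearEquiv.ofBijective T.mulVecLin
    ⟨LinearMap.ker_eq_bot.1 hker, LinearMap.range_eq_top.1 hran⟩
  have hE : LinearMap.toMatrix' E.toLinearMap = T := LinearMap.toMatrix'_toLin' T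
  refine ⟨T, LinearMap.toMatrix' E.symm.toLinearMap, ?_, ?_, h⟩
  · rw [← hE, ← LinearMap.toMatrix'_comp]
    simp
  · rw [← hE, ← LinearMap.toMatrix'_comp]
    simp

end Algebras

variable {G : Type*} [Ring G] [HopfAlgebra ℂ G] [StarRing G] [StarModule ℂ G]
variable [FiniteDimensional ℂ G] [IsSemisimpleRing G]
variable {ι : Type*}

namespace IrrepSystem

variable (V : IrrepSystem G ι)

theorem n_pos (I : ι) : 0 < V.n I := (V.irrep I).1

instance (I : ι) : NeZero (V.n I) := ⟨(V.n_pos I).ne'⟩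

/-- Wedderburn's theorem supplies matrix blocks, each an irreducible representation and so
equivalent to some `τ (σ i)`. The block idempotents separate different blocks, so `σ` is injective;
since the diagonal matrix units sum to one, some of them acts nontrivially in any `V^I`, and Schur's
lemma identifies `V^I` with that block. -/
theorem exists_wedderburn : ∃ (n : ℕ) (d : Fin n → ℕ) (σ : Fin n ≃ ι)
    (e : G ≃ₐ[ℂ] Π i : Fin n, Matrix (Fin (d i)) (Fin (d i)) ℂ),
    ∀ i, RepEquiv (V.τ (σ i)).toAlgHom
      ((Pi.evalAlgHom ℂ (fun i => Matrix (Fin (d i)) (Fin (d i)) ℂ) i).comp e.toAlgHom) := by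
  obtain ⟨n, d, hd, ⟨e⟩⟩ := IsSemisimpleRing.exists_algEquiv_pi_matrix_of_isAlgClosed ℂ G
  let ρ := fun i => (Pi.evalAlgHom ℂ (fun i => Matrix (Fin (d i)) (Fin (d i)) ℂ) i).comp e.toAlgHom
  have hρ : ∀ i x, ρ i x = e x i := fun _ _ => rfl
  have hirr : ∀ i, IsIrrep (ρ i) := fun i => isIrrep_of_surjective (Nat.pos_of_neZero _) _
    fun X => ⟨e.symm (Pi.single i X), by rw [hρ]; simp⟩
  choose σ hσ using fun i => V.exhaustive _ (ρ i) (hirr i)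
  have hinj : Function.Injective σ := by
    intro i j hij
    by_contra hne
    have h1 : V.τ (σ i) (e.symm (Pi.single i 1)) = 1 := by
      have h := (hσ i).symm.apply_eq (x := e.symm (Pi.single i 1)) (y := 1) (by
        rw [hρ, hρ]; simp)
      simpa using h
    have h2 : V.τ (σ j) (e.symm (Pi.single i 1)) = 0 := by
      have h := (hσ j).symm.apply_eq (x := e.symm (Pi.single i 1)) (y := 0) (by
        rw [hρ, hρ]; simp [Pi.single_eq_of_ne' hne])
      simpa using h
    rw [← hij, h1] at h2
    exact one_ne_zero h2
  have hsurj : Function.Surjective σ := by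
    intro I
    let E : ∀ i, Fin (d i) → Fin (d i) → G := fun i a b =>
      e.symm (Pi.single i (Matrix.single a b 1))
    have hsum : ∑ i, ∑ a, E i a a = 1 := by
      apply e.injective
      funext i
      simp only [E, map_sum, AlgEquiv.apply_symm_apply, map_one, Finset.sum_apply, Pi.one_apply]
      rw [Finset.sum_eq_single i]
      · simp only [Pi.single_eq_same, Matrix.sum_single_eq_diagonal]
        simp
      · intro j _ hj
        exact Finset.sum_eq_zero fun a _ => Pi.single_eq_of_ne hj.symm _
      · simp
    have hne : ∃ i a, V.τ I (E i a a) ≠ 0 := by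
      by_contra! h
      have h1 := congrArg (V.τ I) hsum
      simp only [map_sum, h, Finset.sum_const_zero, map_one] at h1
      exact zero_ne_one h1
    obtain ⟨i, a, ha⟩ := hne
    obtain ⟨k, l, hkl⟩ : ∃ k l, V.τ I (E i a a) k l ≠ 0 := by
      by_contra! h
      exact ha (by ext k l; exact h k l)
    -- The `b`-th basis vector goes to `E_{ba} w`, with `w` the `l`-th basis vector of `V^I`. The
    -- entry `(k, a)` of `T` is nonzero by the choice of `k` and `l`.
    let T : Matrix (Fin (V.n I)) (Fin (d i)) ℂ := Matrix.of fun p b => V.τ I (E i b a) p l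
    refine ⟨i, V.inequiv _ _ ((hσ i).trans (RepEquiv.symm ?_))⟩
    refine repEquiv_of_intertwiner (T := T) (V.irrep I) (hirr i)
      (fun h => hkl (congrFun (congrFun h k) a)) fun x => ?_
    ext p b
    have hx : x * E i b a = ∑ c, ρ i x c b • E i c a := by
      apply e.injective
      funext j
      simp only [E, map_mul, map_sum, map_smul, AlgEquiv.apply_symm_apply, Pi.mul_apply,
        Finset.sum_apply, Pi.smul_apply]
      by_cases hj : j = i
      · subst hj
        simp only [Pi.single_eq_same, hρ]
        ext s t
        simp [Matrix.sum_apply, Matrix.mul_apply, Matrix.single_apply, ite_and,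
          Finset.sum_ite_eq]
      · simp [Pi.single_eq_of_ne hj]
    have h2 := congrFun (congrFun (congrArg (V.τ I) hx) p) l
    simp only [map_mul, map_sum, map_smul, Matrix.sum_apply, Matrix.smul_apply,
      smul_eq_mul] at h2
    calc _ = (V.τ I x * V.τ I (E i b a)) p l := by simp [Matrix.mul_apply, T]
      _ = _ := by
        rw [h2]
        simp [Matrix.mul_apply, T, mul_comm]
  exact ⟨n, d, Equiv.ofBijective σ ⟨hinj, hsurj⟩, e, hσ⟩

theorem eq_of_τ {x y : G} (h : ∀ I, V.τ I x = V.τ I y) : x = y := by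
  obtain ⟨n, d, σ, e, he⟩ := V.exists_wedderburn
  apply e.injective
  funext i
  exact (he i).apply_eq (h (σ i))

theorem exists_τ_eq (X : ∀ I, Matrix (Fin (V.n I)) (Fin (V.n I)) ℂ) :
    ∃ x : G, ∀ I, V.τ I x = X I := by
  obtain ⟨n, d, σ, e, he⟩ := V.exists_wedderburn
  choose T T' h1 h2 h3 using he
  refine ⟨e.symm fun i => T' i * X (σ i) * T i, fun I => ?_⟩
  obtain ⟨i, rfl⟩ := σ.surjective I
  have h := h3 i (e.symm fun i => T' i * X (σ i) * T i)
  have h4 : ((Pi.evalAlgHom ℂ (fun i => Matrix (Fin (d i)) (Fin (d i)) ℂ) i).comp e.toAlgHom)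
      (e.symm fun i => T' i * X (σ i) * T i) = T' i * X (σ i) * T i := by
    simp
  rw [h4] at h
  set x := e.symm fun i => T' i * X (σ i) * T i
  change V.τ (σ i) x * T i = _ at h
  calc V.τ (σ i) x = V.τ (σ i) x * T i * T' i := by
        rw [Matrix.mul_assoc, h1, Matrix.mul_one]
    _ = (T i * T' i) * X (σ i) * (T i * T' i) := by rw [h]; simp only [Matrix.mul_assoc]
    _ = X (σ i) := by rw [h1, Matrix.one_mul, Matrix.mul_one]

/-- The Wedderburn isomorphism given by the irreducible representations. -/
def wedderburn : G ≃ₐ[ℂ] Π I, Matrix (Fin (V.n I)) (Fin (V.n I)) ℂ :=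
  AlgEquiv.ofBijective (AlgHom.pi fun I => (V.τ I).toAlgHom)
    ⟨fun _ _ h => V.eq_of_τ fun I => congrFun h I, fun X => by
      obtain ⟨x, hx⟩ := V.exists_τ_eq X
      exact ⟨x, funext hx⟩⟩

theorem wedderburn_apply (x : G) (I : ι) : V.wedderburn x I = V.τ I x := rfl

theorem τ_wedderburn_symm (X : ∀ I, Matrix (Fin (V.n I)) (Fin (V.n I)) ℂ) (I : ι) :
    V.τ I (V.wedderburn.symm X) = X I := by
  rw [← wedderburn_apply, AlgEquiv.apply_symm_apply]

variable [DecidableEq ι]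

/-- The matrix units of `G`. -/
def E (I : ι) (a b : Fin (V.n I)) : G := V.wedderburn.symm (Pi.single I (Matrix.single a b 1))

/-- The minimal central idempotents of `G`. -/
def e (I : ι) : G := V.wedderburn.symm (Pi.single I 1)

theorem τ_e (I J : ι) : V.τ J (V.e I) = if I = J then 1 else 0 := by
  rw [e, τ_wedderburn_symm]
  split_ifs with h
  · subst h; simp
  · exact Pi.single_eq_of_ne' h _

theorem τ_E_self (I : ι) (a b : Fin (V.n I)) : V.τ I (V.E I a b) = Matrix.single a b 1 := by
  rw [E, τ_wedderburn_symm, Pi.single_eq_same]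

theorem τ_E_of_ne {I J : ι} (h : I ≠ J) (a b : Fin (V.n I)) : V.τ J (V.E I a b) = 0 := by
  rw [E, τ_wedderburn_symm, Pi.single_eq_of_ne' h]

theorem e_comm (I : ι) (x : G) : V.e I * x = x * V.e I := by
  refine V.eq_of_τ fun J => ?_
  rw [map_mul, map_mul, τ_e]
  split_ifs <;> simp

theorem e_mul_e (I J : ι) : V.e I * V.e J = if I = J then V.e I else 0 := by
  refine V.eq_of_τ fun K => ?_
  rw [map_mul, τ_e, τ_e]
  by_cases h : I = J
  · subst h; simp [τ_e]
  · by_cases h2 : I = K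
    · subst h2; simp [h, Ne.symm h]
    · simp [h, h2]

theorem mul_e_triv (x : G) :
    x * V.e V.triv = Coalgebra.counit (R := ℂ) x • V.e V.triv := by
  refine V.eq_of_τ fun K => ?_
  rw [map_mul, map_smul, τ_e]
  split_ifs with h
  · subst h; simp [V.τ_triv]
  · simp

variable [Fintype ι]

theorem sum_e : ∑ I, V.e I = 1 := by
  refine V.eq_of_τ fun K => ?_
  rw [map_sum, map_one]
  simp [τ_e]

theorem eq_sum_E (x : G) : x = ∑ I, ∑ a, ∑ b, V.τ I x a b • V.E I a b := by
  refine V.eq_of_τ fun K => ?_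
  simp only [map_sum, map_smul]
  rw [Finset.sum_eq_single K]
  · simp only [τ_E_self]
    conv_lhs => rw [Matrix.matrix_eq_sum_single (V.τ K x)]
    simp
  · intro J _ hJ
    simp [V.τ_E_of_ne hJ]
  · simp

end IrrepSystem

end Semisimple

/-! ### Evaluation in the irreducible representations -/

section Evaluation

variable {G : Type*} [Ring G] [HopfAlgebra ℂ G] [StarRing G] [StarModule ℂ G]
variable {ι : Type*} {A : Type*} [Ring A] [Algebra ℂ A] {B : Type*} [Ring B] [Algebra ℂ B]

namespace IrrepSystem

variable (V : IrrepSystem G ι)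

/-- The matrix coefficients of `τ^I`. -/
def coef (I : ι) (a b : Fin (V.n I)) : G →ₗ[ℂ] ℂ :=
  Matrix.entryLinearMap ℂ ℂ a b ∘ₗ (V.τ I).toAlgHom.toLinearMap

@[simp] theorem coef_apply (I : ι) (a b : Fin (V.n I)) (x : G) : V.coef I a b x = V.τ I x a b :=
  rfl

variable (A) in
/-- `τ^I ⊗ id`. -/
def ev (I : ι) : G ⊗[ℂ] A →ₐ[ℂ] Matrix (Fin (V.n I)) (Fin (V.n I)) A :=
  AlgHom.ofLinearMap
    { toFun := fun X => Matrix.of fun a b => slice A (V.coef I a b) X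
      map_add' := fun X Y => by ext; simp
      map_smul' := fun c X => by ext; simp }
    (by
      ext a b
      simp [Algebra.TensorProduct.one_def, Matrix.one_apply])
    (fun X Y => by
      ext a b
      simp only [LinearMap.coe_mk, AddHom.coe_mk, Matrix.mul_apply, Matrix.of_apply]
      induction X with
      | zero => simp
      | add p q hp hq => simp only [map_add, add_mul, hp, hq, Finset.sum_add_distrib]
      | tmul x s =>
        induction Y with
        | zero => simp
        | add p q hp hq => simp only [map_add, mul_add, hp, hq, Finset.sum_add_distrib]
        | tmul y t =>
          simp [Matrix.mul_apply, Finset.sum_smul, smul_smul, mul_comm])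

theorem ev_apply (I : ι) (X : G ⊗[ℂ] A) (a b : Fin (V.n I)) :
    V.ev A I X a b = slice A (V.coef I a b) X := rfl

@[simp] theorem ev_tmul (I : ι) (x : G) (s : A) (a b : Fin (V.n I)) :
    V.ev A I (x ⊗ₜ s) a b = V.τ I x a b • s := rfl

variable (A) in
/-- `τ^I ⊗ τ^J ⊗ id`. -/
def ev2 (I J : ι) : G ⊗[ℂ] (G ⊗[ℂ] A) →ₐ[ℂ]
    Matrix (Fin (V.n I) × Fin (V.n J)) (Fin (V.n I) × Fin (V.n J)) A :=
  (Matrix.compAlgEquiv (Fin (V.n I)) (Fin (V.n J)) A ℂ).toAlgHom.comp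
    ((V.ev A J).mapMatrix.comp (V.ev (G ⊗[ℂ] A) I))

theorem ev2_apply (I J : ι) (X : G ⊗[ℂ] (G ⊗[ℂ] A)) (p q : Fin (V.n I) × Fin (V.n J)) :
    V.ev2 A I J X p q = V.ev A J (V.ev (G ⊗[ℂ] A) I X p.1 q.1) p.2 q.2 := rfl

@[simp] theorem ev2_tmul (I J : ι) (x y : G) (s : A) (p q : Fin (V.n I) × Fin (V.n J)) :
    V.ev2 A I J (x ⊗ₜ (y ⊗ₜ s)) p q = (V.τ I x p.1 q.1 * V.τ J y p.2 q.2) • s := by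
  rw [ev2_apply, ev_tmul, map_smul, Matrix.smul_apply, ev_tmul, smul_smul]

theorem ten_tmul (I J : ι) (x y : G) : V.ten I J (x ⊗ₜ y) = V.τ I x ⊗ₖ V.τ J y := by
  simp [IrrepSystem.ten]

theorem ev_idT (I : ι) (f : A →ₐ[ℂ] B) (X : G ⊗[ℂ] A) :
    V.ev B I (idT G f X) = (V.ev A I X).map f := by
  ext a b
  rw [Matrix.map_apply, ev_apply, ev_apply, slice_idT]

theorem ev_one_tmul (I : ι) (s : A) (a b : Fin (V.n I)) :
    V.ev A I (1 ⊗ₜ s) a b = if a = b then s else 0 := by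
  simp [Matrix.one_apply]

theorem ev_tmul_one (I : ι) (x : G) : V.ev A I (x ⊗ₜ 1) = scal A (V.τ I x) := by
  ext a b
  simp [scal, Algebra.algebraMap_eq_smul_one]

theorem ev2_j12 (I J : ι) (X : G ⊗[ℂ] G) : V.ev2 A I J (j12 G A X) = scal A (V.ten I J X) := by
  ext p q
  induction X with
  | zero => simp [scal]
  | add x y hx hy =>
    simp only [scal, Matrix.map_apply, map_add, Matrix.add_apply] at hx hy ⊢
    rw [hx, hy]
  | tmul x y => simp [scal, ten_tmul, Algebra.algebraMap_eq_smul_one]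

theorem ev2_j13 (I J : ι) (X : G ⊗[ℂ] A) :
    V.ev2 A I J (j13 G A X) = onLeft (Fin (V.n J)) (V.ev A I X) := by
  ext p q
  induction X with
  | zero => simp [onLeft]
  | add x y hx hy =>
    simp only [onLeft, Matrix.of_apply, map_add, Matrix.add_apply] at hx hy ⊢
    rw [hx, hy]
    split_ifs <;> simp
  | tmul x y =>
    simp [onLeft, Matrix.one_apply]

theorem ev2_j23 (I J : ι) (X : G ⊗[ℂ] A) :
    V.ev2 A I J (j23 G A X) = onRight (Fin (V.n I)) (V.ev A J X) := by
  ext p q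
  rw [j23_apply, ev2_apply, ev_one_tmul]
  simp only [onRight, Matrix.of_apply]
  split_ifs <;> simp

theorem scal_mul_ev2 {I J K : ι} {C : Matrix (Fin (V.n K)) (Fin (V.n I) × Fin (V.n J)) ℂ}
    (hC : C ∈ V.intertwiners I J K) (X : G ⊗[ℂ] A) :
    scal A C * V.ev2 A I J (comulL G A X) = V.ev A K X * scal A C := by
  induction X with
  | zero => simp
  | add x y hx hy => simp only [map_add, Matrix.mul_add, Matrix.add_mul, hx, hy]
  | tmul x s =>
    have h1 : V.ev2 A I J (1 ⊗ₜ (1 ⊗ₜ s)) = Matrix.diagonal fun _ => s := by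
      ext p q
      simp [Matrix.diagonal_apply, Matrix.one_apply, Prod.ext_iff]
      by_cases h1 : p.1 = q.1 <;> by_cases h2 : p.2 = q.2 <;> simp [h1, h2]
    have h2 : V.ev A K (x ⊗ₜ s) = scal A (V.τ K x) * Matrix.diagonal fun _ => s := by
      ext a b
      simp [scal, Algebra.algebraMap_eq_smul_one]
    have h3 : (Matrix.diagonal fun _ : Fin (V.n K) => s) * scal A C =
        scal A C * Matrix.diagonal fun _ : Fin (V.n I) × Fin (V.n J) => s := by
      ext a b
      rw [Matrix.diagonal_mul, Matrix.mul_diagonal, scal, Matrix.map_apply, Algebra.commutes]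
    have h4 := hC x
    rw [comulL_tmul_eq, map_mul, ev2_j12, h1, h2, Matrix.mul_assoc, h3, ← Matrix.mul_assoc,
      ← Matrix.mul_assoc]
    congr 1
    simp only [scal]
    rw [← Matrix.map_mul, ← Matrix.map_mul, h4]

variable [FiniteDimensional ℂ G] [IsSemisimpleRing G] [DecidableEq ι] [Fintype ι]

theorem eq_sum_ev (X : G ⊗[ℂ] A) : X = ∑ I, ∑ a, ∑ b, V.E I a b ⊗ₜ V.ev A I X a b := by
  induction X with
  | zero => simp
  | add x y hx hy =>
    simp only [map_add, Matrix.add_apply, TensorProduct.tmul_add, Finset.sum_add_distrib]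
    rw [← hx, ← hy]
  | tmul x s =>
    conv_lhs => rw [V.eq_sum_E x]
    simp only [TensorProduct.sum_tmul, ev_tmul, TensorProduct.tmul_smul,
      TensorProduct.smul_tmul']

theorem ev_ext {X Y : G ⊗[ℂ] A} (h : ∀ I, V.ev A I X = V.ev A I Y) : X = Y := by
  rw [V.eq_sum_ev X, V.eq_sum_ev Y]
  simp only [h]

theorem ev2_ext {X Y : G ⊗[ℂ] (G ⊗[ℂ] A)} (h : ∀ I J, V.ev2 A I J X = V.ev2 A I J Y) :
    X = Y := by
  refine V.ev_ext fun I => ?_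
  ext a b
  refine V.ev_ext fun J => ?_
  ext c d
  exact congrFun (congrFun (h I J) (a, c)) (b, d)

/-- The element of `G ⊗ A` with prescribed evaluations. -/
def ofEv (X : ∀ I, Matrix (Fin (V.n I)) (Fin (V.n I)) A) : G ⊗[ℂ] A :=
  ∑ I, ∑ a, ∑ b, V.E I a b ⊗ₜ X I a b

theorem ev_ofEv (X : ∀ I, Matrix (Fin (V.n I)) (Fin (V.n I)) A) (I : ι) :
    V.ev A I (V.ofEv X) = X I := by
  ext c d
  simp only [ofEv, map_sum, Matrix.sum_apply]
  rw [Finset.sum_eq_single I]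
  · simp only [ev_tmul, τ_E_self]
    rw [Finset.sum_eq_single c, Finset.sum_eq_single d]
    · simp
    · intro b _ hb; simp [hb]
    · simp
    · intro a _ ha
      exact Finset.sum_eq_zero fun b _ => by simp [ha]
    · simp
  · intro J _ hJ
    simp [V.τ_E_of_ne hJ]
  · simp

/-- The intertwiners from `V^I ⊗ V^J` to the irreducibles are jointly injective. -/
theorem intertwiners_inj (I J : ι) {k : Type*} {X : Matrix (Fin (V.n I) × Fin (V.n J)) k ℂ}
    (h : ∀ K, ∀ C ∈ V.intertwiners I J K, C * X = 0) : X = 0 := by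
  have h1 : ∀ K a b, V.ten I J (Coalgebra.comul (R := ℂ) (V.E K a b)) * X = 0 := by
    intro K a b
    ext p q
    -- For fixed `a` and `p`, the `p`-th rows of the operators `Δ(E_{ac})` form an intertwiner to
    -- `V^K`, because `E_{ac} x` is the combination `∑_d τ(x)_{cd} E_{ad}`.
    let C : Matrix (Fin (V.n K)) (Fin (V.n I) × Fin (V.n J)) ℂ := Matrix.of fun c r =>
      V.ten I J (Coalgebra.comul (R := ℂ) (V.E K a c)) p r
    have hC : C ∈ V.intertwiners I J K := by
      intro x
      have hx : ∀ c, V.E K a c * x = ∑ d, V.τ K x c d • V.E K a d := by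
        intro c
        refine V.eq_of_τ fun L => ?_
        simp only [map_mul, map_sum, map_smul]
        by_cases hL : K = L
        · subst hL
          simp only [τ_E_self]
          ext s t
          simp [Matrix.sum_apply, Matrix.mul_apply, Matrix.single_apply, ite_and]
        · simp [V.τ_E_of_ne hL]
      ext c r
      have h2 := congrFun (congrFun (congrArg (fun y => V.ten I J (Coalgebra.comul (R := ℂ) y))
        (hx c)) p) r
      simp only [Bialgebra.comul_mul, map_mul, map_sum, map_smul, Matrix.sum_apply,
        Matrix.smul_apply] at h2
      simpa [C, Matrix.mul_apply] using h2
    have := congrFun (congrFun (h K C hC) b) q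
    simpa [C, Matrix.mul_apply] using this
  have h2 : ∀ K, V.ten I J (Coalgebra.comul (R := ℂ) (V.e K)) * X = 0 := by
    intro K
    have : V.e K = ∑ a, V.E K a a := by
      refine V.eq_of_τ fun L => ?_
      rw [map_sum, τ_e]
      split_ifs with hL
      · subst hL
        simp only [τ_E_self, Matrix.sum_single_eq_diagonal]
        simp
      · simp [V.τ_E_of_ne hL]
    rw [this]
    simp [Matrix.sum_mul, h1]
  have h3 : V.ten I J (Coalgebra.comul (R := ℂ) (∑ K, V.e K)) * X = 0 := by
    simp [Matrix.sum_mul, h2]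
  rw [sum_e] at h3
  simpa using h3

end IrrepSystem
end Evaluation

/-! ### The Clebsch-Gordan maps and the twist -/

section ClebschGordan

variable {G ι : Type*} [Ring G] [HopfAlgebra ℂ G] [StarRing G] [StarModule ℂ G]
variable [FiniteDimensional ℂ G] [IsSemisimpleRing G] [Fintype ι] [DecidableEq ι]

namespace SymmetryData

variable (D : SymmetryData G ι)

theorem κ_ne_zero (I : ι) : D.κ I ≠ 0 := by
  intro h
  have h1 := D.κ_sq I
  have h2 : IsUnit (D.τ I D.v) := D.toRibbonStarHopf.isUnit_v.map (D.τ I)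
  rw [h1, h] at h2
  simp at h2

theorem eq_of_τ {x y : G} (h : ∀ I, D.τ I x = D.τ I y) : x = y := D.toIrrepSystem.eq_of_τ h

/-- The inverse of `κ`. -/
def kinv : G := D.toIrrepSystem.wedderburn.symm fun I => (D.κ I)⁻¹ • 1

theorem τ_kinv (I : ι) : D.τ I D.kinv = (D.κ I)⁻¹ • (1 : Matrix _ _ ℂ) :=
  D.toIrrepSystem.τ_wedderburn_symm _ I

theorem kappa_mul_kinv : D.kappa * D.kinv = 1 := D.eq_of_τ fun I => by
  rw [map_mul, D.τ_kappa, τ_kinv]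
  simp [smul_smul, D.κ_ne_zero I]

theorem kinv_mul_kappa : D.kinv * D.kappa = 1 := D.eq_of_τ fun I => by
  rw [map_mul, D.τ_kappa, τ_kinv]
  simp [smul_smul, D.κ_ne_zero I]

theorem inverse_kappa : Ring.inverse D.kappa = D.kinv :=
  Ring.inverse_unit ⟨D.kappa, D.kinv, D.kappa_mul_kinv, D.kinv_mul_kappa⟩

theorem kappa_comm (x : G) : D.kappa * x = x * D.kappa := D.eq_of_τ fun I => by
  rw [map_mul, map_mul, D.τ_kappa]
  simp

theorem kinv_comm (x : G) : D.kinv * x = x * D.kinv := D.eq_of_τ fun I => by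
  rw [map_mul, map_mul, D.τ_kinv]
  simp

theorem kappa_sq : D.kappa * D.kappa = D.v := D.eq_of_τ fun I => by
  rw [map_mul, D.τ_kappa, D.κ_sq, pow_two, smul_mul_smul_comm, one_mul]

theorem tmul_comm_of_central {x y : G} (hx : ∀ z, x * z = z * x) (hy : ∀ z, y * z = z * y)
    (X : G ⊗[ℂ] G) : Commute (x ⊗ₜ[ℂ] y) X := by
  induction X with
  | zero => exact Commute.zero_right _
  | add p q hp hq => exact hp.add_right hq
  | tmul a b => simp [Commute, SemiconjBy, hx a, hy b]

/-- `Θ = R Δ(κ) (κ ⊗ κ)⁻¹`. -/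
def Θ : G ⊗[ℂ] G := (D.R : G ⊗[ℂ] G) * Coalgebra.comul (R := ℂ) D.kappa * (D.kinv ⊗ₜ D.kinv)

/-- The inverse of `Θ`. -/
def Θi : G ⊗[ℂ] G := (D.kappa ⊗ₜ D.kappa) * Coalgebra.comul (R := ℂ) D.kinv *
  D.toRibbonStarHopf.Ri

theorem comul_kappa_mul : Coalgebra.comul (R := ℂ) D.kappa * Coalgebra.comul (R := ℂ) D.kinv =
    1 := by
  rw [← Bialgebra.comul_mul, kappa_mul_kinv, Bialgebra.comul_one]

theorem comul_kinv_mul : Coalgebra.comul (R := ℂ) D.kinv * Coalgebra.comul (R := ℂ) D.kappa =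
    1 := by
  rw [← Bialgebra.comul_mul, kinv_mul_kappa, Bialgebra.comul_one]

theorem kk_mul : (D.kappa ⊗ₜ[ℂ] D.kappa) * (D.kinv ⊗ₜ D.kinv) = 1 := by
  rw [Algebra.TensorProduct.tmul_mul_tmul, kappa_mul_kinv, Algebra.TensorProduct.one_def]

theorem ii_mul : (D.kinv ⊗ₜ[ℂ] D.kinv) * (D.kappa ⊗ₜ D.kappa) = 1 := by
  rw [Algebra.TensorProduct.tmul_mul_tmul, kinv_mul_kappa, Algebra.TensorProduct.one_def]

theorem Θ_mul_Θi : D.Θ * D.Θi = 1 := by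
  have hR := D.toRibbonStarHopf.mul_Ri
  rw [Θ, Θi]
  calc _ = (D.R : G ⊗[ℂ] G) * Coalgebra.comul (R := ℂ) D.kappa * ((D.kinv ⊗ₜ D.kinv) *
        (D.kappa ⊗ₜ D.kappa)) * Coalgebra.comul (R := ℂ) D.kinv *
        D.toRibbonStarHopf.Ri := by simp only [mul_assoc]
    _ = 1 := by rw [ii_mul, mul_one, mul_assoc (D.R : G ⊗[ℂ] G), comul_kappa_mul, mul_one, hR]

theorem Θi_mul_Θ : D.Θi * D.Θ = 1 := by
  have hR := D.toRibbonStarHopf.Ri_mul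
  rw [Θ, Θi]
  calc _ = (D.kappa ⊗ₜ D.kappa) * Coalgebra.comul (R := ℂ) D.kinv *
        (D.toRibbonStarHopf.Ri * (D.R : G ⊗[ℂ] G)) * Coalgebra.comul (R := ℂ) D.kappa *
        (D.kinv ⊗ₜ D.kinv) := by simp only [mul_assoc]
    _ = 1 := by
        rw [hR, mul_one, mul_assoc (D.kappa ⊗ₜ[ℂ] D.kappa), comul_kinv_mul, mul_one, kk_mul]

/-- This is `Δ(v) = (R'R)⁻¹ (v ⊗ v)` with one of the two factors of `v = κ²` moved across. -/
theorem Θ_eq : swapT G D.R * D.Θ = (D.kappa ⊗ₜ D.kappa) * Coalgebra.comul (R := ℂ) D.kinv := by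
  have h := D.comul_v
  rw [← kappa_sq, Bialgebra.comul_mul] at h
  have h2 : swapT G (D.R : G ⊗[ℂ] G) * (D.R : G ⊗[ℂ] G) * Coalgebra.comul (R := ℂ) D.kappa =
      ((D.kappa * D.kappa) ⊗ₜ (D.kappa * D.kappa)) * Coalgebra.comul (R := ℂ) D.kinv := by
    rw [← h]
    simp only [mul_assoc]
    rw [comul_kappa_mul, mul_one]
  rw [Θ, ← mul_assoc, ← mul_assoc, h2, mul_assoc,
    ← (tmul_comm_of_central D.kinv_comm D.kinv_comm _).eq, ← mul_assoc,
    Algebra.TensorProduct.tmul_mul_tmul, mul_assoc, kappa_mul_kinv, mul_one]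

theorem CG_mem (I J K : ι) (a : Fin (D.fusion I J K)) (x : G) :
    (D.CG I J K a).1 * D.ten I J (Coalgebra.comul (R := ℂ) x) =
      D.τ K x * (D.CG I J K a).1 := (D.CG I J K a).2 x

theorem CG_inj (I J : ι) {k : Type*} {X : Matrix (Fin (D.n I) × Fin (D.n J)) k ℂ}
    (h : ∀ K a, (D.CG I J K a).1 * X = 0) : X = 0 := by
  refine D.toIrrepSystem.intertwiners_inj I J fun K C hC => ?_
  have h1 := (D.CG I J K).sum_repr ⟨C, hC⟩
  have h2 := congrArg Subtype.val h1
  simp only [AddSubmonoidClass.coe_finsetSum, SetLike.val_smul] at h2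
  rw [← h2, Matrix.sum_mul]
  exact Finset.sum_eq_zero fun a _ => by rw [Matrix.smul_mul, h, smul_zero]

theorem ten_kk (I J : ι) : D.ten I J (D.kappa ⊗ₜ D.kappa) =
    (D.κ I * D.κ J) • (1 : Matrix (Fin (D.n I) × Fin (D.n J)) _ ℂ) := by
  rw [IrrepSystem.ten_tmul, D.τ_kappa, D.τ_kappa, Matrix.smul_kronecker, Matrix.kronecker_smul,
    Matrix.one_kronecker_one, smul_smul]

theorem ten_ii (I J : ι) : D.ten I J (D.kinv ⊗ₜ D.kinv) =
    ((D.κ I)⁻¹ * (D.κ J)⁻¹) • (1 : Matrix (Fin (D.n I) × Fin (D.n J)) _ ℂ) := by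
  rw [IrrepSystem.ten_tmul, D.τ_kinv, D.τ_kinv, Matrix.smul_kronecker, Matrix.kronecker_smul,
    Matrix.one_kronecker_one, smul_smul]

/-- `Θ` is the Gram operator of the Clebsch-Gordan maps. -/
theorem ten_Θ (I J : ι) :
    D.ten I J D.Θ = ∑ K, ∑ a, ((D.CG I J K a).1)ᴴ * (D.CG I J K a).1 := by
  set S := ∑ K, ∑ a, ((D.CG I J K a).1)ᴴ * (D.CG I J K a).1 with hS
  -- After composition with any `C^b[IJ|L]`, the normalization leaves `(κ_I κ_J / κ_L) C^b`, and
  -- `Δ(κ)` contributes `κ_L`. The maps `C^b` are jointly injective.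
  have h1 : D.ten I J (swapT G D.R) * S * D.ten I J (Coalgebra.comul (R := ℂ) D.kappa) =
      (D.κ I * D.κ J) • 1 := by
    rw [← sub_eq_zero]
    refine D.CG_inj I J fun L b => ?_
    rw [Matrix.mul_sub, sub_eq_zero, hS, Matrix.mul_sum, Matrix.sum_mul, Matrix.mul_sum]
    rw [Finset.sum_eq_single L, Matrix.mul_sum, Matrix.sum_mul, Matrix.mul_sum,
      Finset.sum_eq_single b]
    · rw [Matrix.mul_assoc, Matrix.mul_assoc, D.CG_mem, D.τ_kappa, ← Matrix.mul_assoc,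
        ← Matrix.mul_assoc, D.normalized, if_pos rfl]
      simp [smul_smul, D.κ_ne_zero L, mul_div_cancel₀]
    · intro a _ hab
      rw [Matrix.mul_assoc, Matrix.mul_assoc, ← Matrix.mul_assoc, ← Matrix.mul_assoc,
        D.normalized, if_neg (Ne.symm hab), Matrix.zero_mul]
    · simp
    · intro K _ hK
      rw [Matrix.mul_sum, Matrix.sum_mul, Matrix.mul_sum]
      refine Finset.sum_eq_zero fun a _ => ?_
      rw [Matrix.mul_assoc, Matrix.mul_assoc, ← Matrix.mul_assoc, ← Matrix.mul_assoc,
        D.orthogonal _ _ _ _ _ _ (Ne.symm hK), Matrix.zero_mul]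
    · simp
  have h2 := congrArg (D.ten I J) D.Θ_eq
  rw [map_mul (D.ten I J) (D.kappa ⊗ₜ[ℂ] D.kappa), ten_kk, ← h1, Matrix.mul_assoc, ← map_mul, comul_kappa_mul, map_one,
    Matrix.mul_one, map_mul] at h2
  have h3 : D.ten I J (swapT G D.toRibbonStarHopf.Ri) * D.ten I J (swapT G D.R) = 1 := by
    rw [← map_mul, RibbonStarHopf.swapT_Ri_mul, map_one]
  rw [← Matrix.one_mul (D.ten I J D.Θ), ← Matrix.one_mul S, ← h3, Matrix.mul_assoc, h2,
    Matrix.mul_assoc]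

/-- The dual Clebsch-Gordan maps `V^K → V^I ⊗ V^J`. -/
def CGd (I J K : ι) (a : Fin (D.fusion I J K)) : Matrix (Fin (D.n I) × Fin (D.n J)) (Fin (D.n K)) ℂ :=
  D.ten I J D.Θi * ((D.CG I J K a).1)ᴴ

/-- Since `∑ C^* C` is `Θ` itself, the resolution of the identity is `Θ⁻¹ Θ = 1`. -/
theorem sum_CGd_mul_CG (I J : ι) : ∑ K, ∑ a, D.CGd I J K a * (D.CG I J K a).1 = 1 := by
  simp only [CGd, Matrix.mul_assoc, ← Matrix.mul_sum]
  rw [← ten_Θ, ← map_mul, Θi_mul_Θ, map_one]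

theorem Θi_eq : D.Θi = Coalgebra.comul (R := ℂ) D.kappa * (D.kinv ⊗ₜ D.kinv) * swapT G D.R := by
  have h : Coalgebra.comul (R := ℂ) D.kappa * (D.kinv ⊗ₜ D.kinv) * swapT G D.R * D.Θ = 1 := by
    rw [mul_assoc, Θ_eq, mul_assoc, ← mul_assoc (D.kinv ⊗ₜ[ℂ] D.kinv), ii_mul, one_mul,
      comul_kappa_mul]
  calc D.Θi = Coalgebra.comul (R := ℂ) D.kappa * (D.kinv ⊗ₜ D.kinv) * swapT G D.R * D.Θ *
        D.Θi := by rw [h, one_mul]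
    _ = _ := by rw [mul_assoc, Θ_mul_Θi, mul_one]

theorem CG_mul_CGd_aux (I J K L : ι) (a : Fin (D.fusion I J K)) (b : Fin (D.fusion I J L)) :
    (D.CG I J K a).1 * D.CGd I J L b = (D.κ K * ((D.κ I)⁻¹ * (D.κ J)⁻¹)) •
      ((D.CG I J K a).1 * D.ten I J (swapT G D.R) * ((D.CG I J L b).1)ᴴ) := by
  rw [CGd, Θi_eq, map_mul, map_mul, ten_ii, ← Matrix.mul_assoc, ← Matrix.mul_assoc,
    ← Matrix.mul_assoc, D.CG_mem, D.τ_kappa]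
  simp [smul_smul, mul_comm]

theorem CG_mul_CGd (I J K : ι) (a b : Fin (D.fusion I J K)) :
    (D.CG I J K a).1 * D.CGd I J K b = if a = b then 1 else 0 := by
  rw [CG_mul_CGd_aux, D.normalized]
  split_ifs with h
  · rw [smul_smul]
    have h1 := D.κ_ne_zero I
    have h2 := D.κ_ne_zero J
    have h3 := D.κ_ne_zero K
    rw [show D.κ K * ((D.κ I)⁻¹ * (D.κ J)⁻¹) * (D.κ I * D.κ J / D.κ K) = 1 by field_simp,
      one_smul]
  · rw [smul_zero]

theorem CG_mul_CGd_of_ne (I J : ι) {K L : ι} (h : K ≠ L) (a : Fin (D.fusion I J K))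
    (b : Fin (D.fusion I J L)) : (D.CG I J K a).1 * D.CGd I J L b = 0 := by
  rw [CG_mul_CGd_aux, D.orthogonal _ _ _ _ _ _ h, smul_zero]

/-- The dual maps are intertwiners as well: insert the resolution of the identity, move `x` across
each `C`, and use biorthogonality. -/
theorem comul_mul_CGd (I J K : ι) (a : Fin (D.fusion I J K)) (x : G) :
    D.ten I J (Coalgebra.comul (R := ℂ) x) * D.CGd I J K a = D.CGd I J K a * D.τ K x := by
  have h : ∀ X : Matrix (Fin (D.n I) × Fin (D.n J)) (Fin (D.n I) × Fin (D.n J)) ℂ, X =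
      ∑ L, ∑ b, D.CGd I J L b * ((D.CG I J L b).1 * X) := by
    intro X
    conv_lhs => rw [← Matrix.one_mul X, ← D.sum_CGd_mul_CG I J]
    simp only [Matrix.sum_mul, Matrix.mul_assoc]
  rw [h (D.ten I J (Coalgebra.comul (R := ℂ) x))]
  simp only [D.CG_mem, Matrix.sum_mul, Matrix.mul_assoc]
  rw [Finset.sum_eq_single K, Finset.sum_eq_single a, CG_mul_CGd, if_pos rfl, Matrix.mul_one]
  · intro b _ hb
    rw [CG_mul_CGd, if_neg hb]
    simp
  · simp
  · intro L _ hL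
    exact Finset.sum_eq_zero fun b _ => by
      rw [CG_mul_CGd_of_ne _ _ _ hL]
      simp
  · simp

end SymmetryData
end ClebschGordan

/-! ### Universal elements of graph algebras -/

section Universal

variable {G : Type*} [Ring G] [HopfAlgebra ℂ G] [StarRing G] [StarModule ℂ G]
variable {A : Type*} [Ring A] [Algebra ℂ A] {B : Type*} [Ring B] [Algebra ℂ B]

namespace RibbonStarHopf

variable (H : RibbonStarHopf G)

/-- The functoriality relation for a universal monodromy. -/
structure IsMonodromy (N : G ⊗[ℂ] A) : Prop where
  fusion : j12 G A H.Ri * j13 G A N * j12 G A H.R * j23 G A N = comulL G A N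
  counit : counitL G A N = 1

/-- The exchange relation for two universal monodromies. -/
def Exchange (N N' : G ⊗[ℂ] A) : Prop :=
  Commute (j12 G A H.Ri * j13 G A N * j12 G A H.R) (j23 G A N')

variable {H}

theorem IsMonodromy.map {N : G ⊗[ℂ] A} (h : H.IsMonodromy N) (f : A →ₐ[ℂ] B) :
    H.IsMonodromy (idT G f N) := by
  refine ⟨?_, ?_⟩
  · rw [← idT_comulL, ← h.fusion]
    simp only [map_mul, idT_j12, idT_j13, idT_j23]
  · rw [counitL_idT, h.counit, map_one]

end RibbonStarHopf
end Universal

/-! ### The relations of the graph algebra for universal elements. -/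

section Graph

variable {G ι : Type*} [Ring G] [HopfAlgebra ℂ G] [StarRing G] [StarModule ℂ G]
variable [FiniteDimensional ℂ G] [IsSemisimpleRing G] [Fintype ι] [DecidableEq ι]
variable {A : Type*} [Ring A] [Algebra ℂ A] {B : Type*} [Ring B] [Algebra ℂ B]

namespace SymmetryData

variable (D : SymmetryData G ι)

theorem scal_smul {k l : Type*} (c : ℂ) (X : Matrix k l ℂ) :
    scal A (c • X) = c • scal A X := by
  ext a b
  simp [scal, Algebra.smul_def]

theorem smul_onLeft {k l : Type*} [DecidableEq k] [DecidableEq l] (c : ℂ) (X : Matrix k k A) :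
    onLeft l (c • X) = c • onLeft l X := by
  ext a b
  simp [onLeft]

theorem smul_onRight {k l : Type*} [DecidableEq k] [DecidableEq l] (c : ℂ) (X : Matrix l l A) :
    onRight k (c • X) = c • onRight k X := by
  ext a b
  simp [onRight]

/-- The universal element with the evaluations `κ_I X^I`. -/
def univ (X : ∀ I, Matrix (Fin (D.n I)) (Fin (D.n I)) A) : G ⊗[ℂ] A :=
  D.ofEv fun I => D.κ I • X I

theorem ev_univ (X : ∀ I, Matrix (Fin (D.n I)) (Fin (D.n I)) A) (I : ι) :
    D.ev A I (D.univ X) = D.κ I • X I := D.ev_ofEv _ I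

theorem ev2_funL (X : ∀ I, Matrix (Fin (D.n I)) (Fin (D.n I)) A) (I J : ι) :
    D.ev2 A I J (j13 G A (D.univ X) * j12 G A D.R * j23 G A (D.univ X)) =
      (D.κ I * D.κ J) • D.funL X I J := by
  rw [map_mul, map_mul, IrrepSystem.ev2_j12, IrrepSystem.ev2_j13, IrrepSystem.ev2_j23, ev_univ,
    ev_univ, smul_onLeft, smul_onRight, funL, RR]
  simp only [Matrix.smul_mul, Matrix.mul_smul, smul_smul, mul_comm]

theorem ev2_exchL (X Y : ∀ I, Matrix (Fin (D.n I)) (Fin (D.n I)) A) (I J : ι) :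
    D.ev2 A I J (j12 G A D.toRibbonStarHopf.Ri * j13 G A (D.univ X) * j12 G A D.R *
      j23 G A (D.univ Y)) = (D.κ I * D.κ J) • D.exchL X Y I J := by
  rw [map_mul, map_mul, map_mul, IrrepSystem.ev2_j12, IrrepSystem.ev2_j12, IrrepSystem.ev2_j13,
    IrrepSystem.ev2_j23, ev_univ, ev_univ, smul_onLeft, smul_onRight, exchL, RR, RRinv,
    RibbonStarHopf.Ri]
  simp only [Matrix.smul_mul, Matrix.mul_smul, smul_smul, mul_comm]

theorem ev2_exchR (X Y : ∀ I, Matrix (Fin (D.n I)) (Fin (D.n I)) A) (I J : ι) :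
    D.ev2 A I J (j23 G A (D.univ Y) * (j12 G A D.toRibbonStarHopf.Ri * j13 G A (D.univ X) *
      j12 G A D.R)) = (D.κ I * D.κ J) • D.exchR X Y I J := by
  rw [map_mul, map_mul, map_mul, IrrepSystem.ev2_j12, IrrepSystem.ev2_j12, IrrepSystem.ev2_j13,
    IrrepSystem.ev2_j23, ev_univ, ev_univ, smul_onLeft, smul_onRight, exchR, RR, RRinv,
    RibbonStarHopf.Ri]
  simp only [Matrix.smul_mul, Matrix.mul_smul, smul_smul, Matrix.mul_assoc]

theorem j12_tmul_comm {x : G} (hx : ∀ z, x * z = z * x) (X : G ⊗[ℂ] A) :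
    Commute (x ⊗ₜ[ℂ] (1 : A)) X := by
  induction X with
  | zero => exact Commute.zero_right _
  | add p q hp hq => exact hp.add_right hq
  | tmul a b => simp [Commute, SemiconjBy, hx a]

/-- The label-dependent number `κ_K⁻¹` is the value of the central element `κ⁻¹`, so it can be
pulled through the intertwiner as `Δ(κ⁻¹)`. -/
theorem scal_conj_ev (I J K : ι) (a : Fin (D.fusion I J K)) (N : G ⊗[ℂ] A) :
    (D.κ K)⁻¹ • (D.ev A K N * scal A (D.CG I J K a).1) = scal A (D.CG I J K a).1 *
      D.ev2 A I J (j12 G A (Coalgebra.comul (R := ℂ) D.kinv) * comulL G A N) := by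
  have h : D.ev2 A I J (j12 G A (Coalgebra.comul (R := ℂ) D.kinv) * comulL G A N) =
      D.ev2 A I J (comulL G A ((D.kinv ⊗ₜ 1) * N)) := by
    rw [map_mul (comulL G A), comulL_tmul_eq, ← Algebra.TensorProduct.one_def,
      ← Algebra.TensorProduct.one_def, mul_one]
  rw [h, D.scal_mul_ev2 (D.CG I J K a).2, map_mul, IrrepSystem.ev_tmul_one, D.τ_kinv, scal_smul,
    scal_one, Matrix.smul_mul, Matrix.one_mul, Matrix.smul_mul]

/-- By `ten_Θ` the sum over `C^* C` is `Θ`, and `Θ Δ(κ⁻¹) = (κ⁻¹ ⊗ κ⁻¹) R`. The factors `κ_I` in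
`univ` are chosen to absorb exactly this, leaving `R₁₂ (Δ ⊗ id)(N)`. -/
theorem ev2_fuse (X : ∀ I, Matrix (Fin (D.n I)) (Fin (D.n I)) A) (I J : ι) :
    D.ev2 A I J (j12 G A D.R * comulL G A (D.univ X)) = (D.κ I * D.κ J) • D.fuse X I J := by
  have h1 : ∀ K, X K = (D.κ K)⁻¹ • D.ev A K (D.univ X) := by
    intro K
    rw [ev_univ, smul_smul, inv_mul_cancel₀ (D.κ_ne_zero K), one_smul]
  have h2 : D.fuse X I J = D.ev2 A I J (j12 G A (D.Θ * Coalgebra.comul (R := ℂ) D.kinv) *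
      comulL G A (D.univ X)) := by
    rw [map_mul (j12 G A), mul_assoc, map_mul, IrrepSystem.ev2_j12, ten_Θ, fuse]
    have h3 : scal A (∑ K, ∑ a, ((D.CG I J K a).1)ᴴ * (D.CG I J K a).1) =
        ∑ K, ∑ a, scal A ((D.CG I J K a).1)ᴴ * scal A (D.CG I J K a).1 := by
      ext p q
      simp only [scal, Matrix.map_apply, Matrix.sum_apply, map_sum, Matrix.mul_apply, map_mul]
    rw [h3, Matrix.sum_mul]
    refine Finset.sum_congr rfl fun K _ => ?_
    rw [Matrix.sum_mul]
    refine Finset.sum_congr rfl fun a _ => ?_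
    rw [Matrix.mul_assoc, Matrix.mul_assoc, ← scal_conj_ev]
    conv_lhs => rw [h1 K]
    simp only [Matrix.smul_mul, Matrix.mul_smul]
  have h4 : D.Θ * Coalgebra.comul (R := ℂ) D.kinv = (D.kinv ⊗ₜ D.kinv) * (D.R : G ⊗[ℂ] G) := by
    have h5 := fun Y => (tmul_comm_of_central (x := D.kinv) (y := D.kinv) D.kinv_comm
      D.kinv_comm Y).eq
    rw [Θ, mul_assoc, h5, mul_assoc, ← mul_assoc (Coalgebra.comul (R := ℂ) D.kappa),
      comul_kappa_mul, one_mul, h5]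
  rw [h2, h4, map_mul (j12 G A), mul_assoc, map_mul _ (j12 G A (D.kinv ⊗ₜ D.kinv)),
    IrrepSystem.ev2_j12, ten_ii, scal_smul,
    scal_one, Matrix.smul_mul, Matrix.one_mul, smul_smul]
  have h5 := D.κ_ne_zero I
  have h6 := D.κ_ne_zero J
  rw [show D.κ I * D.κ J * ((D.κ I)⁻¹ * (D.κ J)⁻¹) = 1 by field_simp, one_smul]

theorem smul_κ_inj {k : Type*} (I J : ι) (X Y : Matrix k k A) :
    (D.κ I * D.κ J) • X = (D.κ I * D.κ J) • Y ↔ X = Y := by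
  refine ⟨fun h => ?_, fun h => by rw [h]⟩
  have h0 : D.κ I * D.κ J ≠ 0 := mul_ne_zero (D.κ_ne_zero I) (D.κ_ne_zero J)
  calc X = (D.κ I * D.κ J)⁻¹ • ((D.κ I * D.κ J) • X) := by
        rw [smul_smul, inv_mul_cancel₀ h0, one_smul]
    _ = Y := by rw [h, smul_smul, inv_mul_cancel₀ h0, one_smul]

/-- Evaluation in all pairs of irreducible representations is faithful, so the family of matrix
relations is one equation in `G ⊗ G ⊗ A`. -/
theorem functoriality_iff (X : ∀ I, Matrix (Fin (D.n I)) (Fin (D.n I)) A) :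
    (∀ I J, D.funL X I J = D.fuse X I J) ↔
      j12 G A D.toRibbonStarHopf.Ri * j13 G A (D.univ X) * j12 G A D.R * j23 G A (D.univ X) =
        comulL G A (D.univ X) := by
  have h : j12 G A D.toRibbonStarHopf.Ri * j13 G A (D.univ X) * j12 G A D.R * j23 G A (D.univ X) =
        comulL G A (D.univ X) ↔ j13 G A (D.univ X) * j12 G A D.R * j23 G A (D.univ X) =
        j12 G A D.R * comulL G A (D.univ X) := by
    constructor
    · intro h
      rw [← h]
      simp only [← mul_assoc]
      rw [RibbonStarHopf.j12_R_mul_Ri, one_mul]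
    · intro h
      rw [mul_assoc, mul_assoc, ← mul_assoc (j13 G A _), h, ← mul_assoc,
        RibbonStarHopf.j12_Ri_mul, one_mul]
  rw [h]
  constructor
  · intro h
    refine D.ev2_ext fun I J => ?_
    rw [ev2_funL, ev2_fuse, h]
  · intro h I J
    rw [← D.smul_κ_inj I J, ← ev2_funL, ← ev2_fuse, h]

theorem exchange_iff (X Y : ∀ I, Matrix (Fin (D.n I)) (Fin (D.n I)) A) :
    (∀ I J, D.exchL X Y I J = D.exchR X Y I J) ↔
      D.toRibbonStarHopf.Exchange (D.univ X) (D.univ Y) := by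
  constructor
  · intro h
    refine D.ev2_ext fun I J => ?_
    rw [ev2_exchL, ev2_exchR, h]
  · intro h I J
    rw [← D.smul_κ_inj I J, ← ev2_exchL, ← ev2_exchR, h.eq]

theorem ev_triv (N : G ⊗[ℂ] A) (a b : Fin (D.n D.triv)) :
    D.ev A D.triv N a b = if a = b then counitL G A N else 0 := by
  induction N with
  | zero => simp
  | add p q hp hq =>
    rw [map_add, map_add, Matrix.add_apply, hp, hq]
    split_ifs <;> simp
  | tmul x y =>
    rw [IrrepSystem.ev_tmul, D.τ_triv]
    by_cases h : a = b <;> simp [h]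

theorem counit_kappa : Coalgebra.counit (R := ℂ) D.kappa = D.κ D.triv := by
  have h := D.τ_kappa D.triv
  rw [D.τ_triv] at h
  have := congrFun (congrFun h 0) 0
  simpa using this

/-- From `ε(v) = 1` only `κ_0 = ±1` follows. The sign is fixed by positivity: in the trivial
representations `Θ` is the scalar `κ_0⁻¹`, and it is a Gram operator. -/
theorem κ_triv : D.κ D.triv = 1 := by
  have h1 : D.κ D.triv ^ 2 = 1 := by
    have h := D.κ_sq D.triv
    rw [D.τ_triv, D.counit_v] at h
    have := congrFun (congrFun h 0) 0
    simpa using this.symm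
  have h2 : ∀ X : G ⊗[ℂ] G, D.ten D.triv D.triv X =
      Coalgebra.counit (R := ℂ) (counitL G G X) • 1 := by
    intro X
    induction X with
    | zero => simp
    | add p q hp hq => simp only [map_add, hp, hq, add_smul]
    | tmul x y =>
      rw [IrrepSystem.ten_tmul, D.τ_triv, D.τ_triv, Matrix.smul_kronecker, Matrix.kronecker_smul,
        Matrix.one_kronecker_one, smul_smul, counitL_tmul, map_smul, smul_eq_mul]
  have h3 := h2 D.Θ
  have h4 : Coalgebra.counit (R := ℂ) (counitL G G D.Θ) = D.κ D.triv * (D.κ D.triv)⁻¹ ^ 2 := by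
    have h5 : Coalgebra.counit (R := ℂ) D.kinv = (D.κ D.triv)⁻¹ := by
      have h := congrArg (Coalgebra.counit (R := ℂ)) D.kappa_mul_kinv
      rw [Bialgebra.counit_mul, Bialgebra.counit_one, counit_kappa] at h
      exact eq_inv_of_mul_eq_one_right h
    rw [Θ, map_mul (counitL G G), map_mul (counitL G G), RibbonStarHopf.counitL_R,
      counitL_comul, one_mul,
      Bialgebra.counit_mul, counit_kappa, counitL_tmul, map_smul, h5, smul_eq_mul, pow_two]
  rw [ten_Θ, h4] at h3
  -- The trace of a sum of operators `C^* C` is a sum of squared absolute values.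
  have h6 : 0 ≤ (Matrix.trace (∑ K, ∑ a, ((D.CG D.triv D.triv K a).1)ᴴ *
      (D.CG D.triv D.triv K a).1)).re := by
    simp only [Matrix.trace_sum, Complex.re_sum]
    refine Finset.sum_nonneg fun K _ => Finset.sum_nonneg fun a _ => ?_
    simp only [Matrix.trace, Matrix.diag_apply, Matrix.mul_apply, Matrix.conjTranspose_apply,
      Complex.re_sum]
    refine Finset.sum_nonneg fun p _ => Finset.sum_nonneg fun q _ => ?_
    simp only [Complex.star_def, Complex.mul_re, Complex.conj_re, Complex.conj_im]
    nlinarith [mul_self_nonneg ((D.CG D.triv D.triv K a).1 q p).re,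
      mul_self_nonneg ((D.CG D.triv D.triv K a).1 q p).im]
  rw [h3] at h6
  rcases sq_eq_sq_iff_eq_or_eq_neg.1 (h1.trans (one_pow 2).symm) with h | h
  · exact h
  · exfalso
    rw [h] at h6
    simp only [Matrix.trace_smul, Matrix.trace_one] at h6
    have hn : (0 : ℝ) < D.n D.triv := by exact_mod_cast D.toIrrepSystem.n_pos D.triv
    simp at h6
    nlinarith

theorem unit_iff (X : ∀ I, Matrix (Fin (D.n I)) (Fin (D.n I)) A) :
    X D.triv = 1 ↔ counitL G A (D.univ X) = 1 := by
  have h := D.ev_univ X D.triv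
  rw [κ_triv, one_smul] at h
  rw [← h]
  constructor
  · intro h1
    have h2 := congrFun (congrFun h1 0) 0
    rwa [ev_triv, if_pos rfl, Matrix.one_apply_eq] at h2
  · intro h1
    ext a b
    rw [ev_triv, h1, Matrix.one_apply]

/-- The universal element of the `ν`-th puncture. -/
def N {m : ℕ} (ν : Fin m) : G ⊗[ℂ] D.L m := D.univ (D.M ν)

theorem ev_N {m : ℕ} (ν : Fin m) (I : ι) : D.ev (D.L m) I (D.N ν) = D.κ I • D.M ν I :=
  D.ev_univ _ I

theorem isMonodromy_N {m : ℕ} (ν : Fin m) : D.toRibbonStarHopf.IsMonodromy (D.N ν) :=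
  ⟨(D.functoriality_iff _).1 fun I J => D.M_fun m ν I J, (D.unit_iff _).1 (D.M_triv m ν)⟩

theorem exchange_N {m : ℕ} {ν μ : Fin m} (h : ν < μ) :
    D.toRibbonStarHopf.Exchange (D.N ν) (D.N μ) :=
  (D.exchange_iff _ _).1 fun I J => D.M_exch m ν μ h I J

theorem univ_ev (Y : G ⊗[ℂ] A) : D.univ (fun I => (D.κ I)⁻¹ • D.ev A I Y) = Y := by
  refine D.ev_ext fun I => ?_
  rw [ev_univ, smul_smul, mul_inv_cancel₀ (D.κ_ne_zero I), one_smul]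

variable {m : ℕ} (Y : Fin m → G ⊗[ℂ] A)

/-- The homomorphism from the graph algebra given by universal monodromies in exchange
relations. -/
def liftL (h1 : ∀ ν, D.toRibbonStarHopf.IsMonodromy (Y ν))
    (h2 : ∀ ν μ, ν < μ → D.toRibbonStarHopf.Exchange (Y ν) (Y μ)) : D.L m →ₐ[ℂ] A :=
  RingQuot.liftAlgHom ℂ ⟨FreeAlgebra.lift ℂ fun x : D.Gen m =>
    ((D.κ x.I)⁻¹ • D.ev A x.I (Y x.ν)) x.a x.b, by
    have hφ : ∀ ν : Fin m, (fun I => (D.freeM ν I).map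
        (FreeAlgebra.lift ℂ fun x : D.Gen m => ((D.κ x.I)⁻¹ • D.ev A x.I (Y x.ν)) x.a x.b)) =
        fun I => (D.κ I)⁻¹ • D.ev A I (Y ν) := by
      intro ν
      ext I a b
      simp [freeM]
    intro x y hxy
    cases hxy with
    | functoriality ν I J p q =>
      have h := (D.functoriality_iff fun I => (D.κ I)⁻¹ • D.ev A I (Y ν)).2
        (by rw [univ_ev]; exact (h1 ν).fusion) I J
      rw [← hφ, ← map_funL, ← map_fuse] at h
      exact congrFun (congrFun h p) q
    | exchange ν μ hνμ I J p q =>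
      have h := (D.exchange_iff (fun I => (D.κ I)⁻¹ • D.ev A I (Y ν))
        (fun I => (D.κ I)⁻¹ • D.ev A I (Y μ))).2
        (by rw [univ_ev, univ_ev]; exact h2 ν μ hνμ) I J
      rw [← hφ, ← hφ, ← map_exchL, ← map_exchR] at h
      exact congrFun (congrFun h p) q
    | unit ν a b =>
      have h := (D.unit_iff fun I => (D.κ I)⁻¹ • D.ev A I (Y ν)).2
        (by rw [univ_ev]; exact (h1 ν).counit)
      have h2 := congrFun (congrFun ((congrFun (hφ ν) D.triv).trans h) a) b
      rw [Matrix.map_apply] at h2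
      rw [h2]
      by_cases hab : a = b
      · subst hab
        simp
      · simp [Matrix.one_apply_ne hab]⟩

theorem liftL_M (h1 : ∀ ν, D.toRibbonStarHopf.IsMonodromy (Y ν))
    (h2 : ∀ ν μ, ν < μ → D.toRibbonStarHopf.Exchange (Y ν) (Y μ)) (ν : Fin m) (I : ι)
    (a b : Fin (D.n I)) :
    D.liftL Y h1 h2 (D.M ν I a b) = (D.κ I)⁻¹ • D.ev A I (Y ν) a b := by
  have h : D.M ν I a b = RingQuot.mkAlgHom ℂ (D.GraphRel m) (D.freeM ν I a b) := rfl
  rw [h]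
  refine (RingQuot.liftAlgHom_mkAlgHom_apply ℂ _ _ _).trans ?_
  simp [freeM]

theorem idT_liftL (h1 : ∀ ν, D.toRibbonStarHopf.IsMonodromy (Y ν))
    (h2 : ∀ ν μ, ν < μ → D.toRibbonStarHopf.Exchange (Y ν) (Y μ)) (ν : Fin m) :
    idT G (D.liftL Y h1 h2) (D.N ν) = Y ν := by
  refine D.ev_ext fun I => ?_
  rw [IrrepSystem.ev_idT, ev_N]
  ext a b
  rw [Matrix.map_apply, Matrix.smul_apply, map_smul, liftL_M, smul_smul,
    mul_inv_cancel₀ (D.κ_ne_zero I), one_smul]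

theorem M_eq_ev {m : ℕ} (ν : Fin m) (I : ι) (a b : Fin (D.n I)) :
    D.M ν I a b = (D.κ I)⁻¹ • slice (D.L m) (D.coef I a b) (D.N ν) := by
  rw [← IrrepSystem.ev_apply, ev_N, Matrix.smul_apply, smul_smul,
    inv_mul_cancel₀ (D.κ_ne_zero I), one_smul]

theorem adjoin_M (m : ℕ) : Algebra.adjoin ℂ
    {X : D.L m | ∃ (ν : Fin m) (I : ι) (a b : Fin (D.n I)), X = D.M ν I a b} = ⊤ := by
  rw [eq_top_iff]
  rintro X -
  obtain ⟨x, rfl⟩ := RingQuot.mkAlgHom_surjective ℂ (D.GraphRel m) X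
  induction x using FreeAlgebra.induction with
  | grade0 r => rw [AlgHom.commutes]; exact Subalgebra.algebraMap_mem _ r
  | grade1 x => exact Algebra.subset_adjoin ⟨x.ν, x.I, x.a, x.b, rfl⟩
  | mul a b ha hb => rw [map_mul]; exact Subalgebra.mul_mem _ ha hb
  | add a b ha hb => rw [map_add]; exact Subalgebra.add_mem _ ha hb

/-- The graph algebra is generated by the slices of the universal monodromies. -/
theorem adjoin_slice_N (S : Subalgebra ℂ (D.L m))
    (h : ∀ (ν : Fin m) (f : G →ₗ[ℂ] ℂ), slice (D.L m) f (D.N ν) ∈ S) : S = ⊤ := by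
  rw [eq_top_iff, ← D.adjoin_M m]
  refine Algebra.adjoin_le ?_
  rintro X ⟨ν, I, a, b, rfl⟩
  rw [M_eq_ev]
  exact S.smul_mem (h _ _) _

theorem hom_ext {f f' : D.L m →ₐ[ℂ] A} (h : ∀ ν, idT G f (D.N ν) = idT G f' (D.N ν)) :
    f = f' := by
  have h1 : AlgHom.equalizer f f' = ⊤ := by
    refine D.adjoin_slice_N _ fun ν g => ?_
    change f _ = f' _
    rw [← slice_idT, ← slice_idT, h]
  ext X
  have : X ∈ AlgHom.equalizer f f' := by rw [h1]; trivial
  exact this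

end SymmetryData
end Graph

/-! ### Characters -/

section Functionals

variable {G : Type*} [Ring G] [HopfAlgebra ℂ G]
variable {A : Type*} [Ring A] [Algebra ℂ A]

/-- The convolution product of functionals. -/
def cmul (f f' : G →ₗ[ℂ] ℂ) : G →ₗ[ℂ] ℂ := f' ∘ₗ slice G f ∘ₗ Coalgebra.comul

theorem cmul_apply (f f' : G →ₗ[ℂ] ℂ) (x : G) :
    cmul f f' x = f' (slice G f (Coalgebra.comul (R := ℂ) x)) := rfl

theorem slice_comulL (f f' : G →ₗ[ℂ] ℂ) (X : G ⊗[ℂ] A) :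
    slice A f' (slice (G ⊗[ℂ] A) f (comulL G A X)) = slice A (cmul f f') X := by
  induction X with
  | zero => simp
  | add p q hp hq => simp only [map_add, hp, hq]
  | tmul x a =>
    rw [comulL_tmul_eq, slice_mul_one_tmul, slice_j12, slice_tmul, cmul_apply,
      Algebra.TensorProduct.tmul_mul_tmul, mul_one, one_mul, slice_tmul]

theorem cmul_assoc (f f' f'' : G →ₗ[ℂ] ℂ) : cmul (cmul f f') f'' = cmul f (cmul f' f'') := by
  ext x
  rw [cmul_apply, ← slice_comulL, cmul_apply, cmul_apply]
  have h : comulL G G (Coalgebra.comul (R := ℂ) x) =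
      idT G (Bialgebra.comulAlgHom ℂ G) (Coalgebra.comul (R := ℂ) x) :=
    Coalgebra.coassoc_apply (R := ℂ) x
  rw [h, slice_idT]
  rfl

theorem slice_sum {κ : Type*} (s : Finset κ) (c : κ → ℂ) (f : κ → G →ₗ[ℂ] ℂ) (X : G ⊗[ℂ] A) :
    slice A (∑ i ∈ s, c i • f i) X = ∑ i ∈ s, c i • slice A (f i) X := by
  induction X with
  | zero => simp
  | add p q hp hq => simp only [map_add, hp, hq, smul_add, Finset.sum_add_distrib]
  | tmul x a => simp [Finset.sum_smul, smul_smul]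

theorem sum_cmul {κ : Type*} (s : Finset κ) (f : G →ₗ[ℂ] ℂ) (c : κ → ℂ) (f' : κ → G →ₗ[ℂ] ℂ) :
    cmul (∑ i ∈ s, c i • f' i) f = ∑ i ∈ s, c i • cmul (f' i) f := by
  ext x
  simp [cmul_apply, slice_sum]

end Functionals

/-! ### Characters, quantum traces and fusion rules. -/

section Modular

variable {G ι : Type*} [Ring G] [HopfAlgebra ℂ G] [StarRing G] [StarModule ℂ G]
variable [FiniteDimensional ℂ G] [IsSemisimpleRing G] [Fintype ι] [DecidableEq ι]
variable {A : Type*} [Ring A] [Algebra ℂ A]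

local notation "SS" => HopfAlgebra.antipode ℂ (A := G)

namespace SymmetryData

variable (D : SymmetryData G ι)

/-- The character of `τ^I`. -/
def char (I : ι) : G →ₗ[ℂ] ℂ :=
  Matrix.traceLinearMap (Fin (D.n I)) ℂ ℂ ∘ₗ (D.τ I).toAlgHom.toLinearMap

theorem char_apply (I : ι) (x : G) : D.char I x = (D.τ I x).trace := rfl

/-- The `q`-trace as a functional on `G`. -/
def tq (I : ι) : G →ₗ[ℂ] ℂ := D.char I ∘ₗ LinearMap.mulRight ℂ D.g

theorem tq_apply (I : ι) (x : G) : D.tq I x = D.char I (x * D.g) := rfl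

theorem qtr_eq (I : ι) (N : G ⊗[ℂ] A) : D.qtr I (D.ev A I N) = slice A (D.tq I) N := by
  induction N with
  | zero => simp [qtr]
  | add p q hp hq =>
    rw [map_add, map_add, ← hp, ← hq, qtr, qtr, qtr, Matrix.add_mul, Matrix.trace_add]
  | tmul x a =>
    rw [slice_tmul, tq_apply, char_apply, map_mul, qtr]
    simp only [Matrix.trace, Matrix.diag_apply, Matrix.mul_apply, IrrepSystem.ev_tmul, scal,
      Matrix.map_apply, Finset.sum_smul]
    refine Finset.sum_congr rfl fun i _ => Finset.sum_congr rfl fun j _ => ?_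
    rw [← Algebra.commutes, ← Algebra.smul_def, smul_smul, mul_comm]

theorem tq_one (I : ι) : D.tq I 1 = D.qdim I := by
  have h := D.qtr_eq I (1 ⊗ₜ (1 : ℂ) : G ⊗[ℂ] ℂ)
  rw [← Algebra.TensorProduct.one_def, map_one] at h
  rw [qdim, h, Algebra.TensorProduct.one_def, slice_tmul, smul_eq_mul, mul_one]

/-- By `y g = g S²(y)` and cyclicity, `tr(x y g) = tr(x g S²(y)) = tr(S²(y) x g)`. -/
theorem isTwistedTrace_tq (I : ι) : IsTwistedTrace (D.tq I) := by
  intro x y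
  rw [tq_apply, tq_apply, mul_assoc, D.toRibbonStarHopf.mul_g, ← mul_assoc, char_apply, char_apply,
    map_mul, Matrix.trace_mul_comm, ← map_mul, mul_assoc]

theorem trace_ten (I J : ι) (X : G ⊗[ℂ] G) :
    (D.ten I J X).trace = D.char J (slice G (D.char I) X) := by
  induction X with
  | zero => simp
  | add p q hp hq => rw [map_add, Matrix.trace_add, hp, hq, map_add, map_add]
  | tmul x y =>
    rw [IrrepSystem.ten_tmul, Matrix.trace_kronecker, slice_tmul, map_smul, smul_eq_mul]
    rfl

theorem slice_mulRight (f : G →ₗ[ℂ] ℂ) (X : G ⊗[ℂ] G) (x y : G) :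
    slice G (f ∘ₗ LinearMap.mulRight ℂ x) X * y = slice G f (X * x ⊗ₜ y) := by
  induction X with
  | zero => simp
  | add p q hp hq => rw [map_add, add_mul, hp, hq, add_mul, map_add]
  | tmul a b => simp

theorem tq_tq (I J : ι) (X : G ⊗[ℂ] G) :
    D.tq J (slice G (D.tq I) X) = (D.ten I J (X * D.g ⊗ₜ D.g)).trace := by
  rw [tq_apply, tq, slice_mulRight, trace_ten]

/-- The fusion rules for characters. -/
theorem cmul_char (I J : ι) :
    cmul (D.char I) (D.char J) = ∑ K, (D.fusion I J K : ℂ) • D.char K := by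
  ext x
  rw [cmul_apply, ← trace_ten, ← Matrix.one_mul (D.ten I J _), ← sum_CGd_mul_CG, Matrix.sum_mul,
    Matrix.trace_sum, LinearMap.sum_apply]
  refine Finset.sum_congr rfl fun K _ => ?_
  rw [Matrix.sum_mul, Matrix.trace_sum, Finset.sum_congr rfl fun a _ => show
    (D.CGd I J K a * (D.CG I J K a).1 * D.ten I J (Coalgebra.comul (R := ℂ) x)).trace =
      D.char K x by
    rw [Matrix.mul_assoc, Matrix.trace_mul_comm, CG_mem, Matrix.mul_assoc, CG_mul_CGd, if_pos rfl,
      Matrix.mul_one, char_apply]]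
  simp

/-- Evaluate the fusion rule for characters at `x g`; as `g` is grouplike, each leg receives its own
`g`. -/
theorem cmul_tq (I J : ι) :
    cmul (D.tq I) (D.tq J) = ∑ K, (D.fusion I J K : ℂ) • D.tq K := by
  ext x
  have h := congrArg (fun f => f (x * D.g)) (D.cmul_char I J)
  simp only [cmul_apply, ← trace_ten, LinearMap.sum_apply, LinearMap.smul_apply,
    Bialgebra.comul_mul, D.toRibbonStarHopf.comul_g] at h
  rw [cmul_apply, tq_tq]
  simpa only [LinearMap.sum_apply, LinearMap.smul_apply, tq_apply] using h

/-- The trivial representation acts by scalars and yet reaches every matrix unit, which excludes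
off-diagonal ones. -/
theorem n_triv : D.n D.triv = 1 := by
  by_contra h
  have h0 := D.toIrrepSystem.n_pos D.triv
  let a : Fin (D.n D.triv) := ⟨0, h0⟩
  let b : Fin (D.n D.triv) := ⟨1, by omega⟩
  have h1 := D.toIrrepSystem.τ_E_self D.triv a b
  rw [D.τ_triv] at h1
  have h2 := congrFun (congrFun h1 a) b
  have hab : a ≠ b := by simp [a, b]
  simp [hab] at h2

theorem char_triv (x : G) : D.char D.triv x = Coalgebra.counit (R := ℂ) x := by
  rw [char_apply, D.τ_triv, Matrix.trace_smul, Matrix.trace_one, Fintype.card_fin, n_triv]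
  simp

theorem char_e (I J : ι) : D.char J (D.e I) = if I = J then (D.n I : ℂ) else 0 := by
  rw [char_apply, IrrepSystem.τ_e]
  split_ifs with h
  · subst h; simp
  · simp

theorem sum_char_e (c : ι → ℂ) (K : ι) : (∑ I, c I • D.char I) (D.e K) = c K * D.n K := by
  simp [LinearMap.sum_apply, char_e]

theorem char_linearIndependent {c c' : ι → ℂ} (h : ∑ I, c I • D.char I = ∑ I, c' I • D.char I)
    (K : ι) : c K = c' K := by
  have h1 := congrArg (fun f => f (D.e K)) h
  simp only [sum_char_e] at h1
  have h2 : (D.n K : ℂ) ≠ 0 := by exact_mod_cast (D.toIrrepSystem.n_pos K).ne'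
  exact mul_right_cancel₀ h2 h1

/-- Conjugation by `R` exchanges `Δ` and `Δ'`, and traces do not see it. -/
theorem cmul_char_comm (I J : ι) : cmul (D.char I) (D.char J) = cmul (D.char J) (D.char I) := by
  ext x
  have h : ∀ X : G ⊗[ℂ] G, (D.ten I J X).trace = (D.ten J I (swapT G X)).trace := by
    intro X
    induction X with
    | zero => simp
    | add p q hp hq => rw [map_add, Matrix.trace_add, hp, hq, map_add, map_add, Matrix.trace_add]
    | tmul x y =>
      rw [swapT_tmul, IrrepSystem.ten_tmul, IrrepSystem.ten_tmul, Matrix.trace_kronecker,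
        Matrix.trace_kronecker, mul_comm]
  rw [cmul_apply, ← trace_ten, h, cmul_apply, ← trace_ten]
  have h2 : swapT G (Coalgebra.comul (R := ℂ) x) =
      (D.R : G ⊗[ℂ] G) * Coalgebra.comul (R := ℂ) x * D.toRibbonStarHopf.Ri := by
    rw [D.intertwine, mul_assoc, D.toRibbonStarHopf.mul_Ri, mul_one]
  rw [h2, map_mul, map_mul, Matrix.trace_mul_comm, ← Matrix.mul_assoc, ← map_mul,
    D.toRibbonStarHopf.Ri_mul, map_one, Matrix.one_mul]

theorem fusion_comm (I J K : ι) : D.fusion I J K = D.fusion J I K := by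
  have h := D.cmul_char_comm I J
  rw [cmul_char, cmul_char] at h
  exact_mod_cast D.char_linearIndependent h K

/-! ### Conjugate representations -/

/-- The transpose of `τ^I ∘ S` is again onto the matrix algebra, because `S²` is conjugation by `u`;
hence it is irreducible. -/
theorem exists_isConj (I : ι) : ∃ J, D.IsConj J I := by
  let ρ : G →ₐ[ℂ] Matrix (Fin (D.n I)) (Fin (D.n I)) ℂ := AlgHom.ofLinearMap
    ((Matrix.transposeLinearEquiv (Fin (D.n I)) (Fin (D.n I)) ℂ ℂ).toLinearMap ∘ₗ
      (D.τ I).toAlgHom.toLinearMap ∘ₗ SS)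
    (by
      change (D.τ I (SS 1))ᵀ = 1
      rw [HopfAlgebra.antipode_one, map_one, Matrix.transpose_one])
    (fun x y => by
      change (D.τ I (SS (x * y)))ᵀ = (D.τ I (SS x))ᵀ * (D.τ I (SS y))ᵀ
      rw [HopfAlgebra.antipode_mul_antidistrib, map_mul, Matrix.transpose_mul])
  have hρ : Function.Surjective ρ := by
    intro X
    obtain ⟨x, hx⟩ := D.toIrrepSystem.exists_τ_eq (fun J => if h : I = J then h ▸ Xᵀ else 0)
    have hx' : D.τ I x = Xᵀ := by simpa using hx I
    refine ⟨SS (D.ui * x * D.u), ?_⟩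
    change (D.τ I (SS (SS (D.ui * x * D.u))))ᵀ = X
    have h1 := D.toRibbonStarHopf.antipode_sq_conj x
    rw [h1, hx', Matrix.transpose_transpose]
  obtain ⟨J, T, T', h1, h2, h3⟩ := D.exhaustive (D.n I) ρ
    (isIrrep_of_surjective (D.toIrrepSystem.n_pos I) ρ hρ)
  exact ⟨J, T, T', h1, h2, h3⟩

theorem isConj_bar (I : ι) : D.IsConj (D.bar I) I := by
  have : Nonempty ι := ⟨D.triv⟩
  exact Classical.epsilon_spec (D.exists_isConj I)

theorem char_bar (I : ι) (x : G) : D.char (D.bar I) x = D.char I (SS x) := by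
  obtain ⟨T, T', h1, h2, h3⟩ := D.isConj_bar I
  have h : D.τ (D.bar I) x = T * (D.τ I (SS x))ᵀ * T' := by
    rw [← h3, Matrix.mul_assoc, h1, Matrix.mul_one]
  rw [char_apply, h, Matrix.trace_mul_comm, ← Matrix.mul_assoc, h2, Matrix.one_mul,
    Matrix.trace_transpose, char_apply]

/-- The matrix in `V^I ⊗ V^J` of a functional on `V^I ⊗ V^J`. -/
def unfold (I J : ι) (T : Matrix (Fin (D.n D.triv)) (Fin (D.n I) × Fin (D.n J)) ℂ) :
    Matrix (Fin (D.n I)) (Fin (D.n J)) ℂ := Matrix.of fun i j => T 0 (i, j)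

/-- `x ⊗ y ↦ τ^I(x)ᵀ B τ^J(y)`. -/
def bilin (I J : ι) (B : Matrix (Fin (D.n I)) (Fin (D.n J)) ℂ) :
    G ⊗[ℂ] G →ₗ[ℂ] Matrix (Fin (D.n I)) (Fin (D.n J)) ℂ :=
  TensorProduct.lift (LinearMap.mk₂ ℂ (fun x y => (D.τ I x)ᵀ * B * D.τ J y)
    (fun x x' y => by simp [Matrix.add_mul]) (fun r x y => by simp)
    (fun x y y' => by simp [Matrix.mul_add]) (fun r x y => by simp))

theorem bilin_tmul (I J : ι) (B : Matrix (Fin (D.n I)) (Fin (D.n J)) ℂ) (x y : G) :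
    D.bilin I J B (x ⊗ₜ y) = (D.τ I x)ᵀ * B * D.τ J y := rfl

theorem unfold_mul_ten (I J : ι) (T : Matrix (Fin (D.n D.triv)) (Fin (D.n I) × Fin (D.n J)) ℂ)
    (X : G ⊗[ℂ] G) : D.unfold I J (T * D.ten I J X) = D.bilin I J (D.unfold I J T) X := by
  ext i j
  induction X with
  | zero => simp [unfold]
  | add p q hp hq =>
    simp only [map_add, Matrix.add_apply, unfold, Matrix.mul_add, Matrix.of_apply] at hp hq ⊢
    rw [hp, hq]
  | tmul x y =>
    simp only [IrrepSystem.ten_tmul, bilin_tmul, unfold,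
      Matrix.mul_apply, Fintype.sum_prod_type, Matrix.kroneckerMap_apply, Matrix.of_apply,
      Matrix.transpose_apply, Finset.sum_mul]
    rw [Finset.sum_comm]
    exact Finset.sum_congr rfl fun _ _ => Finset.sum_congr rfl fun _ _ => by ring

theorem unfold_inj (I J : ι) {T T' : Matrix (Fin (D.n D.triv)) (Fin (D.n I) × Fin (D.n J)) ℂ}
    (h : D.unfold I J T = D.unfold I J T') : T = T' := by
  have : Subsingleton (Fin (D.n D.triv)) := by rw [n_triv]; infer_instance
  ext c p
  rw [Subsingleton.elim c 0]
  exact congrFun (congrFun h p.1) p.2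

/-- Functionals on `V^I ⊗ V^J` correspond to morphisms from `V^J` to the dual of `V^I`. -/
theorem mem_intertwiners_triv (I J : ι)
    (T : Matrix (Fin (D.n D.triv)) (Fin (D.n I) × Fin (D.n J)) ℂ) :
    T ∈ D.intertwiners I J D.triv ↔
      ∀ x : G, D.unfold I J T * D.τ J (SS x) = (D.τ I x)ᵀ * D.unfold I J T := by
  have h0 : T ∈ D.intertwiners I J D.triv ↔ ∀ x : G, D.bilin I J (D.unfold I J T)
      (Coalgebra.comul (R := ℂ) x) = Coalgebra.counit (R := ℂ) x • D.unfold I J T := by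
    refine forall_congr' fun x => ?_
    rw [← unfold_mul_ten, D.τ_triv, Matrix.smul_mul, Matrix.one_mul]
    refine ⟨fun h => by rw [h]; rfl, fun h => D.unfold_inj I J h⟩
  rw [h0]
  set B := D.unfold I J T
  constructor
  · intro h x
    -- `L` sends `a ⊗ b ⊗ c` to `aᵀ B b S(c)`. In one bracketing of the threefold coproduct of `x`
    -- invariance of `B` removes the first two legs; in the other the antipode removes the last two.
    let L : G ⊗[ℂ] (G ⊗[ℂ] G) →ₗ[ℂ] Matrix (Fin (D.n I)) (Fin (D.n J)) ℂ :=
      TensorProduct.lift (LinearMap.mk₂ ℂ (fun X z => D.bilin I J B X * D.τ J (SS z))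
        (fun x x' y => by simp [Matrix.add_mul]) (fun r x y => by simp)
        (fun x y y' => by simp [Matrix.mul_add]) (fun r x y => by simp)) ∘ₗ
      (TensorProduct.assoc ℂ G G G).symm.toLinearMap
    have hL : ∀ a b c, L (a ⊗ₜ (b ⊗ₜ c)) = (D.τ I a)ᵀ * B * D.τ J b * D.τ J (SS c) :=
      fun a b c => rfl
    have h1 : ∀ X : G ⊗[ℂ] G, L (comulL G G X) = B * D.τ J (SS (counitL G G X)) := by
      intro X
      induction X with
      | zero => simp
      | add p q hp hq => simp only [map_add, hp, hq, Matrix.mul_add]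
      | tmul a b =>
        have : L (comulL G G (a ⊗ₜ b)) =
            D.bilin I J B (Coalgebra.comul (R := ℂ) a) * D.τ J (SS b) := by
          rw [comulL_tmul_eq]
          induction Coalgebra.comul (R := ℂ) a with
          | zero => simp
          | add p q hp hq => simp only [map_add, add_mul, hp, hq, Matrix.add_mul]
          | tmul c d =>
            rw [j12_tmul, Algebra.TensorProduct.tmul_mul_tmul, mul_one,
              Algebra.TensorProduct.tmul_mul_tmul, mul_one, one_mul, hL, bilin_tmul]
        rw [this, h, counitL_tmul, map_smul, map_smul, Matrix.smul_mul, Matrix.mul_smul]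
    have h2 : ∀ X : G ⊗[ℂ] G, L (idT G (Bialgebra.comulAlgHom ℂ G) X) =
        (D.τ I (LinearMap.mul' ℂ G (TensorProduct.map LinearMap.id
          (Algebra.linearMap ℂ G ∘ₗ Coalgebra.counit) X)))ᵀ * B := by
      intro X
      induction X with
      | zero => simp
      | add p q hp hq => simp only [map_add, hp, hq, Matrix.transpose_add, Matrix.add_mul]
      | tmul a b =>
        have : L (a ⊗ₜ Coalgebra.comul (R := ℂ) b) = (D.τ I a)ᵀ * B * D.τ J
            (LinearMap.mul' ℂ G (LinearMap.lTensor G SS (Coalgebra.comul (R := ℂ) b))) := by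
          induction Coalgebra.comul (R := ℂ) b with
          | zero => simp
          | add p q hp hq => simp only [map_add, TensorProduct.tmul_add, hp, hq, Matrix.mul_add]
          | tmul c d =>
            rw [hL, LinearMap.lTensor_tmul, LinearMap.mul'_apply, map_mul, Matrix.mul_assoc]
        rw [idT_tmul]
        refine this.trans ?_
        rw [HopfAlgebra.mul_antipode_lTensor_comul_apply, TensorProduct.map_tmul,
          LinearMap.mul'_apply, LinearMap.comp_apply, Algebra.linearMap_apply, LinearMap.id_apply,
          AlgHomClass.commutes, map_mul, AlgHomClass.commutes, Algebra.algebraMap_eq_smul_one,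
          Algebra.algebraMap_eq_smul_one]
        simp
    have h3 : comulL G G (Coalgebra.comul (R := ℂ) x) =
        idT G (Bialgebra.comulAlgHom ℂ G) (Coalgebra.comul (R := ℂ) x) :=
      Coalgebra.coassoc_apply (R := ℂ) x
    have h4 := h1 (Coalgebra.comul (R := ℂ) x)
    rw [h3, h2, counitL_comul] at h4
    rw [← h4]
    congr 3
    have h5 := congrArg (LinearMap.mul' ℂ G ∘ₗ LinearMap.lTensor G (Algebra.linearMap ℂ G))
      (Coalgebra.lTensor_counit_comul (R := ℂ) x)
    rw [LinearMap.comp_apply, ← LinearMap.comp_apply (LinearMap.lTensor G _),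
      ← LinearMap.lTensor_comp] at h5
    simpa [LinearMap.lTensor] using h5
  · intro h x
    have h1 : ∀ X : G ⊗[ℂ] G, D.bilin I J B X =
        B * D.τ J (LinearMap.mul' ℂ G (LinearMap.rTensor G SS X)) := by
      intro X
      induction X with
      | zero => simp
      | add p q hp hq => simp only [map_add, hp, hq, Matrix.mul_add]
      | tmul a b =>
        rw [bilin_tmul, ← h, LinearMap.rTensor_tmul, LinearMap.mul'_apply, map_mul,
          Matrix.mul_assoc]
    rw [h1, HopfAlgebra.mul_antipode_rTensor_comul_apply, AlgHomClass.commutes,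
      Algebra.algebraMap_eq_smul_one, Matrix.mul_smul, Matrix.mul_one]

theorem τ_surjective (I : ι) : Function.Surjective (D.τ I) := by
  intro X
  refine ⟨∑ a, ∑ b, X a b • D.E I a b, ?_⟩
  simp only [map_sum, map_smul, IrrepSystem.τ_E_self]
  ext a b
  simp [Matrix.sum_apply, Matrix.single_apply, ite_and]

/-- Functionals on `V^I ⊗ V^J` correspond to intertwiners from `V^J` to the dual of `V^I`, and
Schur's lemma counts these. -/
theorem fusion_triv (I J : ι) : D.fusion I J D.triv = if J = D.bar I then 1 else 0 := by
  obtain ⟨T, T', h1, h2, h3⟩ := D.isConj_bar I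
  have hu : D.τ J D.u * D.τ J D.ui = 1 := by
    rw [← map_mul, D.toRibbonStarHopf.mul_ui, map_one]
  have hu' : D.τ J D.ui * D.τ J D.u = 1 := by
    rw [← map_mul, D.toRibbonStarHopf.ui_mul, map_one]
  have hS : ∀ x, D.τ J (SS (SS x)) * D.τ J D.u = D.τ J D.u * D.τ J x := fun x => by
    rw [← map_mul, D.toRibbonStarHopf.antipode_sq_mul_u, map_mul]
  -- Invariance of `C`, used at `S(x)`, produces `S²(x)` on `V^J`. Multiplying by `u` turns it back
  -- into `x`.
  have key : ∀ C ∈ D.intertwiners I J D.triv, ∀ x,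
      D.τ (D.bar I) x * (T * (D.unfold I J C * D.τ J D.u)) =
        (T * (D.unfold I J C * D.τ J D.u)) * D.τ J x := by
    intro C hC x
    have h := (D.mem_intertwiners_triv I J C).1 hC (SS x)
    rw [← Matrix.mul_assoc, h3, Matrix.mul_assoc, ← Matrix.mul_assoc _ (D.unfold I J C), ← h,
      Matrix.mul_assoc, Matrix.mul_assoc, Matrix.mul_assoc, hS]
  have back : ∀ C, D.unfold I J C = T' * (T * (D.unfold I J C * D.τ J D.u)) * D.τ J D.ui := by
    intro C
    rw [← Matrix.mul_assoc, h2, Matrix.one_mul, Matrix.mul_assoc, hu, Matrix.mul_one]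
  split_ifs with hJ
  · subst hJ
    let C₀ : Matrix (Fin (D.n D.triv)) (Fin (D.n I) × Fin (D.n (D.bar I))) ℂ :=
      Matrix.of fun _ p => (T' * D.τ (D.bar I) D.ui) p.1 p.2
    have hC₀ : D.unfold I (D.bar I) C₀ = T' * D.τ (D.bar I) D.ui := rfl
    have hm : C₀ ∈ D.intertwiners I (D.bar I) D.triv := by
      rw [mem_intertwiners_triv, hC₀]
      intro x
      have e1 : D.τ (D.bar I) D.ui * D.τ (D.bar I) (SS x) =
          D.τ (D.bar I) (D.ui * SS x * D.u) * D.τ (D.bar I) D.ui := by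
        rw [← map_mul, ← map_mul, mul_assoc (D.ui * SS x), D.toRibbonStarHopf.mul_ui, mul_one]
      have e2 : ∀ y, T' * D.τ (D.bar I) y = (D.τ I (SS y))ᵀ * T' := by
        intro y
        calc T' * D.τ (D.bar I) y = T' * (D.τ (D.bar I) y * T) * T' := by
              rw [Matrix.mul_assoc, Matrix.mul_assoc, h1, Matrix.mul_one]
          _ = _ := by rw [h3, ← Matrix.mul_assoc, h2, Matrix.one_mul]
      have e3 : SS (D.ui * SS x * D.u) = x :=
        D.toRibbonStarHopf.antipode_conj x
      rw [Matrix.mul_assoc, e1, ← Matrix.mul_assoc, e2, e3, Matrix.mul_assoc]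
    refine finrank_eq_one (⟨C₀, hm⟩ : D.intertwiners I (D.bar I) D.triv) ?_ ?_
    · intro h0
      have h4 : D.unfold I (D.bar I) C₀ = 0 := by
        rw [show C₀ = 0 from congrArg Subtype.val h0]
        rfl
      have h5 : (1 : Matrix (Fin (D.n (D.bar I))) (Fin (D.n (D.bar I))) ℂ) = 0 := by
        calc 1 = T * (T' * D.τ (D.bar I) D.ui) * D.τ (D.bar I) D.u := by
              rw [Matrix.mul_assoc, Matrix.mul_assoc, hu', Matrix.mul_one, h1]
          _ = 0 := by rw [← hC₀, h4]; simp
      exact one_ne_zero h5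
    · rintro ⟨C, hC⟩
      have h4 := key C hC
      have h5 : T * (D.unfold I (D.bar I) C * D.τ (D.bar I) D.u) ∈
          Set.range (Matrix.scalar (Fin (D.n (D.bar I)))) := by
        rw [Matrix.mem_range_scalar_iff_commute_single']
        intro i j
        obtain ⟨x, hx⟩ := D.τ_surjective (D.bar I) (Matrix.single i j 1)
        rw [← hx]
        exact h4 x
      obtain ⟨c, hc⟩ := h5
      refine ⟨c, Subtype.ext (D.unfold_inj _ _ ?_)⟩
      rw [back C, ← hc, Matrix.scalar_apply, ← Matrix.smul_one_eq_diagonal, Matrix.mul_smul,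
        Matrix.mul_one, Matrix.smul_mul, ← hC₀]
      rfl
  · refine Module.finrank_eq_zero_of_rank_eq_zero ?_
    rw [rank_zero_iff_forall_zero]
    rintro ⟨C, hC⟩
    by_contra hne
    have h4 := key C hC
    by_cases h5 : T * (D.unfold I J C * D.τ J D.u) = 0
    · apply hne
      refine Subtype.ext (D.unfold_inj _ _ ?_)
      rw [back C, h5]
      simp only [Matrix.mul_zero, Matrix.zero_mul]
      rfl
    · exact hJ (D.inequiv _ _ (repEquiv_of_intertwiner (D.irrep _) (D.irrep _) h5 h4)).symm

end SymmetryData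
end Modular

/-! ### The modular `S`-matrix -/

section SMatrix

variable {G ι : Type*} [Ring G] [HopfAlgebra ℂ G] [StarRing G] [StarModule ℂ G]
variable [FiniteDimensional ℂ G] [IsSemisimpleRing G] [Fintype ι] [DecidableEq ι]

local notation "SS" => HopfAlgebra.antipode ℂ (A := G)

namespace SymmetryData

variable (D : SymmetryData G ι)

/-- The value of a character at `e_0` is the multiplicity of the trivial representation, here in
`V^J ⊗ V^I ⊗ V^L`. -/
theorem triple_e (J I L : ι) : cmul (cmul (D.char J) (D.char I)) (D.char L) (D.e D.triv) =
    ∑ P, if L = D.bar P then (D.fusion J I P : ℂ) else 0 := by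
  rw [cmul_char, sum_cmul, LinearMap.sum_apply]
  refine Finset.sum_congr rfl fun P _ => ?_
  rw [LinearMap.smul_apply, cmul_char, sum_char_e, n_triv, fusion_triv]
  split_ifs <;> simp

/-- The multiplicity of the trivial representation in `V^I ⊗ V^Ī` is one, and fusion is symmetric.
-/
theorem bar_bar (I : ι) : D.bar (D.bar I) = I := by
  have h1 := D.fusion_triv I (D.bar I)
  rw [if_pos rfl, fusion_comm, fusion_triv] at h1
  by_contra h
  rw [if_neg (fun h' => h h'.symm)] at h1
  exact zero_ne_one h1

theorem bar_inj {I J : ι} : D.bar I = D.bar J ↔ I = J :=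
  ⟨fun h => by rw [← D.bar_bar I, h, bar_bar], fun h => by rw [h]⟩

/-- Frobenius reciprocity for the fusion rules. -/
theorem fusion_bar (J I M : ι) : D.fusion J I M = D.fusion J (D.bar M) (D.bar I) := by
  -- Both sides count the trivial representation in the product of `J`, `I` and `M̄`, grouped
  -- differently.
  have h : cmul (cmul (D.char J) (D.char I)) (D.char (D.bar M)) (D.e D.triv) =
      cmul (cmul (D.char J) (D.char (D.bar M))) (D.char I) (D.e D.triv) := by
    rw [cmul_assoc, cmul_assoc, D.cmul_char_comm I]
  rw [triple_e, triple_e] at h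
  have h2 : ∀ P, I = D.bar P ↔ D.bar I = P := fun P =>
    ⟨fun h => by rw [h, bar_bar], fun h => by rw [← h, bar_bar]⟩
  simp only [bar_inj, h2, Finset.sum_ite_eq, Finset.mem_univ, if_true] at h
  exact_mod_cast h

theorem qdim_bar_eq (I : ι) : D.qdim (D.bar I) = D.char I (SS D.g) := by
  rw [← tq_one, tq_apply, one_mul, char_bar]

/-- `S(g)` is grouplike too, so characters evaluated at it respect fusion. -/
theorem qdim_bar_mul (I J : ι) : D.qdim (D.bar I) * D.qdim (D.bar J) =
    ∑ K, (D.fusion I J K : ℂ) * D.qdim (D.bar K) := by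
  have h := congrArg (fun f => f (SS D.g)) (D.cmul_char I J)
  simp only [cmul_apply, comul_antipode, D.toRibbonStarHopf.comul_g, swapT_tmul,
    TensorProduct.map_tmul, slice_tmul, map_smul, LinearMap.sum_apply, LinearMap.smul_apply,
    smul_eq_mul, ← qdim_bar_eq] at h
  exact h

theorem qdim_triv : D.qdim D.triv = 1 := by
  rw [← tq_one, tq_apply, one_mul, char_triv, D.toRibbonStarHopf.counit_g]

/-- The central element `(tr_q^I ⊗ id)(R'R)`. -/
def z (I : ι) : G := slice G (D.tq I) D.Q

theorem z_comm (I : ι) (x : G) : Commute x (D.z I) := by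
  have h := (D.isTwistedTrace_tq I).slice_comm (AlgHom.id ℂ G) (N := D.Q) (fun y => by
    rw [coact_apply, idT_id]
    exact (D.toRibbonStarHopf.Q_comm y).symm) x
  exact h

theorem scalar_of_comm {x : G} (hx : ∀ y, Commute y x) (J : ι) :
    ∃ c : ℂ, D.τ J x = c • (1 : Matrix _ _ ℂ) := by
  have h5 : D.τ J x ∈ Set.range (Matrix.scalar (Fin (D.n J))) := by
    rw [Matrix.mem_range_scalar_iff_commute_single']
    intro i j
    obtain ⟨y, hy⟩ := D.τ_surjective J (Matrix.single i j 1)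
    rw [← hy]
    exact (hx y).map (D.τ J)
  obtain ⟨c, hc⟩ := h5
  exact ⟨c, by rw [← hc, Matrix.scalar_apply, ← Matrix.smul_one_eq_diagonal]⟩

theorem tq_eq_of_scalar {x : G} {c : ℂ} {J : ι} (h : D.τ J x = c • (1 : Matrix _ _ ℂ)) :
    D.tq J x = c * D.qdim J := by
  rw [tq_apply, char_apply, map_mul, h, Matrix.smul_mul, Matrix.one_mul, Matrix.trace_smul,
    ← char_apply, ← one_mul D.g, ← tq_apply, tq_one, smul_eq_mul]

/-- The scalar by which `z_I` acts on `V^J`. -/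
def lam (I J : ι) : ℂ := (D.scalar_of_comm (D.z_comm I) J).choose

theorem τ_z (I J : ι) : D.τ J (D.z I) = D.lam I J • (1 : Matrix _ _ ℂ) :=
  (D.scalar_of_comm (D.z_comm I) J).choose_spec

theorem tq_z (I J : ι) : D.tq J (D.z I) = D.lam I J * D.qdim J :=
  D.tq_eq_of_scalar (D.τ_z I J)

/-- The two sides are the traces of `R'R` and `RR'` with `g ⊗ g` inserted. Since `R'` commutes with
`g ⊗ g`, cyclicity identifies them. -/
theorem tq_z_symm (I J : ι) : D.tq J (D.z I) = D.tq I (D.z J) := by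
  have h : ∀ X : G ⊗[ℂ] G, (D.ten I J X).trace = (D.ten J I (swapT G X)).trace := by
    intro X
    induction X with
    | zero => simp
    | add p q hp hq => rw [map_add, Matrix.trace_add, hp, hq, map_add, map_add, Matrix.trace_add]
    | tmul x y =>
      rw [swapT_tmul, IrrepSystem.ten_tmul, IrrepSystem.ten_tmul, Matrix.trace_kronecker,
        Matrix.trace_kronecker, mul_comm]
  have h2 := D.toRibbonStarHopf.swapT_R_mul_comulOp D.g
  rw [D.toRibbonStarHopf.comul_g, swapT_tmul] at h2
  have h3 : swapT G (D.Q * D.g ⊗ₜ D.g) = (D.R : G ⊗[ℂ] G) * D.g ⊗ₜ D.g * swapT G D.R := by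
    rw [map_mul, RibbonStarHopf.Q, map_mul, swapT_swapT, swapT_tmul, mul_assoc, h2, mul_assoc]
  rw [z, z, tq_tq, tq_tq, h, h3, map_mul _ _ (swapT G D.R), Matrix.trace_mul_comm, ← map_mul,
    ← mul_assoc, ← RibbonStarHopf.Q]

theorem S_eq (I J : ι) : D.S I J = D.norm_const * (D.lam I J * D.qdim J) := by
  rw [← tq_z, z, tq_tq, map_mul (D.ten I J), IrrepSystem.ten_tmul]
  rfl

theorem S_symm (I J : ι) : D.S I J = D.S J I := by
  rw [S_eq, S_eq, ← tq_z, ← tq_z, tq_z_symm]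

/-- Take both quantum traces of the functoriality relation for `Q`. The conjugation by `R₁₂` is
invisible to the first one, and the coproduct yields the fusion rule. -/
theorem z_mul (I J : ι) : D.z I * D.z J = ∑ K, (D.fusion I J K : ℂ) • D.z K := by
  have h := congrArg (fun X => slice G (D.tq J) (slice (G ⊗[ℂ] G) (D.tq I) X))
    D.toRibbonStarHopf.comulL_Q
  simp only [j23_apply, slice_mul_one_tmul] at h
  rw [slice_comulL, RibbonStarHopf.slice_conj _ (D.isTwistedTrace_tq I), slice_one_tmul_mul,
    cmul_tq, slice_sum] at h
  exact h

theorem lam_mul (I J L : ι) :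
    D.lam I L * D.lam J L = ∑ K, (D.fusion I J K : ℂ) * D.lam K L := by
  have h := congrArg (fun x => D.τ L x 0 0) (D.z_mul I J)
  rw [mul_comm]
  simpa [τ_z, map_sum, Matrix.sum_apply] using h

theorem lam_triv (I : ι) : D.lam I D.triv = D.qdim I := by
  have h : Coalgebra.counit (R := ℂ) (D.z I) = D.qdim I := by
    have h1 : ∀ X : G ⊗[ℂ] G, Coalgebra.counit (R := ℂ) (slice G (D.tq I) X) =
        D.tq I (counitL G G (swapT G X)) := by
      intro X
      induction X with
      | zero => simp
      | add p q hp hq => simp only [map_add, hp, hq]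
      | tmul x y => simp [mul_comm]
    rw [z, h1, RibbonStarHopf.Q, map_mul, map_mul, swapT_swapT, RibbonStarHopf.counitL_swapT_R,
      RibbonStarHopf.counitL_R, one_mul, tq_one]
  have h2 := D.tq_z I D.triv
  have h3 := D.τ_z I D.triv
  rw [D.τ_triv, h] at h3
  have := congrFun (congrFun h3 0) 0
  simpa using this.symm

theorem qdim_eq_ofReal (hd : ∀ I, 0 < (D.qdim I).re ∧ (D.qdim I).im = 0) (I : ι) :
    D.qdim I = ((D.qdim I).re : ℂ) :=
  Complex.ext rfl (hd I).2

theorem qdim_ne_zero (hd : ∀ I, 0 < (D.qdim I).re ∧ (D.qdim I).im = 0) (I : ι) :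
    D.qdim I ≠ 0 := fun h => by
  have := (hd I).1
  rw [h] at this
  simp at this

theorem sum_qdim_sq (hd : ∀ I, 0 < (D.qdim I).re ∧ (D.qdim I).im = 0) :
    ∑ I, D.qdim I * D.qdim I = ((∑ I, (D.qdim I).re ^ 2 : ℝ) : ℂ) := by
  push_cast
  refine Finset.sum_congr rfl fun I _ => ?_
  conv_lhs => rw [D.qdim_eq_ofReal hd I]
  rw [pow_two]

theorem sum_re_pos (hd : ∀ I, 0 < (D.qdim I).re ∧ (D.qdim I).im = 0) :
    0 < ∑ I, (D.qdim I).re ^ 2 :=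
  Finset.sum_pos (fun I _ => by have := (hd I).1; positivity) ⟨D.triv, Finset.mem_univ _⟩

theorem sum_qdim_sq_ne_zero (hd : ∀ I, 0 < (D.qdim I).re ∧ (D.qdim I).im = 0) :
    ∑ I, D.qdim I * D.qdim I ≠ 0 := by
  rw [D.sum_qdim_sq hd]
  exact_mod_cast (D.sum_re_pos hd).ne'

theorem norm_const_sq (hd : ∀ I, 0 < (D.qdim I).re ∧ (D.qdim I).im = 0) :
    (D.norm_const : ℂ) * D.norm_const * ∑ I, D.qdim I * D.qdim I = 1 := by
  rw [D.sum_qdim_sq hd, norm_const]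
  have h := D.sum_re_pos hd
  have h2 : (√(∑ I, (D.qdim I).re ^ 2))⁻¹ * (√(∑ I, (D.qdim I).re ^ 2))⁻¹ *
      ∑ I, (D.qdim I).re ^ 2 = 1 := by
    rw [← mul_inv, Real.mul_self_sqrt h.le, inv_mul_cancel₀ h.ne']
  exact_mod_cast h2

/-- Multiplication by `z_J` permutes the terms of `∑ d_I z_I` according to fusion, and Frobenius
reciprocity resums them with the factor `d_J̄`. -/
theorem lam_mul_sum (J K : ι) : D.lam J K * ∑ I, D.qdim I * D.lam I K =
    D.qdim (D.bar J) * ∑ I, D.qdim I * D.lam I K := by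
  have h1 : ∀ M, ∑ I, (D.fusion J I M : ℂ) * D.qdim I = D.qdim (D.bar J) * D.qdim M := by
    intro M
    have h2 := D.qdim_bar_mul J (D.bar M)
    rw [bar_bar] at h2
    rw [h2]
    let σ : ι ≃ ι := ⟨D.bar, D.bar, D.bar_bar, D.bar_bar⟩
    rw [← σ.sum_comp]
    refine Finset.sum_congr rfl fun I _ => ?_
    change (D.fusion J (D.bar I) M : ℂ) * D.qdim (D.bar I) = _
    rw [D.fusion_bar J (D.bar I) M, bar_bar]
  calc _ = ∑ I, ∑ M, D.qdim I * ((D.fusion J I M : ℂ) * D.lam M K) := by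
        rw [Finset.mul_sum]
        refine Finset.sum_congr rfl fun I _ => ?_
        rw [mul_left_comm, lam_mul, Finset.mul_sum]
    _ = ∑ M, (∑ I, (D.fusion J I M : ℂ) * D.qdim I) * D.lam M K := by
        rw [Finset.sum_comm]
        refine Finset.sum_congr rfl fun M _ => ?_
        rw [Finset.sum_mul]
        exact Finset.sum_congr rfl fun I _ => by ring
    _ = _ := by
        rw [Finset.mul_sum]
        refine Finset.sum_congr rfl fun M _ => ?_
        rw [h1, mul_assoc]

/-- At the trivial label `lam_mul_sum` compares `d_J ∑ d²` with `d_J̄ ∑ d²`, and `∑ d²` is nonzero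
by positivity. -/
theorem qdim_bar (hd : ∀ I, 0 < (D.qdim I).re ∧ (D.qdim I).im = 0) (J : ι) :
    D.qdim (D.bar J) = D.qdim J := by
  have h := D.lam_mul_sum J D.triv
  simp only [lam_triv] at h
  exact (mul_right_cancel₀ (D.sum_qdim_sq_ne_zero hd) h).symm

/-- If the sum were nonzero at some `K` other than the trivial label, then `lam_mul_sum` would force
`λ_J(K) = d_J` for all `J`, making two columns of `S` proportional. -/
theorem sum_qdim_lam (hd : ∀ I, 0 < (D.qdim I).re ∧ (D.qdim I).im = 0) (hS : IsUnit D.S)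
    (K : ι) : ∑ I, D.qdim I * D.lam I K =
      if K = D.triv then ∑ I, D.qdim I * D.qdim I else 0 := by
  split_ifs with hK
  · subst hK
    simp only [lam_triv]
  · by_contra hne
    have h1 : ∀ J, D.lam J K = D.qdim J := fun J => by
      have h := D.lam_mul_sum J K
      rw [D.qdim_bar hd] at h
      exact mul_right_cancel₀ hne h
    -- Column `K` of `S` would be `d_K` times the column of the trivial label.
    have h2 : D.S *ᵥ (Pi.single K 1 - D.qdim K • Pi.single D.triv 1) = 0 := by
      ext J
      simp only [Matrix.mulVec_sub, Matrix.mulVec_smul, Matrix.mulVec_single_one, Pi.sub_apply,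
        Pi.smul_apply, Matrix.col_apply, Pi.zero_apply, S_eq, h1, lam_triv, qdim_triv, smul_eq_mul]
      ring
    have h3 : (Pi.single K 1 - D.qdim K • Pi.single D.triv 1 : ι → ℂ) = 0 := by
      obtain ⟨u, hu⟩ := hS
      have h4 := congrArg ((↑u⁻¹ : Matrix ι ι ℂ) *ᵥ ·) h2
      simpa [Matrix.mulVec_mulVec, ← hu] using h4
    have h5 := congrFun h3 K
    simp [hK] at h5

/-- The regular combination of the central elements `z_I` is a multiple of the projector onto
the trivial representation. -/
theorem sum_qdim_z (hd : ∀ I, 0 < (D.qdim I).re ∧ (D.qdim I).im = 0) (hS : IsUnit D.S) :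
    ∑ I, D.qdim I • D.z I = (∑ I, D.qdim I * D.qdim I) • D.e D.triv := by
  refine D.eq_of_τ fun K => ?_
  rw [map_sum, map_smul, IrrepSystem.τ_e]
  simp only [map_smul, τ_z, smul_smul, ← Finset.sum_smul]
  rw [D.sum_qdim_lam hd hS]
  by_cases h : K = D.triv
  · subst h; simp
  · simp [h, Ne.symm h]

/-- The square of `S` is charge conjugation: expand `λ_K λ_L` by fusion. Only the trivial channel
survives the sum against `d_I²`, by `sum_qdim_lam` and the symmetry of `S`. -/
theorem S_sq (hd : ∀ I, 0 < (D.qdim I).re ∧ (D.qdim I).im = 0) (hS : IsUnit D.S) (K L : ι) :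
    ∑ I, D.S K I * D.S I L = if L = D.bar K then 1 else 0 := by
  have h1 : ∀ I, D.S K I * D.S I L = D.norm_const * D.norm_const *
      ∑ M, (D.fusion K L M : ℂ) * (D.lam M I * D.qdim I * D.qdim I) := by
    intro I
    rw [D.S_symm I L, S_eq, S_eq]
    calc _ = (D.norm_const : ℂ) * D.norm_const * ((D.lam K I * D.lam L I) *
          (D.qdim I * D.qdim I)) := by ring
      _ = _ := by
        rw [lam_mul, Finset.sum_mul]
        congr 1
        exact Finset.sum_congr rfl fun M _ => by ring
  have h2 : ∀ M, ∑ I, D.lam M I * D.qdim I * D.qdim I =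
      if M = D.triv then ∑ I, D.qdim I * D.qdim I else 0 := by
    intro M
    have h3 : ∀ I, D.lam M I * D.qdim I = D.lam I M * D.qdim M := fun I => by
      rw [← tq_z, ← tq_z, tq_z_symm]
    have h4 := D.sum_qdim_lam hd hS M
    calc _ = D.qdim M * ∑ I, D.qdim I * D.lam I M := by
          rw [Finset.mul_sum]
          exact Finset.sum_congr rfl fun I _ => by rw [h3]; ring
      _ = _ := by
          rw [h4]
          split_ifs with h
          · rw [h, qdim_triv, one_mul]
          · simp
  simp only [h1]
  rw [← Finset.mul_sum, Finset.sum_comm]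
  simp only [← Finset.mul_sum, h2]
  simp only [mul_ite, mul_zero, Finset.sum_ite_eq', Finset.mem_univ, if_true]
  rw [mul_left_comm, D.norm_const_sq hd, mul_one, fusion_triv]
  split_ifs <;> simp

/-- Conjugating a label is multiplication by `S²`, so the sum is an entry of `S⁴ = 1`. -/
theorem sum_S_bar (hd : ∀ I, 0 < (D.qdim I).re ∧ (D.qdim I).im = 0) (hS : IsUnit D.S)
    (K L : ι) : ∑ I, D.S K (D.bar I) * D.S I L = if K = L then 1 else 0 := by
  have h1 : ∀ I, D.S K (D.bar I) = ∑ J, D.S K J * ∑ P, D.S J P * D.S P I := by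
    intro I
    have h2 : ∀ J, I = D.bar J ↔ D.bar I = J := fun J =>
      ⟨fun h => by rw [h, bar_bar], fun h => by rw [← h, bar_bar]⟩
    simp only [D.S_sq hd hS, h2, mul_ite, mul_one, mul_zero, Finset.sum_ite_eq, Finset.mem_univ,
      if_true]
  have h3 : ∑ I, D.S K (D.bar I) * D.S I L = ∑ P, (D.S * D.S) K P * (D.S * D.S) P L := by
    rw [← Matrix.mul_apply, Matrix.mul_assoc, ← Matrix.mul_assoc D.S D.S D.S,
      ← Matrix.mul_assoc D.S, Matrix.mul_apply]
    refine Finset.sum_congr rfl fun I _ => ?_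
    rw [h1, Matrix.mul_apply]
    rfl
  rw [h3]
  simp only [Matrix.mul_apply, D.S_sq hd hS, ite_mul, one_mul, zero_mul, Finset.sum_ite_eq',
    Finset.mem_univ, if_true, bar_bar]
  simp only [eq_comm]

/-- The combination of the central elements `z_I` in the definition of the characteristic
projectors is the minimal central idempotent. -/
theorem sum_chiCoeff_z (hd : ∀ I, 0 < (D.qdim I).re ∧ (D.qdim I).im = 0) (hS : IsUnit D.S)
    (K : ι) : ∑ I, D.chiCoeff K I • D.z I = D.e K := by
  refine D.eq_of_τ fun L => ?_
  rw [map_sum, IrrepSystem.τ_e]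
  simp only [map_smul, τ_z, smul_smul, ← Finset.sum_smul]
  have h1 : ∑ I, D.chiCoeff K I * D.lam I L =
      D.qdim K * (D.qdim L)⁻¹ * ∑ I, D.S K (D.bar I) * D.S I L := by
    rw [Finset.mul_sum]
    refine Finset.sum_congr rfl fun I _ => ?_
    rw [chiCoeff, D.S_eq I L]
    have := D.qdim_ne_zero hd L
    field_simp
  rw [h1, D.sum_S_bar hd hS]
  split_ifs with h
  · subst h
    rw [mul_one, mul_inv_cancel₀ (D.qdim_ne_zero hd K), one_smul]
  · simp

/-! ### Factorizability -/

/-- The slice is central, hence a scalar on each `V^L`. Its quantum trace there is the multiplicity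
of the trivial representation in the fusion of `K̄` with `L`. -/
theorem slice_tq_comul_e (hd : ∀ I, 0 < (D.qdim I).re ∧ (D.qdim I).im = 0) (K : ι) :
    D.qdim K • slice G (D.tq (D.bar K)) (Coalgebra.comul (R := ℂ) (D.e D.triv)) = D.e K := by
  set y := slice G (D.tq (D.bar K)) (Coalgebra.comul (R := ℂ) (D.e D.triv)) with hy
  have hc : ∀ x, Commute x y := by
    intro x
    have h := (D.isTwistedTrace_tq (D.bar K)).slice_comm (AlgHom.id ℂ G)
      (N := Coalgebra.comul (R := ℂ) (D.e D.triv)) (fun w => by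
        rw [coact_apply, idT_id, Commute, SemiconjBy, ← Bialgebra.comul_mul, ← Bialgebra.comul_mul,
          IrrepSystem.e_comm]) x
    exact h
  refine D.eq_of_τ fun L => ?_
  obtain ⟨c, h1⟩ := D.scalar_of_comm hc L
  have h2 := D.tq_eq_of_scalar h1
  rw [hy, ← cmul_apply, cmul_tq] at h2
  have h3 : ∀ M, D.tq M (D.e D.triv) = if M = D.triv then 1 else 0 := by
    intro M
    split_ifs with h
    · subst h
      have := D.tq_eq_of_scalar (x := D.e D.triv) (c := 1) (J := D.triv) (by
        rw [IrrepSystem.τ_e, if_pos rfl, one_smul])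
      rw [this, qdim_triv, one_mul]
    · have := D.tq_eq_of_scalar (x := D.e D.triv) (c := 0) (J := M) (by
        rw [IrrepSystem.τ_e, if_neg (Ne.symm h), zero_smul])
      rw [this, zero_mul]
  simp only [LinearMap.sum_apply, LinearMap.smul_apply, h3, smul_eq_mul, mul_ite, mul_one,
    mul_zero, Finset.sum_ite_eq', Finset.mem_univ, if_true, fusion_triv, bar_bar] at h2
  rw [map_smul, h1, IrrepSystem.τ_e, smul_smul]
  by_cases h : L = K
  · subst h
    rw [if_pos rfl] at h2
    rw [if_pos rfl, mul_comm, ← h2]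
    simp
  · rw [if_neg h] at h2
    rw [if_neg (Ne.symm h)]
    have : c = 0 := by
      rcases (show c = 0 ∨ D.qdim L = 0 by simpa using h2.symm) with h4 | h4
      · exact h4
      · exact absurd h4 (D.qdim_ne_zero hd L)
    rw [this, mul_zero, zero_smul]

/-- Use `Δ(y) Δ(e_0) = ε(y) Δ(e_0)` in the expression `∑ (S(x¹) ⊗ 1) Δ(x²) Δ(e_0)`, and compare with
the other bracketing, where `S(x¹) x²` collapses. -/
theorem one_tmul_mul_comul_e (x : G) :
    (1 ⊗ₜ x) * Coalgebra.comul (R := ℂ) (D.e D.triv) =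
      (SS x ⊗ₜ 1) * Coalgebra.comul (R := ℂ) (D.e D.triv) := by
  set E := Coalgebra.comul (R := ℂ) (D.e D.triv) with hE
  have hx : ∀ y, Coalgebra.comul (R := ℂ) y * E = Coalgebra.counit (R := ℂ) y • E := by
    intro y
    rw [hE, ← Bialgebra.comul_mul, IrrepSystem.mul_e_triv, map_smul]
  let L : G ⊗[ℂ] (G ⊗[ℂ] G) →ₗ[ℂ] G ⊗[ℂ] G :=
    TensorProduct.lift (LinearMap.mk₂ ℂ (fun a X => (SS a ⊗ₜ 1) * X * E)
      (fun a b X => by simp [TensorProduct.add_tmul, add_mul])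
      (fun c a X => by rw [map_smul, ← TensorProduct.smul_tmul', smul_mul_assoc, smul_mul_assoc])
      (fun a X Y => by simp [mul_add, add_mul]) (fun c a X => by simp))
  have hL : ∀ a X, L (a ⊗ₜ X) = (SS a ⊗ₜ 1) * X * E := fun a X => rfl
  have h1 : ∀ Y : G ⊗[ℂ] G, L (idT G (Bialgebra.comulAlgHom ℂ G) Y) =
      (SS (LinearMap.mul' ℂ G (TensorProduct.map LinearMap.id
          (Algebra.linearMap ℂ G ∘ₗ Coalgebra.counit) Y)) ⊗ₜ 1) * E := by
    intro Y
    induction Y with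
    | zero => simp
    | add p q hp hq => simp only [map_add, hp, hq, TensorProduct.add_tmul, add_mul]
    | tmul a b =>
      rw [idT_tmul, hL, mul_assoc, Bialgebra.comulAlgHom_apply, hx, TensorProduct.map_tmul,
        LinearMap.mul'_apply, LinearMap.comp_apply, Algebra.linearMap_apply, LinearMap.id_apply,
        Algebra.algebraMap_eq_smul_one, mul_smul_comm, mul_smul_comm, mul_one, map_smul,
        ← TensorProduct.smul_tmul', smul_mul_assoc]
  have h2 : ∀ Y : G ⊗[ℂ] G, L (comulL G G Y) = (1 ⊗ₜ counitL G G Y) * E := by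
    intro Y
    induction Y with
    | zero => simp
    | add p q hp hq => simp only [map_add, hp, hq, TensorProduct.tmul_add, add_mul]
    | tmul a b =>
      have h3 : L (comulL G G (a ⊗ₜ b)) =
          (LinearMap.mul' ℂ G (LinearMap.rTensor G SS (Coalgebra.comul (R := ℂ) a)) ⊗ₜ b) * E := by
        rw [comulL_tmul_eq]
        induction Coalgebra.comul (R := ℂ) a with
        | zero => simp
        | add p q hp hq => simp only [map_add, add_mul, hp, hq, TensorProduct.add_tmul]
        | tmul c d =>
          rw [j12_tmul, Algebra.TensorProduct.tmul_mul_tmul, mul_one,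
            Algebra.TensorProduct.tmul_mul_tmul, mul_one, one_mul, hL,
            Algebra.TensorProduct.tmul_mul_tmul, one_mul, LinearMap.rTensor_tmul,
            LinearMap.mul'_apply]
      rw [h3, HopfAlgebra.mul_antipode_rTensor_comul_apply, counitL_tmul,
        Algebra.algebraMap_eq_smul_one, TensorProduct.smul_tmul]
  have h3 : comulL G G (Coalgebra.comul (R := ℂ) x) =
      idT G (Bialgebra.comulAlgHom ℂ G) (Coalgebra.comul (R := ℂ) x) :=
    Coalgebra.coassoc_apply (R := ℂ) x
  have h4 := h2 (Coalgebra.comul (R := ℂ) x)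
  rw [h3, h1, counitL_comul] at h4
  rw [← h4]
  congr 3
  have h5 := congrArg (LinearMap.mul' ℂ G ∘ₗ LinearMap.lTensor G (Algebra.linearMap ℂ G))
    (Coalgebra.lTensor_counit_comul (R := ℂ) x)
  rw [LinearMap.comp_apply, ← LinearMap.comp_apply (LinearMap.lTensor G _),
    ← LinearMap.lTensor_comp] at h5
  simpa [LinearMap.lTensor] using h5

/-- The `R`-matrix is factorizable: the slices of `R'R` exhaust `G`. -/
theorem exists_slice_Q (hd : ∀ I, 0 < (D.qdim I).re ∧ (D.qdim I).im = 0) (hS : IsUnit D.S)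
    (x : G) : ∃ f : G →ₗ[ℂ] ℂ, slice G f D.Q = x := by
  let W : Submodule ℂ G := Submodule.span ℂ (Set.range fun f : G →ₗ[ℂ] ℂ => slice G f D.Q)
  have hW : ∀ y ∈ W, ∃ f : G →ₗ[ℂ] ℂ, slice G f D.Q = y := by
    intro y hy
    induction hy using Submodule.span_induction with
    | mem y h => obtain ⟨f, hf⟩ := h; exact ⟨f, hf⟩
    | zero => exact ⟨0, by
        have := slice_sum (A := G) (∅ : Finset ι) (fun _ => 0) (fun _ => 0) D.Q
        simpa using this⟩
    | add a b _ _ ha hb =>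
      obtain ⟨f, rfl⟩ := ha
      obtain ⟨f', rfl⟩ := hb
      have := slice_sum (A := G) Finset.univ (fun _ => 1) ![f, f'] D.Q
      exact ⟨f + f', by simpa using this⟩
    | smul c a _ ha =>
      obtain ⟨f, rfl⟩ := ha
      have := slice_sum (A := G) (Finset.univ : Finset (Fin 1)) (fun _ => c) ![f] D.Q
      exact ⟨c • f, by simpa using this⟩
  refine hW x ?_
  -- A nonzero multiple of `e_0` is `∑ d_I z_I`, and `Δ(z_I)` is a slice of `(id ⊗ Δ)(Q) = R'₁₂ Q₁₃
  -- R₁₂`. The outer factors only change the functional applied to `Q`.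
  have h1 : ∀ f : G →ₗ[ℂ] ℂ, slice G f (Coalgebra.comul (R := ℂ) (D.e D.triv)) ∈ W := by
    intro f
    have h2 := congrArg (Coalgebra.comul (R := ℂ)) (D.sum_qdim_z hd hS)
    rw [map_smul] at h2
    have h3 : ∀ I, slice G f (Coalgebra.comul (R := ℂ) (D.z I)) ∈ W := by
      intro I
      have h4 : Coalgebra.comul (R := ℂ) (D.z I) =
          slice (G ⊗[ℂ] G) (D.tq I) (j12 G G (swapT G D.R) * j13 G G D.Q * j12 G G D.R) := by
        rw [← RibbonStarHopf.idT_comul_Q, slice_idT]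
        rfl
      rw [h4]
      have h5 : ∀ X Y Z : G ⊗[ℂ] G, ∃ f', slice G f (slice (G ⊗[ℂ] G) (D.tq I)
          (j12 G G X * j13 G G Z * j12 G G Y)) = slice G f' Z := by
        intro X Y Z
        let f' : G →ₗ[ℂ] ℂ := f ∘ₗ slice G (D.tq I) ∘ₗ LinearMap.mulLeft ℂ X ∘ₗ
          LinearMap.mulRight ℂ Y ∘ₗ
          (Algebra.TensorProduct.includeLeft : G →ₐ[ℂ] G ⊗[ℂ] G).toLinearMap
        refine ⟨f', ?_⟩
        induction Z with
        | zero => simp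
        | add p q hp hq => simp only [map_add, mul_add, add_mul, hp, hq]
        | tmul a b =>
          have h6 : j12 G G X * j13 G G (a ⊗ₜ b) * j12 G G Y =
              j12 G G (X * (a ⊗ₜ 1 * Y)) * (1 ⊗ₜ (1 ⊗ₜ b)) := by
            have h7 : (1 ⊗ₜ[ℂ] (1 ⊗ₜ[ℂ] b) : G ⊗[ℂ] (G ⊗[ℂ] G)) * j12 G G Y =
                j12 G G Y * (1 ⊗ₜ[ℂ] (1 ⊗ₜ[ℂ] b)) := by
              induction Y with
              | zero => simp
              | add p q hp hq => simp only [map_add, mul_add, add_mul, hp, hq]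
              | tmul c d => simp
            have h8 : j13 G G (a ⊗ₜ b) = j12 G G (a ⊗ₜ 1) * (1 ⊗ₜ[ℂ] (1 ⊗ₜ[ℂ] b)) := by simp
            rw [h8, map_mul, map_mul, mul_assoc, mul_assoc, h7]
            simp only [mul_assoc]
          rw [h6, slice_mul_one_tmul, slice_j12, Algebra.TensorProduct.tmul_mul_tmul, mul_one,
            one_mul, slice_tmul, slice_tmul]
          rfl
      obtain ⟨f', hf'⟩ := h5 (swapT G D.R) D.R D.Q
      rw [hf']
      exact Submodule.subset_span ⟨f', rfl⟩
    have h4 : (∑ I, D.qdim I * D.qdim I) • slice G f (Coalgebra.comul (R := ℂ) (D.e D.triv)) ∈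
        W := by
      rw [← map_smul, ← h2, map_sum, map_sum]
      refine Submodule.sum_mem _ fun I _ => ?_
      rw [map_smul, map_smul]
      exact W.smul_mem _ (h3 I)
    exact (W.smul_mem_iff (D.sum_qdim_sq_ne_zero hd)).1 h4
  -- Each `e_K` is a slice of `Δ(e_0)`, and multiplication by `x` in the remaining leg moves to the
  -- sliced leg as `S(x)`.
  have h2 : ∀ K, x * D.e K ∈ W := by
    intro K
    rw [← D.slice_tq_comul_e hd K, mul_smul_comm, ← slice_one_tmul_mul, one_tmul_mul_comul_e]
    refine W.smul_mem _ ?_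
    have h3 : ∀ (f : G →ₗ[ℂ] ℂ) (X : G ⊗[ℂ] G), slice G f ((SS x ⊗ₜ 1) * X) =
        slice G (f ∘ₗ LinearMap.mulLeft ℂ (SS x)) X := by
      intro f X
      induction X with
      | zero => simp
      | add p q hp hq => simp only [map_add, mul_add, hp, hq]
      | tmul a b => simp
    rw [h3]
    exact h1 _
  rw [← mul_one x, ← D.toIrrepSystem.sum_e, Finset.mul_sum]
  exact Submodule.sum_mem _ fun K _ => h2 K

end SymmetryData
end SMatrix

/-! ### Adding a puncture -/

section Braiding

variable {G : Type*} [Ring G] [HopfAlgebra ℂ G]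
variable {A : Type*} [Ring A] [Algebra ℂ A] {B : Type*} [Ring B] [Algebra ℂ B]

theorem commute_of_tmul {X : G ⊗[ℂ] A} {C : Type*} [Ring C] [Algebra ℂ C] (f : G ⊗[ℂ] A →ₐ[ℂ] C)
    {c : C} (h : ∀ x a, Commute (f (x ⊗ₜ a)) c) : Commute (f X) c := by
  induction X with
  | zero => rw [map_zero]; exact Commute.zero_left _
  | add p q hp hq => rw [map_add]; exact hp.add_left hq
  | tmul x a => exact h x a

theorem j13_j13_comm (X : G ⊗[ℂ] A) (Y : G ⊗[ℂ] G) :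
    Commute (j13 G (G ⊗[ℂ] A) (j13 G A X)) (j23 G (G ⊗[ℂ] A) (j12 G A Y)) := by
  refine commute_of_tmul ((j13 G (G ⊗[ℂ] A)).comp (j13 G A)) fun x a => ?_
  refine Commute.symm (commute_of_tmul ((j23 G (G ⊗[ℂ] A)).comp (j12 G A)) fun y z => ?_)
  simp [Commute, SemiconjBy]

theorem j13_j12_comm (X : G ⊗[ℂ] A) (Y : G ⊗[ℂ] G) :
    Commute (j13 G (G ⊗[ℂ] A) (j12 G A Y)) (j23 G (G ⊗[ℂ] A) (j13 G A X)) := by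
  refine commute_of_tmul ((j13 G (G ⊗[ℂ] A)).comp (j12 G A)) fun x a => ?_
  refine Commute.symm (commute_of_tmul ((j23 G (G ⊗[ℂ] A)).comp (j13 G A)) fun y z => ?_)
  simp [Commute, SemiconjBy]

theorem comulL_j12 (X : G ⊗[ℂ] G) : comulL G (G ⊗[ℂ] A) (j12 G A X) =
    idT G (idT G Algebra.TensorProduct.includeLeft) (comulL G G X) := by
  rw [idT_comulL]
  rfl

theorem comulL_j13 (X : G ⊗[ℂ] A) : comulL G (G ⊗[ℂ] A) (j13 G A X) =
    idT G (idT G Algebra.TensorProduct.includeRight) (comulL G A X) := by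
  rw [idT_comulL]
  rfl

/-- Applied with `r = R₁₂`, `a = R₁₃`, `b = R₂₃`. Yang-Baxter lets the conjugating factors be
collected on the outside, since `x` and `b`, and also `a` and `y`, act on disjoint legs. -/
theorem conj_fusion_aux {Q : Type*} [Ring Q] {r ri a ai b bi x y : Q} (hr : ri * r = 1)
    (hr' : r * ri = 1) (ha : ai * a = 1) (ha' : a * ai = 1) (hb : bi * b = 1) (hb' : b * bi = 1)
    (yb : r * a * b = b * a * r) (hx : Commute x b) (hy : Commute a y) :
    ri * (ai * x * a) * r * (bi * y * b) = (bi * ai) * (ri * x * r * y) * (a * b) := by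
  have h1 : a * r * bi = bi * r * a := by
    calc a * r * bi = bi * (b * a * r) * bi := by
          simp only [← mul_assoc]
          rw [hb, one_mul]
      _ = bi * r * a := by
          rw [← yb]
          simp only [mul_assoc]
          rw [hb', mul_one]
  have h2 : ri * ai * bi = bi * ai * ri := by
    calc ri * ai * bi = bi * ai * ri * (r * a * b) * ri * ai * bi := by
          have : bi * ai * ri * (r * a * b) = 1 := by
            calc _ = bi * (ai * (ri * r) * a) * b := by simp only [mul_assoc]
              _ = 1 := by rw [hr, mul_one, ha, mul_one, hb]
          rw [this, one_mul]
      _ = bi * ai * ri * (b * (a * (r * ri) * ai) * bi) := by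
          rw [yb]
          simp only [mul_assoc]
      _ = bi * ai * ri := by rw [hr', mul_one, ha', mul_one, hb', mul_one]
  have h3 : x * bi = bi * x := by
    calc x * bi = bi * (b * x) * bi := by rw [← mul_assoc, hb, one_mul]
      _ = bi * x := by rw [← hx.eq, mul_assoc, mul_assoc, hb', mul_one]
  calc ri * (ai * x * a) * r * (bi * y * b) = ri * ai * x * (a * r * bi) * y * b := by
        simp only [mul_assoc]
    _ = ri * ai * (x * bi) * r * (a * y) * b := by
        rw [h1]
        simp only [mul_assoc]
    _ = ri * ai * bi * x * r * y * a * b := by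
        rw [h3, hy.eq]
        simp only [mul_assoc]
    _ = _ := by
        rw [h2]
        simp only [mul_assoc]

theorem conj_exchange_aux {Q : Type*} [Ring Q] {r ri a ai b bi x y : Q} (hr : ri * r = 1)
    (hr' : r * ri = 1) (ha : ai * a = 1) (ha' : a * ai = 1) (hb : bi * b = 1) (hb' : b * bi = 1)
    (yb : r * a * b = b * a * r) (hx : Commute x b) (hy : Commute a y)
    (h : Commute (ri * x * r) y) :
    Commute (ri * (ai * x * a) * r) (bi * y * b) := by
  have h1 : a * r * bi = bi * r * a := by
    calc a * r * bi = bi * (b * a * r) * bi := by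
          simp only [← mul_assoc]
          rw [hb, one_mul]
      _ = bi * r * a := by
          rw [← yb]
          simp only [mul_assoc]
          rw [hb', mul_one]
  have h2 : b * ri * ai = ai * ri * b := by
    calc b * ri * ai = ai * ri * (r * a * b) * ri * ai := by
          have : ai * ri * (r * a * b) = b := by
            calc _ = ai * (ri * r) * a * b := by simp only [mul_assoc]
              _ = b := by rw [hr, mul_one, ha, one_mul]
          rw [this]
      _ = ai * ri * b * (a * (r * ri) * ai) := by
          rw [yb]
          simp only [mul_assoc]
      _ = ai * ri * b := by rw [hr', mul_one, ha', mul_one]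
  have h4 : b * (ri * (ai * x * a) * r) * bi = ai * (ri * x * r) * a := by
    calc _ = (b * ri * ai) * x * (a * r * bi) := by simp only [mul_assoc]
      _ = ai * ri * (b * x) * bi * r * a := by
          rw [h1, h2]
          simp only [mul_assoc]
      _ = ai * ri * x * (b * bi) * r * a := by
          rw [← hx.eq]
          simp only [mul_assoc]
      _ = _ := by
          rw [hb', mul_one]
          simp only [mul_assoc]
  have hy' : Commute ai y := by
    have : a * (ai * y - y * ai) = 0 := by
      rw [mul_sub, ← mul_assoc, ha', ← mul_assoc, hy.eq, mul_assoc, ha', one_mul, mul_one, sub_self]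
    have h5 := congrArg (ai * ·) this
    simp only [← mul_assoc, ha, one_mul, mul_zero] at h5
    exact sub_eq_zero.1 h5
  have h5 : Commute (b * (ri * (ai * x * a) * r) * bi) y := by
    rw [h4]
    exact (hy'.mul_left h).mul_left hy
  set w := ri * (ai * x * a) * r
  calc w * (bi * y * b) = bi * ((b * w * bi) * y) * b := by
        simp only [← mul_assoc]
        rw [hb, one_mul]
    _ = bi * (y * (b * w * bi)) * b := by rw [h5.eq]
    _ = (bi * y * b) * w := by
        simp only [mul_assoc]
        rw [hb, mul_one]

/-- `x ⊗ y ↦ (1 ⊗ S(y) ⊗ 1) Z (x ⊗ 1 ⊗ 1)`. -/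
def insertOp (Z : G ⊗[ℂ] (G ⊗[ℂ] A)) : G ⊗[ℂ] G →ₗ[ℂ] G ⊗[ℂ] (G ⊗[ℂ] A) :=
  TensorProduct.lift (LinearMap.mk₂ ℂ
    (fun x y => (1 ⊗ₜ (HopfAlgebra.antipode ℂ y ⊗ₜ 1)) * Z * (x ⊗ₜ 1))
    (fun a b y => by rw [TensorProduct.add_tmul, mul_add])
    (fun c a y => by rw [← TensorProduct.smul_tmul', mul_smul_comm])
    (fun a x y => by
      rw [map_add, TensorProduct.add_tmul, TensorProduct.tmul_add, add_mul, add_mul])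
    (fun c a y => by rw [map_smul, ← TensorProduct.smul_tmul', TensorProduct.tmul_smul,
      smul_mul_assoc, smul_mul_assoc]))

theorem insertOp_tmul (Z : G ⊗[ℂ] (G ⊗[ℂ] A)) (x y : G) : insertOp Z (x ⊗ₜ y) =
    (1 ⊗ₜ (HopfAlgebra.antipode ℂ y ⊗ₜ 1)) * Z * (x ⊗ₜ 1) := rfl

variable [StarRing G] [StarModule ℂ G]

namespace RibbonStarHopf

variable (H : RibbonStarHopf G)

theorem yang_baxter' : j12 G (G ⊗[ℂ] A) H.R * j13 G (G ⊗[ℂ] A) (j12 G A H.R) *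
    j23 G (G ⊗[ℂ] A) (j12 G A H.R) = j23 G (G ⊗[ℂ] A) (j12 G A H.R) *
    j13 G (G ⊗[ℂ] A) (j12 G A H.R) * j12 G (G ⊗[ℂ] A) H.R := by
  have h := congrArg (idT G (idT G (Algebra.TensorProduct.includeLeft : G →ₐ[ℂ] G ⊗[ℂ] A)))
    H.yang_baxter
  simp only [map_mul, idT_j12, idT_j13, idT_j23] at h
  exact h

variable (A) in
theorem isMonodromy_Q [FiniteDimensional ℂ G] : H.IsMonodromy (j12 G A H.Q) :=
  IsMonodromy.map (N := H.Q) ⟨H.comulL_Q, H.counitL_Q⟩ Algebra.TensorProduct.includeLeft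

/-- Conjugation of a universal monodromy by the `R`-matrix. -/
def shift (N : G ⊗[ℂ] A) : G ⊗[ℂ] (G ⊗[ℂ] A) := j12 G A H.Ri * j13 G A N * j12 G A H.R

variable {H}

/-- The coproduct acts on the conjugating `R` by `R₁₃ R₂₃`, so the claim is the relation for `N`
conjugated as in `conj_fusion_aux`. -/
theorem IsMonodromy.shift {N : G ⊗[ℂ] A} (h : H.IsMonodromy N) : H.IsMonodromy (H.shift N) := by
  refine ⟨?_, ?_⟩
  · have e1 : comulL G (G ⊗[ℂ] A) (H.shift N) =
        (j23 G _ (j12 G A H.Ri) * j13 G _ (j12 G A H.Ri)) *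
        (j12 G (G ⊗[ℂ] A) H.Ri * j13 G _ (j13 G A N) * j12 G (G ⊗[ℂ] A) H.R * j23 G _ (j13 G A N)) *
        (j13 G _ (j12 G A H.R) * j23 G _ (j12 G A H.R)) := by
      have e2 : comulL G (G ⊗[ℂ] A) (j12 G A H.R) =
          j13 G _ (j12 G A H.R) * j23 G _ (j12 G A H.R) := by
        rw [comulL_j12, comulL_R, map_mul, idT_j13, idT_j23]
        rfl
      have e3 : comulL G (G ⊗[ℂ] A) (j12 G A H.Ri) =
          j23 G _ (j12 G A H.Ri) * j13 G _ (j12 G A H.Ri) := by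
        have e4 : comulL G (G ⊗[ℂ] A) (j12 G A H.Ri) * (j13 G _ (j12 G A H.R) *
            j23 G _ (j12 G A H.R)) = 1 := by
          rw [← e2, ← map_mul, H.j12_Ri_mul, map_one]
        have e5 : (j13 G (G ⊗[ℂ] A) (j12 G A H.R) * j23 G _ (j12 G A H.R)) *
            (j23 G _ (j12 G A H.Ri) * j13 G _ (j12 G A H.Ri)) = 1 := by
          rw [mul_assoc, ← mul_assoc (j23 G (G ⊗[ℂ] A) (j12 G A H.R)), ← map_mul, H.j12_R_mul_Ri,
            map_one, one_mul, ← map_mul, H.j12_R_mul_Ri, map_one]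
        exact left_inv_eq_right_inv e4 e5
      have e4 := congrArg (idT G (idT G (Algebra.TensorProduct.includeRight : A →ₐ[ℂ] G ⊗[ℂ] A)))
        h.fusion
      rw [← comulL_j13] at e4
      simp only [map_mul, idT_j12, idT_j13, idT_j23] at e4
      rw [RibbonStarHopf.shift, map_mul, map_mul, e2, e3, ← e4]
      rfl
    rw [e1, RibbonStarHopf.shift]
    simp only [map_mul (j13 G (G ⊗[ℂ] A)), map_mul (j23 G (G ⊗[ℂ] A))]
    refine conj_fusion_aux H.j12_Ri_mul H.j12_R_mul_Ri ?_ ?_ ?_ ?_ H.yang_baxter'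
      (j13_j13_comm _ _) (j13_j12_comm _ _)
    · rw [← map_mul, H.j12_Ri_mul, map_one]
    · rw [← map_mul, H.j12_R_mul_Ri, map_one]
    · rw [← map_mul, H.j12_Ri_mul, map_one]
    · rw [← map_mul, H.j12_R_mul_Ri, map_one]
  · have e1 : counitL G (G ⊗[ℂ] A) (j12 G A H.R) = 1 := by
      rw [counitL_j12, counitL_R, Algebra.TensorProduct.one_def]
    have e2 : counitL G (G ⊗[ℂ] A) (j12 G A H.Ri) = 1 := by
      have := congrArg (counitL G (G ⊗[ℂ] A)) (H.j12_Ri_mul (A := A))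
      rwa [map_mul, e1, mul_one, map_one] at this
    rw [RibbonStarHopf.shift, map_mul, map_mul, e1, e2, counitL_j13, h.counit, one_mul, mul_one,
      Algebra.TensorProduct.one_def]

theorem Exchange.shift {N N' : G ⊗[ℂ] A} (h : H.Exchange N N') :
    H.Exchange (H.shift N) (H.shift N') := by
  rw [Exchange, RibbonStarHopf.shift, RibbonStarHopf.shift]
  simp only [map_mul (j13 G (G ⊗[ℂ] A)), map_mul (j23 G (G ⊗[ℂ] A))]
  refine conj_exchange_aux H.j12_Ri_mul H.j12_R_mul_Ri ?_ ?_ ?_ ?_ H.yang_baxter'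
    (j13_j13_comm _ _) (j13_j12_comm _ _) ?_
  · rw [← map_mul, H.j12_Ri_mul, map_one]
  · rw [← map_mul, H.j12_R_mul_Ri, map_one]
  · rw [← map_mul, H.j12_Ri_mul, map_one]
  · rw [← map_mul, H.j12_R_mul_Ri, map_one]
  · have e := congrArg (idT G (idT G (Algebra.TensorProduct.includeRight : A →ₐ[ℂ] G ⊗[ℂ] A))) h.eq
    simp only [map_mul, idT_j12, idT_j13, idT_j23] at e
    exact e

/-- The conjugation is by `R₁₃ R₁₂ = (id ⊗ Δ)(R)`, which commutes with `Q₂₃` because `Q` commutes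
with coproducts. The conjugated `N` occupies legs disjoint from those of `Q₂₃`. -/
theorem exchange_shift_Q (N : G ⊗[ℂ] A) : H.Exchange (H.shift N) (j12 G A H.Q) := by
  have e1 : Commute (j13 G (G ⊗[ℂ] A) (j12 G A H.R) * j12 G (G ⊗[ℂ] A) H.R)
      (j23 G (G ⊗[ℂ] A) (j12 G A H.Q)) := by
    have e2 : Commute (idT G (Bialgebra.comulAlgHom ℂ G) (H.R : G ⊗[ℂ] G)) (j23 G G H.Q) := by
      refine commute_of_tmul (idT G (Bialgebra.comulAlgHom ℂ G)) fun x y => ?_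
      rw [idT_tmul, j23_apply, Commute, SemiconjBy, Algebra.TensorProduct.tmul_mul_tmul,
        Algebra.TensorProduct.tmul_mul_tmul, mul_one, one_mul, Bialgebra.comulAlgHom_apply,
        (H.Q_comm y).eq]
    rw [idT_comul_R] at e2
    have e3 := congrArg (idT G (idT G (Algebra.TensorProduct.includeLeft : G →ₐ[ℂ] G ⊗[ℂ] A)))
      e2.eq
    simp only [map_mul, idT_j12, idT_j13, idT_j23] at e3
    exact e3
  have e2 : (j12 G (G ⊗[ℂ] A) H.Ri * j13 G (G ⊗[ℂ] A) (j12 G A H.Ri)) *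
      (j13 G (G ⊗[ℂ] A) (j12 G A H.R) * j12 G (G ⊗[ℂ] A) H.R) = 1 := by
    rw [mul_assoc, ← mul_assoc (j13 G (G ⊗[ℂ] A) _), ← map_mul, j12_Ri_mul, map_one, one_mul,
      j12_Ri_mul]
  have e3 : (j13 G (G ⊗[ℂ] A) (j12 G A H.R) * j12 G (G ⊗[ℂ] A) H.R) *
      (j12 G (G ⊗[ℂ] A) H.Ri * j13 G (G ⊗[ℂ] A) (j12 G A H.Ri)) = 1 := by
    rw [mul_assoc, ← mul_assoc (j12 G (G ⊗[ℂ] A) _), j12_R_mul_Ri, one_mul, ← map_mul, j12_R_mul_Ri,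
      map_one]
  have e4 : Commute (j12 G (G ⊗[ℂ] A) H.Ri * j13 G (G ⊗[ℂ] A) (j12 G A H.Ri))
      (j23 G (G ⊗[ℂ] A) (j12 G A H.Q)) := by
    let U : (G ⊗[ℂ] (G ⊗[ℂ] (G ⊗[ℂ] A)))ˣ := ⟨_, _, e3, e2⟩
    have : Commute (U : G ⊗[ℂ] (G ⊗[ℂ] (G ⊗[ℂ] A))) (j23 G (G ⊗[ℂ] A) (j12 G A H.Q)) := e1
    exact this.units_inv_left
  have e5 := (e4.mul_left (j13_j13_comm N H.Q)).mul_left e1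
  rw [Exchange, RibbonStarHopf.shift, map_mul (j13 G (G ⊗[ℂ] A)), map_mul (j13 G (G ⊗[ℂ] A))]
  have e6 : j12 G (G ⊗[ℂ] A) H.Ri * (j13 G (G ⊗[ℂ] A) (j12 G A H.Ri) * j13 G (G ⊗[ℂ] A) (j13 G A N) *
      j13 G (G ⊗[ℂ] A) (j12 G A H.R)) * j12 G (G ⊗[ℂ] A) H.R =
      j12 G (G ⊗[ℂ] A) H.Ri * j13 G (G ⊗[ℂ] A) (j12 G A H.Ri) * j13 G (G ⊗[ℂ] A) (j13 G A N) *
      (j13 G (G ⊗[ℂ] A) (j12 G A H.R) * j12 G (G ⊗[ℂ] A) H.R) := by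
    simp only [mul_assoc]
  rw [e6]
  exact e5

/-- The holonomy around an additional puncture. -/
theorem Q_mul_shift (δ : G →ₐ[ℂ] A) :
    j12 G A H.Q * H.shift (idT G δ H.Q) = idT G (coact δ) H.Q := by
  have h := congrArg (idT G (idT G δ)) H.idT_comul_Q
  rw [idT_comp] at h
  simp only [map_mul, idT_j12, idT_j13] at h
  have h2 : (idT G δ).comp (Bialgebra.comulAlgHom ℂ G) = coact δ := rfl
  rw [← h2, h, RibbonStarHopf.shift, RibbonStarHopf.Q, map_mul]
  simp only [← mul_assoc]
  rw [mul_assoc (j12 G A (swapT G (H.R : G ⊗[ℂ] G))), j12_R_mul_Ri, mul_one]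

theorem j12_Q_comm (X : G ⊗[ℂ] A) : Commute (comulL G A X) (j12 G A H.Q) := by
  refine commute_of_tmul (comulL G A) fun x a => ?_
  rw [comulL_tmul_eq]
  refine Commute.mul_left ?_ ?_
  · exact ((H.Q_comm x).symm).map (j12 G A)
  · refine Commute.symm (commute_of_tmul (j12 G A) fun y z => ?_)
    simp [Commute, SemiconjBy]

/-- By coassociativity the iterated coproduct commutes with `N₂₃`. Flipping the first two legs gives
commutation of the flipped element with `N₁₃`, and `R₁₂` undoes the flip. -/
theorem comulL_coact_comm_shift {δ : G →ₐ[ℂ] A} {N : G ⊗[ℂ] A} (h : ∀ x, Commute (coact δ x) N)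
    (x : G) : Commute (comulL G A (coact δ x)) (H.shift N) := by
  have h1 : Commute (comulL G A (coact δ x)) (j23 G A N) := by
    rw [coassoc_coact, coact_apply]
    refine commute_of_tmul (idT G (coact δ)) fun y z => ?_
    rw [idT_tmul, j23_apply, Commute, SemiconjBy, Algebra.TensorProduct.tmul_mul_tmul,
      Algebra.TensorProduct.tmul_mul_tmul, mul_one, one_mul, (h z).eq]
  have h2 := h1.map (swap12 G A)
  rw [swap12_j23] at h2
  have h3 := H.j12_R_mul_comulL (coact δ x)
  set W := swap12 G A (comulL G A (coact δ x))
  have h4 : comulL G A (coact δ x) * j12 G A H.Ri = j12 G A H.Ri * W := by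
    calc _ = j12 G A H.Ri * (j12 G A H.R * comulL G A (coact δ x)) * j12 G A H.Ri := by
          rw [← mul_assoc, j12_Ri_mul, one_mul]
      _ = _ := by rw [h3, mul_assoc, mul_assoc, j12_R_mul_Ri, mul_one]
  rw [Commute, SemiconjBy, RibbonStarHopf.shift, ← mul_assoc, ← mul_assoc, h4,
    mul_assoc (j12 G A H.Ri) W, h2.eq]
  simp only [mul_assoc]
  rw [h3]

/-- The `R`-matrix is invertible with respect to the product of `G` and the opposite of `G`. -/
theorem insertOp_R [FiniteDimensional ℂ G] (X Y : G ⊗[ℂ] A) :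
    insertOp (j13 G A X * j12 G A H.R * j23 G A Y) H.R = j13 G A X * j23 G A Y := by
  have h1 : ∀ y : G, Commute (1 ⊗ₜ (HopfAlgebra.antipode ℂ y ⊗ₜ 1)) (j13 G A X) := fun y => by
    refine Commute.symm (commute_of_tmul (j13 G A) fun a b => ?_)
    simp [Commute, SemiconjBy]
  have h2 : ∀ x : G, Commute (j23 G A Y) (x ⊗ₜ 1) := fun x => by
    simp [Commute, SemiconjBy]
  let mid : G ⊗[ℂ] G → G ⊗[ℂ] G →ₗ[ℂ] G ⊗[ℂ] G := fun Z => TensorProduct.lift (LinearMap.mk₂ ℂ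
      (fun x y => (1 ⊗ₜ HopfAlgebra.antipode ℂ y) * Z * (x ⊗ₜ 1))
      (fun a b y => by simp [TensorProduct.add_tmul, mul_add])
      (fun c a y => by rw [← TensorProduct.smul_tmul', mul_smul_comm])
      (fun a x y => by simp [TensorProduct.tmul_add, add_mul])
      (fun c a y => by rw [map_smul, TensorProduct.tmul_smul, smul_mul_assoc, smul_mul_assoc]))
  have hmid : ∀ Z x y, mid Z (x ⊗ₜ y) = (1 ⊗ₜ HopfAlgebra.antipode ℂ y) * Z * (x ⊗ₜ 1) :=
    fun Z x y => rfl
  -- Up to the antipode in the second leg this is `(id ⊗ S⁻¹)(R) · R = R⁻¹ R`.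
  have h4 : mid H.R H.R = 1 := by
    have h5 : ∀ Z W : G ⊗[ℂ] G, mid Z W = LinearMap.lTensor G (HopfAlgebra.antipode ℂ)
        (TensorProduct.map LinearMap.id H.antipodeInv Z * W) := by
      intro Z W
      induction W with
      | zero => simp
      | add p q hp hq => simp only [map_add, mul_add, hp, hq]
      | tmul x y =>
        rw [hmid]
        induction Z with
        | zero => simp
        | add p q hp hq => simp only [map_add, mul_add, add_mul, hp, hq]
        | tmul a b =>
          rw [TensorProduct.map_tmul, Algebra.TensorProduct.tmul_mul_tmul,
            Algebra.TensorProduct.tmul_mul_tmul, Algebra.TensorProduct.tmul_mul_tmul, one_mul,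
            mul_one, LinearMap.lTensor_tmul, HopfAlgebra.antipode_mul_antidistrib,
            antipodeInv_apply, antipode_conj]
          rfl
    rw [h5, map_antipodeInv_R, Ri_mul, Algebra.TensorProduct.one_def, LinearMap.lTensor_tmul,
      HopfAlgebra.antipode_one]
  have h5 : ∀ W : G ⊗[ℂ] G, insertOp (j13 G A X * j12 G A H.R * j23 G A Y) W =
      j13 G A X * j12 G A (mid H.R W) * j23 G A Y := by
    intro W
    induction W with
    | zero => simp
    | add p q hp hq => simp only [map_add, mul_add, add_mul, hp, hq]
    | tmul x y =>
      rw [insertOp_tmul, hmid, map_mul (j12 G A),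
        map_mul (j12 G A), mul_assoc, mul_assoc _ (j23 G A Y), (h2 x).eq, ← mul_assoc,
        ← mul_assoc, ← mul_assoc, (h1 y).eq]
      simp only [mul_assoc]
      rfl
  rw [h5, h4, map_one, mul_one]

end RibbonStarHopf
end Braiding

/-! ### Graph algebras as iterated tensor products -/

section Slices

variable {G : Type*} [Ring G] [HopfAlgebra ℂ G]
variable {A : Type*} [Ring A] [Algebra ℂ A]

/-- All the slices of an element of `G ⊗ G ⊗ A` lie in a subspace. -/
def SlicesIn (U : Submodule ℂ A) (Z : G ⊗[ℂ] (G ⊗[ℂ] A)) : Prop :=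
  ∀ f f' : G →ₗ[ℂ] ℂ, slice A f' (slice (G ⊗[ℂ] A) f Z) ∈ U

theorem slice_tmul_mul (f : G →ₗ[ℂ] ℂ) (x : G) (a : A) (Z : G ⊗[ℂ] A) :
    slice A f ((x ⊗ₜ a) * Z) = a * slice A (f ∘ₗ LinearMap.mulLeft ℂ x) Z := by
  induction Z with
  | zero => simp
  | add p q hp hq => simp only [map_add, mul_add, hp, hq]
  | tmul y b => simp

theorem slice_mul_tmul (f : G →ₗ[ℂ] ℂ) (x : G) (a : A) (Z : G ⊗[ℂ] A) :
    slice A f (Z * (x ⊗ₜ a)) = slice A (f ∘ₗ LinearMap.mulRight ℂ x) Z * a := by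
  induction Z with
  | zero => simp
  | add p q hp hq => simp only [map_add, add_mul, hp, hq]
  | tmul y b => simp

variable {U : Submodule ℂ A}

theorem SlicesIn.add {Z Z' : G ⊗[ℂ] (G ⊗[ℂ] A)} (h : SlicesIn U Z) (h' : SlicesIn U Z') :
    SlicesIn U (Z + Z') := fun f f' => by
  rw [map_add, map_add]
  exact U.add_mem (h f f') (h' f f')

theorem SlicesIn.zero : SlicesIn U (0 : G ⊗[ℂ] (G ⊗[ℂ] A)) := fun f f' => by
  rw [map_zero, map_zero]
  exact U.zero_mem

theorem SlicesIn.tmul_mul {Z : G ⊗[ℂ] (G ⊗[ℂ] A)} (h : SlicesIn U Z) (x y : G) :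
    SlicesIn U (x ⊗ₜ (y ⊗ₜ 1) * Z) := fun f f' => by
  rw [slice_tmul_mul, slice_tmul_mul, one_mul]
  exact h _ _

theorem SlicesIn.mul_tmul {Z : G ⊗[ℂ] (G ⊗[ℂ] A)} (h : SlicesIn U Z) (x y : G) :
    SlicesIn U (Z * x ⊗ₜ (y ⊗ₜ 1)) := fun f f' => by
  rw [slice_mul_tmul, slice_mul_tmul, mul_one]
  exact h _ _

theorem SlicesIn.j12_mul {Z : G ⊗[ℂ] (G ⊗[ℂ] A)} (h : SlicesIn U Z) (X : G ⊗[ℂ] G) :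
    SlicesIn U (j12 G A X * Z) := by
  induction X with
  | zero => rw [map_zero, zero_mul]; exact SlicesIn.zero
  | add p q hp hq => rw [map_add, add_mul]; exact hp.add hq
  | tmul x y => exact h.tmul_mul x y

theorem SlicesIn.mul_j12 {Z : G ⊗[ℂ] (G ⊗[ℂ] A)} (h : SlicesIn U Z) (X : G ⊗[ℂ] G) :
    SlicesIn U (Z * j12 G A X) := by
  induction X with
  | zero => rw [map_zero, mul_zero]; exact SlicesIn.zero
  | add p q hp hq => rw [map_add, mul_add]; exact hp.add hq
  | tmul x y => exact h.mul_tmul x y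

theorem SlicesIn.insertOp {Z : G ⊗[ℂ] (G ⊗[ℂ] A)} (h : SlicesIn U Z) (X : G ⊗[ℂ] G) :
    SlicesIn U (insertOp Z X) := by
  induction X with
  | zero => rw [map_zero]; exact SlicesIn.zero
  | add p q hp hq => rw [map_add]; exact hp.add hq
  | tmul x y =>
    rw [insertOp_tmul]
    exact (h.tmul_mul 1 _).mul_tmul x 1

theorem slice_j13_mul_j23 (f f' : G →ₗ[ℂ] ℂ) (X Y : G ⊗[ℂ] A) :
    slice A f' (slice (G ⊗[ℂ] A) f (j13 G A X * j23 G A Y)) = slice A f X * slice A f' Y := by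
  rw [j23_apply, slice_mul_one_tmul, slice_j13, slice_one_tmul_mul]

theorem slice_j23_mul_j13 (f f' : G →ₗ[ℂ] ℂ) (X Y : G ⊗[ℂ] A) :
    slice A f' (slice (G ⊗[ℂ] A) f (j23 G A Y * j13 G A X)) = slice A f' Y * slice A f X := by
  rw [j23_apply, slice_one_tmul_mul, slice_j13, slice_mul_one_tmul]

theorem j23_mul_j12_mul_j13 (x y : G) (X Y : G ⊗[ℂ] A) :
    j23 G A Y * j12 G A (x ⊗ₜ y) * j13 G A X =
      x ⊗ₜ (1 ⊗ₜ 1) * (j23 G A Y * j13 G A X) * 1 ⊗ₜ (y ⊗ₜ 1) := by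
  have h1 : Commute (x ⊗ₜ (1 ⊗ₜ 1)) (j23 G A Y) := by
    simp [Commute, SemiconjBy, ← Algebra.TensorProduct.one_def]
  have h2 : Commute (j13 G A X) (1 ⊗ₜ (y ⊗ₜ 1)) := by
    refine commute_of_tmul (j13 G A) fun a b => ?_
    simp [Commute, SemiconjBy]
  have h3 : j12 G A (x ⊗ₜ y) = x ⊗ₜ (1 ⊗ₜ 1) * 1 ⊗ₜ (y ⊗ₜ 1) := by simp
  rw [h3, mul_assoc, mul_assoc, ← h2.eq, ← mul_assoc, ← h1.eq]
  simp only [mul_assoc]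

end Slices

/-! ### The isomorphism of `L_{m+1}` with `G ⊗ L_m`. -/

section Model

variable {G ι : Type*} [Ring G] [HopfAlgebra ℂ G] [StarRing G] [StarModule ℂ G]
variable [FiniteDimensional ℂ G] [IsSemisimpleRing G] [Fintype ι] [DecidableEq ι]

namespace SymmetryData

variable (D : SymmetryData G ι)

/-- The conditions on the quantum dimensions and the `S`-matrix. -/
class Modular : Prop where
  qdim_pos : ∀ I, 0 < (D.qdim I).re ∧ (D.qdim I).im = 0
  isUnit_S : IsUnit D.S

/-- The universal monodromies in `G ⊗ L_m`. -/
def phiFam (m : ℕ) : Fin (m + 1) → G ⊗[ℂ] (G ⊗[ℂ] D.L m) :=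
  Fin.snoc (α := fun _ => G ⊗[ℂ] (G ⊗[ℂ] D.L m)) (fun ν => D.shift (D.N ν)) (j12 G (D.L m) D.Q)

theorem phiFam_last (m : ℕ) : D.phiFam m (Fin.last m) = j12 G (D.L m) D.Q := by
  rw [phiFam, Fin.snoc_last]

theorem phiFam_castSucc {m : ℕ} (ν : Fin m) : D.phiFam m ν.castSucc = D.shift (D.N ν) := by
  rw [phiFam, Fin.snoc_castSucc]

/-- The homomorphism `L_{m+1} → G ⊗ L_m`. -/
def phi (m : ℕ) : D.L (m + 1) →ₐ[ℂ] G ⊗[ℂ] D.L m :=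
  D.liftL (D.phiFam m)
    (fun ν => by
      refine Fin.lastCases ?_ (fun ν => ?_) ν
      · rw [phiFam_last]
        exact D.toRibbonStarHopf.isMonodromy_Q _
      · rw [phiFam_castSucc]
        exact (D.isMonodromy_N ν).shift)
    (fun ν μ => by
      refine Fin.lastCases ?_ (fun μ => ?_) μ <;> refine Fin.lastCases ?_ (fun ν => ?_) ν
      · intro h
        exact absurd h (lt_irrefl _)
      · intro _
        rw [phiFam_last, phiFam_castSucc]
        exact RibbonStarHopf.exchange_shift_Q _
      · intro h
        exact absurd h (not_lt.2 (Fin.le_last _))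
      · intro h
        rw [phiFam_castSucc, phiFam_castSucc]
        exact (D.exchange_N (Fin.castSucc_lt_castSucc_iff.1 h)).shift)

theorem idT_phi_last (m : ℕ) : idT G (D.phi m) (D.N (Fin.last m)) = j12 G (D.L m) D.Q := by
  rw [phi, idT_liftL, phiFam_last]

theorem idT_phi_castSucc {m : ℕ} (ν : Fin m) :
    idT G (D.phi m) (D.N ν.castSucc) = D.shift (D.N ν) := by
  rw [phi, idT_liftL, phiFam_castSucc]

theorem mem_range_idT (D : SymmetryData G ι) {A : Type*} [Ring A] [Algebra ℂ A] (S : Subalgebra ℂ A) (X : G ⊗[ℂ] A) :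
    X ∈ (idT G S.val).range ↔ ∀ f, slice A f X ∈ S := by
  constructor
  · rintro ⟨Y, rfl⟩ f
    change slice A f (idT G S.val Y) ∈ S
    rw [slice_idT]
    exact (slice S f Y).2
  · intro h
    rw [D.eq_sum_ev X]
    refine Subalgebra.sum_mem _ fun I _ => Subalgebra.sum_mem _ fun a _ =>
      Subalgebra.sum_mem _ fun b _ => ⟨D.E I a b ⊗ₜ ⟨_, h (D.coef I a b)⟩, ?_⟩
    rfl

/-- Factorizability puts `G ⊗ 1` into the range, through the image `Q₁₂` of the last monodromy. Then
the conjugation by `R₁₂` in the images of the other monodromies can be undone inside the range,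
which gives `1 ⊗ L_m`. -/
theorem phi_surjective [hM : D.Modular] (m : ℕ) : Function.Surjective (D.phi m) := by
  set S := (D.phi m).range with hS
  have h0 : ∀ ν, ∀ f, slice _ f (idT G (D.phi m) (D.N ν)) ∈ S := fun ν f => by
    rw [slice_idT]
    exact ⟨_, rfl⟩
  have h1 : ∀ x : G, x ⊗ₜ[ℂ] (1 : D.L m) ∈ S := by
    intro x
    obtain ⟨f, rfl⟩ := D.exists_slice_Q hM.qdim_pos hM.isUnit_S x
    rw [← slice_j12, ← idT_phi_last]
    exact h0 _ _
  have h2 : ∀ X : G ⊗[ℂ] G, j12 G (D.L m) X ∈ (idT G S.val).range := fun X => by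
    rw [D.mem_range_idT]
    intro f
    rw [slice_j12]
    exact h1 _
  have h3 : ∀ ν : Fin m, j13 G (D.L m) (D.N ν) ∈ (idT G S.val).range := fun ν => by
    have h4 : D.shift (D.N ν) ∈ (idT G S.val).range := by
      rw [D.mem_range_idT, ← idT_phi_castSucc]
      exact h0 _
    have h5 : j13 G (D.L m) (D.N ν) = j12 G (D.L m) D.R * D.shift (D.N ν) *
        j12 G (D.L m) D.toRibbonStarHopf.Ri := by
      rw [RibbonStarHopf.shift]
      simp only [← mul_assoc]
      rw [RibbonStarHopf.j12_R_mul_Ri, one_mul, mul_assoc, RibbonStarHopf.j12_R_mul_Ri, mul_one]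
    rw [h5]
    exact Subalgebra.mul_mem _ (Subalgebra.mul_mem _ (h2 _) h4) (h2 _)
  have h4 : S.comap (Algebra.TensorProduct.includeRight : D.L m →ₐ[ℂ] G ⊗[ℂ] D.L m) = ⊤ := by
    refine D.adjoin_slice_N _ fun ν f => ?_
    change 1 ⊗ₜ[ℂ] slice (D.L m) f (D.N ν) ∈ S
    rw [← slice_j13]
    exact (D.mem_range_idT S _).1 (h3 ν) f
  intro Z
  change Z ∈ S
  induction Z with
  | zero => exact S.zero_mem
  | add p q hp hq => exact S.add_mem hp hq
  | tmul x X =>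
    have h5 : X ∈ S.comap (Algebra.TensorProduct.includeRight : D.L m →ₐ[ℂ] G ⊗[ℂ] D.L m) := by
      rw [h4]
      trivial
    have h6 := S.mul_mem (h1 x) h5
    change x ⊗ₜ[ℂ] 1 * 1 ⊗ₜ[ℂ] X ∈ S at h6
    rwa [Algebra.TensorProduct.tmul_mul_tmul, mul_one, one_mul] at h6

/-- The embedding `L_m → L_{m+1}` of the graph algebra of the first `m` punctures. -/
def emb (m : ℕ) : D.L m →ₐ[ℂ] D.L (m + 1) :=
  D.liftL (fun ν => D.N ν.castSucc) (fun _ => D.isMonodromy_N _)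
    (fun _ _ h => D.exchange_N (Fin.castSucc_lt_castSucc_iff.2 h))

theorem idT_emb {m : ℕ} (ν : Fin m) : idT G (D.emb m) (D.N ν) = D.N ν.castSucc := by
  rw [emb, idT_liftL]

/-- `f ⊗ X ↦ (f ⊗ id)(N_last) X`. -/
def spanMap (m : ℕ) : (G →ₗ[ℂ] ℂ) ⊗[ℂ] D.L m →ₗ[ℂ] D.L (m + 1) :=
  TensorProduct.lift (LinearMap.mk₂ ℂ
    (fun f X => slice (D.L (m + 1)) f (D.N (Fin.last m)) * D.emb m X)
    (fun f f' X => by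
      have := slice_sum (A := D.L (m + 1)) Finset.univ (fun _ => 1) ![f, f'] (D.N (Fin.last m))
      simp only [Fin.sum_univ_two, one_smul, Matrix.cons_val_zero, Matrix.cons_val_one] at this
      rw [this, add_mul])
    (fun c f X => by
      have := slice_sum (A := D.L (m + 1)) (Finset.univ : Finset (Fin 1)) (fun _ => c) ![f]
        (D.N (Fin.last m))
      simp only [Fin.sum_univ_one, Matrix.cons_val_zero] at this
      rw [this, smul_mul_assoc])
    (fun f X Y => by rw [map_add, mul_add])
    (fun c f X => by rw [map_smul, mul_smul_comm]))

theorem spanMap_tmul {m : ℕ} (f : G →ₗ[ℂ] ℂ) (X : D.L m) : D.spanMap m (f ⊗ₜ X) =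
    slice (D.L (m + 1)) f (D.N (Fin.last m)) * D.emb m X := rfl

/-- Normal ordering: one slice of the last monodromy, followed by an element of the first `m`
punctures, spans everything. This bounds the dimension of `L_{m+1}` by that of `G ⊗ L_m`. -/
theorem spanMap_surjective (m : ℕ) : Function.Surjective (D.spanMap m) := by
  set U := LinearMap.range (D.spanMap m) with hU
  have hN : ∀ f X, slice (D.L (m + 1)) f (D.N (Fin.last m)) * D.emb m X ∈ U := fun f X =>
    ⟨f ⊗ₜ X, rfl⟩
  have hN1 : ∀ f, slice (D.L (m + 1)) f (D.N (Fin.last m)) ∈ U := fun f => by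
    have := hN f 1
    rwa [map_one, mul_one] at this
  have hr : ∀ u ∈ U, ∀ X, u * D.emb m X ∈ U := by
    rintro u ⟨t, rfl⟩ X
    induction t with
    | zero => rw [map_zero, zero_mul]; exact U.zero_mem
    | add p q hp hq => rw [map_add, add_mul]; exact U.add_mem hp hq
    | tmul f Y => rw [spanMap_tmul, mul_assoc, ← map_mul]; exact hN _ _
  -- The relations reorder only `N_ν R N_last`, with an `R`-matrix in between; `insertOp_R` removes
  -- it afterwards without leaving the ordered span. For `ν` the last puncture functoriality is
  -- used, otherwise exchange.
  have key : ∀ (ν : Fin (m + 1)) (f f' : G →ₗ[ℂ] ℂ),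
      slice (D.L (m + 1)) f (D.N ν) * slice (D.L (m + 1)) f' (D.N (Fin.last m)) ∈ U := by
    intro ν f f'
    have h1 : SlicesIn U (j13 G _ (D.N ν) * j12 G _ D.R * j23 G _ (D.N (Fin.last m))) := by
      refine Fin.lastCases ?_ (fun ν => ?_) ν
      · have h2 := (D.isMonodromy_N (Fin.last m)).fusion
        have h3 : j13 G _ (D.N (Fin.last m)) * j12 G _ D.R * j23 G _ (D.N (Fin.last m)) =
            j12 G _ D.R * comulL G _ (D.N (Fin.last m)) := by
          rw [← h2]
          simp only [← mul_assoc]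
          rw [RibbonStarHopf.j12_R_mul_Ri, one_mul]
        rw [h3]
        refine SlicesIn.j12_mul (fun f f' => ?_) _
        rw [slice_comulL]
        exact hN1 _
      · have h2 := (D.exchange_N (Fin.castSucc_lt_last ν)).eq
        have h3 : j13 G _ (D.N ν.castSucc) * j12 G _ D.R * j23 G _ (D.N (Fin.last m)) =
            j12 G _ D.R * ((j23 G _ (D.N (Fin.last m)) * j12 G _ D.toRibbonStarHopf.Ri *
              j13 G _ (D.N ν.castSucc)) * j12 G _ D.R) := by
          rw [mul_assoc (j23 G _ (D.N (Fin.last m))), mul_assoc (j23 G _ (D.N (Fin.last m))), ← h2]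
          simp only [← mul_assoc]
          rw [RibbonStarHopf.j12_R_mul_Ri, one_mul]
        rw [h3]
        refine SlicesIn.j12_mul (SlicesIn.mul_j12 ?_ _) _
        have h4 : ∀ W : G ⊗[ℂ] G, SlicesIn U (j23 G _ (D.N (Fin.last m)) * j12 G _ W *
            j13 G _ (D.N ν.castSucc)) := by
          intro W
          induction W with
          | zero => rw [map_zero, mul_zero, zero_mul]; exact SlicesIn.zero
          | add p q hp hq => rw [map_add, mul_add, add_mul]; exact hp.add hq
          | tmul x y =>
            rw [j23_mul_j12_mul_j13]
            refine (SlicesIn.tmul_mul (fun f f' => ?_) x 1).mul_tmul 1 y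
            rw [slice_j23_mul_j13, ← idT_emb, slice_idT]
            exact hN _ _
        exact h4 _
    have h2 := (h1.insertOp D.R) f f'
    rwa [RibbonStarHopf.insertOp_R, slice_j13_mul_j23] at h2
  -- The left stabilizer of the ordered span contains the generators, so the span is a left ideal.
  let S : Subalgebra ℂ (D.L (m + 1)) :=
    { carrier := {Y | ∀ u ∈ U, Y * u ∈ U}
      mul_mem' := fun {a b} ha hb u hu => by rw [mul_assoc]; exact ha _ (hb _ hu)
      add_mem' := fun {a b} ha hb u hu => by rw [add_mul]; exact U.add_mem (ha _ hu) (hb _ hu)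
      algebraMap_mem' := fun c u hu => by
        rw [← Algebra.smul_def]
        exact U.smul_mem c hu }
  have hS : S = ⊤ := by
    refine D.adjoin_slice_N S fun ν f => ?_
    rintro u ⟨t, rfl⟩
    induction t with
    | zero => rw [map_zero, mul_zero]; exact U.zero_mem
    | add p q hp hq => rw [map_add, mul_add]; exact U.add_mem hp hq
    | tmul f' Y =>
      rw [spanMap_tmul, ← mul_assoc]
      exact hr _ (key ν f f') Y
  intro Y
  have hY : Y ∈ S := by rw [hS]; trivial
  -- The slice of the last monodromy by the counit is `1`.
  have h1 : (1 : D.L (m + 1)) ∈ U := by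
    have := hN1 Coalgebra.counit
    have h2 : slice (D.L (m + 1)) Coalgebra.counit (D.N (Fin.last m)) =
        counitL G _ (D.N (Fin.last m)) := rfl
    rwa [h2, (D.isMonodromy_N _).counit] at this
  have := hY 1 h1
  rwa [mul_one] at this

/-- `L_0` is trivial. -/
def counit₀ : D.L 0 →ₐ[ℂ] ℂ := D.liftL (A := ℂ) Fin.elim0 (fun ν => ν.elim0) (fun ν => ν.elim0)

theorem algebraMap_L_zero (X : D.L 0) : X = algebraMap ℂ _ (D.counit₀ X) := by
  have h : (Algebra.ofId ℂ (D.L 0)).comp D.counit₀ = AlgHom.id ℂ _ :=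
    D.hom_ext fun ν => ν.elim0
  exact (DFunLike.congr_fun h X).symm

instance finiteDimensional_L (m : ℕ) : FiniteDimensional ℂ (D.L m) := by
  induction m with
  | zero =>
    refine Module.Finite.of_surjective (Algebra.linearMap ℂ (D.L 0)) fun X => ?_
    exact ⟨_, (D.algebraMap_L_zero X).symm⟩
  | succ m ih => exact Module.Finite.of_surjective (D.spanMap m) (D.spanMap_surjective m)

/-- The composite of `spanMap` and `phi` is a surjection between spaces of equal finite dimension,
hence injective; since `spanMap` is onto, `phi` is injective. -/
theorem phi_injective [D.Modular] (m : ℕ) : Function.Injective (D.phi m) := by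
  have h1 : Function.Surjective ((D.phi m).toLinearMap ∘ₗ D.spanMap m) :=
    (D.phi_surjective m).comp (D.spanMap_surjective m)
  have h2 : Module.finrank ℂ ((G →ₗ[ℂ] ℂ) ⊗[ℂ] D.L m) = Module.finrank ℂ (G ⊗[ℂ] D.L m) := by
    rw [Module.finrank_tensorProduct, Module.finrank_tensorProduct]
    congr 1
    exact Subspace.dual_finrank_eq
  have h3 := (LinearMap.injective_iff_surjective_of_finrank_eq_finrank h2).2 h1
  rw [injective_iff_map_eq_zero]
  intro Y hY
  obtain ⟨t, rfl⟩ := D.spanMap_surjective m Y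
  have h4 : ((D.phi m).toLinearMap ∘ₗ D.spanMap m) t = 0 := hY
  rw [(injective_iff_map_eq_zero _).1 h3 t h4, map_zero]

/-- The isomorphism `L_{m+1} ≃ G ⊗ L_m`. -/
def phiE [D.Modular] (m : ℕ) : D.L (m + 1) ≃ₐ[ℂ] G ⊗[ℂ] D.L m :=
  AlgEquiv.ofBijective (D.phi m) ⟨D.phi_injective m, D.phi_surjective m⟩

theorem phiE_apply [D.Modular] (m : ℕ) (X : D.L (m + 1)) : D.phiE m X = D.phi m X := rfl

end SymmetryData
end Model

/-! ### The quantum moment map -/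

section Moment

variable {G ι : Type*} [Ring G] [HopfAlgebra ℂ G] [StarRing G] [StarModule ℂ G]
variable [FiniteDimensional ℂ G] [IsSemisimpleRing G] [Fintype ι] [DecidableEq ι]
variable {A : Type*} [Ring A] [Algebra ℂ A] {B : Type*} [Ring B] [Algebra ℂ B]

theorem comp_coact (f : A →ₐ[ℂ] B) (δ : G →ₐ[ℂ] A) (x : G) :
    idT G f (coact δ x) = coact (f.comp δ) x := by
  rw [coact_apply, coact_apply, idT_comp]

theorem idT_injective {f : A →ₐ[ℂ] B} (hf : Function.Injective f) :
    Function.Injective (idT G f) :=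
  Module.Flat.lTensor_preserves_injective_linearMap (M := G) f.toLinearMap hf

theorem Commute.of_injective {f : A →ₐ[ℂ] B} (hf : Function.Injective f) {x y : A}
    (h : Commute (f x) (f y)) : Commute x y := by
  apply hf
  rw [map_mul, map_mul, h.eq]

namespace SymmetryData

variable (D : SymmetryData G ι) [hM : D.Modular]

/-- The quantum moment map `G → L_m`. -/
def delta : ∀ m : ℕ, G →ₐ[ℂ] D.L m
  | 0 => (Algebra.ofId ℂ (D.L 0)).comp (Bialgebra.counitAlgHom ℂ G)
  | m + 1 => (D.phiE m).symm.toAlgHom.comp (coact (delta m))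

theorem delta_zero (x : G) : D.delta 0 x = algebraMap ℂ _ (Coalgebra.counit (R := ℂ) x) := rfl

theorem phi_delta (m : ℕ) (x : G) : D.phi m (D.delta (m + 1) x) = coact (D.delta m) x :=
  (D.phiE m).apply_symm_apply _

theorem phi_comp_delta (m : ℕ) : (D.phi m).comp (D.delta (m + 1)) = coact (D.delta m) := by
  ext x
  exact D.phi_delta m x

/-- Covariance of the monodromies with respect to the moment map. -/
theorem coact_delta_comm_N {m : ℕ} (ν : Fin m) (x : G) :
    Commute (coact (D.delta m) x) (D.N ν) := by
  induction m generalizing x with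
  | zero => exact ν.elim0
  | succ m ih =>
    refine Commute.of_injective (idT_injective (D.phi_injective m)) ?_
    rw [comp_coact, phi_comp_delta, ← coassoc_coact]
    refine Fin.lastCases ?_ (fun ν => ?_) ν
    · rw [idT_phi_last]
      exact RibbonStarHopf.j12_Q_comm _
    · rw [idT_phi_castSucc]
      exact RibbonStarHopf.comulL_coact_comm_shift (ih ν) x

/-- The product of the monodromies. -/
def totalN (m : ℕ) : G ⊗[ℂ] D.L m := (List.ofFn fun ν : Fin m => D.N ν).reverse.prod

/-- By induction the product is mapped to `Q₁₂` times the shift of `(id ⊗ delta)(Q)`, which is `(id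
⊗ Δ)(Q)` with the moment map applied (`Q_mul_shift`). -/
theorem totalN_eq (m : ℕ) : D.totalN m = idT G (D.delta m) D.Q := by
  induction m with
  | zero =>
    have h : ∀ X : G ⊗[ℂ] G, idT G (D.delta 0) X =
        counitL G G (swapT G X) ⊗ₜ 1 := by
      intro X
      induction X with
      | zero => simp
      | add p q hp hq => simp only [map_add, hp, hq, TensorProduct.add_tmul]
      | tmul x y =>
        rw [idT_tmul, delta_zero, swapT_tmul, counitL_tmul, Algebra.algebraMap_eq_smul_one,
          TensorProduct.smul_tmul]
    rw [h, RibbonStarHopf.Q, map_mul, map_mul, swapT_swapT, RibbonStarHopf.counitL_swapT_R,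
      RibbonStarHopf.counitL_R, one_mul, ← Algebra.TensorProduct.one_def]
    rfl
  | succ m ih =>
    have h0 : D.totalN (m + 1) = D.N (Fin.last m) * idT G (D.emb m) (D.totalN m) := by
      rw [totalN, List.ofFn_succ', List.concat_eq_append, List.reverse_append,
        List.reverse_singleton, List.singleton_append, List.prod_cons, totalN, map_list_prod,
        List.map_reverse, List.map_ofFn]
      congr 4
      funext ν
      exact (D.idT_emb ν).symm
    apply idT_injective (D.phi_injective m)
    -- `shift` is a conjugation and therefore multiplicative along the product.
    have h1 : idT G (D.phi m) (idT G (D.emb m) (D.totalN m)) = D.shift (D.totalN m) := by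
      rw [totalN, map_list_prod, map_list_prod, List.map_map]
      have h2 : ∀ l : List (Fin m), (List.map (idT G (D.phi m) ∘ idT G (D.emb m))
          (l.map D.N)).prod = D.shift (l.map D.N).prod := by
        intro l
        induction l with
        | nil => simp [RibbonStarHopf.shift, RibbonStarHopf.j12_Ri_mul]
        | cons ν l ihl =>
          simp only [List.map_cons, List.prod_cons, Function.comp_apply] at ihl ⊢
          rw [idT_emb, idT_phi_castSucc, ihl, RibbonStarHopf.shift, RibbonStarHopf.shift,
            RibbonStarHopf.shift, map_mul]
          simp only [mul_assoc]
          rw [← mul_assoc (j12 G (D.L m) (D.R : G ⊗[ℂ] G)), RibbonStarHopf.j12_R_mul_Ri, one_mul]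
      have h3 := h2 (List.ofFn fun ν : Fin m => ν).reverse
      rw [List.map_reverse, List.map_ofFn] at h3
      exact h3
    rw [h0, map_mul, h1, idT_phi_last, ih, RibbonStarHopf.Q_mul_shift, idT_comp, phi_comp_delta]

theorem c_eq {m : ℕ} (ν : Fin m) (I : ι) : D.c ν I = slice (D.L m) (D.tq I) (D.N ν) := by
  rw [← qtr_eq, ev_N, c, qtr, qtr, Matrix.smul_mul, Matrix.trace_smul]

theorem ev_totalN (m : ℕ) (I : ι) : D.ev (D.L m) I (D.totalN m) =
    D.κ I ^ m • (List.ofFn fun ν : Fin m => D.M ν I).reverse.prod := by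
  rw [totalN, map_list_prod]
  have h : ∀ l : List (Fin m), (List.map (D.ev (D.L m) I) (l.map D.N)).prod =
      D.κ I ^ l.length • (l.map fun ν => D.M ν I).prod := by
    intro l
    induction l with
    | nil => simp
    | cons ν l ih =>
      simp only [List.map_cons, List.prod_cons, List.length_cons]
      rw [ih, ev_N, smul_mul_smul_comm, pow_succ']
  have h2 := h (List.ofFn fun ν : Fin m => ν).reverse
  simp only [List.map_reverse, List.map_ofFn, List.length_reverse, List.length_ofFn] at h2
  rw [List.map_reverse, List.map_ofFn]
  exact h2

/-- The powers of `κ_I` in `c₀` and `total` are exactly those with which `totalN` evaluates to the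
product of the `M_ν^I`. -/
theorem c₀_eq (m : ℕ) (I : ι) : D.c₀ m I = D.delta m (D.z I) := by
  have h : D.c₀ m I = D.qtr I (D.ev (D.L m) I (D.totalN m)) := by
    rw [ev_totalN, c₀, total, qtr, qtr, Matrix.smul_mul, Matrix.smul_mul, Matrix.trace_smul,
      Matrix.trace_smul, smul_smul, zpow_sub_one₀ (D.κ_ne_zero I), zpow_natCast, mul_comm,
      inv_mul_cancel_right₀ (D.κ_ne_zero I)]
  rw [h, qtr_eq, totalN_eq, slice_idT]
  rfl

theorem χ₀_eq (m : ℕ) (K : ι) : D.χ₀ m K = D.delta m (D.e K) := by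
  simp only [χ₀, c₀_eq, ← D.sum_chiCoeff_z hM.qdim_pos hM.isUnit_S K, map_sum, map_smul]

theorem phi_χ_last (m : ℕ) (K : ι) : D.phi m (D.χ (Fin.last m) K) = D.e K ⊗ₜ 1 := by
  have h : ∀ I, D.phi m (D.c (Fin.last m) I) = D.z I ⊗ₜ 1 := fun I => by
    rw [c_eq, ← slice_idT, idT_phi_last, slice_j12]
    rfl
  simp only [χ, map_sum, map_smul, h, ← D.sum_chiCoeff_z hM.qdim_pos hM.isUnit_S K,
    TensorProduct.sum_tmul, TensorProduct.smul_tmul']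

/-- The quantum trace does not see the conjugation by `R₁₂`. -/
theorem phi_χ_castSucc {m : ℕ} (ν : Fin m) (K : ι) :
    D.phi m (D.χ ν.castSucc K) = 1 ⊗ₜ D.χ ν K := by
  have h : ∀ I, D.phi m (D.c ν.castSucc I) = 1 ⊗ₜ D.c ν I := fun I => by
    rw [c_eq, ← slice_idT, idT_phi_castSucc, RibbonStarHopf.shift,
      RibbonStarHopf.slice_conj _ (D.isTwistedTrace_tq I), ← c_eq]
  simp only [χ, map_sum, map_smul, h, TensorProduct.tmul_sum, TensorProduct.tmul_smul]

/-- The product of the characteristic projectors of the punctures. -/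
def chiProd {m : ℕ} (K : Fin m → ι) : D.L m := (List.ofFn fun ν => D.χ ν (K ν)).prod

theorem phi_chiProd {m : ℕ} (K : Fin (m + 1) → ι) : D.phi m (D.chiProd K) =
    D.e (K (Fin.last m)) ⊗ₜ D.chiProd fun ν => K ν.castSucc := by
  rw [chiProd, List.ofFn_succ', List.concat_eq_append, List.prod_append, map_mul,
    List.prod_singleton, phi_χ_last, map_list_prod, List.map_ofFn]
  have h : (List.ofFn (D.phi m ∘ fun ν : Fin m => D.χ ν.castSucc (K ν.castSucc))).prod =
      1 ⊗ₜ D.chiProd fun ν => K ν.castSucc := by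
    have h1 : (D.phi m ∘ fun ν : Fin m => D.χ ν.castSucc (K ν.castSucc)) =
        (Algebra.TensorProduct.includeRight : D.L m →ₐ[ℂ] G ⊗[ℂ] D.L m) ∘
          fun ν => D.χ ν (K ν.castSucc) := by
      funext ν
      exact D.phi_χ_castSucc _ _
    rw [h1, ← List.map_ofFn, ← map_list_prod]
    rfl
  rw [h, Algebra.TensorProduct.tmul_mul_tmul, one_mul, mul_one]

/-- Under `phi` the product of the projectors is `e_K ⊗ (central)`, by induction. -/
theorem chiProd_comm {m : ℕ} (K : Fin m → ι) (X : D.L m) : Commute (D.chiProd K) X := by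
  induction m with
  | zero =>
    rw [D.algebraMap_L_zero X]
    exact (Algebra.commutes _ _).symm
  | succ m ih =>
    refine Commute.of_injective (D.phi_injective m) ?_
    rw [phi_chiProd]
    generalize D.phi m X = Y
    induction Y with
    | zero => exact Commute.zero_right _
    | add p q hp hq => exact hp.add_right hq
    | tmul x y =>
      rw [Commute, SemiconjBy, Algebra.TensorProduct.tmul_mul_tmul,
        Algebra.TensorProduct.tmul_mul_tmul, (ih _ y).eq, IrrepSystem.e_comm]

theorem chiProd_idem {m : ℕ} (K : Fin m → ι) : D.chiProd K * D.chiProd K = D.chiProd K := by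
  induction m with
  | zero => simp [chiProd]
  | succ m ih =>
    apply D.phi_injective m
    rw [map_mul, phi_chiProd, Algebra.TensorProduct.tmul_mul_tmul, ih, IrrepSystem.e_mul_e,
      if_pos rfl]

theorem moduliUnit_eq {m : ℕ} (K : Fin m → ι) :
    D.moduliUnit K = D.delta m (D.e D.triv) * D.chiProd K := by
  rw [moduliUnit, χ₀_eq, chiProd]

theorem moduliUnit_idem {m : ℕ} (K : Fin m → ι) :
    D.moduliUnit K * D.moduliUnit K = D.moduliUnit K := by
  rw [moduliUnit_eq, mul_assoc, ← mul_assoc (D.chiProd K), (D.chiProd_comm K _).eq,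
    mul_assoc (D.delta m _), chiProd_idem, ← mul_assoc, ← map_mul, IrrepSystem.e_mul_e, if_pos rfl]

/-! ### Invariants -/

/-- Invertibility is visible after `phi`, where the monodromies are built from `R`, `R'` and earlier
monodromies. It gives meaning to the inverse in `Mstar`. -/
theorem isUnit_N {m : ℕ} (ν : Fin m) : IsUnit (D.N ν) := by
  induction m with
  | zero => exact ν.elim0
  | succ m ih =>
    have h1 : IsUnit (idT G (D.phi m) (D.N ν)) := by
      have hR : ∀ X : (G ⊗[ℂ] G)ˣ, IsUnit (j12 G (D.L m) (X : G ⊗[ℂ] G)) := fun X =>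
        X.isUnit.map _
      refine Fin.lastCases ?_ (fun ν => ?_) ν
      · rw [idT_phi_last, RibbonStarHopf.Q, map_mul]
        exact IsUnit.mul ((D.R.isUnit.map (swapT G)).map _) (hR _)
      · rw [idT_phi_castSucc, RibbonStarHopf.shift]
        exact IsUnit.mul (IsUnit.mul (hR _) ((ih ν).map _)) (hR _)
    have h2 := h1.map (idT G (D.phiE m).symm.toAlgHom)
    rw [idT_comp] at h2
    have h3 : (D.phiE m).symm.toAlgHom.comp (D.phi m) = AlgHom.id ℂ _ := by
      ext X
      exact (D.phiE m).symm_apply_apply X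
    rwa [h3, idT_id] at h2

theorem mul_constConv_apply (F : G →ₗ[ℂ] A) (X : A) (x : G) :
    (WithConv.toConv F * constConv G A X).ofConv x = F x * X := by
  have r := Coalgebra.Repr.arbitrary ℂ x
  rw [r.convMul_apply]
  have h := congrArg (fun Y => F (TensorProduct.rid ℂ G Y) * X)
    (Coalgebra.sum_tmul_counit_eq (R := ℂ) r)
  simp only [map_sum, TensorProduct.rid_tmul, map_smul, one_smul, Finset.sum_mul] at h
  rw [← h]
  refine Finset.sum_congr rfl fun i _ => ?_
  rw [constConv_apply, mul_smul_comm, smul_mul_assoc]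

theorem constConv_mul_apply (F : G →ₗ[ℂ] A) (X : A) (x : G) :
    (constConv G A X * WithConv.toConv F).ofConv x = X * F x := by
  have r := Coalgebra.Repr.arbitrary ℂ x
  rw [r.convMul_apply]
  have h := congrArg (fun Y => X * F Y) (Coalgebra.sum_counit_smul (R := ℂ) r)
  simp only [map_sum, map_smul, Finset.mul_sum] at h
  rw [← h]
  refine Finset.sum_congr rfl fun i _ => ?_
  rw [constConv_apply, mul_smul_comm, smul_mul_assoc]

theorem U_mul_apply (F : G →ₐ[ℂ] A) (I : ι) (a b : Fin (D.n I)) (x : G) :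
    (D.U A I a b * WithConv.toConv F.toLinearMap).ofConv x =
      slice A (D.coef I a b) (coact F x) := by
  have r := Coalgebra.Repr.arbitrary ℂ x
  rw [r.convMul_apply, coact_apply, ← r.eq, map_sum, map_sum]
  refine Finset.sum_congr rfl fun i _ => ?_
  rw [idT_tmul, slice_tmul, U, conv_apply, ← Algebra.smul_def]
  rfl

/-- The invariants are the commutant of the image of the moment map. -/
theorem mem_invariants {m : ℕ} (X : D.L m) :
    X ∈ D.invariants m ↔ ∀ x, Commute (D.delta m x) X := by
  let U : WithConv (G →ₗ[ℂ] D.L m) := WithConv.toConv (D.delta m).toLinearMap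
  let V : WithConv (G →ₗ[ℂ] D.L m) :=
    WithConv.toConv ((D.delta m).toLinearMap ∘ₗ HopfAlgebra.antipode ℂ)
  have hUV : U * V = 1 := by
    ext x
    have r := Coalgebra.Repr.arbitrary ℂ x
    rw [r.convMul_apply]
    have h := congrArg (D.delta m) (HopfAlgebra.sum_mul_antipode_eq_smul (R := ℂ) r)
    simp only [map_sum, map_mul, map_smul, map_one] at h
    refine h.trans ?_
    simp [Algebra.algebraMap_eq_smul_one]
  have hVU : V * U = 1 := by
    ext x
    have r := Coalgebra.Repr.arbitrary ℂ x
    rw [r.convMul_apply]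
    have h := congrArg (D.delta m) (HopfAlgebra.sum_antipode_mul_eq_smul (R := ℂ) r)
    simp only [map_sum, map_mul, map_smul, map_one] at h
    refine h.trans ?_
    simp [Algebra.algebraMap_eq_smul_one]
  -- `ψ(X)` is `ξ ↦ ∑ delta(ξ¹) X delta(S(ξ²))`, the adjoint action through the moment map. It
  -- agrees with the given action because both are homomorphisms that coincide on generators.
  let ψ : D.L m →ₐ[ℂ] WithConv (G →ₗ[ℂ] D.L m) := AlgHom.ofLinearMap
    (LinearMap.mulLeft ℂ U ∘ₗ LinearMap.mulRight ℂ V ∘ₗ (constConv G (D.L m)).toLinearMap)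
    (by
      change U * (constConv G (D.L m) 1 * V) = 1
      rw [map_one, one_mul, hUV])
    (fun X Y => by
      change U * (constConv G (D.L m) (X * Y) * V) =
        U * (constConv G (D.L m) X * V) * (U * (constConv G (D.L m) Y * V))
      simp only [map_mul, mul_assoc]
      rw [← mul_assoc V U, hVU, one_mul])
  have hψ : D.actHom m = ψ := by
    refine AlgHom.ext_of_adjoin_eq_top (D.adjoin_M m) ?_
    rintro X ⟨ν, I, a, b, rfl⟩
    rw [actHom_M]
    change _ = U * (constConv G (D.L m) (D.M ν I a b) * V)
    -- This is the covariance `coact_delta_comm_N`, read as an identity of functions of `ξ` and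
    -- multiplied by the convolution inverse of the moment map.
    have hc : D.U (D.L m) I * ((D.M ν I).map fun y => U * (constConv G (D.L m) y * V)) =
        (D.M ν I).map (constConv G (D.L m)) * D.U (D.L m) I := by
      ext1 i j
      have h5 : ∀ y : WithConv (G →ₗ[ℂ] D.L m), y * U * V = y := fun y => by
        rw [mul_assoc, hUV, mul_one]
      rw [← h5 (((D.M ν I).map (constConv G (D.L m)) * D.U (D.L m) I) i j)]
      simp only [Matrix.mul_apply, Matrix.map_apply, ← mul_assoc, Finset.sum_mul]
      rw [← Finset.sum_mul, ← Finset.sum_mul]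
      congr 1
      ext x
      have h6 := congrArg (fun Z => D.ev (D.L m) I Z i j) (D.coact_delta_comm_N ν x).eq
      simp only [map_mul, ev_N, Matrix.mul_smul, Matrix.smul_mul, Matrix.smul_apply] at h6
      have h7 := smul_right_injective _ (D.κ_ne_zero I) h6
      simp only [Matrix.mul_apply, IrrepSystem.ev_apply, ← U_mul_apply] at h7
      simp only [WithConv.ofConv_sum, LinearMap.sum_apply]
      refine Eq.trans ?_ (h7.trans ?_)
      · refine Finset.sum_congr rfl fun k _ => ?_
        exact mul_constConv_apply (D.U (D.L m) I i k * U).ofConv _ x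
      · refine Finset.sum_congr rfl fun k _ => ?_
        rw [mul_assoc]
        exact (constConv_mul_apply (D.U (D.L m) I k j * U).ofConv _ x).symm
    have h5 := congrArg (D.Uinv (D.L m) I * ·) hc
    simp only [← Matrix.mul_assoc, Uinv_mul_U, Matrix.one_mul] at h5
    rw [dress, ← h5]
    rfl
  have h1 : X ∈ D.invariants m ↔ D.actHom m X = constConv G (D.L m) X := by
    constructor
    · intro h
      ext ξ
      exact h ξ
    · intro h ξ
      rw [act, h]
      rfl
  -- Invariance `U X V = X` is the same as `U X = X U`.
  have h2 : D.actHom m X = constConv G (D.L m) X ↔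
      U * constConv G (D.L m) X = constConv G (D.L m) X * U := by
    rw [hψ]
    change U * (constConv G (D.L m) X * V) = _ ↔ _
    constructor
    · intro h
      conv_rhs => rw [← h]
      simp only [mul_assoc]
      rw [hVU, mul_one]
    · intro h
      rw [← mul_assoc, h, mul_assoc, hUV, mul_one]
  have h3 : ∀ x, (U * constConv G (D.L m) X).ofConv x = D.delta m x * X := by
    intro x
    exact mul_constConv_apply _ X x
  have h4 : ∀ x, (constConv G (D.L m) X * U).ofConv x = X * D.delta m x := by
    intro x
    exact constConv_mul_apply _ X x
  rw [h1, h2]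
  constructor
  · intro h x
    rw [Commute, SemiconjBy, ← h3, ← h4, h]
  · intro h
    ext x
    rw [h3, h4, (h x).eq]

end SymmetryData
end Moment

/-! ### Moduli algebras as corners -/

section Corner

variable {G ι : Type*} [Ring G] [HopfAlgebra ℂ G] [StarRing G] [StarModule ℂ G]
variable [FiniteDimensional ℂ G] [IsSemisimpleRing G] [Fintype ι] [DecidableEq ι]

theorem comulL_tmul_one {A : Type*} [Ring A] [Algebra ℂ A] (x : G) :
    comulL G A (x ⊗ₜ 1) = j12 G A (Coalgebra.comul (R := ℂ) x) := by
  rw [comulL_tmul_eq, ← Algebra.TensorProduct.one_def, ← Algebra.TensorProduct.one_def, mul_one]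

theorem comulL_mul_comul_comm {A : Type*} [Ring A] [Algebra ℂ A] {x : G}
    (hx : ∀ y, x * y = y * x) (Z : G ⊗[ℂ] A) :
    Commute (comulL G A Z) (j12 G A (Coalgebra.comul (R := ℂ) x)) := by
  rw [← comulL_tmul_one]
  refine Commute.map (f := comulL G A) ?_
  exact (SymmetryData.j12_tmul_comm hx Z).symm

namespace SymmetryData

variable (D : SymmetryData G ι) [hM : D.Modular]

theorem delta_mul_e_triv {m : ℕ} (x : G) : D.delta m x * D.delta m (D.e D.triv) =
    Coalgebra.counit (R := ℂ) x • D.delta m (D.e D.triv) := by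
  rw [← map_mul, IrrepSystem.mul_e_triv, map_smul]

theorem e_triv_mul_delta {m : ℕ} (x : G) : D.delta m (D.e D.triv) * D.delta m x =
    Coalgebra.counit (R := ℂ) x • D.delta m (D.e D.triv) := by
  rw [← map_mul, IrrepSystem.e_comm, IrrepSystem.mul_e_triv, map_smul]

variable {D}

theorem delta_mul_of_corner {m : ℕ} {K : Fin m → ι} {X : D.L m} (h : D.moduliUnit K * X = X)
    (x : G) : D.delta m x * X = Coalgebra.counit (R := ℂ) x • X := by
  rw [← h, moduliUnit_eq, mul_assoc, ← mul_assoc, delta_mul_e_triv, smul_mul_assoc]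

theorem mul_delta_of_corner {m : ℕ} {K : Fin m → ι} {X : D.L m} (h : X * D.moduliUnit K = X)
    (x : G) : X * D.delta m x = Coalgebra.counit (R := ℂ) x • X := by
  rw [← h, moduliUnit_eq, (D.chiProd_comm K _).symm.eq, ← mul_assoc, mul_assoc _ _ (D.delta m x),
    e_triv_mul_delta, mul_smul_comm]

/-- An element of the corner is automatically invariant, since `delta(x)` multiplies the projector
by `ε(x)` from either side. Conversely the projector commutes with invariant elements. -/
theorem mem_moduli {m : ℕ} {K : Fin m → ι} {X : D.L m} :
    X ∈ D.moduli K ↔ D.moduliUnit K * X = X ∧ X * D.moduliUnit K = X := by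
  constructor
  · intro hX
    let C : NonUnitalSubalgebra ℂ (D.L m) :=
      { carrier := {X | D.moduliUnit K * X = X ∧ X * D.moduliUnit K = X}
        add_mem' := fun {a b} ha hb => ⟨by rw [mul_add, ha.1, hb.1], by rw [add_mul, ha.2, hb.2]⟩
        zero_mem' := ⟨mul_zero _, zero_mul _⟩
        mul_mem' := fun {a b} ha hb => ⟨by rw [← mul_assoc, ha.1], by rw [mul_assoc, hb.2]⟩
        smul_mem' := fun c a ha => ⟨by rw [mul_smul_comm, ha.1], by rw [smul_mul_assoc, ha.2]⟩ }
    have h : D.moduli K ≤ C := by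
      refine NonUnitalAlgebra.adjoin_le ?_
      rintro _ ⟨Y, hY, rfl⟩
      have h1 : Commute (D.moduliUnit K) Y := by
        rw [moduliUnit_eq]
        exact ((D.mem_invariants Y).1 hY _).mul_left (D.chiProd_comm K Y)
      refine ⟨by rw [← mul_assoc, moduliUnit_idem], ?_⟩
      rw [mul_assoc, ← h1.eq, ← mul_assoc, moduliUnit_idem]
    exact h hX
  · rintro ⟨h1, h2⟩
    rw [← h1]
    refine NonUnitalAlgebra.subset_adjoin _ ⟨X, (D.mem_invariants X).2 fun x => ?_, rfl⟩
    rw [Commute, SemiconjBy, delta_mul_of_corner h1, mul_delta_of_corner h2]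

theorem moduliUnit_mem {m : ℕ} (K : Fin m → ι) : D.moduliUnit K ∈ D.moduli K :=
  mem_moduli.2 ⟨D.moduliUnit_idem K, D.moduliUnit_idem K⟩

variable (D)

/-- The isomorphism `L_{n+2} ≃ G ⊗ G ⊗ L_n`. -/
def thetaE (n : ℕ) : D.L (n + 2) ≃ₐ[ℂ] G ⊗[ℂ] (G ⊗[ℂ] D.L n) :=
  (D.phiE (n + 1)).trans (Algebra.TensorProduct.congr AlgEquiv.refl (D.phiE n))

theorem thetaE_apply (n : ℕ) (X : D.L (n + 2)) :
    D.thetaE n X = idT G (D.phi n) (D.phi (n + 1) X) := rfl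

theorem thetaE_delta (n : ℕ) (x : G) : D.thetaE n (D.delta (n + 2) x) =
    comulL G (D.L n) (coact (D.delta n) x) := by
  rw [thetaE_apply, phi_delta, comp_coact, phi_comp_delta, coassoc_coact]

theorem thetaE_chiProd {n : ℕ} (K : Fin (n + 2) → ι) : D.thetaE n (D.chiProd K) =
    D.e (K (Fin.last (n + 1))) ⊗ₜ (D.e (K (Fin.last n).castSucc) ⊗ₜ
      D.chiProd fun ν : Fin n => K (ν.castAdd 2)) := by
  rw [thetaE_apply, phi_chiProd, idT_tmul, phi_chiProd]
  rfl

/-- The minimal projectors of the fusion algebra. -/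
def pinchProj (n : ℕ) (J : ι) : D.L (n + 2) :=
  (D.thetaE n).symm (j12 G (D.L n) (Coalgebra.comul (R := ℂ) (D.e J)))

theorem thetaE_pinchProj (n : ℕ) (J : ι) : D.thetaE n (D.pinchProj n J) =
    j12 G (D.L n) (Coalgebra.comul (R := ℂ) (D.e J)) := (D.thetaE n).apply_symm_apply _

theorem pinchProj_mul (n : ℕ) (J L : ι) : D.pinchProj n J * D.pinchProj n L =
    if J = L then D.pinchProj n J else 0 := by
  apply (D.thetaE n).injective
  rw [map_mul, thetaE_pinchProj, thetaE_pinchProj, ← map_mul, ← Bialgebra.comul_mul,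
    IrrepSystem.e_mul_e]
  split_ifs with h
  · rw [thetaE_pinchProj]
  · simp

theorem sum_pinchProj (n : ℕ) : ∑ J, D.pinchProj n J = 1 := by
  apply (D.thetaE n).injective
  simp only [map_sum, thetaE_pinchProj]
  rw [← map_sum, ← map_sum, IrrepSystem.sum_e, Bialgebra.comul_one, map_one, map_one]

theorem pinchProj_comm_delta (n : ℕ) (J : ι) (x : G) :
    Commute (D.delta (n + 2) x) (D.pinchProj n J) := by
  refine Commute.of_injective (f := (D.thetaE n).toAlgHom) (D.thetaE n).injective ?_
  change Commute (D.thetaE n _) (D.thetaE n _)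
  rw [thetaE_pinchProj, thetaE_delta]
  exact comulL_mul_comul_comm (D.toIrrepSystem.e_comm J) _

theorem pinchProj_comm_moduliUnit {n : ℕ} (K : Fin (n + 2) → ι) (J : ι) :
    Commute (D.moduliUnit K) (D.pinchProj n J) := by
  rw [moduliUnit_eq]
  exact (D.pinchProj_comm_delta n J _).mul_left (D.chiProd_comm K _)

/-- In `G ⊗ G ⊗ L_n` the product of the last two monodromies is `(id ⊗ Δ)(Q)` in the first three
legs, and its quantum trace is `Δ(z_I)`. The factor `κ_I⁻²` compensates the normalization of the two
universal elements. -/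
theorem cycleElt_eq (n : ℕ) (I : ι) : D.cycleElt n I =
    (D.κ I * D.κ I)⁻¹ • (D.thetaE n).symm (j12 G (D.L n) (Coalgebra.comul (R := ℂ) (D.z I))) := by
  have h1 : D.cycleElt n I = (D.κ I * D.κ I)⁻¹ • slice (D.L (n + 2)) (D.tq I)
      (D.N (Fin.last (n + 1)) * D.N (Fin.last n).castSucc) := by
    rw [← qtr_eq, map_mul, ev_N, ev_N, smul_mul_smul_comm, cycleElt, qtr, qtr, Matrix.smul_mul,
      Matrix.trace_smul, smul_smul, inv_mul_cancel₀ (mul_ne_zero (D.κ_ne_zero I) (D.κ_ne_zero I)),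
      one_smul]
  rw [h1]
  congr 1
  apply (D.thetaE n).injective
  rw [AlgEquiv.apply_symm_apply, thetaE_apply, ← slice_idT, ← slice_idT, map_mul (idT G (D.phi (n + 1))),
    map_mul (idT G (idT G (D.phi n))), idT_phi_last, idT_phi_castSucc, RibbonStarHopf.shift,
    map_mul (idT G (idT G (D.phi n))), map_mul (idT G (idT G (D.phi n))), idT_j12, idT_j12,
    idT_j12, idT_j13, idT_phi_last]
  have h2 := RibbonStarHopf.Q_mul_shift (H := D.toRibbonStarHopf)
    (Algebra.TensorProduct.includeLeft : G →ₐ[ℂ] G ⊗[ℂ] D.L n)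
  rw [RibbonStarHopf.shift] at h2
  refine (congrArg (slice _ (D.tq I)) h2).trans ?_
  rw [slice_idT]
  rfl

theorem z_eq_sum_e (I : ι) : D.z I = ∑ J, D.lam I J • D.e J := by
  refine D.eq_of_τ fun K => ?_
  simp [τ_z, IrrepSystem.τ_e]

/-- Since `S` is invertible, the `z_I` and the `e_J` are linear combinations of each other. -/
theorem comm_cycleElt_iff {n : ℕ} (X : D.L (n + 2)) :
    (∀ I, Commute X (D.cycleElt n I)) ↔ ∀ J, Commute X (D.pinchProj n J) := by
  let F : G →ₗ[ℂ] D.L (n + 2) := (D.thetaE n).symm.toLinearMap ∘ₗ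
    (j12 G (D.L n)).toLinearMap ∘ₗ Coalgebra.comul
  have hc : ∀ I, D.cycleElt n I = (D.κ I * D.κ I)⁻¹ • F (D.z I) := D.cycleElt_eq n
  have hp : ∀ J, D.pinchProj n J = F (D.e J) := fun J => rfl
  constructor
  · intro h J
    rw [hp, ← D.sum_chiCoeff_z hM.qdim_pos hM.isUnit_S J, map_sum]
    refine Commute.sum_right _ _ _ fun I _ => ?_
    rw [map_smul]
    have h1 := (h I).smul_right (D.κ I * D.κ I)
    rw [hc, smul_smul, mul_inv_cancel₀ (mul_ne_zero (D.κ_ne_zero I) (D.κ_ne_zero I)),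
      one_smul] at h1
    exact h1.smul_right _
  · intro h I
    rw [hc, z_eq_sum_e, map_sum]
    refine (Commute.sum_right _ _ _ fun J _ => ?_).smul_right _
    rw [map_smul, ← hp]
    exact (h J).smul_right _

variable {D}

/-- For elements of the corner, commuting with `p c` and with `c` are equivalent when `p` commutes
with `c`. -/
theorem mem_fusionCommutant {n : ℕ} {K : Fin (n + 2) → ι} {X : D.L (n + 2)} :
    X ∈ D.fusionCommutant K ↔ X ∈ D.moduli K ∧ ∀ J, Commute X (D.pinchProj n J) := by
  rw [← D.comm_cycleElt_iff]
  refine and_congr_right fun hX => ?_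
  have hX := mem_moduli.1 hX
  have hc : ∀ I, Commute (D.moduliUnit K) (D.cycleElt n I) :=
    (D.comm_cycleElt_iff _).2 (D.pinchProj_comm_moduliUnit K)
  have h1 : ∀ I, Commute X (D.moduliUnit K * D.cycleElt n I) ↔ Commute X (D.cycleElt n I) := by
    intro I
    rw [Commute, SemiconjBy, Commute, SemiconjBy, ← mul_assoc, hX.2, (hc I).eq, mul_assoc, hX.1]
  simp only [← h1]
  constructor
  · intro h I
    exact (NonUnitalSubalgebra.mem_centralizer_iff ℂ).1 h _
      (NonUnitalAlgebra.subset_adjoin _ ⟨I, rfl⟩) |>.symm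
  · intro h
    refine (NonUnitalSubalgebra.mem_centralizer_iff ℂ).2 fun Y hY => ?_
    have h2 : D.fusionAlg K ≤ NonUnitalSubalgebra.centralizer ℂ {X} := by
      refine NonUnitalAlgebra.adjoin_le ?_
      rintro _ ⟨I, rfl⟩
      refine (NonUnitalSubalgebra.mem_centralizer_iff ℂ).2 ?_
      rintro _ rfl
      exact h I
    exact ((NonUnitalSubalgebra.mem_centralizer_iff ℂ).1 (h2 hY) X rfl).symm

end SymmetryData
end Corner

/-! ### Conjugate-linear antihomomorphisms -/

section AntiStar

/-- A conjugate-linear unital antihomomorphism of an algebra to itself. -/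
structure AntiStar (A : Type*) [Ring A] [Algebra ℂ A] extends A →ₛₗ[starRingEnd ℂ] A where
  map_one' : toFun 1 = 1
  map_mul' : ∀ x y, toFun (x * y) = toFun y * toFun x

namespace AntiStar

variable {A : Type*} [Ring A] [Algebra ℂ A] {B : Type*} [Ring B] [Algebra ℂ B]

instance : CoeFun (AntiStar A) fun _ => A → A := ⟨fun s => s.toFun⟩

variable (s : AntiStar A)

theorem map_add (x y : A) : s (x + y) = s x + s y := s.map_add' x y
theorem map_zero : s 0 = 0 := s.toLinearMap.map_zero
theorem map_smul (c : ℂ) (x : A) : s (c • x) = star c • s x := s.map_smul' c x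
theorem map_one : s 1 = 1 := s.map_one'
theorem map_mul (x y : A) : s (x * y) = s y * s x := s.map_mul' x y
theorem map_sum {κ : Type*} (t : Finset κ) (f : κ → A) : s (∑ i ∈ t, f i) = ∑ i ∈ t, s (f i) :=
  _root_.map_sum s.toLinearMap f t

/-- Conjugation of an antihomomorphism by a unit. -/
def conj {F Fi : A} (h : F * Fi = 1) (h' : Fi * F = 1) : AntiStar A where
  toLinearMap := (LinearMap.mulLeft ℂ Fi ∘ₗ LinearMap.mulRight ℂ F).comp s.toLinearMap
  map_one' := by
    change Fi * (s 1 * F) = 1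
    rw [s.map_one, one_mul, h']
  map_mul' x y := by
    change Fi * (s (x * y) * F) = Fi * (s y * F) * (Fi * (s x * F))
    rw [s.map_mul]
    calc _ = Fi * (s y * (1 * (s x * F))) := by rw [one_mul]; simp only [mul_assoc]
      _ = _ := by rw [← h]; simp only [mul_assoc]

theorem conj_apply {F Fi : A} (h : F * Fi = 1) (h' : Fi * F = 1) (x : A) :
    s.conj h h' x = Fi * s x * F := (mul_assoc _ _ _).symm

/-- Transport of an antihomomorphism along an isomorphism. -/
def transport (e : B ≃ₐ[ℂ] A) : AntiStar B where
  toLinearMap := e.symm.toLinearMap.comp (s.toLinearMap.comp e.toLinearMap)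
  map_one' := by
    change e.symm (s (e 1)) = 1
    rw [_root_.map_one, s.map_one, _root_.map_one]
  map_mul' x y := by
    change e.symm (s (e (x * y))) = e.symm (s (e y)) * e.symm (s (e x))
    rw [_root_.map_mul, s.map_mul, _root_.map_mul]

theorem apply_transport (e : B ≃ₐ[ℂ] A) (x : B) : e (s.transport e x) = s (e x) :=
  e.apply_symm_apply _

variable (G : Type*) [Ring G] [HopfAlgebra ℂ G] [StarRing G] [StarModule ℂ G]

/-- The antihomomorphism `* ⊗ s`. -/
def tens : AntiStar (G ⊗[ℂ] A) where
  toLinearMap := TensorProduct.map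
    (σ₁₂ := starRingEnd ℂ) ((starLinearEquiv ℂ (A := G)).toLinearMap) s.toLinearMap
  map_one' := by
    change star (1 : G) ⊗ₜ s 1 = _
    rw [star_one, s.map_one]
    rfl
  map_mul' x y := by
    set f : G ⊗[ℂ] A →ₛₗ[starRingEnd ℂ] G ⊗[ℂ] A := TensorProduct.map
      (σ₁₂ := starRingEnd ℂ) ((starLinearEquiv ℂ (A := G)).toLinearMap) s.toLinearMap
    have hf : ∀ a b, f (a ⊗ₜ b) = star a ⊗ₜ s b := fun _ _ => rfl
    change f (x * y) = f y * f x
    induction x with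
    | zero => simp
    | add p q hp hq => simp only [_root_.map_add, add_mul, mul_add, hp, hq]
    | tmul a b =>
      induction y with
      | zero => simp
      | add p q hp hq => simp only [_root_.map_add, add_mul, mul_add, hp, hq]
      | tmul c d => simp [hf, s.map_mul]

variable {G}

theorem tens_tmul (x : G) (a : A) : s.tens G (x ⊗ₜ a) = star x ⊗ₜ s a := rfl

theorem tens_idT {δ : G →ₐ[ℂ] A} (h : ∀ x, s (δ x) = δ (star x)) (X : G ⊗[ℂ] G) :
    s.tens G (idT G δ X) = idT G δ (star X) := by
  induction X with
  | zero => simp [AntiStar.map_zero]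
  | add p q hp hq => simp only [_root_.map_add, star_add, AntiStar.map_add, hp, hq]
  | tmul x y => rw [idT_tmul, tens_tmul, h, TensorProduct.star_tmul, idT_tmul]

theorem tens_j12 (X : G ⊗[ℂ] G) : (s.tens G).tens G (j12 G A X) = j12 G A (star X) := by
  refine (s.tens G).tens_idT (δ := Algebra.TensorProduct.includeLeft) (fun x => ?_) X
  change s.tens G (x ⊗ₜ 1) = star x ⊗ₜ 1
  rw [tens_tmul, s.map_one]

theorem tens_j13 (X : G ⊗[ℂ] A) : (s.tens G).tens G (j13 G A X) = j13 G A (s.tens G X) := by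
  induction X with
  | zero => simp [AntiStar.map_zero]
  | add p q hp hq => simp only [_root_.map_add, AntiStar.map_add, hp, hq]
  | tmul x y => simp [tens_tmul]

variable {ι : Type*} (V : IrrepSystem G ι)

theorem ev_tens (I : ι) (X : G ⊗[ℂ] A) (a b : Fin (V.n I)) :
    V.ev A I (s.tens G X) a b = s (V.ev A I X b a) := by
  induction X with
  | zero => simp [AntiStar.map_zero]
  | add p q hp hq => simp only [_root_.map_add, AntiStar.map_add, Matrix.add_apply, hp, hq]
  | tmul x y =>
    rw [tens_tmul, IrrepSystem.ev_tmul, IrrepSystem.ev_tmul, s.map_smul, map_star,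
      Matrix.star_eq_conjTranspose, Matrix.conjTranspose_apply]

theorem ev2_tens (I J : ι) (X : G ⊗[ℂ] (G ⊗[ℂ] A)) (p q : Fin (V.n I) × Fin (V.n J)) :
    V.ev2 A I J ((s.tens G).tens G X) p q = s (V.ev2 A I J X q p) := by
  rw [IrrepSystem.ev2_apply, ev_tens, ev_tens, IrrepSystem.ev2_apply]

end AntiStar
end AntiStar

/-! ### The `*`-operation of the graph algebras -/

section Star

variable {G ι : Type*} [Ring G] [HopfAlgebra ℂ G] [StarRing G] [StarModule ℂ G]
variable [FiniteDimensional ℂ G] [IsSemisimpleRing G] [Fintype ι] [DecidableEq ι]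
variable {A : Type*} [Ring A] [Algebra ℂ A]

namespace RibbonStarHopf

variable (H : RibbonStarHopf G)

theorem star_swapT (X : G ⊗[ℂ] G) : star (swapT G X) = swapT G (star X) := by
  induction X with
  | zero => simp
  | add p q hp hq => simp only [map_add, star_add, hp, hq]
  | tmul x y => simp

theorem star_R_eq : star (H.R : G ⊗[ℂ] G) = swapT G H.Ri := by
  have h := congrArg (swapT G) H.star_R
  rwa [swapT_swapT] at h

theorem star_swapT_R : star (swapT G (H.R : G ⊗[ℂ] G)) = H.Ri := by
  rw [star_swapT]
  exact H.star_R

theorem star_comul (H : RibbonStarHopf G) (x : G) : star (Coalgebra.comul (R := ℂ) x) =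
    swapT G (Coalgebra.comul (R := ℂ) (star x)) := by
  rw [H.comul_star, swapT_swapT]

end RibbonStarHopf

namespace SymmetryData

variable (D : SymmetryData G ι)

/-- `Θ` differs from `R` by factors that commute with every coproduct, so it intertwines `Δ` and
`Δ'` as well. -/
theorem Θ_mul_comul (x : G) : D.Θ * Coalgebra.comul (R := ℂ) x =
    swapT G (Coalgebra.comul (R := ℂ) x) * D.Θ := by
  have h1 : Commute (D.kinv ⊗ₜ[ℂ] D.kinv) (Coalgebra.comul (R := ℂ) x) :=
    tmul_comm_of_central D.kinv_comm D.kinv_comm _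
  have h2 : Commute (Coalgebra.comul (R := ℂ) D.kappa) (Coalgebra.comul (R := ℂ) x) := by
    rw [Commute, SemiconjBy, ← Bialgebra.comul_mul, D.kappa_comm, Bialgebra.comul_mul]
  rw [Θ, mul_assoc, h1.eq, ← mul_assoc, mul_assoc _ (Coalgebra.comul (R := ℂ) D.kappa), h2.eq,
    ← mul_assoc, D.intertwine]
  simp only [mul_assoc]

variable {D}

variable (s : AntiStar A) (δ : G →ₐ[ℂ] A)

variable (D) in
/-- The `*`-operation on `G ⊗ A` twisted by `Θ`. -/
def twist : AntiStar (G ⊗[ℂ] A) :=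
  (s.tens G).conj (F := idT G δ D.Θ) (Fi := idT G δ D.Θi)
    (by rw [← map_mul, Θ_mul_Θi, map_one]) (by rw [← map_mul, Θi_mul_Θ, map_one])

theorem twist_apply (X : G ⊗[ℂ] A) :
    D.twist s δ X = idT G δ D.Θi * s.tens G X * idT G δ D.Θ := AntiStar.conj_apply _ _ _ _

variable {s δ}

/-- The legwise `*` turns `Δ` into `Δ'`; conjugation by `Θ` turns it back. So the moment map stays
compatible with the `*`-operations at the next stage. -/
theorem twist_coact (h : ∀ x, s (δ x) = δ (star x)) (x : G) :
    D.twist s δ (coact δ x) = coact δ (star x) := by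
  rw [twist_apply, coact_apply, s.tens_idT h, D.toRibbonStarHopf.star_comul, ← map_mul, ← map_mul, mul_assoc,
    ← Θ_mul_comul, ← mul_assoc, Θi_mul_Θ, one_mul, coact_apply]

/-- Abstract form of the Yang-Baxter moves below: `t` carries one conjugate of `x` to another when
`t u = r c` with `c` commuting with `x`. -/
theorem semiconj_of_mul_eq {Q : Type*} [Ring Q] {t c u ui r ri x : Q} (h : t * u = r * c)
    (hc : Commute c x) (hu : u * ui = 1) (hr : ri * r = 1) :
    SemiconjBy t (u * x * ui) (r * x * ri) := by
  have h1 : ri * t = c * ui := by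
    calc ri * t = ri * (t * u) * ui := by rw [mul_assoc, mul_assoc, hu, mul_one]
      _ = _ := by rw [h, ← mul_assoc, hr, one_mul]
  calc t * (u * x * ui) = t * u * (x * ui) := by simp only [mul_assoc]
    _ = r * (c * x) * ui := by rw [h]; simp only [mul_assoc]
    _ = r * x * (c * ui) := by rw [hc.eq]; simp only [mul_assoc]
    _ = _ := by rw [← h1]; simp only [mul_assoc]

theorem semiconj_conj {Q : Type*} [Ring Q] {k ki : Q} (h : k * ki = 1) (x : Q) :
    SemiconjBy k (ki * x * k) x := by
  rw [SemiconjBy, ← mul_assoc, ← mul_assoc, h, one_mul]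

variable (D δ) in
/-- The conjugate `κ⁻¹ R N R⁻¹ κ` of a universal monodromy. -/
def monConj (N : G ⊗[ℂ] A) : G ⊗[ℂ] A :=
  (1 ⊗ₜ δ D.kinv) * (idT G δ D.R * N * idT G δ D.toRibbonStarHopf.Ri) * (1 ⊗ₜ δ D.kappa)

end SymmetryData
end Star

/-! ### Adjoints of universal monodromies under the twisted operation. -/

section StarMonodromy

variable {G ι : Type*} [Ring G] [HopfAlgebra ℂ G] [StarRing G] [StarModule ℂ G]
variable [FiniteDimensional ℂ G] [IsSemisimpleRing G] [Fintype ι] [DecidableEq ι]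
variable {A : Type*} [Ring A] [Algebra ℂ A] {B : Type*} [Ring B] [Algebra ℂ B]

namespace RibbonStarHopf

variable (H : RibbonStarHopf G)

theorem star_Ri_eq : star H.Ri = swapT G (H.R : G ⊗[ℂ] G) := by
  rw [← H.star_swapT_R, star_star]

/-- Here `R Q R⁻¹ = R R'`, while the legwise adjoint of `R'R` is `R'⁻¹ R⁻¹`. -/
theorem star_Q_mul : star H.Q * ((H.R : G ⊗[ℂ] G) * H.Q * H.Ri) = 1 := by
  have h : (H.R : G ⊗[ℂ] G) * H.Q * H.Ri = H.R * swapT G H.R := by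
    rw [Q, mul_assoc, mul_assoc, mul_Ri, mul_one]
  rw [h, Q, star_mul, star_R_eq, star_swapT_R, mul_assoc, ← mul_assoc H.Ri, Ri_mul, one_mul,
    swapT_Ri_mul]

theorem yang_baxter_idT (δ : G →ₐ[ℂ] A) :
    j12 G A H.R * j13 G A (idT G δ H.R) * j23 G A (idT G δ H.R) =
      j23 G A (idT G δ H.R) * j13 G A (idT G δ H.R) * j12 G A H.R := by
  have h := congrArg (idT G (idT G δ)) H.yang_baxter
  simpa only [map_mul, idT_j12, idT_j13, idT_j23] using h

theorem yang_baxter_swap (δ : G →ₐ[ℂ] A) :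
    j12 G A (swapT G H.R) * j23 G A (idT G δ H.R) * j13 G A (idT G δ H.R) =
      j13 G A (idT G δ H.R) * j23 G A (idT G δ H.R) * j12 G A (swapT G H.R) := by
  have h := congrArg (swap12 G A) (H.yang_baxter_idT δ)
  simpa only [map_mul, swap12_j12, swap12_j13, swap12_j23] using h

theorem idT_coact_R (δ : G →ₐ[ℂ] A) :
    idT G (coact δ) (H.R : G ⊗[ℂ] G) = j13 G A (idT G δ H.R) * j12 G A H.R := by
  have h := congrArg (idT G (idT G δ)) H.idT_comul_R
  rw [idT_comp, map_mul, idT_j12, idT_j13] at h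
  exact h

theorem idT_coact_Ri (δ : G →ₐ[ℂ] A) :
    idT G (coact δ) H.Ri = j12 G A H.Ri * j13 G A (idT G δ H.Ri) := by
  have h1 : idT G (coact δ) H.Ri * (idT G (coact δ) (H.R : G ⊗[ℂ] G)) = 1 := by
    rw [← map_mul, Ri_mul, map_one]
  have h2 : idT G (coact δ) (H.R : G ⊗[ℂ] G) * (j12 G A H.Ri * j13 G A (idT G δ H.Ri)) = 1 := by
    rw [idT_coact_R, mul_assoc, ← mul_assoc (j12 G A _), j12_R_mul_Ri, one_mul, ← map_mul,
      ← map_mul, mul_Ri, map_one, map_one]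
  exact left_inv_eq_right_inv h1 h2

theorem comulL_idT_R (δ : G →ₐ[ℂ] A) :
    comulL G A (idT G δ (H.R : G ⊗[ℂ] G)) = j13 G A (idT G δ H.R) * j23 G A (idT G δ H.R) := by
  rw [← idT_comulL, comulL_R, map_mul, idT_j13, idT_j23]

theorem idT_coact_comm_j23 {δ : G →ₐ[ℂ] A} {N : G ⊗[ℂ] A} (h : ∀ x, Commute (coact δ x) N)
    (X : G ⊗[ℂ] G) : Commute (idT G (coact δ) X) (j23 G A N) := by
  refine commute_of_tmul (idT G (coact δ)) fun y z => ?_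
  rw [idT_tmul, j23_apply, Commute, SemiconjBy, Algebra.TensorProduct.tmul_mul_tmul,
    Algebra.TensorProduct.tmul_mul_tmul, (h z).eq, mul_one, one_mul]

end RibbonStarHopf

namespace AntiStar

theorem tens_conj (s : AntiStar A) {F Fi : A} (h : F * Fi = 1) (h' : Fi * F = 1) (X : G ⊗[ℂ] A) :
    (s.conj h h').tens G X = (1 ⊗ₜ Fi) * s.tens G X * (1 ⊗ₜ F) := by
  induction X with
  | zero => simp [AntiStar.map_zero]
  | add p q hp hq => simp only [AntiStar.map_add, mul_add, add_mul, hp, hq]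
  | tmul x y => simp [tens_tmul, conj_apply]

theorem idT_tens_transport (s : AntiStar A) (e : B ≃ₐ[ℂ] A) (X : G ⊗[ℂ] B) :
    idT G e.toAlgHom ((s.transport e).tens G X) = s.tens G (idT G e.toAlgHom X) := by
  induction X with
  | zero => simp [AntiStar.map_zero]
  | add p q hp hq => simp only [AntiStar.map_add, _root_.map_add, hp, hq]
  | tmul x y =>
    rw [tens_tmul, idT_tmul, idT_tmul, tens_tmul]
    exact congrArg _ (s.apply_transport e y)

end AntiStar

namespace SymmetryData

variable (D : SymmetryData G ι)

theorem comm_one_tmul_central {x : G} (hx : ∀ z, x * z = z * x) (Z : G ⊗[ℂ] (G ⊗[ℂ] A)) :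
    Commute (1 ⊗ₜ (x ⊗ₜ 1)) Z := by
  refine (commute_of_tmul (AlgHom.id ℂ _) fun y z => ?_).symm
  change Commute (y ⊗ₜ z) _
  rw [Commute, SemiconjBy, Algebra.TensorProduct.tmul_mul_tmul,
    Algebra.TensorProduct.tmul_mul_tmul, (j12_tmul_comm hx z).eq, mul_one, one_mul]

theorem comm_one_tmul_idT {x : G} (hx : ∀ z, x * z = z * x) (δ : G →ₐ[ℂ] A) (Z : G ⊗[ℂ] G) :
    Commute (1 ⊗ₜ δ x) (idT G δ Z) := by
  refine (commute_of_tmul (idT G δ) fun y z => ?_).symm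
  rw [idT_tmul, Commute, SemiconjBy, Algebra.TensorProduct.tmul_mul_tmul,
    Algebra.TensorProduct.tmul_mul_tmul, ← map_mul, ← map_mul, hx, mul_one, one_mul]

theorem comm_one_one_tmul_j12 (a : A) (Z : G ⊗[ℂ] G) :
    Commute (1 ⊗ₜ (1 ⊗ₜ a)) (j12 G A Z) := by
  refine (commute_of_tmul (j12 G A) fun y z => ?_).symm
  simp [Commute, SemiconjBy]

theorem idT_Θ (δ : G →ₐ[ℂ] A) : idT G δ D.Θ =
    idT G δ D.R * coact δ D.kappa * (D.kinv ⊗ₜ δ D.kinv) := by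
  rw [Θ, map_mul, map_mul, coact_apply, idT_tmul]

variable {D}

/-- The behaviour of a universal monodromy under an antihomomorphism. -/
def StarMon (D : SymmetryData G ι) (s : AntiStar A) (δ : G →ₐ[ℂ] A) (N : G ⊗[ℂ] A) : Prop :=
  s.tens G N * D.monConj δ N = 1

variable (s : AntiStar A) (δ : G →ₐ[ℂ] A)

theorem tens_twist (X : G ⊗[ℂ] (G ⊗[ℂ] A)) : (D.twist s δ).tens G X =
    j23 G A (idT G δ D.Θi) * (s.tens G).tens G X * j23 G A (idT G δ D.Θ) := by
  rw [twist, AntiStar.tens_conj]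
  rfl

theorem j23_Θi_mul : j23 G A (idT G δ D.Θi) * j23 G A (idT G δ D.Θ) = 1 := by
  rw [← map_mul, ← map_mul, Θi_mul_Θ, map_one, map_one]

variable (D) in
theorem monConj_coact (N : G ⊗[ℂ] (G ⊗[ℂ] A)) : D.monConj (coact δ) N =
    j23 G A (coact δ D.kinv) * (j13 G A (idT G δ D.R) * (j12 G A D.R * N *
      j12 G A D.toRibbonStarHopf.Ri) * j13 G A (idT G δ D.toRibbonStarHopf.Ri)) *
      j23 G A (coact δ D.kappa) := by
  rw [monConj, RibbonStarHopf.idT_coact_R, RibbonStarHopf.idT_coact_Ri]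
  simp only [mul_assoc, j23_apply]

theorem j23_kappa_mul : j23 G A (coact δ D.kappa) * j23 G A (coact δ D.kinv) = 1 := by
  rw [← map_mul, ← map_mul, kappa_mul_kinv, map_one, map_one]

/-- Conjugation by `Θ₂₃` carries the prescribed conjugate of `Q₁₂` to `R₁₂ Q₁₂ R₁₂⁻¹`, which is
inverse to the legwise adjoint. The factors of `Θ` are treated one at a time. -/
theorem starMon_Q : D.StarMon (D.twist s δ) (coact δ) (j12 G A D.Q) := by
  set H := D.toRibbonStarHopf
  set X := D.monConj (coact δ) (j12 G A D.Q) with hX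
  set n := j12 G A D.R * j12 G A D.Q * j12 G A H.Ri with hn
  have hw : ∀ Z : G ⊗[ℂ] (G ⊗[ℂ] G),
      Commute (j23 G A (D.kinv ⊗ₜ δ D.kinv)) (idT G (idT G δ) Z) := by
    intro Z
    have h1 := (j12_tmul_comm (A := G ⊗[ℂ] G) (x := (1 : G)) (fun z => by simp) Z)
    have h2 : Commute (j23 G G (D.kinv ⊗ₜ D.kinv)) Z := by
      refine (commute_of_tmul (AlgHom.id ℂ _) fun y z => ?_).symm
      change Commute (y ⊗ₜ z) _
      rw [j23_apply, Commute, SemiconjBy, Algebra.TensorProduct.tmul_mul_tmul,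
        Algebra.TensorProduct.tmul_mul_tmul,
        (tmul_comm_of_central D.kinv_comm D.kinv_comm z).eq, mul_one, one_mul]
    exact h2.map (idT G (idT G δ))
  have hwX : SemiconjBy (j23 G A (D.kinv ⊗ₜ δ D.kinv)) X X := by
    have h1 : X = idT G (idT G δ) (D.monConj (coact (AlgHom.id ℂ G)) (j12 G G D.Q)) := by
      simp only [monConj_coact, map_mul, idT_j12, idT_j13, idT_j23, coact_apply, idT_id, hX]
    rw [h1]
    exact hw _
  have h1 : SemiconjBy (j23 G A (coact δ D.kappa)) X
      (j13 G A (idT G δ D.R) * j12 G A D.R * j12 G A D.Q *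
        (j12 G A H.Ri * j13 G A (idT G δ H.Ri))) := by
    have h2 := monConj_coact D δ (j12 G A D.Q)
    rw [← hX] at h2
    have h3 := semiconj_conj (j23_kappa_mul (D := D) δ) (j13 G A (idT G δ D.R) *
      (j12 G A D.R * j12 G A D.Q * j12 G A H.Ri) * j13 G A (idT G δ H.Ri))
    rw [← h2] at h3
    simpa only [mul_assoc] using h3
  -- Yang-Baxter, together with the fact that `R₁₃ R₂₃ = (Δ ⊗ id)(R)` commutes with `Q₁₂`.
  have h2 : SemiconjBy (j23 G A (idT G δ D.R))
      (j13 G A (idT G δ D.R) * j12 G A D.R * j12 G A D.Q *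
        (j12 G A H.Ri * j13 G A (idT G δ H.Ri))) n := by
    refine semiconj_of_mul_eq (c := j13 G A (idT G δ D.R) * j23 G A (idT G δ D.R)) ?_ ?_ ?_
      H.j12_Ri_mul
    · rw [← mul_assoc, ← mul_assoc]
      exact (H.yang_baxter_idT δ).symm
    · rw [← H.comulL_idT_R]
      exact H.j12_Q_comm _
    · rw [mul_assoc, ← mul_assoc (j12 G A _), H.j12_R_mul_Ri, one_mul, ← map_mul, ← map_mul,
        H.mul_Ri, map_one, map_one]
  have hE : SemiconjBy (j23 G A (idT G δ D.Θ)) X n := by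
    rw [idT_Θ, map_mul, map_mul]
    exact (h2.mul_left h1).mul_left hwX
  have h3 : (s.tens G).tens G (j12 G A D.Q) * n = 1 := by
    rw [hn, s.tens_j12, ← map_mul, ← map_mul, ← map_mul, H.star_Q_mul, map_one]
  rw [StarMon, tens_twist, mul_assoc, hE.eq, ← mul_assoc, mul_assoc _ _ n, h3, mul_one, j23_Θi_mul]

variable {s δ}

/-- The same scheme as in `starMon_Q`, but the adjoint of the conjugating `R₁₂` brings in `R'₁₂`, so
the conjugation is by `R'₁₂ Θ₂₃`. -/
theorem StarMon.shift {N : G ⊗[ℂ] A} (h : D.StarMon s δ N) (hN : ∀ x, Commute (coact δ x) N) :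
    D.StarMon (D.twist s δ) (coact δ) (D.shift N) := by
  set H := D.toRibbonStarHopf
  set X := D.monConj (coact δ) (H.shift N) with hX
  set n := j13 G A (idT G δ D.R) * j13 G A N * j13 G A (idT G δ H.Ri) with hn
  have hX' : X = j23 G A (coact δ D.kinv) * n * j23 G A (coact δ D.kappa) := by
    rw [hX, monConj_coact, RibbonStarHopf.shift, hn]
    simp only [← mul_assoc]
    rw [mul_assoc (j23 G A (coact δ D.kinv) * j13 G A (idT G δ D.R)), H.j12_R_mul_Ri, mul_one,
      mul_assoc _ (j12 G A (D.R : G ⊗[ℂ] G)) (j12 G A H.Ri), H.j12_R_mul_Ri, mul_one]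
  have h1 : SemiconjBy (j23 G A (coact δ D.kappa)) X n := by
    rw [hX']
    exact semiconj_conj (j23_kappa_mul δ) _
  -- The flipped Yang-Baxter relation, together with the covariance of `N` under the moment map.
  have h2 : SemiconjBy (j12 G A (swapT G H.R) * j23 G A (idT G δ H.R)) n n := by
    refine semiconj_of_mul_eq (c := j23 G A (idT G δ H.R) * j12 G A (swapT G H.R)) ?_ ?_ ?_ ?_
    · rw [H.yang_baxter_swap, mul_assoc]
    · have h3 := (RibbonStarHopf.idT_coact_comm_j23 hN (H.R : G ⊗[ℂ] G)).map (swap12 G A)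
      rwa [H.idT_coact_R, map_mul, swap12_j12, swap12_j13, swap12_j23] at h3
    · rw [← map_mul, ← map_mul, H.mul_Ri, map_one, map_one]
    · rw [← map_mul, ← map_mul, H.Ri_mul, map_one, map_one]
  have hL : (1 : G ⊗[ℂ] (G ⊗[ℂ] A)) = 1 ⊗ₜ (1 ⊗ₜ 1) := rfl
  have h3 : SemiconjBy (1 ⊗ₜ (1 ⊗ₜ δ D.kinv)) n (j13 G A (D.monConj δ N)) := by
    rw [hn, monConj, map_mul, map_mul, map_mul, map_mul, SemiconjBy, mul_assoc _ _ (j13 G A _),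
      mul_assoc _ _ (1 ⊗ₜ (1 ⊗ₜ δ D.kinv))]
    rw [j13_tmul, j13_tmul, Algebra.TensorProduct.tmul_mul_tmul,
      Algebra.TensorProduct.tmul_mul_tmul, mul_one, ← map_mul δ, kappa_mul_kinv, map_one,
      ← hL, mul_one]
  have hE : j12 G A (swapT G H.R) * j23 G A (idT G δ D.Θ) =
      (1 ⊗ₜ (1 ⊗ₜ δ D.kinv)) * (j12 G A (swapT G H.R) * j23 G A (idT G δ H.R)) *
        j23 G A (coact δ D.kappa) * (1 ⊗ₜ (D.kinv ⊗ₜ 1)) := by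
    have h4 : j23 G A (D.kinv ⊗ₜ δ D.kinv) = (1 ⊗ₜ (1 ⊗ₜ δ D.kinv)) * (1 ⊗ₜ (D.kinv ⊗ₜ 1)) := by
      simp
    have h5 : Commute (1 ⊗ₜ (1 ⊗ₜ δ D.kinv)) (j23 G A (idT G δ H.R * coact δ D.kappa)) := by
      rw [coact_apply, ← map_mul]
      exact (comm_one_tmul_idT D.kinv_comm δ _).map (j23 G A)
    rw [idT_Θ, map_mul, h4, ← mul_assoc (j23 G A _), ← h5.eq]
    simp only [← mul_assoc]
    rw [(comm_one_one_tmul_j12 (δ D.kinv) (swapT G H.R)).eq, map_mul]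
    simp only [← mul_assoc]
  have h6 : SemiconjBy (j12 G A (swapT G H.R) * j23 G A (idT G δ D.Θ)) X
      (j13 G A (D.monConj δ N)) := by
    rw [hE]
    exact ((h3.mul_left h2).mul_left h1).mul_left (comm_one_tmul_central D.kinv_comm X)
  have h7 : (s.tens G).tens G (H.shift N) =
      j12 G A (swapT G H.Ri) * j13 G A (s.tens G N) * j12 G A (swapT G H.R) := by
    rw [RibbonStarHopf.shift, AntiStar.map_mul, AntiStar.map_mul, s.tens_j12, s.tens_j12,
      s.tens_j13, H.star_R_eq, H.star_Ri_eq, mul_assoc]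
  rw [StarMon, tens_twist, h7, ← hX]
  calc _ = j23 G A (idT G δ D.Θi) * j12 G A (swapT G H.Ri) * j13 G A (s.tens G N) *
        (j12 G A (swapT G H.R) * j23 G A (idT G δ D.Θ) * X) := by simp only [mul_assoc]
    _ = j23 G A (idT G δ D.Θi) * j12 G A (swapT G H.Ri) * (j13 G A (s.tens G N) *
        j13 G A (D.monConj δ N)) * (j12 G A (swapT G H.R) * j23 G A (idT G δ D.Θ)) := by
      rw [h6.eq]; simp only [mul_assoc]
    _ = j23 G A (idT G δ D.Θi) * (j12 G A (swapT G H.Ri) * j12 G A (swapT G H.R)) *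
        j23 G A (idT G δ D.Θ) := by
      rw [← map_mul (j13 G A), show s.tens G N * D.monConj δ N = 1 from h, map_one, mul_one]
      simp only [mul_assoc]
    _ = 1 := by rw [← map_mul, H.swapT_Ri_mul, map_one, mul_one, j23_Θi_mul]

end SymmetryData
end StarMonodromy

/-! ### The `*`-operation on all graph algebras. -/

section GraphStar

variable {G ι : Type*} [Ring G] [HopfAlgebra ℂ G] [StarRing G] [StarModule ℂ G]
variable [FiniteDimensional ℂ G] [IsSemisimpleRing G] [Fintype ι] [DecidableEq ι]
variable {A : Type*} [Ring A] [Algebra ℂ A] {B : Type*} [Ring B] [Algebra ℂ B]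

namespace SymmetryData

variable (D : SymmetryData G ι)

theorem star_e (I : ι) : star (D.e I) = D.e I := by
  refine D.eq_of_τ fun J => ?_
  rw [map_star, IrrepSystem.τ_e]
  split_ifs <;> simp

theorem idT_twist (s : AntiStar A) (e : B ≃ₐ[ℂ] A) (δ : G →ₐ[ℂ] B) (X : G ⊗[ℂ] B) :
    idT G e.toAlgHom (D.twist (s.transport e) δ X) =
      D.twist s (e.toAlgHom.comp δ) (idT G e.toAlgHom X) := by
  rw [twist_apply, twist_apply, map_mul, map_mul, idT_comp, idT_comp,
    AntiStar.idT_tens_transport]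

theorem idT_monConj (f : A →ₐ[ℂ] B) (δ : G →ₐ[ℂ] A) (N : G ⊗[ℂ] A) :
    idT G f (D.monConj δ N) = D.monConj (f.comp δ) (idT G f N) := by
  simp only [monConj, map_mul, idT_comp, idT_tmul]
  rfl

/-- The cocycle identity for `Θ`. -/
theorem Θ_cocycle : j23 G G D.Θ * idT G (Bialgebra.comulAlgHom ℂ G) D.Θ =
    j12 G G D.Θ * comulL G G D.Θ := by
  set K : G ⊗[ℂ] (G ⊗[ℂ] G) := comulL G G (Coalgebra.comul (R := ℂ) D.kappa)
  have hK : idT G (Bialgebra.comulAlgHom ℂ G) (Coalgebra.comul (R := ℂ) D.kappa) = K :=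
    (Coalgebra.coassoc_apply (R := ℂ) D.kappa).symm
  have hc23 : ∀ Z : G ⊗[ℂ] (G ⊗[ℂ] G), Commute (j23 G G (D.kinv ⊗ₜ[ℂ] D.kinv)) Z := by
    intro Z
    refine (commute_of_tmul (AlgHom.id ℂ _) fun y z => ?_).symm
    change Commute (y ⊗ₜ z) _
    rw [j23_apply, Commute, SemiconjBy, Algebra.TensorProduct.tmul_mul_tmul,
      Algebra.TensorProduct.tmul_mul_tmul,
      (tmul_comm_of_central D.kinv_comm D.kinv_comm z).eq, mul_one, one_mul]
  have hc12 : ∀ Z : G ⊗[ℂ] (G ⊗[ℂ] G), Commute (j12 G G (D.kinv ⊗ₜ[ℂ] D.kinv)) Z := by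
    intro Z
    have h := (hc23 (swap12 G G (idT G (swapT G) (swap12 G G Z)))).map
      ((swap12 G G).comp ((idT G (swapT G)).comp (swap12 G G)))
    have h1 : ∀ W : G ⊗[ℂ] (G ⊗[ℂ] G), ((swap12 G G).comp ((idT G (swapT G)).comp (swap12 G G)))
        (swap12 G G (idT G (swapT G) (swap12 G G W))) = W := by
      intro W
      change swap12 G G (idT G (swapT G) (swap12 G G (swap12 G G _))) = W
      rw [swap12_swap12, idT_comp]
      have h2 : (swapT G).comp (swapT G) = AlgHom.id ℂ _ := by
        ext x
        · rfl
        · rfl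
      rw [h2, idT_id, swap12_swap12]
    rw [h1] at h
    exact h
  have hk23 : ∀ Z : G ⊗[ℂ] G, Commute (j23 G G (Coalgebra.comul (R := ℂ) D.kappa))
      (idT G (Bialgebra.comulAlgHom ℂ G) Z) := by
    intro Z
    exact (comm_one_tmul_idT D.kappa_comm (Bialgebra.comulAlgHom ℂ G) Z)
  have hk12 : ∀ Z : G ⊗[ℂ] G, Commute (j12 G G (Coalgebra.comul (R := ℂ) D.kappa))
      (comulL G G Z) := fun Z => (comulL_mul_comul_comm D.kappa_comm Z).symm
  have e1 : j23 G G (Coalgebra.comul (R := ℂ) D.kappa) *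
      idT G (Bialgebra.comulAlgHom ℂ G) (D.kinv ⊗ₜ D.kinv) = D.kinv ⊗ₜ (1 ⊗ₜ 1) := by
    rw [idT_tmul, j23_apply, Algebra.TensorProduct.tmul_mul_tmul, one_mul]
    exact congrArg _ D.comul_kappa_mul
  have e2 : j12 G G (Coalgebra.comul (R := ℂ) D.kappa) *
      comulL G G (D.kinv ⊗ₜ D.kinv) = 1 ⊗ₜ (1 ⊗ₜ D.kinv) := by
    rw [comulL_tmul_eq, ← mul_assoc, ← map_mul, D.comul_kappa_mul, map_one, one_mul]
  -- Both sides reduce to a product of three `R`-matrices times the twofold coproduct of `κ` and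
  -- `κ⁻¹ ⊗ κ⁻¹ ⊗ κ⁻¹`. The two orders of the `R`-matrices agree by Yang-Baxter.
  have l : j23 G G D.Θ * idT G (Bialgebra.comulAlgHom ℂ G) D.Θ =
      j23 G G D.R * (j13 G G D.R * j12 G G D.R) * K * (D.kinv ⊗ₜ (D.kinv ⊗ₜ D.kinv)) := by
    rw [Θ, map_mul, map_mul, (hc23 _).symm.eq, map_mul (idT G _), map_mul (idT G _),
      D.toRibbonStarHopf.idT_comul_R, hK]
    have h3 := hk23 ((D.R : G ⊗[ℂ] G) * Coalgebra.comul (R := ℂ) D.kappa)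
    rw [map_mul, D.toRibbonStarHopf.idT_comul_R, hK] at h3
    calc _ = j23 G G (D.kinv ⊗ₜ[ℂ] D.kinv) * (j23 G G D.R *
        (j23 G G (Coalgebra.comul (R := ℂ) D.kappa) * (j13 G G D.R * j12 G G D.R * K)) *
          idT G (Bialgebra.comulAlgHom ℂ G) (D.kinv ⊗ₜ D.kinv)) := by simp only [mul_assoc]
      _ = j23 G G D.R * (j13 G G D.R * j12 G G D.R) * K *
          (j23 G G (Coalgebra.comul (R := ℂ) D.kappa) *
          idT G (Bialgebra.comulAlgHom ℂ G) (D.kinv ⊗ₜ D.kinv)) *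
            j23 G G (D.kinv ⊗ₜ[ℂ] D.kinv) := by
        rw [(hc23 _).eq, h3.eq]; simp only [mul_assoc]
      _ = _ := by
        rw [e1, mul_assoc _ (D.kinv ⊗ₜ[ℂ] _)]
        simp
  have r : j12 G G D.Θ * comulL G G D.Θ =
      j12 G G D.R * (j13 G G D.R * j23 G G D.R) * K * (D.kinv ⊗ₜ (D.kinv ⊗ₜ D.kinv)) := by
    rw [Θ, map_mul, map_mul, (hc12 _).symm.eq, map_mul (comulL G G), map_mul (comulL G G),
      D.toRibbonStarHopf.comulL_R]
    have h3 := hk12 ((D.R : G ⊗[ℂ] G) * Coalgebra.comul (R := ℂ) D.kappa)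
    rw [map_mul, D.toRibbonStarHopf.comulL_R] at h3
    calc _ = j12 G G (D.kinv ⊗ₜ[ℂ] D.kinv) * (j12 G G D.R *
        (j12 G G (Coalgebra.comul (R := ℂ) D.kappa) * (j13 G G D.R * j23 G G D.R * K)) *
          comulL G G (D.kinv ⊗ₜ D.kinv)) := by simp only [mul_assoc]; rfl
      _ = j12 G G D.R * (j13 G G D.R * j23 G G D.R) * K *
          (j12 G G (Coalgebra.comul (R := ℂ) D.kappa) * comulL G G (D.kinv ⊗ₜ D.kinv)) *
            j12 G G (D.kinv ⊗ₜ[ℂ] D.kinv) := by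
        rw [(hc12 _).eq, h3.eq]; simp only [mul_assoc]; rfl
      _ = _ := by
        rw [e2, mul_assoc _ (1 ⊗ₜ[ℂ] _)]
        simp
  rw [l, r, ← mul_assoc (j23 G G _), ← D.toRibbonStarHopf.yang_baxter, mul_assoc (j12 G G _)]

/-- The cocycle identity regroups the two successive twists: one factor is `Θ₁₂` on the pair of legs
to be pinched, the other is the coproduct, on this pair, of the twist with a single leg. -/
theorem twist_twist (s : AntiStar A) (δ : G →ₐ[ℂ] A) (Z : G ⊗[ℂ] (G ⊗[ℂ] A)) :
    D.twist (D.twist s δ) (coact δ) Z = comulL G A (idT G δ D.Θi) * j12 G A D.Θi *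
      (s.tens G).tens G Z * (j12 G A D.Θ * comulL G A (idT G δ D.Θ)) := by
  have h1 : j23 G A (idT G δ D.Θ) * idT G (coact δ) D.Θ =
      j12 G A D.Θ * comulL G A (idT G δ D.Θ) := by
    have h := congrArg (idT G (idT G δ)) D.Θ_cocycle
    rw [map_mul, map_mul, idT_j23, idT_comp, idT_j12, idT_comulL] at h
    exact h
  have h2 : idT G (coact δ) D.Θi * j23 G A (idT G δ D.Θi) =
      comulL G A (idT G δ D.Θi) * j12 G A D.Θi := by
    refine left_inv_eq_right_inv (a := j23 G A (idT G δ D.Θ) * idT G (coact δ) D.Θ) ?_ ?_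
    · rw [mul_assoc, ← mul_assoc (j23 G A _), j23_Θi_mul, one_mul, ← map_mul, Θi_mul_Θ, map_one]
    · rw [h1, mul_assoc, ← mul_assoc (comulL G A _), ← map_mul, ← map_mul, Θ_mul_Θi, map_one,
        map_one, one_mul, ← map_mul, Θ_mul_Θi, map_one]
  rw [twist_apply, tens_twist, ← h1, ← h2]
  simp only [mul_assoc]

variable [hM : D.Modular]

/-- The `*`-operation on the graph algebra. -/
def starL : ∀ m : ℕ, AntiStar (D.L m)
  | 0 =>
    { toLinearMap := (Algebra.linearMap ℂ (D.L 0)).comp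
        ((starLinearEquiv ℂ (A := ℂ)).toLinearMap.comp D.counit₀.toLinearMap)
      map_one' := by
        change algebraMap ℂ (D.L 0) (star (D.counit₀ 1)) = 1
        rw [map_one, star_one, map_one]
      map_mul' := fun x y => by
        change algebraMap ℂ (D.L 0) (star (D.counit₀ (x * y))) =
          algebraMap ℂ (D.L 0) (star (D.counit₀ y)) * algebraMap ℂ (D.L 0) (star (D.counit₀ x))
        rw [map_mul, star_mul, map_mul] }
  | m + 1 => (D.twist (starL m) (D.delta m)).transport (D.phiE m)

theorem phi_starL (m : ℕ) (X : D.L (m + 1)) : D.phi m (D.starL (m + 1) X) =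
    D.twist (D.starL m) (D.delta m) (D.phi m X) :=
  AntiStar.apply_transport _ (D.phiE m) X

theorem starL_delta (m : ℕ) (x : G) : D.starL m (D.delta m x) = D.delta m (star x) := by
  induction m generalizing x with
  | zero =>
    change algebraMap ℂ (D.L 0) (star (D.counit₀ (D.delta 0 x))) = _
    rw [delta_zero, delta_zero, AlgHom.commutes, D.counit_star]
    rfl
  | succ m ih =>
    apply D.phi_injective m
    rw [phi_starL, phi_delta, phi_delta, twist_coact ih]

/-- `starL` obeys the prescribed formula for the adjoint of the monodromies, with `delta(ξ)` in
place of `ξ`. -/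
theorem starMon_N {m : ℕ} (ν : Fin m) : D.StarMon (D.starL m) (D.delta m) (D.N ν) := by
  induction m with
  | zero => exact ν.elim0
  | succ m ih =>
    apply idT_injective (D.phi_injective m)
    have h : ∀ X, idT G (D.phi m) ((D.starL (m + 1)).tens G X) =
        (D.twist (D.starL m) (D.delta m)).tens G (idT G (D.phi m) X) := fun X =>
      AntiStar.idT_tens_transport _ (D.phiE m) X
    rw [map_mul, map_one, h, idT_monConj, phi_comp_delta]
    refine Fin.lastCases ?_ (fun ν => ?_) ν
    · rw [idT_phi_last]
      exact starMon_Q _ _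
    · rw [idT_phi_castSucc]
      exact (ih ν).shift (D.coact_delta_comm_N ν)

/-- The projectors are central, so the twist by `Θ` does not affect them, and the minimal central
idempotents are self-adjoint. -/
theorem starL_chiProd {m : ℕ} (K : Fin m → ι) : D.starL m (D.chiProd K) = D.chiProd K := by
  induction m with
  | zero =>
    change algebraMap ℂ (D.L 0) (star (D.counit₀ (D.chiProd K))) = _
    simp [chiProd]
  | succ m ih =>
    apply D.phi_injective m
    have h := D.chiProd_comm K ((D.phiE m).symm (idT G (D.delta m) D.Θ))
    have h1 := congrArg (D.phiE m) h.eq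
    rw [map_mul, map_mul, AlgEquiv.apply_symm_apply, phiE_apply] at h1
    rw [phi_starL, twist_apply]
    rw [phi_chiProd] at h1 ⊢
    rw [AntiStar.tens_tmul, ih, star_e, mul_assoc, h1, ← mul_assoc, ← map_mul, Θi_mul_Θ, map_one,
      one_mul]

theorem starL_moduliUnit {m : ℕ} (K : Fin m → ι) :
    D.starL m (D.moduliUnit K) = D.moduliUnit K := by
  rw [moduliUnit_eq, AntiStar.map_mul, starL_chiProd, starL_delta, star_e, (D.chiProd_comm K _).eq]

variable {D}

theorem starL_mem_moduli {m : ℕ} {K : Fin m → ι} {X : D.L m} (h : X ∈ D.moduli K) :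
    D.starL m X ∈ D.moduli K := by
  rw [mem_moduli] at h ⊢
  have h1 := D.starL_moduliUnit K
  refine ⟨?_, ?_⟩
  · conv_lhs => rw [← h1, ← AntiStar.map_mul, h.2]
  · conv_lhs => rw [← h1, ← AntiStar.map_mul, h.1]

variable (D)

theorem thetaE_starL (n : ℕ) (X : D.L (n + 2)) : D.thetaE n (D.starL (n + 2) X) =
    comulL G _ (idT G (D.delta n) D.Θi) * j12 G _ D.Θi *
      ((D.starL n).tens G).tens G (D.thetaE n X) *
        (j12 G _ D.Θ * comulL G _ (idT G (D.delta n) D.Θ)) := by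
  rw [← twist_twist, thetaE_apply, phi_starL]
  have h := D.idT_twist (D.twist (D.starL n) (D.delta n)) (D.phiE n) (D.delta (n + 1))
    (D.phi (n + 1) X)
  refine h.trans ?_
  have h1 : (D.phiE n).toAlgHom.comp (D.delta (n + 1)) = coact (D.delta n) := D.phi_comp_delta n
  rw [h1]
  rfl

end SymmetryData
end GraphStar

/-! ### The semi-direct product -/

section SemiDirect

variable {G ι : Type*} [Ring G] [HopfAlgebra ℂ G] [StarRing G] [StarModule ℂ G]
variable [FiniteDimensional ℂ G] [IsSemisimpleRing G] [Fintype ι] [DecidableEq ι]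
variable {A : Type*} [Ring A] [Algebra ℂ A] {B : Type*} [Ring B] [Algebra ℂ B]

/-- `ξ ↦ ∑ ξ² ⊗ δ(ξ¹)`. -/
def coactOp (δ : G →ₐ[ℂ] A) : G →ₐ[ℂ] G ⊗[ℂ] A :=
  (idT G δ).comp ((swapT G).comp (Bialgebra.comulAlgHom ℂ G))

theorem coactOp_apply (δ : G →ₐ[ℂ] A) (x : G) :
    coactOp δ x = idT G δ (swapT G (Coalgebra.comul (R := ℂ) x)) := rfl

/-- `x ⊗ y ⊗ z ↦ x ⊗ z ⊗ δ(y)`. -/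
def swap23 (δ : G →ₐ[ℂ] A) : G ⊗[ℂ] (G ⊗[ℂ] G) →ₐ[ℂ] G ⊗[ℂ] (G ⊗[ℂ] A) :=
  idT G ((idT G δ).comp (swapT G))

theorem swap23_j12 (δ : G →ₐ[ℂ] A) (X : G ⊗[ℂ] G) :
    swap23 δ (j12 G G X) = j13 G A (idT G δ X) := by
  induction X with
  | zero => simp
  | add p q hp hq => simp only [map_add, hp, hq]
  | tmul x y => simp [swap23]

theorem swap23_j13 (δ : G →ₐ[ℂ] A) (X : G ⊗[ℂ] G) : swap23 δ (j13 G G X) = j12 G A X := by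
  induction X with
  | zero => simp
  | add p q hp hq => simp only [map_add, hp, hq]
  | tmul x y => simp [swap23]

theorem swap23_j23 (δ : G →ₐ[ℂ] A) (X : G ⊗[ℂ] G) :
    swap23 δ (j23 G G X) = j23 G A (idT G δ (swapT G X)) := rfl

/-- The iterated coproduct, with its second and third legs exchanged and `δ` on the last, restricts
on the legs of `N₁₃` to `coact δ`. -/
theorem swap23_comulL_comm {δ : G →ₐ[ℂ] A} {N : G ⊗[ℂ] A} (h : ∀ x, Commute (coact δ x) N)
    (Z : G ⊗[ℂ] G) : Commute (swap23 δ (comulL G G Z)) (j13 G A N) := by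
  refine commute_of_tmul ((swap23 δ).comp (comulL G G)) fun x y => ?_
  change Commute (swap23 δ (comulL G G (x ⊗ₜ y))) _
  rw [comulL_tmul_eq, map_mul, swap23_j12]
  refine Commute.mul_left ((h x).map (j13 G A)) ?_
  have h1 : swap23 δ (1 ⊗ₜ (1 ⊗ₜ y)) = 1 ⊗ₜ (y ⊗ₜ 1) := by simp [swap23]
  rw [h1]
  refine Commute.symm (commute_of_tmul (j13 G A) fun a b => ?_)
  simp [Commute, SemiconjBy]

theorem idT_coactOp_comul (δ : G →ₐ[ℂ] A) (x : G) :
    idT G (coactOp δ) (Coalgebra.comul (R := ℂ) x) =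
      swap23 δ (comulL G G (Coalgebra.comul (R := ℂ) x)) := by
  have h : comulL G G (Coalgebra.comul (R := ℂ) x) =
    idT G (Bialgebra.comulAlgHom ℂ G) (Coalgebra.comul (R := ℂ) x) :=
    Coalgebra.coassoc_apply (R := ℂ) x
  rw [h, swap23, idT_comp]
  rfl

theorem mulL_antipodeL_comul (x : G) : mulL G G (antipodeL G _
    (idT G (Bialgebra.comulAlgHom ℂ G) (Coalgebra.comul (R := ℂ) x))) = 1 ⊗ₜ x := by
  have h : comulL G G (Coalgebra.comul (R := ℂ) x) =
    idT G (Bialgebra.comulAlgHom ℂ G) (Coalgebra.comul (R := ℂ) x) :=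
    Coalgebra.coassoc_apply (R := ℂ) x
  rw [← h, mulL_antipodeL_comulL, counitL_comul]

theorem mulL_antipodeL_tmul_comul (x y : G) : mulL G G (antipodeL G _
    (idT G (Bialgebra.comulAlgHom ℂ G) (x ⊗ₜ y))) =
      (HopfAlgebra.antipode ℂ x ⊗ₜ 1) * Coalgebra.comul (R := ℂ) y := by
  rw [idT_tmul, antipodeL_tmul]
  change mulL G G (HopfAlgebra.antipode ℂ x ⊗ₜ[ℂ] (Coalgebra.comul (R := ℂ) y)) = _
  induction Coalgebra.comul (R := ℂ) y with
  | zero => simp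
  | add p q hp hq => simp only [map_add, mul_add, TensorProduct.tmul_add, hp, hq]
  | tmul a b => simp

namespace SymmetryData

variable (D : SymmetryData G ι)

theorem half_eq_ev (J : ι) (f : G →ₐ[ℂ] B) (X : G ⊗[ℂ] G) :
    D.half J f.toLinearMap X = D.ev B J (idT G f X) := by
  ext a b
  rw [IrrepSystem.ev_apply]
  induction X with
  | zero => simp [half]
  | add p q hp hq =>
    simp only [half, Matrix.of_apply, map_add] at hp hq ⊢
    rw [hp, hq]
  | tmul x y => rfl

theorem half_map (J : ι) (f : G →ₗ[ℂ] A) (h : A →ₐ[ℂ] B) (X : G ⊗[ℂ] G) :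
    (D.half J f X).map h = D.half J (h.toLinearMap ∘ₗ f) X := by
  ext a b
  induction X with
  | zero => simp [half]
  | add p q hp hq =>
    simp only [half, Matrix.of_apply, map_add, Matrix.map_apply] at hp hq ⊢
    rw [hp, hq]
  | tmul x y => simp [half]

/-- The quotient map onto the semi-direct product. -/
def projSD (m : ℕ) : TensorAlgebra ℂ (G × D.L m) →ₐ[ℂ] D.SD m :=
  RingQuot.mkAlgHom ℂ (D.CrossRel m)

theorem SD_rel {m : ℕ} {x y : TensorAlgebra ℂ (G × D.L m)} (h : D.CrossRel m x y) :
    D.projSD m x = D.projSD m y :=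
  RingQuot.mkAlgHom_rel ℂ h

/-- The embedding of `G` as a homomorphism. -/
def inGHom (m : ℕ) : G →ₐ[ℂ] D.SD m := AlgHom.ofLinearMap (D.inG m)
  ((D.SD_rel CrossRel.oneG).trans (map_one _))
  (fun ξ η => (D.SD_rel (CrossRel.mulG ξ η)).trans (map_mul _ _ _))

/-- The embedding of `L_m` as a homomorphism. -/
def inLHom (m : ℕ) : D.L m →ₐ[ℂ] D.SD m := AlgHom.ofLinearMap (D.inL m)
  ((D.SD_rel CrossRel.oneL).trans (map_one _))
  (fun ξ η => (D.SD_rel (CrossRel.mulL ξ η)).trans (map_mul _ _ _))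

theorem idT_map_M {m : ℕ} (ν : Fin m) (J : ι) (f : D.L m →ₐ[ℂ] B) :
    D.ev B J (idT G f (D.N ν)) = D.κ J • (D.M ν J).map f := by
  rw [IrrepSystem.ev_idT, ev_N]
  ext a b
  simp

theorem inGHom_comm_N {m : ℕ} (ν : Fin m) (ξ : G) :
    Commute (idT G (D.inGHom m) (Coalgebra.comul (R := ℂ) ξ)) (idT G (D.inLHom m) (D.N ν)) := by
  refine D.ev_ext fun J => ?_
  have h : D.ev _ J (idT G (D.inGHom m) (Coalgebra.comul (R := ℂ) ξ)) * (D.M ν J).map (D.inLHom m) =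
      (D.M ν J).map (D.inLHom m) * D.ev _ J (idT G (D.inGHom m) (Coalgebra.comul (R := ℂ) ξ)) := by
    rw [← half_eq_ev]
    have h1 : D.half J (D.inGHom m).toLinearMap (Coalgebra.comul (R := ℂ) ξ) =
        (D.half J (D.preG m) (Coalgebra.comul (R := ℂ) ξ)).map (D.projSD m) := (D.half_map _ _ _ _).symm
    have h2 : (D.M ν J).map (D.inLHom m) = ((D.M ν J).map (D.preL m)).map (D.projSD m) := by
      ext a b
      rfl
    rw [h1, h2, ← Matrix.map_mul, ← Matrix.map_mul]
    ext a b
    exact D.SD_rel (CrossRel.cross ξ ν J a b)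
  rw [map_mul, map_mul, idT_map_M, Matrix.mul_smul, h, Matrix.smul_mul]

/-- The subspace `L_m G` of the semi-direct product. -/
def spanSD (m : ℕ) : G ⊗[ℂ] D.L m →ₗ[ℂ] D.SD m :=
  TensorProduct.lift ((LinearMap.mul ℂ (D.SD m)).compl₁₂ (D.inL m) (D.inG m)).flip

theorem spanSD_tmul {m : ℕ} (ξ : G) (X : D.L m) :
    D.spanSD m (ξ ⊗ₜ X) = D.inLHom m X * D.inGHom m ξ := rfl

/-- Elements of `G` can be ordered to the right of `L_m`, which bounds the dimension of the
semi-direct product from above. -/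
theorem spanSD_surjective (m : ℕ) : Function.Surjective (D.spanSD m) := by
  set U := LinearMap.range (D.spanSD m) with hU
  have hU0 : ∀ X ξ, D.inLHom m X * D.inGHom m ξ ∈ U := fun X ξ => ⟨ξ ⊗ₜ X, rfl⟩
  have hUl : ∀ X, ∀ u ∈ U, D.inLHom m X * u ∈ U := by
    rintro X _ ⟨t, rfl⟩
    induction t with
    | zero => rw [map_zero, mul_zero]; exact U.zero_mem
    | add p q hp hq => rw [map_add, mul_add]; exact U.add_mem hp hq
    | tmul ξ Y => rw [spanSD_tmul, ← mul_assoc, ← map_mul]; exact hU0 _ _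
  have hUr : ∀ ξ, ∀ u ∈ U, u * D.inGHom m ξ ∈ U := by
    rintro ξ _ ⟨t, rfl⟩
    induction t with
    | zero => rw [map_zero, zero_mul]; exact U.zero_mem
    | add p q hp hq => rw [map_add, add_mul]; exact U.add_mem hp hq
    | tmul η Y => rw [spanSD_tmul, mul_assoc, ← map_mul]; exact hU0 _ _
  -- Writing `1 ⊗ ξ = ∑ (S(ξ¹) ⊗ 1) Δ(ξ²)` lets the crossing relation carry `ξ` across `N_ν`.
  have hN : ∀ (ν : Fin m) (f : G →ₗ[ℂ] ℂ) (ξ : G),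
      D.inGHom m ξ * D.inLHom m (slice _ f (D.N ν)) ∈ U := by
    intro ν f ξ
    set N := idT G (D.inLHom m) (D.N ν) with hN
    have h1 : ∀ (W : G ⊗[ℂ] G) (f : G →ₗ[ℂ] ℂ), slice _ f (N * idT G (D.inGHom m) W) ∈ U := by
      intro W f
      induction W with
      | zero => rw [map_zero, mul_zero, map_zero]; exact U.zero_mem
      | add p q hp hq => rw [map_add, mul_add, map_add]; exact U.add_mem hp hq
      | tmul x y =>
        rw [idT_tmul, slice_mul_tmul, hN, slice_idT]
        exact hU0 _ _
    have h2 : ∀ Z : G ⊗[ℂ] G, slice _ f (idT G (D.inGHom m) (mulL G G (antipodeL G _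
        (idT G (Bialgebra.comulAlgHom ℂ G) Z))) * N) ∈ U := by
      intro Z
      induction Z with
      | zero => simp only [map_zero, zero_mul]; exact U.zero_mem
      | add p q hp hq => simp only [map_add, add_mul]; exact U.add_mem hp hq
      | tmul x y =>
        rw [mulL_antipodeL_tmul_comul, map_mul (idT G _), mul_assoc, (D.inGHom_comm_N ν y).eq, idT_tmul,
          map_one, slice_tmul_mul, one_mul]
        exact h1 _ _
    have h3 := h2 (Coalgebra.comul (R := ℂ) ξ)
    rwa [mulL_antipodeL_comul, idT_tmul, slice_one_tmul_mul, hN, slice_idT] at h3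
  let S : Subalgebra ℂ (D.L m) :=
    { carrier := {X | ∀ u ∈ U, u * D.inLHom m X ∈ U}
      mul_mem' := fun {a b} ha hb u hu => by rw [map_mul, ← mul_assoc]; exact hb _ (ha _ hu)
      add_mem' := fun {a b} ha hb u hu => by
        rw [map_add, mul_add]; exact U.add_mem (ha _ hu) (hb _ hu)
      algebraMap_mem' := fun c u hu => by
        rw [AlgHom.commutes, ← Algebra.commutes, ← Algebra.smul_def]
        exact U.smul_mem c hu }
  have hS : S = ⊤ := by
    refine D.adjoin_slice_N S fun ν f => ?_
    rintro _ ⟨t, rfl⟩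
    induction t with
    | zero => rw [map_zero, zero_mul]; exact U.zero_mem
    | add p q hp hq => rw [map_add, add_mul]; exact U.add_mem hp hq
    | tmul ξ Y =>
      rw [spanSD_tmul, mul_assoc]
      exact hUl _ _ (hN ν f ξ)
  have hSX : ∀ X, ∀ u ∈ U, u * D.inLHom m X ∈ U := fun X => by
    have : X ∈ S := by rw [hS]; trivial
    exact this
  let T : Subalgebra ℂ (D.SD m) :=
    { carrier := {Y | ∀ u ∈ U, u * Y ∈ U}
      mul_mem' := fun {a b} ha hb u hu => by rw [← mul_assoc]; exact hb _ (ha _ hu)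
      add_mem' := fun {a b} ha hb u hu => by rw [mul_add]; exact U.add_mem (ha _ hu) (hb _ hu)
      algebraMap_mem' := fun c u hu => by
        rw [← Algebra.commutes, ← Algebra.smul_def]
        exact U.smul_mem c hu }
  have hT : ∀ t : TensorAlgebra ℂ (G × D.L m), D.projSD m t ∈ T := by
    intro t
    induction t using TensorAlgebra.induction with
    | algebraMap r => rw [AlgHom.commutes]; exact T.algebraMap_mem r
    | ι x =>
      have h : D.projSD m (TensorAlgebra.ι ℂ x) =
          D.inGHom m x.1 + D.inLHom m x.2 := by
        have hx : x = LinearMap.inl ℂ G (D.L m) x.1 + LinearMap.inr ℂ G (D.L m) x.2 := by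
          ext <;> simp
        conv_lhs => rw [hx, map_add, map_add]
        rfl
      rw [h]
      exact T.add_mem (hUr x.1) (hSX x.2)
    | mul a b ha hb => rw [map_mul]; exact T.mul_mem ha hb
    | add a b ha hb => rw [map_add]; exact T.add_mem ha hb
  intro Y
  obtain ⟨t, rfl⟩ : ∃ t, D.projSD m t = Y := RingQuot.mkAlgHom_surjective ℂ (D.CrossRel m) Y
  have h1 : (1 : D.SD m) ∈ U := by
    have := hU0 1 1
    rwa [map_one, map_one, mul_one] at this
  have := hT t 1 h1
  rwa [one_mul] at this

variable [hM : D.Modular]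

/-- The isomorphism of the semi-direct product with `G ⊗ L_m`. -/
def decouple (m : ℕ) : D.SD m →ₐ[ℂ] G ⊗[ℂ] D.L m :=
  RingQuot.liftAlgHom ℂ ⟨TensorAlgebra.lift ℂ ((coactOp (D.delta m)).toLinearMap.coprod
    (Algebra.TensorProduct.includeRight : D.L m →ₐ[ℂ] G ⊗[ℂ] D.L m).toLinearMap), by
    set F := TensorAlgebra.lift ℂ ((coactOp (D.delta m)).toLinearMap.coprod
      (Algebra.TensorProduct.includeRight : D.L m →ₐ[ℂ] G ⊗[ℂ] D.L m).toLinearMap) with hF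
    have hG : ∀ ξ, F (D.preG m ξ) = coactOp (D.delta m) ξ := fun ξ => by simp [hF, preG]
    have hL : ∀ X, F (D.preL m X) = 1 ⊗ₜ X := fun ξ => by simp [hF, preL]
    intro x y hxy
    cases hxy with
    | oneG => rw [hG, map_one, map_one]
    | mulG ξ η => rw [hG, map_mul, map_mul, hG, hG]
    | oneL => rw [hL, map_one]; rfl
    | mulL X Y => rw [hL, map_mul, hL, hL]; simp
    | cross ξ ν J a b =>
      have h1 : (D.half J (D.preG m) (Coalgebra.comul (R := ℂ) ξ)).map F =
          D.ev _ J (idT G (coactOp (D.delta m)) (Coalgebra.comul (R := ℂ) ξ)) := by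
        rw [half_map, ← half_eq_ev]
        congr 1
        ext ξ
        exact hG ξ
      have h2 : ((D.M ν J).map (D.preL m)).map F =
          (D.κ J)⁻¹ • D.ev _ J (j13 G (D.L m) (D.N ν)) := by
        have h := D.idT_map_M ν J
          (Algebra.TensorProduct.includeRight : D.L m →ₐ[ℂ] G ⊗[ℂ] D.L m)
        change D.ev _ J (j13 G (D.L m) (D.N ν)) = _ at h
        rw [h, smul_smul, inv_mul_cancel₀ (D.κ_ne_zero J), one_smul]
        ext a b
        exact hL _
      -- The crossing relation holds in `G ⊗ L_m` because the monodromies are covariant under the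
      -- moment map.
      have h3 := (swap23_comulL_comm (D.coact_delta_comm_N ν)
        (Coalgebra.comul (R := ℂ) ξ)).map (D.ev _ J)
      rw [← idT_coactOp_comul] at h3
      change (Matrix.map _ F) a b = (Matrix.map _ F) a b
      rw [Matrix.map_mul, Matrix.map_mul, h1, h2, Matrix.mul_smul, Matrix.smul_mul, h3.eq]⟩

theorem decouple_inG {m : ℕ} (ξ : G) :
    D.decouple m (D.inGHom m ξ) = coactOp (D.delta m) ξ := by
  refine (RingQuot.liftAlgHom_mkAlgHom_apply ℂ _ _ _).trans ?_
  simp [preG]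

theorem decouple_inL {m : ℕ} (X : D.L m) : D.decouple m (D.inLHom m X) = 1 ⊗ₜ X := by
  refine (RingQuot.liftAlgHom_mkAlgHom_apply ℂ _ _ _).trans ?_
  simp [preL]

/-- `ξ ⊗ 1` is recovered as `∑ (1 ⊗ delta(S(ξ¹)))` times the image of `ξ²`. -/
theorem decouple_surjective (m : ℕ) : Function.Surjective (D.decouple m) := by
  have h0 : ∀ X : D.L m, 1 ⊗ₜ X ∈ (D.decouple m).range := fun X => ⟨_, D.decouple_inL X⟩
  have h1 : ∀ Z : G ⊗[ℂ] G, idT G (D.delta m) (swapT G (mulL G G (antipodeL G _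
      (idT G (Bialgebra.comulAlgHom ℂ G) Z)))) ∈ (D.decouple m).range := by
    intro Z
    induction Z with
    | zero => simp only [map_zero]; exact Subalgebra.zero_mem _
    | add p q hp hq => simp only [map_add]; exact Subalgebra.add_mem _ hp hq
    | tmul x y =>
      rw [mulL_antipodeL_tmul_comul, map_mul, map_mul]
      exact Subalgebra.mul_mem _ (h0 _) ⟨_, D.decouple_inG y⟩
  have h2 : ∀ ξ : G, ξ ⊗ₜ 1 ∈ (D.decouple m).range := by
    intro ξ
    have := h1 (Coalgebra.comul (R := ℂ) ξ)
    rwa [mulL_antipodeL_comul, swapT_tmul, idT_tmul, map_one] at this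
  intro Z
  change Z ∈ (D.decouple m).range
  induction Z with
  | zero => exact Subalgebra.zero_mem _
  | add p q hp hq => exact Subalgebra.add_mem _ hp hq
  | tmul ξ X =>
    have := Subalgebra.mul_mem _ (h2 ξ) (h0 X)
    rwa [Algebra.TensorProduct.tmul_mul_tmul, mul_one, one_mul] at this

theorem decouple_injective (m : ℕ) : Function.Injective (D.decouple m) := by
  have h1 : Function.Surjective ((D.decouple m).toLinearMap ∘ₗ D.spanSD m) :=
    (D.decouple_surjective m).comp (D.spanSD_surjective m)
  have h2 := LinearMap.injective_iff_surjective.2 h1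
  rw [injective_iff_map_eq_zero]
  intro Y hY
  obtain ⟨t, rfl⟩ := D.spanSD_surjective m Y
  have h4 : ((D.decouple m).toLinearMap ∘ₗ D.spanSD m) t = 0 := hY
  rw [(injective_iff_map_eq_zero _).1 h2 t h4, map_zero]

end SymmetryData
end SemiDirect

/-! ### Adjoints of invariant elements -/

section Adjoint

variable {G ι : Type*} [Ring G] [HopfAlgebra ℂ G] [StarRing G] [StarModule ℂ G]
variable [FiniteDimensional ℂ G] [IsSemisimpleRing G] [Fintype ι] [DecidableEq ι]
variable {A : Type*} [Ring A] [Algebra ℂ A] {B : Type*} [Ring B] [Algebra ℂ B]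

namespace SymmetryData

variable (D : SymmetryData G ι)

/-- Unitarity of `v` gives `|κ_I|⁴ = 1`, and `|κ_I|²` is nonnegative. -/
theorem star_κ_mul_κ (I : ι) : star (D.κ I) * D.κ I = 1 := by
  have h := congrArg (fun x => D.τ I x 0 0) D.star_v
  simp only [map_mul, map_star, map_one, D.κ_sq] at h
  simp only [Matrix.star_eq_conjTranspose, Matrix.conjTranspose_smul, Matrix.conjTranspose_one,
    Matrix.smul_mul, Matrix.one_mul, Matrix.smul_apply, Matrix.one_apply_eq,
    smul_eq_mul, mul_one] at h
  have h1 : (Complex.normSq (D.κ I)) ^ 2 = 1 := by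
    have h2 : ((Complex.normSq (D.κ I) : ℂ)) ^ 2 = 1 := by
      rw [Complex.normSq_eq_conj_mul_self, mul_pow, ← h, star_pow]
      rfl
    exact_mod_cast h2
  have h2 : Complex.normSq (D.κ I) = 1 := by
    have := Complex.normSq_nonneg (D.κ I)
    nlinarith
  have h3 := Complex.normSq_eq_conj_mul_self (z := D.κ I)
  rw [h2] at h3
  exact_mod_cast h3.symm

variable {D}

/-- The adjoint of a monodromy, in the decoupled semi-direct product. -/
theorem StarMon.monConj_coactOp {s : AntiStar A} {δ : G →ₐ[ℂ] A} {N Ni : G ⊗[ℂ] A}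
    (h : D.StarMon s δ N) (hN : ∀ x, Commute (coact δ x) N) (hi : N * Ni = 1) :
    D.monConj (coactOp δ) (j13 G A Ni) = j23 G A (idT G δ (swapT G D.Θi)) *
      j13 G A (s.tens G N) * j23 G A (idT G δ (swapT G D.Θ)) := by
  set H := D.toRibbonStarHopf
  set F := j23 G A (idT G δ (swapT G D.Θ)) with hF
  set Fi := j23 G A (idT G δ (swapT G D.Θi)) with hFi
  have hFF : Fi * F = 1 := by
    rw [hF, hFi, ← map_mul, ← map_mul, ← map_mul, Θi_mul_Θ, map_one, map_one, map_one]
  set X := D.monConj (coactOp δ) (j13 G A N) with hX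
  set t := j23 G A (idT G δ (swapT G H.R)) with ht
  set u := j12 G A (H.R : G ⊗[ℂ] G) * j13 G A (idT G δ H.R) with hu
  set ui := j13 G A (idT G δ H.Ri) * j12 G A H.Ri with hui
  have hR : ∀ Y : G ⊗[ℂ] G, idT G (coactOp δ) Y =
      swap23 δ (idT G (Bialgebra.comulAlgHom ℂ G) Y) := fun Y => by
    rw [swap23, idT_comp]
    rfl
  have hRu : idT G (coactOp δ) (H.R : G ⊗[ℂ] G) = u := by
    rw [hR, H.idT_comul_R, map_mul, swap23_j12, swap23_j13]
  have huu : u * ui = 1 := by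
    rw [hu, hui, mul_assoc, ← mul_assoc (j13 G A _), ← map_mul, ← map_mul, H.mul_Ri, map_one,
      map_one, one_mul, H.j12_R_mul_Ri]
  have hRi : idT G (coactOp δ) H.Ri = ui := by
    refine left_inv_eq_right_inv (a := u) ?_ huu
    rw [← hRu, ← map_mul, H.Ri_mul, map_one]
  have hXX : ∀ Y Y' : G ⊗[ℂ] A, Y * Y' = 1 → D.monConj (coactOp δ) (j13 G A Y) *
      D.monConj (coactOp δ) (j13 G A Y') = 1 := by
    intro Y Y' hY
    have k1 : (1 : G) ⊗ₜ[ℂ] coactOp δ D.kappa * (1 ⊗ₜ[ℂ] coactOp δ D.kinv) = 1 := by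
      rw [Algebra.TensorProduct.tmul_mul_tmul, ← map_mul, kappa_mul_kinv, map_one, one_mul]
      rfl
    have k2 : (1 : G) ⊗ₜ[ℂ] coactOp δ D.kinv * (1 ⊗ₜ[ℂ] coactOp δ D.kappa) = 1 := by
      rw [Algebra.TensorProduct.tmul_mul_tmul, ← map_mul, kinv_mul_kappa, map_one, one_mul]
      rfl
    have k3 : idT G (coactOp δ) H.Ri * idT G (coactOp δ) (H.R : G ⊗[ℂ] G) = 1 := by
      rw [← map_mul, H.Ri_mul, map_one]
    have k4 : idT G (coactOp δ) (H.R : G ⊗[ℂ] G) * idT G (coactOp δ) H.Ri = 1 := by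
      rw [← map_mul, H.mul_Ri, map_one]
    have k5 : j13 G A Y * j13 G A Y' = 1 := by rw [← map_mul, hY, map_one]
    have aux : ∀ {Q : Type _} [Ring Q] {a b c d y z : Q}, b * a = 1 → a * b = 1 → c * d = 1 →
        d * c = 1 → y * z = 1 → (a * (d * y * c) * b) * (a * (d * z * c) * b) = 1 := by
      intro Q _ a b c d y z h1 h2 h3 h4 h5
      calc _ = a * (d * y * (c * ((b * a) * d)) * z * c) * b := by simp only [mul_assoc]
        _ = 1 := by
          rw [h1, one_mul, h3, mul_one, mul_assoc d y z, h5, mul_one, h4, mul_one, h2]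
    exact aux k1 k2 k3 k4 k5
  have h1 : SemiconjBy (1 ⊗ₜ coactOp δ D.kappa) X (u * j13 G A N * ui) := by
    rw [hX, monConj, hRu, hRi]
    refine semiconj_conj ?_ _
    rw [Algebra.TensorProduct.tmul_mul_tmul, ← map_mul, kappa_mul_kinv, map_one, one_mul]
    rfl
  have h2 : SemiconjBy t (u * j13 G A N * ui)
      (j13 G A (idT G δ H.R) * j13 G A N * j13 G A (idT G δ H.Ri)) := by
    have yb := congrArg (swap23 δ) H.yang_baxter
    simp only [map_mul, swap23_j12, swap23_j13, swap23_j23] at yb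
    refine semiconj_of_mul_eq (c := j12 G A H.R * t) ?_ ?_ huu ?_
    · rw [hu, ht, ← mul_assoc, ← mul_assoc]
      exact yb.symm
    · have := swap23_comulL_comm hN (H.R : G ⊗[ℂ] G)
      rwa [H.comulL_R, map_mul, swap23_j13, swap23_j23] at this
    · rw [← map_mul, ← map_mul, H.Ri_mul, map_one, map_one]
  have hL : (1 : G ⊗[ℂ] (G ⊗[ℂ] A)) = 1 ⊗ₜ (1 ⊗ₜ 1) := rfl
  have h3 : SemiconjBy (1 ⊗ₜ (1 ⊗ₜ δ D.kinv))
      (j13 G A (idT G δ H.R) * j13 G A N * j13 G A (idT G δ H.Ri))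
      (j13 G A (D.monConj δ N)) := by
    rw [monConj, map_mul, map_mul, map_mul, map_mul, SemiconjBy, mul_assoc _ _ (j13 G A _),
      mul_assoc _ _ (1 ⊗ₜ (1 ⊗ₜ δ D.kinv))]
    rw [j13_tmul, j13_tmul, Algebra.TensorProduct.tmul_mul_tmul,
      Algebra.TensorProduct.tmul_mul_tmul, mul_one, ← map_mul δ, kappa_mul_kinv, map_one,
      ← hL, mul_one]
  have hE : F = (1 ⊗ₜ (1 ⊗ₜ δ D.kinv)) * t * (1 ⊗ₜ coactOp δ D.kappa) *
      (1 ⊗ₜ (D.kinv ⊗ₜ 1)) := by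
    have h4 : j23 G A (D.kinv ⊗ₜ δ D.kinv) = (1 ⊗ₜ (1 ⊗ₜ δ D.kinv)) * (1 ⊗ₜ (D.kinv ⊗ₜ 1)) := by
      simp
    have h5 : Commute (1 ⊗ₜ (1 ⊗ₜ δ D.kinv)) (t * j23 G A (coactOp δ D.kappa)) := by
      rw [coactOp_apply, ht, ← map_mul, ← map_mul]
      exact (comm_one_tmul_idT D.kinv_comm δ _).map (j23 G A)
    rw [hF, Θ, map_mul, map_mul, map_mul, map_mul, map_mul, map_mul, swapT_tmul, idT_tmul, h4,
      ← mul_assoc (_ * _)]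
    change t * j23 G A (coactOp δ D.kappa) * _ * _ = _
    rw [← h5.eq, ← mul_assoc]
    rfl
  -- The flipped `Θ` is a product of `R`- and `κ`-factors, and each removes one layer of the
  -- conjugation, as in `StarMon.shift`.
  have h6 : SemiconjBy F X (j13 G A (D.monConj δ N)) := by
    rw [hE]
    exact ((h3.mul_left h2).mul_left h1).mul_left (comm_one_tmul_central D.kinv_comm X)
  have h7 : Fi * j13 G A (s.tens G N) * F * X = 1 := by
    rw [mul_assoc, h6.eq, ← mul_assoc, mul_assoc Fi, ← map_mul,
      show s.tens G N * D.monConj δ N = 1 from h, map_one, mul_one, hFF]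
  exact (left_inv_eq_right_inv h7 (hXX _ _ hi)).symm

variable [hM : D.Modular]

theorem ev_one_tmul_conj {I : ι} (c d : A) (Y : G ⊗[ℂ] A) (a b : Fin (D.n I)) :
    D.ev A I ((1 ⊗ₜ c) * Y * (1 ⊗ₜ d)) a b = c * D.ev A I Y a b * d := by
  rw [IrrepSystem.ev_apply, slice_mul_one_tmul, slice_one_tmul_mul]
  rfl

/-- In `G ⊗ L_m` the prescribed adjoint of a monodromy is its `starL`-adjoint conjugated by the
flipped `Θ`. The numbers `κ_I` and `star κ_I` from the normalization of `N` cancel because `|κ_I| =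
1`. -/
theorem decouple_Mstar {m : ℕ} (ν : Fin m) (I : ι) (a b : Fin (D.n I)) :
    D.decouple m (D.Mstar ν I b a) = idT G (D.delta m) (swapT G D.Θi) *
      (1 ⊗ₜ D.starL m (D.M ν I a b)) * idT G (D.delta m) (swapT G D.Θ) := by
  obtain ⟨Nu, hNu⟩ := D.isUnit_N ν
  set Ni : G ⊗[ℂ] D.L m := ((Nu⁻¹ : (G ⊗[ℂ] D.L m)ˣ) : G ⊗[ℂ] D.L m) with hNi
  have hi : D.N ν * Ni = 1 := by rw [← hNu, hNi, Units.mul_inv]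
  have hi' : Ni * D.N ν = 1 := by rw [← hNu, hNi, Units.inv_mul]
  have hc : D.κ I * (D.κ I)⁻¹ = 1 := mul_inv_cancel₀ (D.κ_ne_zero I)
  have hM1 : (D.M ν I).map (D.inL m) = (D.κ I)⁻¹ • D.ev _ I (idT G (D.inLHom m) (D.N ν)) := by
    rw [idT_map_M, smul_smul, mul_comm, hc, one_smul]
    rfl
  have hinv : Ring.inverse ((D.M ν I).map (D.inL m)) =
      D.κ I • D.ev _ I (idT G (D.inLHom m) Ni) := by
    rw [hM1]
    refine Ring.inverse_unit (⟨_, D.κ I • D.ev _ I (idT G (D.inLHom m) Ni), ?_, ?_⟩ :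
      (Matrix (Fin (D.n I)) (Fin (D.n I)) (D.SD m))ˣ)
    · rw [smul_mul_smul_comm, ← map_mul, ← map_mul, hi, map_one, map_one, mul_comm, hc, one_smul]
    · rw [smul_mul_smul_comm, ← map_mul, ← map_mul, hi', map_one, map_one, hc, one_smul]
  have h1 : D.half I (D.inG m) (D.R : G ⊗[ℂ] G) = D.ev _ I (idT G (D.inGHom m) D.R) :=
    D.half_eq_ev I (D.inGHom m) _
  have h2 : D.half I (D.inG m) ((D.R⁻¹ : (G ⊗[ℂ] G)ˣ) : G ⊗[ℂ] G) =
      D.ev _ I (idT G (D.inGHom m) D.toRibbonStarHopf.Ri) :=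
    D.half_eq_ev I (D.inGHom m) _
  have h3 : (D.decouple m).comp (D.inGHom m) = coactOp (D.delta m) := by
    ext x
    exact D.decouple_inG x
  have h4 : (D.decouple m).comp (D.inLHom m) = Algebra.TensorProduct.includeRight := by
    ext x
    exact D.decouple_inL x
  have h5 : D.Mstar ν I b a = D.κ I • D.ev _ I ((1 ⊗ₜ D.inGHom m D.kinv) *
      (idT G (D.inGHom m) D.R * idT G (D.inLHom m) Ni *
        idT G (D.inGHom m) D.toRibbonStarHopf.Ri) * (1 ⊗ₜ D.inGHom m D.kappa)) b a := by
    rw [ev_one_tmul_conj, Mstar, h1, h2, hinv, D.inverse_kappa, Matrix.map_apply,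
      map_mul (D.ev _ I), map_mul (D.ev _ I), Matrix.mul_smul, Matrix.smul_mul, Matrix.smul_apply,
      mul_smul_comm, smul_mul_assoc]
    rfl
  have h6 : ∀ Y : G ⊗[ℂ] D.SD m, D.decouple m (D.ev _ I Y b a) =
      D.ev _ I (idT G (D.decouple m) Y) b a := by
    intro Y
    rw [IrrepSystem.ev_idT]
    rfl
  have h7 := (D.starMon_N ν).monConj_coactOp (D.coact_delta_comm_N ν) hi
  rw [h5, map_smul, h6, map_mul (idT G _), map_mul (idT G _), map_mul (idT G _),
    map_mul (idT G _), idT_comp, idT_comp, idT_comp, h3, h4,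
    idT_tmul, idT_tmul, ← AlgHom.comp_apply, ← AlgHom.comp_apply, h3]
  change D.κ I • D.ev _ I (D.monConj (coactOp (D.delta m)) (j13 G _ Ni)) b a = _
  rw [h7, j23_apply, j23_apply, ev_one_tmul_conj, ← smul_mul_assoc, ← mul_smul_comm]
  congr 2
  have h8 : D.ev _ I (j13 G _ ((D.starL m).tens G (D.N ν))) b a =
      1 ⊗ₜ D.ev _ I ((D.starL m).tens G (D.N ν)) b a := by
    rw [IrrepSystem.ev_apply, slice_j13]
    rfl
  rw [h8, AntiStar.ev_tens, ev_N, Matrix.smul_apply, AntiStar.map_smul, TensorProduct.tmul_smul,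
    smul_smul, mul_comm, star_κ_mul_κ, one_smul]

/-- Both sides are conjugate-linear and antimultiplicative in `X`, so the generators decide. -/
theorem decouple_of_starGraph {m : ℕ} {X : D.L m} {Y : D.SD m} (h : D.StarGraph m X Y) :
    D.decouple m Y = idT G (D.delta m) (swapT G D.Θi) * (1 ⊗ₜ D.starL m X) *
      idT G (D.delta m) (swapT G D.Θ) := by
  have h1 : idT G (D.delta m) (swapT G D.Θi) * idT G (D.delta m) (swapT G D.Θ) = 1 := by
    rw [← map_mul, ← map_mul, Θi_mul_Θ, map_one, map_one]
  have h2 : idT G (D.delta m) (swapT G D.Θ) * idT G (D.delta m) (swapT G D.Θi) = 1 := by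
    rw [← map_mul, ← map_mul, Θ_mul_Θi, map_one, map_one]
  induction h with
  | scalar z =>
    rw [AlgHom.commutes, Algebra.algebraMap_eq_smul_one (A := D.L m), AntiStar.map_smul,
      AntiStar.map_one, TensorProduct.tmul_smul, mul_smul_comm, smul_mul_assoc,
      ← Algebra.TensorProduct.one_def, mul_one, h1, Algebra.algebraMap_eq_smul_one]
  | gen ν I a b => exact decouple_Mstar ν I a b
  | add _ _ ih ih' =>
    rw [map_add, AntiStar.map_add, ih, ih', TensorProduct.tmul_add, mul_add, add_mul]
  | @mul X X' Y Y' _ _ ih ih' =>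
    have h3 : (1 : G) ⊗ₜ[ℂ] D.starL m (X * X') =
        (1 ⊗ₜ D.starL m X') * (1 ⊗ₜ D.starL m X) := by
      rw [Algebra.TensorProduct.tmul_mul_tmul, one_mul, AntiStar.map_mul]
    rw [map_mul, ih, ih', h3]
    calc _ = idT G (D.delta m) (swapT G D.Θi) * (1 ⊗ₜ D.starL m X') *
          (idT G (D.delta m) (swapT G D.Θ) * idT G (D.delta m) (swapT G D.Θi)) *
          (1 ⊗ₜ D.starL m X) * idT G (D.delta m) (swapT G D.Θ) := by simp only [mul_assoc]
      _ = _ := by rw [h2, mul_one]; simp only [mul_assoc]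

theorem exists_starGraph {m : ℕ} (X : D.L m) : ∃ Y, D.StarGraph m X Y := by
  have h : X ∈ Algebra.adjoin ℂ
    {X : D.L m | ∃ (ν : Fin m) (I : ι) (a b : Fin (D.n I)), X = D.M ν I a b} := by
    rw [D.adjoin_M]
    trivial
  induction h using Algebra.adjoin_induction with
  | mem x hx =>
    obtain ⟨ν, I, a, b, rfl⟩ := hx
    exact ⟨_, .gen ν I a b⟩
  | algebraMap r => exact ⟨_, .scalar r⟩
  | add x y _ _ hx hy => exact ⟨_, .add hx.choose_spec hy.choose_spec⟩
  | mul x y _ _ hx hy => exact ⟨_, .mul hx.choose_spec hy.choose_spec⟩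

/-- On the moduli algebras, the adjoint is given by `starL`. -/
theorem isAdj_iff {m : ℕ} {K : Fin m → ι} {X : D.L m} (hX : X ∈ D.moduli K) (X' : D.L m) :
    D.IsAdj X X' ↔ X' = D.starL m X := by
  have h1 : idT G (D.delta m) (swapT G D.Θi) * (1 ⊗ₜ D.starL m X) *
      idT G (D.delta m) (swapT G D.Θ) = 1 ⊗ₜ D.starL m X := by
    -- The moment map multiplies elements of the corner by the counit from both sides.
    have hc : Commute ((1 : G) ⊗ₜ[ℂ] D.starL m X) (idT G (D.delta m) (swapT G D.Θ)) := by
      refine (commute_of_tmul (idT G (D.delta m)) fun x y => ?_).symm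
      have h2 := mem_moduli.1 (starL_mem_moduli hX)
      rw [idT_tmul, Commute, SemiconjBy, Algebra.TensorProduct.tmul_mul_tmul,
        Algebra.TensorProduct.tmul_mul_tmul, delta_mul_of_corner h2.1, mul_delta_of_corner h2.2,
        mul_one, one_mul]
    rw [mul_assoc, hc.eq, ← mul_assoc, ← map_mul, ← map_mul, Θi_mul_Θ, map_one, map_one, one_mul]
  have h2 : ∀ Y, D.StarGraph m X Y → Y = D.inL m (D.starL m X) := by
    intro Y hY
    apply D.decouple_injective m
    rw [decouple_of_starGraph hY, h1]
    exact (D.decouple_inL _).symm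
  constructor
  · intro h
    have h3 := congrArg (fun Y => counitL G _ (D.decouple m Y)) (h2 _ h)
    have h4 : ∀ Z, counitL G _ (D.decouple m (D.inL m Z)) = Z := by
      intro Z
      have h5 : D.decouple m (D.inL m Z) = 1 ⊗ₜ Z := D.decouple_inL Z
      rw [h5, counitL_tmul, Bialgebra.counit_one, one_smul]
    simpa only [h4] using h3
  · rintro rfl
    obtain ⟨Y, hY⟩ := exists_starGraph X
    have := h2 Y hY
    rw [IsAdj, ← this]
    exact hY

end SymmetryData
end Adjoint

/-! ### Pinching -/

section Pinch

variable {G ι : Type*} [Ring G] [HopfAlgebra ℂ G] [StarRing G] [StarModule ℂ G]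
variable {A : Type*} [Ring A] [Algebra ℂ A]

/-- The conjugate transpose with respect to an antihomomorphism. -/
def AntiStar.mat {k l : Type*} (s : AntiStar A) (X : Matrix k l A) : Matrix l k A :=
  Matrix.of fun a b => s (X b a)

theorem AntiStar.mat_mul {j k l : Type*} [Fintype k] (s : AntiStar A) (X : Matrix j k A)
    (Y : Matrix k l A) : s.mat (X * Y) = s.mat Y * s.mat X := by
  ext a b
  simp only [AntiStar.mat, Matrix.of_apply, Matrix.mul_apply, s.map_sum, s.map_mul]

theorem AntiStar.mat_scal {k l : Type*} (s : AntiStar A) (X : Matrix k l ℂ) :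
    s.mat (scal A X) = scal A Xᴴ := by
  ext a b
  simp only [AntiStar.mat, scal, Matrix.of_apply, Matrix.map_apply, Matrix.conjTranspose_apply,
    Algebra.algebraMap_eq_smul_one, s.map_smul, s.map_one]

variable [FiniteDimensional ℂ G] [IsSemisimpleRing G] [Fintype ι] [DecidableEq ι]

namespace IrrepSystem

variable (V : IrrepSystem G ι)

theorem e_mul_E (I : ι) (a b : Fin (V.n I)) : V.e I * V.E I a b = V.E I a b := by
  refine V.eq_of_τ fun J => ?_
  rw [map_mul, τ_e]
  split_ifs with h
  · rw [one_mul]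
  · rw [zero_mul, V.τ_E_of_ne h]

/-- The element with a single component. -/
def single (I : ι) : Matrix (Fin (V.n I)) (Fin (V.n I)) A →ₗ[ℂ] G ⊗[ℂ] A where
  toFun X := ∑ a, ∑ b, V.E I a b ⊗ₜ X a b
  map_add' X Y := by simp [TensorProduct.tmul_add, Finset.sum_add_distrib]
  map_smul' c X := by simp [Finset.smul_sum]

theorem single_apply (I : ι) (X : Matrix (Fin (V.n I)) (Fin (V.n I)) A) :
    V.single I X = ∑ a, ∑ b, V.E I a b ⊗ₜ X a b := rfl

theorem ev_single (I : ι) (X : Matrix (Fin (V.n I)) (Fin (V.n I)) A) :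
    V.ev A I (V.single I X) = X := by
  ext c d
  simp only [single_apply, map_sum, Matrix.sum_apply, ev_tmul, τ_E_self, Matrix.single_apply]
  rw [Finset.sum_eq_single c, Finset.sum_eq_single d]
  · simp
  · intro b _ hb
    simp [hb]
  · simp
  · intro a _ ha
    refine Finset.sum_eq_zero fun b _ => ?_
    simp [ha]
  · simp

theorem e_mul_single (I : ι) (X : Matrix (Fin (V.n I)) (Fin (V.n I)) A) :
    (V.e I ⊗ₜ 1) * V.single I X = V.single I X := by
  simp only [single_apply, Finset.mul_sum, Algebra.TensorProduct.tmul_mul_tmul, e_mul_E, one_mul]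

/-- The element with a single component. -/
def single₂ (I J : ι) : Matrix (Fin (V.n I) × Fin (V.n J)) (Fin (V.n I) × Fin (V.n J)) A →ₗ[ℂ]
    G ⊗[ℂ] (G ⊗[ℂ] A) where
  toFun X := V.single I (Matrix.of fun a b => V.single J (Matrix.of fun c d => X (a, c) (b, d)))
  map_add' X Y := by
    rw [← map_add]
    congr 1
    ext a b
    rw [Matrix.add_apply, Matrix.of_apply, Matrix.of_apply, Matrix.of_apply, ← map_add]
    rfl
  map_smul' c X := by
    rw [RingHom.id_apply, ← map_smul]
    congr 1
    ext a b
    rw [Matrix.smul_apply, Matrix.of_apply, Matrix.of_apply, ← map_smul]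
    rfl

theorem ev2_single₂ (I J : ι)
    (X : Matrix (Fin (V.n I) × Fin (V.n J)) (Fin (V.n I) × Fin (V.n J)) A) :
    V.ev2 A I J (V.single₂ I J X) = X := by
  ext p q
  rw [ev2_apply, single₂, LinearMap.coe_mk, AddHom.coe_mk, ev_single, Matrix.of_apply, ev_single,
    Matrix.of_apply]

theorem ee_mul_single₂ (I J : ι)
    (X : Matrix (Fin (V.n I) × Fin (V.n J)) (Fin (V.n I) × Fin (V.n J)) A) :
    j12 G A (V.e I ⊗ₜ V.e J) * V.single₂ I J X = V.single₂ I J X := by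
  rw [single₂, LinearMap.coe_mk, AddHom.coe_mk, single_apply]
  simp only [Finset.mul_sum, Matrix.of_apply, j12_tmul, Algebra.TensorProduct.tmul_mul_tmul,
    e_mul_single, e_mul_E]

theorem ee_comm (I J : ι) (Z : G ⊗[ℂ] (G ⊗[ℂ] A)) :
    Commute (j12 G A (V.e I ⊗ₜ V.e J)) Z := by
  refine (commute_of_tmul (AlgHom.id ℂ _) fun y z => ?_).symm
  change Commute (y ⊗ₜ z) _
  rw [j12_tmul, Commute, SemiconjBy, Algebra.TensorProduct.tmul_mul_tmul,
    Algebra.TensorProduct.tmul_mul_tmul, e_comm,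
    (SymmetryData.j12_tmul_comm (V.e_comm J) z).eq]

theorem ev2_corner_ext {I J : ι} {Z Z' : G ⊗[ℂ] (G ⊗[ℂ] A)}
    (h : j12 G A (V.e I ⊗ₜ V.e J) * Z = Z) (h' : j12 G A (V.e I ⊗ₜ V.e J) * Z' = Z')
    (hZ : V.ev2 A I J Z = V.ev2 A I J Z') : Z = Z' := by
  rw [← h, ← h']
  refine V.ev2_ext fun L M => ?_
  rw [map_mul, map_mul, ev2_j12, ten_tmul, τ_e, τ_e]
  by_cases h1 : I = L
  · by_cases h2 : J = M
    · subst h1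
      subst h2
      rw [hZ]
    · rw [if_neg h2, Matrix.kronecker_zero]
      simp [scal]
  · rw [if_neg h1, Matrix.zero_kronecker]
    simp [scal]

theorem ev_corner_ext {I : ι} {Z Z' : G ⊗[ℂ] A} (h : (V.e I ⊗ₜ 1) * Z = Z)
    (h' : (V.e I ⊗ₜ 1) * Z' = Z') (hZ : V.ev A I Z = V.ev A I Z') : Z = Z' := by
  rw [← h, ← h']
  refine V.ev_ext fun L => ?_
  rw [map_mul, map_mul, ev_tmul_one, τ_e]
  by_cases h1 : I = L
  · subst h1
    rw [hZ]
  · rw [if_neg h1]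
    simp [scal]

end IrrepSystem

namespace SymmetryData

variable (D : SymmetryData G ι)

theorem ev2_comulL_mul_CGd (I J K : ι) (a : Fin (D.fusion I J K)) (X : G ⊗[ℂ] A) :
    D.ev2 A I J (comulL G A X) * scal A (D.CGd I J K a) = scal A (D.CGd I J K a) * D.ev A K X := by
  have h : ∀ X : Matrix (Fin (D.n I) × Fin (D.n J)) (Fin (D.n K)) A, X =
      ∑ L, ∑ b, scal A (D.CGd I J L b) * (scal A (D.CG I J L b).1 * X) := by
    intro X
    have h1 := congrArg (scal A) (D.sum_CGd_mul_CG I J)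
    have h2 : ∀ (t : Finset ι) (f : ι → Matrix (Fin (D.n I) × Fin (D.n J)) (Fin (D.n I) × Fin (D.n J)) ℂ), scal A (∑ L ∈ t, f L) = ∑ L ∈ t, scal A (f L) := by
      intro t f
      ext a b
      simp [scal, Matrix.sum_apply]
    have h3 : ∀ (L : ι) (f : Fin (D.fusion I J L) → Matrix (Fin (D.n I) × Fin (D.n J)) (Fin (D.n I) × Fin (D.n J)) ℂ), scal A (∑ b, f b) = ∑ b, scal A (f b) := by
      intro L f
      ext a b
      simp [scal, Matrix.sum_apply]
    rw [h2, scal_one] at h1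
    simp only [h3] at h1
    conv_lhs => rw [← Matrix.one_mul X, ← h1, Matrix.sum_mul]
    refine Finset.sum_congr rfl fun L _ => ?_
    rw [Matrix.sum_mul]
    refine Finset.sum_congr rfl fun b _ => ?_
    rw [scal_mul, Matrix.mul_assoc]
  rw [h (D.ev2 A I J (comulL G A X) * scal A (D.CGd I J K a)),
    h (scal A (D.CGd I J K a) * D.ev A K X)]
  refine Finset.sum_congr rfl fun L _ => Finset.sum_congr rfl fun b _ => ?_
  congr 1
  rw [← Matrix.mul_assoc, ← Matrix.mul_assoc, IrrepSystem.scal_mul_ev2 _ (D.CG I J L b).2,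
    Matrix.mul_assoc, ← scal_mul]
  by_cases hL : L = K
  · subst hL
    rw [D.CG_mul_CGd]
    split_ifs
    · rw [scal_one, Matrix.one_mul, Matrix.mul_one]
    · simp [scal]
  · rw [D.CG_mul_CGd_of_ne I J hL]
    simp [scal]

/-- A Gram operator is hermitian. -/
theorem ten_Θ_conjTranspose (I J : ι) : (D.ten I J D.Θ)ᴴ = D.ten I J D.Θ := by
  rw [ten_Θ, Matrix.conjTranspose_sum]
  refine Finset.sum_congr rfl fun K _ => ?_
  rw [Matrix.conjTranspose_sum]
  refine Finset.sum_congr rfl fun a _ => ?_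
  rw [Matrix.conjTranspose_mul, Matrix.conjTranspose_conjTranspose]

theorem ten_Θi_conjTranspose (I J : ι) : (D.ten I J D.Θi)ᴴ = D.ten I J D.Θi := by
  refine left_inv_eq_right_inv (a := D.ten I J D.Θ) ?_ ?_
  · conv_lhs => rw [← D.ten_Θ_conjTranspose, ← Matrix.conjTranspose_mul, ← map_mul, Θ_mul_Θi,
      map_one, Matrix.conjTranspose_one]
  · rw [← map_mul, Θ_mul_Θi, map_one]

variable {D}
variable {I I' : ι}

variable (D I I') in
/-- The matrix units of the pinching, acting on `G ⊗ A`. -/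
def pinch (J : ι) (a b : Fin (D.fusion I I' J)) : G ⊗[ℂ] A →ₗ[ℂ] G ⊗[ℂ] (G ⊗[ℂ] A) where
  toFun Y := D.single₂ I I' (scal A (D.CGd I I' J a) * D.ev A J Y * scal A (D.CG I I' J b).1)
  map_add' X Y := by rw [map_add, Matrix.mul_add, Matrix.add_mul, map_add]
  map_smul' c X := by
    rw [map_smul, Matrix.mul_smul, Matrix.smul_mul, map_smul]
    rfl

theorem ev2_pinch (J : ι) (a b : Fin (D.fusion I I' J)) (Y : G ⊗[ℂ] A) :
    D.ev2 A I I' (D.pinch I I' J a b Y) =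
      scal A (D.CGd I I' J a) * D.ev A J Y * scal A (D.CG I I' J b).1 :=
  IrrepSystem.ev2_single₂ _ _ _ _

theorem ee_mul_pinch (J : ι) (a b : Fin (D.fusion I I' J)) (Y : G ⊗[ℂ] A) :
    j12 G A (D.e I ⊗ₜ D.e I') * D.pinch I I' J a b Y = D.pinch I I' J a b Y :=
  IrrepSystem.ee_mul_single₂ _ _ _ _

theorem ee_mul_mul_pinch (J : ι) (a b : Fin (D.fusion I I' J)) (Y : G ⊗[ℂ] A)
    (Z : G ⊗[ℂ] (G ⊗[ℂ] A)) : j12 G A (D.e I ⊗ₜ D.e I') * (Z * D.pinch I I' J a b Y) =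
      Z * D.pinch I I' J a b Y := by
  rw [← mul_assoc, (D.toIrrepSystem.ee_comm I I' Z).eq, mul_assoc, ee_mul_pinch]

theorem ee_mul_pinch_mul (J : ι) (a b : Fin (D.fusion I I' J)) (Y : G ⊗[ℂ] A)
    (Z : G ⊗[ℂ] (G ⊗[ℂ] A)) : j12 G A (D.e I ⊗ₜ D.e I') * (D.pinch I I' J a b Y * Z) =
      D.pinch I I' J a b Y * Z := by
  rw [← mul_assoc, ee_mul_pinch]

/-- Biorthogonality of the Clebsch-Gordan maps and their duals. -/
theorem pinch_mul_pinch (J : ι) (a b c d : Fin (D.fusion I I' J)) (Y Y' : G ⊗[ℂ] A) :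
    D.pinch I I' J a b Y * D.pinch I I' J c d Y' =
      if b = c then D.pinch I I' J a d (Y * Y') else 0 := by
  have h1 : D.ev2 A I I' (D.pinch I I' J a b Y * D.pinch I I' J c d Y') =
      if b = c then scal A (D.CGd I I' J a) * D.ev A J (Y * Y') * scal A (D.CG I I' J d).1
        else 0 := by
    rw [map_mul, ev2_pinch, ev2_pinch, map_mul]
    calc _ = scal A (D.CGd I I' J a) * D.ev A J Y * (scal A (D.CG I I' J b).1 *
        scal A (D.CGd I I' J c)) * (D.ev A J Y' * scal A (D.CG I I' J d).1) := by
          simp only [Matrix.mul_assoc]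
      _ = _ := by
        rw [← scal_mul, D.CG_mul_CGd]
        split_ifs
        · rw [scal_one, Matrix.mul_one]; simp only [Matrix.mul_assoc]
        · simp [scal]
  refine D.toIrrepSystem.ev2_corner_ext (I := I) (J := I') (ee_mul_pinch_mul _ _ _ _ _) ?_ ?_
  · split_ifs
    · exact ee_mul_pinch _ _ _ _
    · exact mul_zero _
  · rw [h1]
    split_ifs
    · rw [ev2_pinch]
    · rw [map_zero]

theorem comulL_mul_pinch (J : ι) (a b : Fin (D.fusion I I' J)) (X Y : G ⊗[ℂ] A) :
    comulL G A X * D.pinch I I' J a b Y = D.pinch I I' J a b (X * Y) := by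
  refine D.toIrrepSystem.ev2_corner_ext (I := I) (J := I') (ee_mul_mul_pinch _ _ _ _ _)
    (ee_mul_pinch _ _ _ _) ?_
  rw [map_mul, ev2_pinch, ev2_pinch, ← Matrix.mul_assoc, ← Matrix.mul_assoc, ev2_comulL_mul_CGd,
    map_mul, Matrix.mul_assoc (scal A _) _ (D.ev A J Y)]

theorem pinch_mul_comulL (J : ι) (a b : Fin (D.fusion I I' J)) (X Y : G ⊗[ℂ] A) :
    D.pinch I I' J a b Y * comulL G A X = D.pinch I I' J a b (Y * X) := by
  refine D.toIrrepSystem.ev2_corner_ext (I := I) (J := I') (ee_mul_pinch_mul _ _ _ _ _)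
    (ee_mul_pinch _ _ _ _) ?_
  rw [map_mul, ev2_pinch, ev2_pinch, Matrix.mul_assoc,
    IrrepSystem.scal_mul_ev2 _ (D.CG I I' J b).2, map_mul]
  simp only [Matrix.mul_assoc]

theorem pinch_e_mul (J : ι) (a b : Fin (D.fusion I I' J)) (Y : G ⊗[ℂ] A) :
    D.pinch I I' J a b ((D.e J ⊗ₜ 1) * Y) = D.pinch I I' J a b Y := by
  have h : D.ev A J ((D.e J ⊗ₜ 1) * Y) = D.ev A J Y := by
    rw [map_mul, IrrepSystem.ev_tmul_one, IrrepSystem.τ_e, if_pos rfl, scal_one, one_mul]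
  simp only [pinch, LinearMap.coe_mk, AddHom.coe_mk, h]

theorem pinch_e_mul_of_ne {J L : ι} (hL : L ≠ J) (a b : Fin (D.fusion I I' J)) (Y : G ⊗[ℂ] A) :
    D.pinch I I' J a b ((D.e L ⊗ₜ 1) * Y) = 0 := by
  have h : D.ev A J ((D.e L ⊗ₜ 1) * Y) = 0 := by
    rw [map_mul, IrrepSystem.ev_tmul_one, IrrepSystem.τ_e, if_neg hL]
    simp [scal]
  simp only [pinch, LinearMap.coe_mk, AddHom.coe_mk, h, Matrix.mul_zero, Matrix.zero_mul, map_zero]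

variable (D I I') in
/-- The component extracting maps, inverse to `pinch`. -/
def unpinch (J : ι) (a b : Fin (D.fusion I I' J)) (Z : G ⊗[ℂ] (G ⊗[ℂ] A)) : G ⊗[ℂ] A :=
  D.single J (scal A (D.CG I I' J a).1 * D.ev2 A I I' Z * scal A (D.CGd I I' J b))

theorem unpinch_pinch (J : ι) (a b : Fin (D.fusion I I' J)) (Y : G ⊗[ℂ] A) :
    D.unpinch I I' J a b (D.pinch I I' J a b Y) = (D.e J ⊗ₜ 1) * Y := by
  refine D.toIrrepSystem.ev_corner_ext (I := J) (IrrepSystem.e_mul_single _ _ _) ?_ ?_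
  · rw [← mul_assoc, Algebra.TensorProduct.tmul_mul_tmul, IrrepSystem.e_mul_e, if_pos rfl, one_mul]
  · rw [unpinch, IrrepSystem.ev_single, ev2_pinch, map_mul, IrrepSystem.ev_tmul_one,
      IrrepSystem.τ_e, if_pos rfl, scal_one, one_mul]
    calc _ = (scal A (D.CG I I' J a).1 * scal A (D.CGd I I' J a)) * D.ev A J Y *
          (scal A (D.CG I I' J b).1 * scal A (D.CGd I I' J b)) := by simp only [Matrix.mul_assoc]
      _ = _ := by
        rw [← scal_mul, ← scal_mul, CG_mul_CGd, CG_mul_CGd, if_pos rfl, if_pos rfl, scal_one,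
          Matrix.one_mul, Matrix.mul_one]

/-- `Δ(e_J)` picks the terms of the label `J` from the resolution of the identity. -/
theorem ten_comul_e (J : ι) : D.ten I I' (Coalgebra.comul (R := ℂ) (D.e J)) =
    ∑ a, D.CGd I I' J a * (D.CG I I' J a).1 := by
  have h := congrArg (D.ten I I' (Coalgebra.comul (R := ℂ) (D.e J)) * ·) (D.sum_CGd_mul_CG I I')
  simp only [mul_one, Matrix.mul_sum, ← Matrix.mul_assoc, comul_mul_CGd] at h
  rw [← h, Finset.sum_eq_single J]
  · refine Finset.sum_congr rfl fun a _ => ?_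
    rw [IrrepSystem.τ_e, if_pos rfl, Matrix.mul_one]
  · intro L _ hL
    refine Finset.sum_eq_zero fun a _ => ?_
    rw [IrrepSystem.τ_e, if_neg (Ne.symm hL), Matrix.mul_zero, Matrix.zero_mul]
  · simp

theorem scal_sum {k l : Type*} {κ : Type*} (t : Finset κ) (f : κ → Matrix k l ℂ) :
    scal A (∑ i ∈ t, f i) = ∑ i ∈ t, scal A (f i) := by
  ext a b
  simp [scal, Matrix.sum_apply]

theorem ee_mul_comul_e (J : ι) :
    j12 G A (D.e I ⊗ₜ D.e I') * j12 G A (Coalgebra.comul (R := ℂ) (D.e J)) =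
      ∑ a, D.pinch I I' J a a 1 := by
  refine D.toIrrepSystem.ev2_corner_ext (I := I) (J := I') ?_ ?_ ?_
  · rw [← mul_assoc, ← map_mul, Algebra.TensorProduct.tmul_mul_tmul, IrrepSystem.e_mul_e,
      IrrepSystem.e_mul_e, if_pos rfl, if_pos rfl]
  · rw [Finset.mul_sum]
    exact Finset.sum_congr rfl fun a _ => ee_mul_pinch _ _ _ _
  · rw [map_mul, IrrepSystem.ev2_j12, IrrepSystem.ev2_j12, ten_comul_e, IrrepSystem.ten_tmul,
      IrrepSystem.τ_e, IrrepSystem.τ_e, if_pos rfl, if_pos rfl, Matrix.one_kronecker_one, scal_one,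
      one_mul, map_sum, scal_sum]
    refine Finset.sum_congr rfl fun a _ => ?_
    rw [ev2_pinch, map_one, Matrix.mul_one, scal_mul]

/-- Insert `∑_a C̃^a C^a`, with `C̃^a` the dual map, for `Δ(e_J)` on both sides of `Z`; what stands
between the outer maps is the component of `Z`. -/
theorem sum_pinch_unpinch (J : ι) {Z : G ⊗[ℂ] (G ⊗[ℂ] A)}
    (h : j12 G A (D.e I ⊗ₜ D.e I') * Z = Z) :
    j12 G A (Coalgebra.comul (R := ℂ) (D.e J)) * Z * j12 G A (Coalgebra.comul (R := ℂ) (D.e J)) =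
      ∑ a, ∑ b, D.pinch I I' J a b (D.unpinch I I' J a b Z) := by
  refine D.toIrrepSystem.ev2_corner_ext (I := I) (J := I') ?_ ?_ ?_
  · rw [← mul_assoc, ← mul_assoc, (D.toIrrepSystem.ee_comm I I' _).eq, mul_assoc _ _ Z, h]
  · simp only [Finset.mul_sum, ee_mul_pinch]
  · simp only [map_mul, IrrepSystem.ev2_j12, ten_comul_e, map_sum, scal_sum, Matrix.sum_mul,
      Matrix.mul_sum]
    rw [Finset.sum_comm]
    refine Finset.sum_congr rfl fun a _ => Finset.sum_congr rfl fun b _ => ?_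
    rw [ev2_pinch, unpinch, IrrepSystem.ev_single, scal_mul, scal_mul]
    simp only [Matrix.mul_assoc]

theorem ev2_mat (s : AntiStar A) (Z : G ⊗[ℂ] (G ⊗[ℂ] A)) :
    D.ev2 A I I' ((s.tens G).tens G Z) = s.mat (D.ev2 A I I' Z) := by
  ext p q
  exact s.ev2_tens _ _ _ _ _ _

theorem ev_mat (s : AntiStar A) (J : ι) (Z : G ⊗[ℂ] A) :
    D.ev A J (s.tens G Z) = s.mat (D.ev A J Z) := by
  ext p q
  exact s.ev_tens _ _ _ _ _

/-- As `Θ` is hermitian, the adjoint of a dual map is `C Θ⁻¹`, and `Θ⁻¹ C^*` is again a dual map. So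
`Θ₁₂` exchanges the roles of `a` and `b`, while the other twist passes through the intertwiners to
the single leg of `V^J`. -/
theorem twist_twist_pinch (s : AntiStar A) (δ : G →ₐ[ℂ] A) (J : ι)
    (a b : Fin (D.fusion I I' J)) (Y : G ⊗[ℂ] A) :
    comulL G A (idT G δ D.Θi) * j12 G A D.Θi * (s.tens G).tens G (D.pinch I I' J a b Y) *
      (j12 G A D.Θ * comulL G A (idT G δ D.Θ)) = D.pinch I I' J b a (D.twist s δ Y) := by
  have h0 : j12 G A (D.e I ⊗ₜ D.e I') * (s.tens G).tens G (D.pinch I I' J a b Y) =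
      (s.tens G).tens G (D.pinch I I' J a b Y) := by
    have h1 : (s.tens G).tens G (j12 G A (D.e I ⊗ₜ D.e I')) = j12 G A (D.e I ⊗ₜ D.e I') := by
      rw [s.tens_j12, TensorProduct.star_tmul, star_e, star_e]
    rw [(D.toIrrepSystem.ee_comm I I' _).eq]
    conv_lhs => rw [← h1, ← AntiStar.map_mul, ee_mul_pinch]
  refine D.toIrrepSystem.ev2_corner_ext (I := I) (J := I') ?_ (ee_mul_pinch _ _ _ _) ?_
  · conv_rhs => rw [← h0]
    simp only [← mul_assoc]
    rw [(D.toIrrepSystem.ee_comm I I' (comulL G A (idT G δ D.Θi))).eq,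
      mul_assoc (comulL G A (idT G δ D.Θi)), (D.toIrrepSystem.ee_comm I I' (j12 G A D.Θi)).eq]
    simp only [mul_assoc]
  · have h1 : s.mat (scal A (D.CGd I I' J a)) = scal A (D.CG I I' J a).1 *
        scal A (D.ten I I' D.Θi) := by
      rw [AntiStar.mat_scal, CGd, Matrix.conjTranspose_mul, Matrix.conjTranspose_conjTranspose,
        ten_Θi_conjTranspose, scal_mul]
    rw [map_mul, map_mul, map_mul, map_mul, ev2_mat, ev2_pinch, ev2_pinch, AntiStar.mat_mul,
      AntiStar.mat_mul, AntiStar.mat_scal, h1, IrrepSystem.ev2_j12, IrrepSystem.ev2_j12,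
      twist_apply, map_mul, map_mul, ev_mat]
    calc _ = D.ev2 A I I' (comulL G A (idT G δ D.Θi)) * (scal A (D.ten I I' D.Θi) *
          scal A ((D.CG I I' J b).1)ᴴ) * s.mat (D.ev A J Y) * (scal A (D.CG I I' J a).1 *
          (scal A (D.ten I I' D.Θi) * scal A (D.ten I I' D.Θ)) *
            D.ev2 A I I' (comulL G A (idT G δ D.Θ))) := by simp only [Matrix.mul_assoc]
      _ = _ := by
        rw [← scal_mul, ← scal_mul, ← map_mul, Θi_mul_Θ, map_one, scal_one, Matrix.mul_one,
          IrrepSystem.scal_mul_ev2 _ (D.CG I I' J a).2]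
        have h2 := D.ev2_comulL_mul_CGd I I' J b (idT G δ D.Θi)
        rw [CGd] at h2
        rw [h2, CGd]
        simp only [Matrix.mul_assoc]

end SymmetryData
end Pinch

/-! ### Matrix units in the moduli algebras -/

section Units

variable {G ι : Type*} [Ring G] [HopfAlgebra ℂ G] [StarRing G] [StarModule ℂ G]
variable [FiniteDimensional ℂ G] [IsSemisimpleRing G] [Fintype ι] [DecidableEq ι]

namespace SymmetryData

variable (D : SymmetryData G ι) [hM : D.Modular]

/-- The matrix units of the pinching, as maps `L_{n+1} → L_{n+2}`. -/
def unit (n : ℕ) (I I' J : ι) (a b : Fin (D.fusion I I' J)) : D.L (n + 1) →ₗ[ℂ] D.L (n + 2) :=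
  (D.thetaE n).symm.toLinearMap ∘ₗ D.pinch I I' J a b ∘ₗ (D.phi n).toLinearMap

theorem thetaE_unit (n : ℕ) (I I' J : ι) (a b : Fin (D.fusion I I' J)) (Y : D.L (n + 1)) :
    D.thetaE n (D.unit n I I' J a b Y) = D.pinch I I' J a b (D.phi n Y) :=
  (D.thetaE n).apply_symm_apply _

variable {D}
variable {n : ℕ} {I I' : ι}

theorem unit_mul_unit (J : ι) (a b c d : Fin (D.fusion I I' J)) (Y Y' : D.L (n + 1)) :
    D.unit n I I' J a b Y * D.unit n I I' J c d Y' =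
      if b = c then D.unit n I I' J a d (Y * Y') else 0 := by
  apply (D.thetaE n).injective
  rw [map_mul, thetaE_unit, thetaE_unit, pinch_mul_pinch]
  split_ifs
  · rw [thetaE_unit, map_mul (D.phi n)]
  · rw [map_zero]

theorem pinchProj_mul_unit (L J : ι) (a b : Fin (D.fusion I I' J)) (Y : D.L (n + 1)) :
    D.pinchProj n L * D.unit n I I' J a b Y = if L = J then D.unit n I I' J a b Y else 0 := by
  apply (D.thetaE n).injective
  rw [map_mul, thetaE_unit, thetaE_pinchProj, ← comulL_tmul_one, comulL_mul_pinch]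
  split_ifs with h
  · subst h
    rw [pinch_e_mul, thetaE_unit]
  · rw [pinch_e_mul_of_ne h, map_zero]

theorem unit_mul_pinchProj (L J : ι) (a b : Fin (D.fusion I I' J)) (Y : D.L (n + 1)) :
    D.unit n I I' J a b Y * D.pinchProj n L = if L = J then D.unit n I I' J a b Y else 0 := by
  rw [← pinchProj_mul_unit]
  apply (D.thetaE n).injective
  rw [map_mul, map_mul, thetaE_unit, thetaE_pinchProj, ← comulL_tmul_one, comulL_mul_pinch,
    pinch_mul_comulL, (j12_tmul_comm (D.toIrrepSystem.e_comm L) (D.phi n Y)).eq]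

theorem unit_mul_unit_of_ne {J L : ι} (h : J ≠ L) (a b : Fin (D.fusion I I' J))
    (c d : Fin (D.fusion I I' L)) (Y Y' : D.L (n + 1)) :
    D.unit n I I' J a b Y * D.unit n I I' L c d Y' = 0 := by
  have h1 := D.pinchProj_mul_unit L L c d Y'
  rw [if_pos rfl] at h1
  rw [← h1, ← mul_assoc, unit_mul_pinchProj, if_neg h.symm, zero_mul]

/-- The labels of the first of the surfaces that arise by pinching. -/
abbrev pinchLabel (K : Fin (n + 2) → ι) (J : ι) : Fin (n + 1) → ι :=
  Fin.snoc (fun ν : Fin n => K (ν.castAdd 2)) J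

theorem phi_moduliUnit (K : Fin (n + 2) → ι) (J : ι) :
    D.phi n (D.moduliUnit (pinchLabel K J)) = (D.e J ⊗ₜ 1) *
      (coact (D.delta n) (D.e D.triv) * (1 ⊗ₜ D.chiProd fun ν : Fin n => K (ν.castAdd 2))) := by
  rw [moduliUnit_eq, map_mul, phi_delta, phi_chiProd, ← mul_assoc,
    (j12_tmul_comm (D.toIrrepSystem.e_comm J) _).eq, mul_assoc,
    Algebra.TensorProduct.tmul_mul_tmul, one_mul, mul_one]
  simp only [pinchLabel, Fin.snoc_last, Fin.snoc_castSucc]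

/-- Apart from `e ⊗ e`, the projector is the coproduct in the first leg of the same element that
appears in `phi_moduliUnit`. This is why the pinching maps exchange the two projectors. -/
theorem thetaE_moduliUnit (K : Fin (n + 2) → ι) : D.thetaE n (D.moduliUnit K) =
    j12 G (D.L n) (D.e (K (Fin.last (n + 1))) ⊗ₜ D.e (K (Fin.last n).castSucc)) *
      comulL G (D.L n) (coact (D.delta n) (D.e D.triv) *
        (1 ⊗ₜ D.chiProd fun ν : Fin n => K (ν.castAdd 2))) := by
  rw [(D.toIrrepSystem.ee_comm _ _ _).eq, moduliUnit_eq, map_mul, thetaE_delta, thetaE_chiProd,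
    map_mul, comulL_tmul_eq, Bialgebra.comul_one, map_one, one_mul, j12_tmul, mul_assoc,
    Algebra.TensorProduct.tmul_mul_tmul, Algebra.TensorProduct.tmul_mul_tmul, one_mul, one_mul,
    mul_one]

theorem moduliUnit_mul_unit (K : Fin (n + 2) → ι) (J : ι)
    (a b : Fin (D.fusion (K (Fin.last (n + 1))) (K (Fin.last n).castSucc) J)) (Y : D.L (n + 1)) :
    D.moduliUnit K * D.unit n _ _ J a b Y =
      D.unit n _ _ J a b (D.moduliUnit (pinchLabel K J) * Y) := by
  apply (D.thetaE n).injective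
  rw [map_mul, thetaE_unit, thetaE_unit, thetaE_moduliUnit, mul_assoc, ee_mul_mul_pinch,
    comulL_mul_pinch, map_mul (D.phi n), phi_moduliUnit, mul_assoc (D.e J ⊗ₜ[ℂ] (1 : D.L n)), pinch_e_mul]

theorem unit_mul_moduliUnit (K : Fin (n + 2) → ι) (J : ι)
    (a b : Fin (D.fusion (K (Fin.last (n + 1))) (K (Fin.last n).castSucc) J)) (Y : D.L (n + 1)) :
    D.unit n _ _ J a b Y * D.moduliUnit K =
      D.unit n _ _ J a b (Y * D.moduliUnit (pinchLabel K J)) := by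
  apply (D.thetaE n).injective
  rw [map_mul, thetaE_unit, thetaE_unit, thetaE_moduliUnit, ← mul_assoc,
    ← (D.toIrrepSystem.ee_comm _ _ _).eq, ee_mul_pinch, pinch_mul_comulL, map_mul (D.phi n), phi_moduliUnit,
    ← mul_assoc (D.phi n Y) (D.e J ⊗ₜ[ℂ] (1 : D.L n)),
    ← (j12_tmul_comm (D.toIrrepSystem.e_comm J) (D.phi n Y)).eq, mul_assoc (D.e J ⊗ₜ[ℂ] (1 : D.L n)),
    pinch_e_mul]

theorem unit_mem {K : Fin (n + 2) → ι} {J : ι}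
    (a b : Fin (D.fusion (K (Fin.last (n + 1))) (K (Fin.last n).castSucc) J)) {Y : D.L (n + 1)}
    (hY : Y ∈ D.moduli (pinchLabel K J)) : D.unit n _ _ J a b Y ∈ D.fusionCommutant K := by
  refine mem_fusionCommutant.2 ⟨mem_moduli.2 ⟨?_, ?_⟩, fun L => ?_⟩
  · rw [moduliUnit_mul_unit, (mem_moduli.1 hY).1]
  · rw [unit_mul_moduliUnit, (mem_moduli.1 hY).2]
  · rw [Commute, SemiconjBy, unit_mul_pinchProj, pinchProj_mul_unit]

/-- Elements of this corner are supported on the block `e_J`, where `unpinch` inverts `pinch`. -/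
theorem eq_zero_of_unit {K : Fin (n + 2) → ι} {J : ι} (a b : Fin (D.fusion I I' J))
    {Y : D.L (n + 1)} (hY : Y ∈ D.moduli (pinchLabel K J)) (h : D.unit n I I' J a b Y = 0) :
    Y = 0 := by
  have h1 := congrArg (D.thetaE n) h
  rw [thetaE_unit, map_zero] at h1
  have h2 := D.unpinch_pinch J a b (D.phi n Y)
  have h3 : D.phi n Y = (D.e J ⊗ₜ 1) * D.phi n Y := by
    conv_lhs => rw [← (mem_moduli.1 hY).1, map_mul, phi_moduliUnit]
    conv_rhs => rw [← (mem_moduli.1 hY).1, map_mul, phi_moduliUnit]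
    simp only [← mul_assoc]
    rw [Algebra.TensorProduct.tmul_mul_tmul, IrrepSystem.e_mul_e, if_pos rfl, mul_one]
  apply D.phi_injective n
  rw [map_zero, h3, ← h2, h1, unpinch, map_zero, Matrix.mul_zero, Matrix.zero_mul, map_zero]

variable (D) in
/-- The components of an element of the commutant of the fusion algebra. -/
def component (K : Fin (n + 2) → ι) (J : ι)
    (a b : Fin (D.fusion (K (Fin.last (n + 1))) (K (Fin.last n).castSucc) J)) (Z : D.L (n + 2)) :
    D.L (n + 1) :=
  D.moduliUnit (pinchLabel K J) * (D.phiE n).symm (D.unpinch _ _ J a b (D.thetaE n Z)) *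
    D.moduliUnit (pinchLabel K J)

theorem component_mem (K : Fin (n + 2) → ι) (J : ι)
    (a b : Fin (D.fusion (K (Fin.last (n + 1))) (K (Fin.last n).castSucc) J)) (Z : D.L (n + 2)) :
    D.component K J a b Z ∈ D.moduli (pinchLabel K J) := by
  refine mem_moduli.2 ⟨?_, ?_⟩
  · rw [component, mul_assoc, ← mul_assoc, moduliUnit_idem]
  · rw [component, mul_assoc, moduliUnit_idem]

/-- Decompose the block by `sum_pinch_unpinch`, then multiply by the projector on both sides; this
replaces each component by its compression to the smaller moduli algebra. -/
theorem sum_component {K : Fin (n + 2) → ι} (J : ι) {Z : D.L (n + 2)} (hZ : Z ∈ D.moduli K) :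
    D.pinchProj n J * Z * D.pinchProj n J =
      ∑ a, ∑ b, D.unit n _ _ J a b (D.component K J a b Z) := by
  have hZ' := mem_moduli.1 hZ
  have h1 : D.pinchProj n J * Z * D.pinchProj n J = ∑ a, ∑ b, D.unit n
      (K (Fin.last (n + 1))) (K (Fin.last n).castSucc) J a b
        ((D.phiE n).symm (D.unpinch _ _ J a b (D.thetaE n Z))) := by
    apply (D.thetaE n).injective
    simp only [map_sum, map_mul, thetaE_unit, thetaE_pinchProj]
    rw [sum_pinch_unpinch (I := K (Fin.last (n + 1))) (I' := K (Fin.last n).castSucc)]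
    · refine Finset.sum_congr rfl fun a _ => Finset.sum_congr rfl fun b _ => ?_
      congr 1
      exact ((D.phiE n).apply_symm_apply _).symm
    · rw [← hZ'.1, map_mul, thetaE_moduliUnit, ← mul_assoc, ← mul_assoc, ← map_mul,
        Algebra.TensorProduct.tmul_mul_tmul, IrrepSystem.e_mul_e, IrrepSystem.e_mul_e,
        if_pos rfl, if_pos rfl]
  have h2 : D.pinchProj n J * Z * D.pinchProj n J = D.moduliUnit K *
      (D.pinchProj n J * Z * D.pinchProj n J) * D.moduliUnit K := by
    have hc := (D.pinchProj_comm_moduliUnit K J).eq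
    calc _ = D.pinchProj n J * (D.moduliUnit K * Z * D.moduliUnit K) * D.pinchProj n J := by
          rw [hZ'.1, hZ'.2]
      _ = D.pinchProj n J * D.moduliUnit K * Z * (D.moduliUnit K * D.pinchProj n J) := by
          simp only [mul_assoc]
      _ = D.moduliUnit K * D.pinchProj n J * Z * (D.pinchProj n J * D.moduliUnit K) :=
          congrArg₂ (· * Z * ·) hc.symm hc
      _ = _ := by simp only [mul_assoc]
  rw [h2, h1, Finset.mul_sum, Finset.sum_mul]
  refine Finset.sum_congr rfl fun a _ => ?_
  rw [Finset.mul_sum, Finset.sum_mul]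
  refine Finset.sum_congr rfl fun b _ => ?_
  rw [moduliUnit_mul_unit, unit_mul_moduliUnit]
  rfl

theorem starL_unit (J : ι) (a b : Fin (D.fusion I I' J)) (Y : D.L (n + 1)) :
    D.starL (n + 2) (D.unit n I I' J a b Y) = D.unit n I I' J b a (D.starL (n + 1) Y) := by
  apply (D.thetaE n).injective
  rw [thetaE_starL, thetaE_unit, thetaE_unit, twist_twist_pinch, phi_starL]

theorem moduliUnit_mul_pinchProj (K : Fin (n + 2) → ι) (J : ι) :
    D.moduliUnit K * D.pinchProj n J =
      ∑ a, D.unit n (K (Fin.last (n + 1))) (K (Fin.last n).castSucc) J a a (D.moduliUnit (pinchLabel K J)) := by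
  apply (D.thetaE n).injective
  rw [map_mul, thetaE_pinchProj, thetaE_moduliUnit, (D.toIrrepSystem.ee_comm _ _ _).eq, mul_assoc,
    ee_mul_comul_e, Finset.mul_sum, map_sum]
  refine Finset.sum_congr rfl fun a _ => ?_
  rw [thetaE_unit, comulL_mul_pinch, phi_moduliUnit, pinch_e_mul, mul_one]

end SymmetryData
end Units

/-! ### Moduli algebras with at most three punctures -/

section Small

variable {G ι : Type*} [Ring G] [HopfAlgebra ℂ G] [StarRing G] [StarModule ℂ G]
variable [FiniteDimensional ℂ G] [IsSemisimpleRing G] [Fintype ι] [DecidableEq ι]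

namespace SymmetryData

variable (D : SymmetryData G ι) [hM : D.Modular]

theorem counit_e_triv : Coalgebra.counit (R := ℂ) (D.e D.triv) = 1 := by
  have h := D.τ_triv (D.e D.triv)
  rw [IrrepSystem.τ_e, if_pos rfl] at h
  have h1 := congrFun (congrFun h 0) 0
  simpa using h1.symm

/-- The moduli algebra with labels `K` is one-dimensional. -/
def IsLine {m : ℕ} (K : Fin m → ι) : Prop :=
  D.moduliUnit K ≠ 0 ∧ ∀ X ∈ D.moduli K, ∃ c : ℂ, X = c • D.moduliUnit K

variable {D}

/-- On `L_0` the moment map is the counit, so the constraint projector and the puncture projector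
are both idempotents of `G`. -/
theorem phi_moduliUnit_one (K : Fin 1 → ι) :
    D.phi 0 (D.moduliUnit K) = (D.e D.triv * D.e (K 0)) ⊗ₜ 1 := by
  have h : ∀ x : G, coact (D.delta 0) x = x ⊗ₜ 1 := by
    intro x
    have h1 : coact (D.delta 0) x = idT G (Algebra.ofId ℂ (D.L 0))
        (TensorProduct.map LinearMap.id (Coalgebra.counit (R := ℂ))
          (Coalgebra.comul (R := ℂ) x)) := by
      rw [coact_apply]
      induction Coalgebra.comul (R := ℂ) x with
      | zero => simp
      | add X Y hX hY => simp only [map_add, hX, hY]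
      | tmul y z => rfl
    have h2 : TensorProduct.map LinearMap.id (Coalgebra.counit (R := ℂ))
        (Coalgebra.comul (R := ℂ) x) = x ⊗ₜ (1 : ℂ) := Coalgebra.lTensor_counit_comul x
    rw [h1, h2]
    exact congrArg (x ⊗ₜ ·) (map_one (Algebra.ofId ℂ (D.L 0)))
  rw [moduliUnit_eq, map_mul, phi_delta, phi_chiProd, h, Algebra.TensorProduct.tmul_mul_tmul,
    one_mul]
  rfl

theorem moduliUnit_one_eq_zero {K : Fin 1 → ι} (h : K 0 ≠ D.triv) : D.moduliUnit K = 0 := by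
  apply D.phi_injective 0
  rw [phi_moduliUnit_one, IrrepSystem.e_mul_e, if_neg h.symm, TensorProduct.zero_tmul, map_zero]

/-- The corner is cut out by `e_0`, on which `G` acts by the counit. -/
theorem isLine_one {K : Fin 1 → ι} (h : K 0 = D.triv) : D.IsLine K := by
  have hp : D.phi 0 (D.moduliUnit K) = D.e D.triv ⊗ₜ 1 := by
    rw [phi_moduliUnit_one, h, IrrepSystem.e_mul_e, if_pos rfl]
  constructor
  · intro h0
    rw [h0, map_zero] at hp
    have h1 := congrArg (fun Z => D.counit₀ (counitL G (D.L 0) Z)) hp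
    simp [counitL, counit_e_triv] at h1
  · intro X hX
    have h1 : ∀ Z : G ⊗[ℂ] D.L 0, ∃ c : ℂ, Z * (D.e D.triv ⊗ₜ 1) = c • (D.e D.triv ⊗ₜ 1) := by
      intro Z
      induction Z with
      | zero => exact ⟨0, by simp⟩
      | add Y Z hY hZ =>
        obtain ⟨c, hc⟩ := hY
        obtain ⟨c', hc'⟩ := hZ
        exact ⟨c + c', by rw [add_mul, hc, hc', add_smul]⟩
      | tmul x y =>
        refine ⟨Coalgebra.counit (R := ℂ) x * D.counit₀ y, ?_⟩
        rw [Algebra.TensorProduct.tmul_mul_tmul, IrrepSystem.mul_e_triv, mul_one,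
          D.algebraMap_L_zero y, Algebra.algebraMap_eq_smul_one, TensorProduct.smul_tmul_smul,
          map_smul, map_one, smul_eq_mul, mul_one]
    obtain ⟨c, hc⟩ := h1 (D.phi 0 X)
    refine ⟨c, D.phi_injective 0 ?_⟩
    rw [map_smul, hp, ← hc, ← hp, ← map_mul, (mem_moduli.1 hX).2]

variable {n : ℕ}

/-- When only the label `J` contributes, the moduli algebra coincides with its block `J`. -/
theorem eq_sum_component {K : Fin (n + 2) → ι} {J : ι}
    (h : ∀ L ≠ J, D.moduliUnit (pinchLabel K L) = 0) {Z : D.L (n + 2)} (hZ : Z ∈ D.moduli K) :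
    Z = ∑ a, ∑ b, D.unit n _ _ J a b (D.component K J a b Z) := by
  have h1 : D.moduliUnit K = D.moduliUnit K * D.pinchProj n J := by
    conv_lhs => rw [← mul_one (D.moduliUnit K), ← sum_pinchProj, Finset.mul_sum]
    refine Finset.sum_eq_single J (fun L _ hL => ?_) (by simp)
    rw [moduliUnit_mul_pinchProj]
    exact Finset.sum_eq_zero fun a _ => by rw [h L hL, map_zero]
  have hZ' := mem_moduli.1 hZ
  rw [← sum_component J hZ]
  calc Z = D.moduliUnit K * D.pinchProj n J * Z * (D.moduliUnit K * D.pinchProj n J) := by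
        rw [← h1, hZ'.1, hZ'.2]
    _ = D.pinchProj n J * (D.moduliUnit K * Z * D.moduliUnit K) * D.pinchProj n J := by
        rw [(D.pinchProj_comm_moduliUnit K J).eq]
        conv_lhs => rw [← (D.pinchProj_comm_moduliUnit K J).eq]
        rw [(D.pinchProj_comm_moduliUnit K J).eq]
        conv_lhs => enter [2]; rw [← (D.pinchProj_comm_moduliUnit K J).eq]
        simp only [mul_assoc]
    _ = _ := by rw [hZ'.1, hZ'.2]

theorem moduliUnit_two_eq_zero {K : Fin 2 → ι} (h : K 0 ≠ D.bar (K 1)) : D.moduliUnit K = 0 := by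
  have hN : D.fusion (K (Fin.last 1)) (K (Fin.last 0).castSucc) D.triv = 0 := by
    rw [fusion_triv]
    exact if_neg h
  have : IsEmpty (Fin (D.fusion (K (Fin.last 1)) (K (Fin.last 0).castSucc) D.triv)) := by
    rw [hN]
    infer_instance
  rw [eq_sum_component (n := 0) (J := D.triv) (fun L hL => moduliUnit_one_eq_zero hL)
    (D.moduliUnit_mem K)]
  exact Finset.sum_eq_zero fun a => isEmptyElim a

/-- Pinching two punctures to one leaves only the trivial label, whose multiplicity is one for
conjugate labels. So there is a single matrix unit over a line. -/
theorem isLine_two {K : Fin 2 → ι} (h : K 0 = D.bar (K 1)) : D.IsLine K := by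
  have hN : D.fusion (K (Fin.last 1)) (K (Fin.last 0).castSucc) D.triv = 1 := by
    rw [fusion_triv]
    exact if_pos h
  have hz : ∀ L ≠ D.triv, D.moduliUnit (pinchLabel (n := 0) K L) = 0 :=
    fun L hL => moduliUnit_one_eq_zero hL
  have hl : D.IsLine (pinchLabel (n := 0) K D.triv) := isLine_one rfl
  let a : Fin (D.fusion (K (Fin.last 1)) (K (Fin.last 0).castSucc) D.triv) := ⟨0, by omega⟩
  have : Subsingleton (Fin (D.fusion (K (Fin.last 1)) (K (Fin.last 0).castSucc) D.triv)) :=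
    ⟨fun b c => Fin.ext (by omega)⟩
  have h1 : ∀ Z ∈ D.moduli K, ∃ c : ℂ,
      Z = c • D.unit 0 _ _ D.triv a a (D.moduliUnit (pinchLabel (n := 0) K D.triv)) := by
    intro Z hZ
    obtain ⟨c, hc⟩ := hl.2 _ (component_mem (n := 0) K D.triv a a Z)
    refine ⟨c, ?_⟩
    conv_lhs => rw [eq_sum_component (n := 0) hz hZ]
    rw [Fintype.sum_subsingleton _ a, Fintype.sum_subsingleton _ a, ← map_smul, ← hc]
  have h2 : D.moduliUnit K =
      D.unit 0 _ _ D.triv a a (D.moduliUnit (pinchLabel (n := 0) K D.triv)) := by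
    have h3 : D.moduliUnit K * D.unit 0 _ _ D.triv a a
        (D.moduliUnit (pinchLabel (n := 0) K D.triv)) =
        D.unit 0 _ _ D.triv a a (D.moduliUnit (pinchLabel (n := 0) K D.triv)) := by
      rw [moduliUnit_mul_unit (n := 0), moduliUnit_idem]
    obtain ⟨c, hc⟩ := h1 _ (D.moduliUnit_mem K)
    have hne : D.unit 0 _ _ D.triv a a (D.moduliUnit (pinchLabel (n := 0) K D.triv)) ≠ 0 :=
      fun h0 => hl.1 (eq_zero_of_unit a a (D.moduliUnit_mem _) h0)
    rw [hc, smul_mul_assoc, unit_mul_unit, if_pos rfl, moduliUnit_idem] at h3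
    have h4 : (c - 1) • D.unit 0 _ _ D.triv a a
        (D.moduliUnit (pinchLabel (n := 0) K D.triv)) = 0 := by
      rw [sub_smul, h3, one_smul, sub_self]
    rw [smul_eq_zero, sub_eq_zero] at h4
    rw [hc, h4.resolve_right hne, one_smul]
  refine ⟨?_, fun Z hZ => ?_⟩
  · rw [h2]
    exact fun h0 => hl.1 (eq_zero_of_unit a a (D.moduliUnit_mem _) h0)
  · rw [h2]
    exact h1 Z hZ

/-- A moduli algebra that is a matrix algebra, with its matrix units. -/
theorem exists_matrixUnits {K : Fin (n + 2) → ι} {J : ι}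
    (h : ∀ L ≠ J, D.moduliUnit (pinchLabel K L) = 0) (hl : D.IsLine (pinchLabel K J)) :
    ∃ m : Module.Basis
      (Fin (D.fusion (K (Fin.last (n + 1))) (K (Fin.last n).castSucc) J) ×
        Fin (D.fusion (K (Fin.last (n + 1))) (K (Fin.last n).castSucc) J)) ℂ (D.moduli K),
      (∀ a b c d, m (a, b) * m (c, d) = if b = c then m (a, d) else 0) ∧
      ∀ a b, D.starL (n + 2) (m (a, b) : D.L (n + 2)) = m (b, a) := by
  let v : Fin (D.fusion (K (Fin.last (n + 1))) (K (Fin.last n).castSucc) J) ×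
        Fin (D.fusion (K (Fin.last (n + 1))) (K (Fin.last n).castSucc) J) → D.moduli K :=
    fun p => ⟨D.unit n _ _ J p.1 p.2 (D.moduliUnit (pinchLabel K J)),
      (mem_fusionCommutant.1 (unit_mem p.1 p.2 (D.moduliUnit_mem _))).1⟩
  have hv : ∀ a b c d, v (a, b) * v (c, d) = if b = c then v (a, d) else 0 := by
    intro a b c d
    apply Subtype.ext
    change D.unit n _ _ J a b _ * D.unit n _ _ J c d _ = _
    rw [unit_mul_unit, moduliUnit_idem]
    split_ifs <;> rfl
  have hne : ∀ p, v p ≠ 0 := fun p h0 =>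
    hl.1 (eq_zero_of_unit p.1 p.2 (D.moduliUnit_mem _) (congrArg Subtype.val h0))
  have hli : LinearIndependent ℂ v := by
    refine Fintype.linearIndependent_iff.2 fun g hg p => ?_
    -- Diagonal matrix units on both sides extract a single coefficient.
    have h1 : v (p.1, p.1) * (∑ q, g q • v q) * v (p.2, p.2) = g p • v p := by
      rw [Finset.mul_sum, Finset.sum_mul]
      refine (Finset.sum_eq_single p (fun q _ hq => ?_) (by simp)).trans ?_
      · rw [mul_smul_comm, smul_mul_assoc]
        by_cases h1 : p.1 = q.1
        · have h2 : q.2 ≠ p.2 := fun h2 => hq (Prod.ext h1.symm h2)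
          rw [mul_assoc, show v q = v (q.1, q.2) from rfl, hv q.1, if_neg h2, mul_zero, smul_zero]
        · rw [show v q = v (q.1, q.2) from rfl, hv, if_neg h1, zero_mul, smul_zero]
      · rw [mul_smul_comm, smul_mul_assoc]
        change g p • (v (p.1, p.1) * v (p.1, p.2) * v (p.2, p.2)) = _
        rw [hv, if_pos rfl, hv, if_pos rfl]
    rw [hg, mul_zero, zero_mul] at h1
    exact (smul_eq_zero.1 h1.symm).resolve_right (hne p)
  have hsp : ⊤ ≤ Submodule.span ℂ (Set.range v) := by
    rintro ⟨Z, hZ⟩ -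
    choose c hc using fun a b => hl.2 _ (component_mem K J a b Z)
    have h1 : (⟨Z, hZ⟩ : D.moduli K) = ∑ a, ∑ b, c a b • v (a, b) := by
      apply Subtype.ext
      have h2 : ((∑ a, ∑ b, c a b • v (a, b) : D.moduli K) : D.L (n + 2)) =
          ∑ a, ∑ b, c a b • (v (a, b) : D.L (n + 2)) := by
        simp only [AddSubmonoidClass.coe_finsetSum]
        rfl
      rw [h2]
      change Z = _
      conv_lhs => rw [eq_sum_component h hZ]
      refine Finset.sum_congr rfl fun a _ => Finset.sum_congr rfl fun b _ => ?_
      rw [hc a b, map_smul]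
    rw [h1]
    exact Submodule.sum_mem _ fun a _ => Submodule.sum_mem _ fun b _ =>
      Submodule.smul_mem _ _ (Submodule.subset_span ⟨(a, b), rfl⟩)
  refine ⟨Module.Basis.mk hli hsp, fun a b c d => ?_, fun a b => ?_⟩
  · simp only [Module.Basis.mk_apply, hv]
  · simp only [Module.Basis.mk_apply]
    change D.starL (n + 2) (D.unit n _ _ J a b _) = D.unit n _ _ J b a _
    rw [starL_unit, starL_moduliUnit]

/-- Pinching the last two punctures with label `L` leaves a sphere labelled `J̄, L`, whose moduli
algebra vanishes unless `L = J` and is then a line. -/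
theorem exists_matrixUnits_three (I I' J : ι) :
    ∃ m : Module.Basis (Fin (D.fusion I I' J) × Fin (D.fusion I I' J)) ℂ
      (D.moduli ![D.bar J, I', I]),
      (∀ a b c d, m (a, b) * m (c, d) = if b = c then m (a, d) else 0) ∧
      ∀ a b, D.starL 3 (m (a, b) : D.L 3) = m (b, a) := by
  refine exists_matrixUnits (n := 1) (K := ![D.bar J, I', I]) (J := J) (fun L hL => ?_) ?_
  · refine moduliUnit_two_eq_zero fun h => hL ?_
    exact (D.bar_inj.1 h).symm
  · exact isLine_two rfl

end SymmetryData
end Small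

/-! ### Gluing -/

section Glue

variable {G ι : Type*} [Ring G] [HopfAlgebra ℂ G] [StarRing G] [StarModule ℂ G]
variable [FiniteDimensional ℂ G] [IsSemisimpleRing G] [Fintype ι] [DecidableEq ι]

namespace SymmetryData

variable (D : SymmetryData G ι) [hM : D.Modular]

/-- The matrix units of the moduli algebra with three punctures. -/
def unit₃ (I I' J : ι) : Module.Basis (Fin (D.fusion I I' J) × Fin (D.fusion I I' J)) ℂ
    (D.moduli ![D.bar J, I', I]) := (D.exists_matrixUnits_three I I' J).choose

variable {D} in
theorem unit₃_mul {I I' J : ι} (a b c d : Fin (D.fusion I I' J)) :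
    D.unit₃ I I' J (a, b) * D.unit₃ I I' J (c, d) = if b = c then D.unit₃ I I' J (a, d) else 0 :=
  (D.exists_matrixUnits_three I I' J).choose_spec.1 a b c d

variable {D} in
theorem starL_unit₃ {I I' J : ι} (a b : Fin (D.fusion I I' J)) :
    D.starL 3 (D.unit₃ I I' J (a, b) : D.L 3) = D.unit₃ I I' J (b, a) :=
  (D.exists_matrixUnits_three I I' J).choose_spec.2 a b

/-- As the adjoint exchanges the indices of the matrix units, coordinates transform like those of a
conjugate transpose. -/
theorem repr_starL {I I' J : ι} {Y Y' : D.moduli ![D.bar J, I', I]}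
    (h : (Y' : D.L 3) = D.starL 3 Y) (a b : Fin (D.fusion I I' J)) :
    (D.unit₃ I I' J).repr Y' (a, b) = star ((D.unit₃ I I' J).repr Y (b, a)) := by
  have h1 : Y' = ∑ p : Fin (D.fusion I I' J) × Fin (D.fusion I I' J),
      star ((D.unit₃ I I' J).repr Y (p.2, p.1)) • D.unit₃ I I' J p := by
    apply Subtype.ext
    rw [h, ← (D.unit₃ I I' J).sum_repr Y]
    simp only [AddSubmonoidClass.coe_finsetSum, AntiStar.map_sum]
    rw [← (Equiv.prodComm _ _).sum_comp]
    refine Finset.sum_congr rfl fun p _ => ?_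
    change D.starL 3 ((D.unit₃ I I' J).repr _ (p.2, p.1) •
      (D.unit₃ I I' J (p.2, p.1) : D.L 3)) = _
    rw [AntiStar.map_smul, starL_unit₃, (D.unit₃ I I' J).sum_repr Y]
    rfl
  conv_lhs => rw [h1]
  rw [Module.Basis.repr_sum_self]

variable {n : ℕ} (K : Fin (n + 2) → ι)

/-- The gluing of the two surfaces that arise by pinching, for the label `J`. -/
def glue (J : ι) : D.moduli (pinchLabel K J) ⊗[ℂ]
      D.moduli ![D.bar J, K (Fin.last n).castSucc, K (Fin.last (n + 1))] →ₗ[ℂ] D.L (n + 2) :=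
  TensorProduct.lift (LinearMap.mk₂ ℂ (fun X Y => ∑ p, (D.unit₃ _ _ J).repr Y p •
      D.unit n (K (Fin.last (n + 1))) (K (Fin.last n).castSucc) J p.1 p.2 X)
    (fun X X' Y => by
      rw [← Finset.sum_add_distrib]
      exact Finset.sum_congr rfl fun p _ => by rw [← smul_add, ← map_add]; rfl)
    (fun c X Y => by
      rw [Finset.smul_sum]
      exact Finset.sum_congr rfl fun p _ => by
        rw [smul_comm c, ← map_smul (D.unit n _ _ J p.1 p.2) c]; rfl)
    (fun X Y Y' => by
      rw [← Finset.sum_add_distrib]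
      exact Finset.sum_congr rfl fun p _ => by rw [← add_smul, map_add]; rfl)
    (fun c X Y => by
      rw [Finset.smul_sum]
      exact Finset.sum_congr rfl fun p _ => by rw [smul_smul, map_smul]; rfl))

variable {D K} {J : ι}

theorem glue_tmul (X : D.moduli (pinchLabel K J))
    (Y : D.moduli ![D.bar J, K (Fin.last n).castSucc, K (Fin.last (n + 1))]) :
    D.glue K J (X ⊗ₜ Y) = ∑ p, (D.unit₃ _ _ J).repr Y p •
      D.unit n (K (Fin.last (n + 1))) (K (Fin.last n).castSucc) J p.1 p.2 X := rfl

theorem glue_tmul_unit₃ (X : D.moduli (pinchLabel K J))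
    (a b : Fin (D.fusion (K (Fin.last (n + 1))) (K (Fin.last n).castSucc) J)) :
    D.glue K J (X ⊗ₜ D.unit₃ _ _ J (a, b)) = D.unit n _ _ J a b X := by
  rw [glue_tmul, Finset.sum_eq_single (a, b)]
  · rw [Module.Basis.repr_self, Finsupp.single_eq_same, one_smul]
  · intro p _ hp
    rw [Module.Basis.repr_self, Finsupp.single_eq_of_ne hp, zero_smul]
  · simp

theorem exists_sum_tmul (T : D.moduli (pinchLabel K J) ⊗[ℂ]
      D.moduli ![D.bar J, K (Fin.last n).castSucc, K (Fin.last (n + 1))]) :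
    ∃ X : _ → _ → D.moduli (pinchLabel K J), T = ∑ a, ∑ b, X a b ⊗ₜ D.unit₃
      (K (Fin.last (n + 1))) (K (Fin.last n).castSucc) J (a, b) := by
  induction T with
  | zero => exact ⟨0, by simp⟩
  | add T T' h h' =>
    obtain ⟨X, hX⟩ := h
    obtain ⟨X', hX'⟩ := h'
    refine ⟨X + X', ?_⟩
    rw [hX, hX']
    simp only [Pi.add_apply, TensorProduct.add_tmul, Finset.sum_add_distrib]
  | tmul X Y =>
    refine ⟨fun a b => (D.unit₃ _ _ J).repr Y (a, b) • X, ?_⟩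
    conv_lhs => rw [← (D.unit₃ _ _ J).sum_repr Y, TensorProduct.tmul_sum, Fintype.sum_prod_type]
    simp only [TensorProduct.tmul_smul, TensorProduct.smul_tmul']

theorem glue_mul (T T' : D.moduli (pinchLabel K J) ⊗[ℂ]
      D.moduli ![D.bar J, K (Fin.last n).castSucc, K (Fin.last (n + 1))]) :
    D.glue K J (T * T') = D.glue K J T * D.glue K J T' := by
  obtain ⟨X, rfl⟩ := exists_sum_tmul T
  obtain ⟨X', rfl⟩ := exists_sum_tmul T'
  simp only [Finset.sum_mul, Finset.mul_sum, map_sum]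
  refine Finset.sum_congr rfl fun a _ => Finset.sum_congr rfl fun b _ =>
    Finset.sum_congr rfl fun c _ => Finset.sum_congr rfl fun d _ => ?_
  rw [Algebra.TensorProduct.tmul_mul_tmul, unit₃_mul, glue_tmul_unit₃, glue_tmul_unit₃,
    unit_mul_unit]
  split_ifs
  · rw [glue_tmul_unit₃]
    rfl
  · rw [TensorProduct.tmul_zero, map_zero]

theorem glue_mul_glue_of_ne {L : ι} (h : J ≠ L) (T : D.moduli (pinchLabel K J) ⊗[ℂ]
      D.moduli ![D.bar J, K (Fin.last n).castSucc, K (Fin.last (n + 1))])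
    (T' : D.moduli (pinchLabel K L) ⊗[ℂ]
      D.moduli ![D.bar L, K (Fin.last n).castSucc, K (Fin.last (n + 1))]) :
    D.glue K J T * D.glue K L T' = 0 := by
  obtain ⟨X, rfl⟩ := exists_sum_tmul T
  obtain ⟨X', rfl⟩ := exists_sum_tmul T'
  simp only [Finset.sum_mul, Finset.mul_sum, map_sum, glue_tmul_unit₃, unit_mul_unit_of_ne h,
    Finset.sum_const_zero]

theorem pinchProj_mul_glue (L : ι) (T : D.moduli (pinchLabel K J) ⊗[ℂ]
      D.moduli ![D.bar J, K (Fin.last n).castSucc, K (Fin.last (n + 1))]) :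
    D.pinchProj n L * D.glue K J T = if L = J then D.glue K J T else 0 := by
  obtain ⟨X, rfl⟩ := exists_sum_tmul T
  simp only [Finset.mul_sum, map_sum, glue_tmul_unit₃, pinchProj_mul_unit]
  split_ifs
  · rfl
  · simp only [Finset.sum_const_zero]

theorem glue_mem (T : D.moduli (pinchLabel K J) ⊗[ℂ]
      D.moduli ![D.bar J, K (Fin.last n).castSucc, K (Fin.last (n + 1))]) :
    D.glue K J T ∈ D.fusionCommutant K := by
  obtain ⟨X, rfl⟩ := exists_sum_tmul T
  simp only [map_sum, glue_tmul_unit₃]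
  exact sum_mem fun a _ => sum_mem fun b _ => unit_mem a b (X a b).2

/-- Multiplying by diagonal units over `1` isolates the `(c, d)` component of the image. -/
theorem glue_injective : Function.Injective (D.glue K J) := by
  rw [injective_iff_map_eq_zero]
  intro T hT
  obtain ⟨X, rfl⟩ := exists_sum_tmul T
  simp only [map_sum, glue_tmul_unit₃] at hT
  refine Finset.sum_eq_zero fun c _ => Finset.sum_eq_zero fun d _ => ?_
  have h1 : D.unit n _ _ J c d (X c d : D.L (n + 1)) = 0 := by
    have h2 := congrArg (fun Z => D.unit n _ _ J c c 1 * Z * D.unit n _ _ J d d 1) hT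
    simpa [Finset.mul_sum, Finset.sum_mul, unit_mul_unit, ite_mul, mul_ite] using h2
  have h3 : X c d = 0 := Subtype.ext (eq_zero_of_unit c d (X c d).2 h1)
  rw [h3, TensorProduct.zero_tmul]

theorem exists_glue_eq {Z : D.L (n + 2)} (hZ : Z ∈ D.moduli K) (J : ι) :
    ∃ T, D.glue K J T = D.pinchProj n J * Z * D.pinchProj n J := by
  refine ⟨∑ a, ∑ b, (⟨D.component K J a b Z, component_mem K J a b Z⟩ :
    D.moduli (pinchLabel K J)) ⊗ₜ D.unit₃ _ _ J (a, b), ?_⟩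
  simp only [map_sum, glue_tmul_unit₃]
  rw [sum_component J hZ]

theorem isAdj_glue {X X' : D.moduli (pinchLabel K J)}
    {Y Y' : D.moduli ![D.bar J, K (Fin.last n).castSucc, K (Fin.last (n + 1))]}
    (hX : D.IsAdj (X : D.L (n + 1)) X') (hY : D.IsAdj (Y : D.L 3) Y') :
    D.IsAdj (D.glue K J (X ⊗ₜ Y)) (D.glue K J (X' ⊗ₜ Y')) := by
  rw [isAdj_iff X.2] at hX
  rw [isAdj_iff Y.2] at hY
  rw [isAdj_iff (mem_fusionCommutant.1 (glue_mem _)).1, glue_tmul, glue_tmul, AntiStar.map_sum,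
    ← (Equiv.prodComm _ _).sum_comp]
  refine Finset.sum_congr rfl fun p _ => ?_
  rw [AntiStar.map_smul, starL_unit, hX]
  exact congrArg (· • _) (D.repr_starL hY p.2 p.1)

variable (D K)

/-- The gluing map. -/
def glueHom : (∀ J : ι, D.moduli (pinchLabel K J) ⊗[ℂ]
      D.moduli ![D.bar J, K (Fin.last n).castSucc, K (Fin.last (n + 1))]) →ₙ+*
    D.fusionCommutant K where
  toFun T := ⟨∑ J, D.glue K J (T J), sum_mem fun _ _ => glue_mem _⟩
  map_zero' := Subtype.ext (by simp)
  map_add' T T' := Subtype.ext (by simp [Finset.sum_add_distrib])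
  map_mul' T T' := Subtype.ext (by
    change ∑ J, D.glue K J (T J * T' J) = (∑ J, D.glue K J (T J)) * ∑ J, D.glue K J (T' J)
    rw [Finset.sum_mul]
    refine Finset.sum_congr rfl fun J _ => ?_
    rw [Finset.mul_sum, Finset.sum_eq_single J, glue_mul]
    · intro L _ hL
      exact glue_mul_glue_of_ne hL.symm _ _
    · simp)

variable {D K}

theorem coe_glueHom (T : ∀ J : ι, D.moduli (pinchLabel K J) ⊗[ℂ]
      D.moduli ![D.bar J, K (Fin.last n).castSucc, K (Fin.last (n + 1))]) :
    (D.glueHom K T : D.L (n + 2)) = ∑ J, D.glue K J (T J) := rfl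

theorem coe_glueHom_single (T : D.moduli (pinchLabel K J) ⊗[ℂ]
      D.moduli ![D.bar J, K (Fin.last n).castSucc, K (Fin.last (n + 1))]) :
    (D.glueHom K (Pi.single J T) : D.L (n + 2)) = D.glue K J T := by
  rw [coe_glueHom, Finset.sum_eq_single J, Pi.single_eq_same]
  · intro L _ hL
    rw [Pi.single_eq_of_ne hL, map_zero]
  · simp

theorem glueHom_smul (z : ℂ) (T : ∀ J : ι, D.moduli (pinchLabel K J) ⊗[ℂ]
      D.moduli ![D.bar J, K (Fin.last n).castSucc, K (Fin.last (n + 1))]) :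
    D.glueHom K (z • T) = z • D.glueHom K T := by
  apply Subtype.ext
  change ∑ J, D.glue K J (z • T J) = z • ∑ J, D.glue K J (T J)
  simp only [map_smul, Finset.smul_sum]

theorem glueHom_bijective : Function.Bijective (D.glueHom K) := by
  constructor
  · rw [injective_iff_map_eq_zero]
    intro T hT
    funext L
    -- The projector of the label `L` separates the summands.
    have h1 : D.pinchProj n L * ∑ J, D.glue K J (T J) = 0 := by
      rw [← coe_glueHom, hT]
      exact mul_zero _
    rw [Finset.mul_sum, Finset.sum_eq_single L, pinchProj_mul_glue, if_pos rfl] at h1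
    · exact glue_injective (h1.trans (map_zero _).symm)
    · intro J _ hJ
      rw [pinchProj_mul_glue, if_neg hJ.symm]
    · simp
  · rintro ⟨Z, hZ⟩
    -- An element of the commutant is the sum of its diagonal blocks, and each block is glued from
    -- its components.
    obtain ⟨hZ, hc⟩ := mem_fusionCommutant.1 hZ
    choose T hT using exists_glue_eq hZ
    refine ⟨T, Subtype.ext ?_⟩
    rw [coe_glueHom]
    calc ∑ J, D.glue K J (T J) = ∑ J, Z * D.pinchProj n J := by
          refine Finset.sum_congr rfl fun J _ => ?_
          rw [hT, ← (hc J).eq, mul_assoc, pinchProj_mul, if_pos rfl]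
      _ = Z := by rw [← Finset.mul_sum, sum_pinchProj, mul_one]

end SymmetryData
end Glue

end ChernSimons
end

theorem mainTheorem5 {G ι : Type*} [Ring G] [HopfAlgebra ℂ G] [StarRing G] [StarModule ℂ G]
    [FiniteDimensional ℂ G] [IsSemisimpleRing G] [Fintype ι] [DecidableEq ι]
    (D : ChernSimons.SymmetryData G ι)
    (hd : ∀ I, 0 < (D.qdim I).re ∧ (D.qdim I).im = 0) (hS : IsUnit D.S)
    (n : ℕ) (K : Fin (n + 2) → ι) :
    ∃ e : D.fusionCommutant K ≃+*
        (∀ J : ι, D.moduli (Fin.snoc (fun ν : Fin n => K (ν.castAdd 2)) J : Fin (n + 1) → ι)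
          ⊗[ℂ] D.moduli ![D.bar J, K (Fin.last n).castSucc, K (Fin.last (n + 1))]),
      (∀ (z : ℂ) (X : D.fusionCommutant K), e (z • X) = z • e X) ∧
      ∀ (J : ι)
        (X X' : D.moduli (Fin.snoc (fun ν : Fin n => K (ν.castAdd 2)) J : Fin (n + 1) → ι))
        (Y Y' : D.moduli ![D.bar J, K (Fin.last n).castSucc, K (Fin.last (n + 1))]),
        D.IsAdj (X : D.L (n + 1)) X' → D.IsAdj (Y : D.L 3) Y' →
        D.IsAdj (e.symm (Pi.single J (X ⊗ₜ[ℂ] Y)) : D.L (n + 2))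
          (e.symm (Pi.single J (X' ⊗ₜ[ℂ] Y'))) := by
  have : D.Modular := ⟨hd, hS⟩
  -- The required isomorphism is the inverse of gluing, so that the adjoint condition is a statement
  -- about the gluing map itself.
  let f := RingEquiv.ofBijective (D.glueHom K) ChernSimons.SymmetryData.glueHom_bijective
  refine ⟨f.symm, fun z X => ?_, fun J X X' Y Y' hX hY => ?_⟩
  · rw [RingEquiv.symm_apply_eq]
    refine Eq.trans ?_ (ChernSimons.SymmetryData.glueHom_smul z (f.symm X)).symm
    exact congrArg (z • ·) (f.apply_symm_apply X).symm
  · have h : ∀ T, (f.symm.symm (Pi.single J T) : D.L (n + 2)) = D.glue K J T :=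
      ChernSimons.SymmetryData.coe_glueHom_single
    rw [h, h]
    exact ChernSimons.SymmetryData.isAdj_glue hX hY
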